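/- Let $(M,\mathcal F)$ be a compact ($C^\infty$, $n$-dimensional, Hausdorff) Finsler manifold: $\mathcal F\colon TM\to[0,\infty)$ is continuous, positively $1$-homogeneous, smooth on $TM\setminus\{0\}$, and $g_{x,y}(u,v)=\frac12\frac{\partial^2}{\partial s\,\partial t}\mathcal F^2_x(y+su+tv)\big|_{s=t=0}$ is positive definite for $y\neq 0$. Let $\mathcal I_pM=\{y\in T_pM : \mathcal F(y)=1\}$ be the indicatrix at $p$, $\pi\colon\mathcal IM\to M$ the indicatrix bundle, and $\mathfrak X(\mathcal IM)$ the Lie algebra of smooth vector fields on $\mathcal IM$. Let $4G^i=g^{il}\bigl(2\frac{\partial g_{jl}}{\partial x^k}-\frac{\partial g_{jk}}{\partial x^l}\bigr)y^jy^k$ and $G^i_j=\partial G^i/\partial y^j$. For $X\in\mathfrak X(M)$ let $X^h=X^i\bigl(\frac{\partial}{\partial x^i}-G^k_i\frac{\partial}{\partial y^k}\bigr)$ be its horizontal lift, let $h$ be the horizontal projector and $R=\frac12[h,h]$ the curvature. A curvature vector field is a vector field $\xi=R(X^h,Y^h)\in\mathfrak X(\mathcal IM)$ with $X,Y\in\mathfrak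 X(M)$. The horizontal Berwald covariant derivative of a vertical vector field $\xi\in\mathfrak X(\mathcal IM)$ with respect to $X\in\mathfrak X(M)$ is $\nabla_X\xi=[X^h,\xi]$. The infinitesimal holonomy algebra $\mathfrak{hol}^*(M)$ is the smallest Lie algebra of vector fields on $\mathcal IM$ that contains all curvature vector fields and contains $\nabla_X\xi$ whenever it contains $\xi$, for every $X\in\mathfrak X(M)$. Fix $r\in\{1,2,\dots,\infty\}$. The holonomy group $\mathrm{Hol}_p(M)$ is the group of transformations of $\mathcal I_pM$ generated by the (nonlinear) parallel translations, i.e. by $X(0)\mapsto X(1)$ with $\dot X^i+G^i_j(c,X)\dot c^j=0$, along the piecewise $C^r$ closed curves $c\colon[0,1]\to M$ starting at $p$. The fibered holonomy group $\mathrm{Hol}_f(M)\subset \mathrm{Diff}^\infty(\mathcal IM)$ is the group generated by the fiber preserving diffeomorphisms $\Phi$ of $\mathcal IM$ with $\Phi|_{\mathcal I_pM}\in\mathrm{Hol}_p(M)$ for all $p\in M$. A vector field $\xi\in\mathfrak X(\mathcal IM)$ is tangent to a subgroup $\mathcal G\subset\mathrm{Diff}^\infty(\mathcal IM)$ if there are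 an integer $k\ge1$ and a $C^\infty$ curve $t\mapsto\varphi_t$ in $\mathrm{Diff}^\infty(\mathcal IM)$, defined on an open interval around $0$, with $\varphi_t\in\mathcal G$, $\varphi_0=\mathrm{id}$, $\frac{\partial^i\varphi_t}{\partial t^i}\big|_{t=0}=0$ for $1\le i<k$ and $\frac{\partial^k\varphi_t}{\partial t^k}\big|_{t=0}=\xi$. The fibered holonomy algebra $\mathfrak{hol}_f(M)$ is the set of vector fields tangent to $\mathrm{Hol}_f(M)$. Then: 0. the curvature vector fields $R(X^h,Y^h)$ are well defined as elements of $\mathfrak X(\mathcal IM)$ for all $X,Y\in\mathfrak X(M)$ and belong to $\mathfrak{hol}^*(M)$; and for every $\xi\in\mathfrak{hol}^*(M)$ and $X\in\mathfrak X(M)$, the field $\xi$ is vertical and $\nabla_X\xi$ is defined and belongs to $\mathfrak{hol}^*(M)$; 1. the elements of $\mathfrak{hol}^*(M)$ are tangent to $\mathrm{Hol}_f(M)$; 2. $\mathfrak{hol}_f(M)$ is a Lie subalgebra of $\mathfrak X(\mathcal IM)$, and $\mathfrak{hol}^*(M)$ is a Lie subalgebra of $\mathfrak{hol}_f(M)$.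 -/

import Mathlib

open Set Manifold
open scoped Manifold ContDiff Bundle

noncomputable section

namespace FinslerHolonomy

/-! ### Smooth maps on a subset of a manifold -/

section Smoothness

variable {E₁ H₁ N E₂ H₂ P : Type*}
  [NormedAddCommGroup E₁] [NormedSpace ℝ E₁] [TopologicalSpace H₁]
  [TopologicalSpace N] [ChartedSpace H₁ N]
  [NormedAddCommGroup E₂] [NormedSpace ℝ E₂] [TopologicalSpace H₂]
  [TopologicalSpace P] [ChartedSpace H₂ P]

/-- Let `e : S → N` be an injection, by which `S` is regarded as a subset of the manifold `N`.
A map `f : S → P` is smooth if, near each point of `S`, it is the restriction to `S` of a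
`C^∞` map defined on an open subset of `N`. When `e` is the inclusion of an embedded submanifold,
this is smoothness for the induced manifold structure of `S`. -/
def SmoothAlong (I₁ : ModelWithCorners ℝ E₁ H₁) (I₂ : ModelWithCorners ℝ E₂ H₂)
    {S : Type*} (e : S → N) (f : S → P) : Prop :=
  ∀ a : S, ∃ U : Set N, IsOpen U ∧ e a ∈ U ∧ ∃ g : N → P, ContMDiffOn I₁ I₂ ∞ g U ∧
    ∀ b : S, e b ∈ U → g (e b) = f b

theorem SmoothAlong.prod_comp {I₁ : ModelWithCorners ℝ E₁ H₁}
    {S : Type*} {e : S → N} {f f' : S → ℝ} (op : ℝ × ℝ → ℝ) (hop : ContDiff ℝ ∞ op)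
    (hf : SmoothAlong I₁ 𝓘(ℝ, ℝ) e f) (hf' : SmoothAlong I₁ 𝓘(ℝ, ℝ) e f') :
    SmoothAlong I₁ 𝓘(ℝ, ℝ) e (fun a => op (f a, f' a)) := by
  intro a
  obtain ⟨U, hU, haU, g, hg, hgf⟩ := hf a
  obtain ⟨U', hU', haU', g', hg', hgf'⟩ := hf' a
  refine ⟨U ∩ U', hU.inter hU', ⟨haU, haU'⟩, fun x => op (g x, g' x), ?_, ?_⟩
  · exact hop.contMDiff.comp_contMDiffOn
      ((hg.mono inter_subset_left).prodMk_space (hg'.mono inter_subset_right))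
  · intro b hb
    simp [hgf b hb.1, hgf' b hb.2]

theorem SmoothAlong.comp_self {I₁ : ModelWithCorners ℝ E₁ H₁}
    {S : Type*} {e : S → N} {f f' : S → S}
    (hf : SmoothAlong I₁ I₁ e (fun a => e (f a)))
    (hf' : SmoothAlong I₁ I₁ e (fun a => e (f' a))) :
    SmoothAlong I₁ I₁ e (fun a => e (f (f' a))) := by
  intro a
  obtain ⟨U', hU', haU', g', hg', hgf'⟩ := hf' a
  obtain ⟨U, hU, haU, g, hg, hgf⟩ := hf (f' a)
  refine ⟨U' ∩ g' ⁻¹' U, hg'.continuousOn.isOpen_inter_preimage hU' hU, ⟨haU', ?_⟩,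
    fun x => g (g' x), ?_, ?_⟩
  · simpa [hgf' a haU'] using haU
  · exact hg.comp (hg'.mono inter_subset_left) inter_subset_right
  · intro b hb
    have h1 := hgf' b hb.1
    have h2 : e (f' b) ∈ U := by
      have := hb.2
      rw [mem_preimage, h1] at this
      exact this
    show g (g' (e b)) = _
    rw [h1, hgf _ h2]

end Smoothness

/-! ### Finsler manifolds -/

section Finsler

/-- A Finsler metric on an `n`-dimensional smooth manifold `M`. -/
structure FinslerMetric (n : ℕ) (M : Type*) [TopologicalSpace M]
    [ChartedSpace (EuclideanSpace ℝ (Fin n)) M] [IsManifold (𝓡 n) ∞ M] where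
  /-- the Finsler norm `𝓕 : TM → ℝ₊` -/
  norm : TangentBundle (𝓡 n) M → ℝ
  nonneg : ∀ v, 0 ≤ norm v
  continuous : Continuous norm
  homogeneous : ∀ (p : M) (y : TangentSpace (𝓡 n) p) (a : ℝ), 0 < a →
    norm ⟨p, a • y⟩ = a * norm ⟨p, y⟩
  smooth : ContMDiffOn (𝓡 n).tangent 𝓘(ℝ, ℝ) ∞ norm {v | v.2 ≠ 0}
  /-- `g_{p,y}(u,u) = ½ ∂²/∂s∂t 𝓕²(y + su + tu)` at `s = t = 0` is positive for `y ≠ 0`, `u ≠ 0`. -/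
  posDef : ∀ (p : M) (y u : TangentSpace (𝓡 n) p), y ≠ 0 → u ≠ 0 →
    0 < (1 / 2 : ℝ) * deriv (fun s : ℝ => deriv (fun t : ℝ =>
      norm ⟨p, y + s • u + t • u⟩ ^ 2) 0) 0

variable {n : ℕ} {M : Type*} [TopologicalSpace M]
  [ChartedSpace (EuclideanSpace ℝ (Fin n)) M] [IsManifold (𝓡 n) ∞ M]

/-- The `i`-th coordinate vector. -/
abbrev coordVec (n : ℕ) (i : Fin n) : EuclideanSpace ℝ (Fin n) := EuclideanSpace.single i 1

namespace FinslerMetric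

variable (F : FinslerMetric n M)

/-! #### The canonical connection

In the following four definitions `(x, y)` are the coordinates on `TM` induced by the preferred
chart of `M` at the base point of `v₀`. -/

/-- The coordinate expression of the Finsler norm. -/
def localNorm (v₀ : TangentBundle (𝓡 n) M) (x y : EuclideanSpace ℝ (Fin n)) : ℝ :=
  F.norm ((extChartAt (𝓡 n).tangent v₀).symm (x, y))

/-- `g_{ij}(x, y)`, as a matrix. -/
def localMetric (v₀ : TangentBundle (𝓡 n) M) (x y : EuclideanSpace ℝ (Fin n)) :
    Matrix (Fin n) (Fin n) ℝ := fun i j =>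
  (1 / 2 : ℝ) * deriv (fun s : ℝ => deriv (fun t : ℝ =>
    F.localNorm v₀ x (y + s • coordVec n i + t • coordVec n j) ^ 2) 0) 0

/-- The geodesic coefficients: `4 G^i = g^{il} (2 ∂g_{jl}/∂x^k - ∂g_{jk}/∂x^l) y^j y^k`. -/
def geodesicCoeff (v₀ : TangentBundle (𝓡 n) M) (i : Fin n) (x y : EuclideanSpace ℝ (Fin n)) : ℝ :=
  (1 / 4 : ℝ) * ∑ l, ∑ j, ∑ k, (F.localMetric v₀ x y)⁻¹ i l *
    (2 * deriv (fun s : ℝ => F.localMetric v₀ (x + s • coordVec n k) y j l) 0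
      - deriv (fun s : ℝ => F.localMetric v₀ (x + s • coordVec n l) y j k) 0) * y j * y k

/-- The connection coefficients `G^i_j = ∂G^i/∂y^j`. -/
def connCoeff (v₀ : TangentBundle (𝓡 n) M) (i j : Fin n) (x y : EuclideanSpace ℝ (Fin n)) : ℝ :=
  deriv (fun s : ℝ => F.geodesicCoeff v₀ i x (y + s • coordVec n j)) 0

/-- The horizontal lift `T_pM → T_v TM`, `∂/∂x^j ↦ ∂/∂x^j - G^i_j(v) ∂/∂y^i`, where `p = π v`. The
tangent space `T_v TM` is modelled on `E × E`, `E = ℝⁿ`, by means of the coordinates `(x, y)`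
induced by the preferred chart at `p`. -/
def horLift (v : TangentBundle (𝓡 n) M) (u : EuclideanSpace ℝ (Fin n)) :
    TangentSpace (𝓡 n).tangent v :=
  ((u, - WithLp.toLp 2 (fun i => ∑ j,
      F.connCoeff v i j (extChartAt (𝓡 n).tangent v v).1 (extChartAt (𝓡 n).tangent v v).2 * u j)) :
    EuclideanSpace ℝ (Fin n) × EuclideanSpace ℝ (Fin n))

/-- The horizontal projector `h : T_v TM → T_v TM`. -/
def horProj (v : TangentBundle (𝓡 n) M) (w : TangentSpace (𝓡 n).tangent v) :
    TangentSpace (𝓡 n).tangent v :=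
  F.horLift v (show EuclideanSpace ℝ (Fin n) × EuclideanSpace ℝ (Fin n) from w).1

/-- The horizontal lift `X^h` of a smooth vector field `X` on `M`. -/
def horLiftField (X : Cₛ^∞⟮𝓡 n; EuclideanSpace ℝ (Fin n), (TangentSpace (𝓡 n) : M → Type _)⟯) :
    ∀ v : TangentBundle (𝓡 n) M, TangentSpace (𝓡 n).tangent v :=
  fun v => F.horLift v (X v.proj)

/-- The curvature `R = ½[h,h]`, the Nijenhuis torsion of the horizontal projector:
`R(V,W) = [hV,hW] - h[hV,W] - h[V,hW] + h²[V,W]`. -/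
def curvature (V W : ∀ v : TangentBundle (𝓡 n) M, TangentSpace (𝓡 n).tangent v)
    (v : TangentBundle (𝓡 n) M) : TangentSpace (𝓡 n).tangent v :=
  VectorField.mlieBracket (𝓡 n).tangent (fun w => F.horProj w (V w)) (fun w => F.horProj w (W w)) v
    - F.horProj v (VectorField.mlieBracket (𝓡 n).tangent (fun w => F.horProj w (V w)) W v)
    - F.horProj v (VectorField.mlieBracket (𝓡 n).tangent V (fun w => F.horProj w (W w)) v)
    + F.horProj v (F.horProj v (VectorField.mlieBracket (𝓡 n).tangent V W v))

/-! #### The indicatrix bundle, its diffeomorphisms and its vector fields -/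

/-- The indicatrix at `p`. -/
def indicatrix (p : M) : Set (TangentSpace (𝓡 n) p) := {y | F.norm ⟨p, y⟩ = 1}

/-- The indicatrix bundle, a hypersurface of `TM`. -/
def indicatrixBundle : Set (TangentBundle (𝓡 n) M) := {v | F.norm v = 1}

/-- The inclusion of the indicatrix at `p` into the indicatrix bundle. -/
def inclIndicatrix (p : M) (y : F.indicatrix p) : F.indicatrixBundle := ⟨⟨p, y.1⟩, y.2⟩

/-- The group of smooth diffeomorphisms of the indicatrix bundle. -/
def diffGroup : Subgroup (Equiv.Perm F.indicatrixBundle) where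
  carrier := {Φ |
    SmoothAlong (𝓡 n).tangent (𝓡 n).tangent (Subtype.val : F.indicatrixBundle → _)
      (fun v => (Φ v).1) ∧
    SmoothAlong (𝓡 n).tangent (𝓡 n).tangent (Subtype.val : F.indicatrixBundle → _)
      (fun v => (Φ⁻¹ v).1)}
  mul_mem' := by
    intro Φ Ψ hΦ hΨ
    refine ⟨SmoothAlong.comp_self (f := Φ) (f' := Ψ) hΦ.1 hΨ.1, ?_⟩
    rw [mul_inv_rev]
    exact SmoothAlong.comp_self (f := (Ψ⁻¹ : Equiv.Perm _)) (f' := (Φ⁻¹ : Equiv.Perm _)) hΨ.2 hΦ.2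
  one_mem' := by
    have h : SmoothAlong (𝓡 n).tangent (𝓡 n).tangent (Subtype.val : F.indicatrixBundle → _)
        (fun v => v.1) :=
      fun a => ⟨univ, isOpen_univ, mem_univ _, id, contMDiffOn_id, fun _ _ => rfl⟩
    exact ⟨h, by rw [inv_one]; exact h⟩
  inv_mem' := by
    intro Φ hΦ
    exact ⟨hΦ.2, by rw [inv_inv]; exact hΦ.1⟩

/-- The algebra of smooth real functions on the indicatrix bundle. -/
def smoothFun : Subalgebra ℝ (F.indicatrixBundle → ℝ) where
  carrier := {f | SmoothAlong (𝓡 n).tangent 𝓘(ℝ, ℝ) (Subtype.val : F.indicatrixBundle → _) f}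
  mul_mem' := fun hf hf' => SmoothAlong.prod_comp (fun z => z.1 * z.2)
    (contDiff_fst.mul contDiff_snd) hf hf'
  add_mem' := fun hf hf' => SmoothAlong.prod_comp (fun z => z.1 + z.2)
    (contDiff_fst.add contDiff_snd) hf hf'
  algebraMap_mem' := fun c _ =>
    ⟨univ, isOpen_univ, mem_univ _, fun _ => c, contMDiffOn_const, fun _ _ => rfl⟩

/-- The Lie algebra of smooth vector fields on the indicatrix bundle: the derivations of the
algebra of smooth functions, with the commutator bracket. -/
abbrev VField : Type _ := Derivation ℝ F.smoothFun F.smoothFun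

/-- The restriction of a smooth function on `TM` to the indicatrix bundle. -/
def restrictFun (g : C^∞⟮(𝓡 n).tangent, TangentBundle (𝓡 n) M; ℝ⟯) : F.smoothFun :=
  ⟨fun v => g v.1, fun _ =>
    ⟨univ, isOpen_univ, mem_univ _, g, g.contMDiff.contMDiffOn, fun _ _ => rfl⟩⟩

/-- The vector field `ξ` on the indicatrix bundle is the restriction of the vector field `W` of
`TM` (which is then tangent to the indicatrix bundle along the indicatrix bundle). -/
def IsRestriction (W : ∀ v : TangentBundle (𝓡 n) M, TangentSpace (𝓡 n).tangent v)
    (ξ : F.VField) : Prop :=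
  ∀ (g : C^∞⟮(𝓡 n).tangent, TangentBundle (𝓡 n) M; ℝ⟯) (v : F.indicatrixBundle),
    (ξ (F.restrictFun g)).1 v = mfderiv (𝓡 n).tangent 𝓘(ℝ, ℝ) g v.1 (W v.1)

/-- `ξ = R(X^h, Y^h)` on the indicatrix bundle. -/
def IsCurvatureField
    (X Y : Cₛ^∞⟮𝓡 n; EuclideanSpace ℝ (Fin n), (TangentSpace (𝓡 n) : M → Type _)⟯)
    (ξ : F.VField) : Prop :=
  F.IsRestriction (F.curvature (F.horLiftField X) (F.horLiftField Y)) ξ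

/-- A vector field on the indicatrix bundle is vertical if it annihilates the functions which are
smooth functions of the base point. -/
def IsVertical (ξ : F.VField) : Prop :=
  ∀ (f : C^∞⟮𝓡 n, M; ℝ⟯) (f' : F.smoothFun), (∀ v : F.indicatrixBundle, f'.1 v = f v.1.proj) →
    ξ f' = 0

/-- `η = ∇_X ξ` is the horizontal Berwald covariant derivative of the vertical vector field `ξ`
with respect to `X`, that is `∇_X ξ = [X^h, ξ]`; in coordinates
`(∇_X ξ)^i = X^j (∂ξ^i/∂x^j - G^k_j ∂ξ^i/∂y^k + (∂G^i_j/∂y^k) ξ^k)`. -/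
def IsBerwaldDeriv
    (X : Cₛ^∞⟮𝓡 n; EuclideanSpace ℝ (Fin n), (TangentSpace (𝓡 n) : M → Type _)⟯)
    (ξ η : F.VField) : Prop :=
  F.IsVertical ξ ∧ ∃ H : F.VField, F.IsRestriction (F.horLiftField X) H ∧ η = ⁅H, ξ⁆

/-- The infinitesimal holonomy algebra: the smallest Lie algebra of vector fields on the indicatrix
bundle that contains the curvature vector fields and is closed under the horizontal Berwald
covariant derivatives. -/
def infHolonomyAlgebra : LieSubalgebra ℝ F.VField :=
  sInf {L | (∀ X Y ξ, F.IsCurvatureField X Y ξ → ξ ∈ L) ∧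
    (∀ ξ ∈ L, ∀ X η, F.IsBerwaldDeriv X ξ η → η ∈ L)}

/-! #### Tangent vector fields of a group of diffeomorphisms -/

/-- `φ` is (on a neighbourhood of `0`) a smooth curve in the group `G` of diffeomorphisms of the
indicatrix bundle which is an integral curve of order `k` of `ξ`: `φ_0 = id`, the derivatives of
`t ↦ φ_t(v)` of order `1, …, k-1` at `0` vanish, and the one of order `k` is `ξ(v)`. The derivatives
are tested on smooth functions. A curve in the diffeomorphism group of a compact manifold is smooth
if and only if `(t, v) ↦ φ_t(v)` is smooth. -/
def IsIntegralCurveOfOrder (G : Subgroup F.diffGroup) (ξ : F.VField) (k : ℕ) (φ : ℝ → G) : Prop :=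
  (∃ ε : ℝ, 0 < ε ∧
    SmoothAlong (𝓘(ℝ, ℝ).prod (𝓡 n).tangent) (𝓡 n).tangent
      (fun z : Ioo (-ε) ε × F.indicatrixBundle => (z.1.1, z.2.1))
      (fun z => ((φ z.1.1).1.1 z.2).1)) ∧
  φ 0 = 1 ∧
  ∀ (f : F.smoothFun) (v : F.indicatrixBundle),
    (∀ i : ℕ, 1 ≤ i → i < k → iteratedDeriv i (fun t : ℝ => f.1 ((φ t).1.1 v)) 0 = 0) ∧
    iteratedDeriv k (fun t : ℝ => f.1 ((φ t).1.1 v)) 0 = (ξ f).1 v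

/-- The set `𝒯ₒ G` of the vector fields that are tangent to the group `G`. -/
def tangentFields (G : Subgroup F.diffGroup) : Set F.VField :=
  {ξ | ∃ k : ℕ, 1 ≤ k ∧ ∃ φ : ℝ → G, F.IsIntegralCurveOfOrder G ξ k φ}

/-! #### Parallel translation and holonomy -/

/-- `0 = τ 0 < τ 1 < ⋯ < τ m = 1` is a subdivision of the unit interval. -/
def IsSubdivision (m : ℕ) (τ : ℕ → ℝ) : Prop :=
  τ 0 = 0 ∧ τ m = 1 ∧ ∀ i < m, τ i < τ (i + 1)

/-- The vector field `V` along the piecewise differentiable curve `c : [0,1] → M` is parallel: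
`V` is continuous, lies over `c`, and on each piece it satisfies `dV^i/dt + G^i_j(c,V) dc^j/dt = 0`,
i.e. the velocity of `V` in `TM` is horizontal. -/
def IsParallel (m : ℕ) (τ : ℕ → ℝ) (c : ℝ → M) (V : ℝ → TangentBundle (𝓡 n) M) : Prop :=
  ContinuousOn V (Icc 0 1) ∧ (∀ s ∈ Icc (0 : ℝ) 1, (V s).proj = c s) ∧
  ∀ i < m, ∀ s ∈ Icc (τ i) (τ (i + 1)), ∃ w : TangentSpace (𝓡 n).tangent (V s),
    HasMFDerivWithinAt 𝓘(ℝ, ℝ) (𝓡 n).tangent V (Icc (τ i) (τ (i + 1))) s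
      (ContinuousLinearMap.toSpanSingleton ℝ w) ∧
    F.horProj (V s) w = w

/-- `h` is the parallel translation of the indicatrix at `p` along a piecewise `C^r` closed curve
starting at `p`. -/
def IsLoopTranslation (r : ℕ∞) (p : M) (h : Equiv.Perm (F.indicatrix p)) : Prop :=
  ∃ (m : ℕ) (τ : ℕ → ℝ) (c : ℝ → M), IsSubdivision m τ ∧
    (∀ i < m, ContMDiffOn 𝓘(ℝ, ℝ) (𝓡 n) r c (Icc (τ i) (τ (i + 1)))) ∧
    c 0 = p ∧ c 1 = p ∧
    ∀ y : F.indicatrix p, ∃ V : ℝ → TangentBundle (𝓡 n) M,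
      F.IsParallel m τ c V ∧ V 0 = ⟨p, y.1⟩ ∧ V 1 = ⟨p, (h y).1⟩

/-- The holonomy group at `p` (for piecewise `C^r` curves), acting on the indicatrix. -/
def holonomyGroup (r : ℕ∞) (p : M) : Subgroup (Equiv.Perm (F.indicatrix p)) :=
  Subgroup.closure {h | F.IsLoopTranslation r p h}

/-- The fibered holonomy group: generated by the fiber preserving diffeomorphisms of the indicatrix
bundle whose restriction to each indicatrix belongs to the holonomy group at that point. -/
def fiberedHolonomyGroup (r : ℕ∞) : Subgroup F.diffGroup :=
  Subgroup.closure {Φ | ∀ p : M, ∃ h ∈ F.holonomyGroup r p, ∀ y : F.indicatrix p,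
    Φ.1 (F.inclIndicatrix p y) = F.inclIndicatrix p (h y)}

/-- The fibered holonomy algebra: the vector fields tangent to the fibered holonomy group. -/
def fiberedHolonomyAlgebra (r : ℕ∞) : Set F.VField :=
  F.tangentFields (F.fiberedHolonomyGroup r)

end FinslerMetric

end Finsler

end FinslerHolonomy

end

/-! The theorem rests on a formal statement about groups of diffeomorphisms and on two geometric
facts about parallel translation.

The formal statement: the vector fields tangent to any subgroup `G` of the diffeomorphism group form
a Lie algebra. A smooth curve `φ_t` acts on functions by `f ↦ f ∘ φ_t`, so its Taylor expansion at
`t = 0` is a power series whose coefficients are linear operators on smooth functions, and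
composition of curves becomes the product of series in the reverse order (`taylor_mul`). If `φ` and
`ψ` start at the identity with leading terms `D t^k` and `D' t^l`, then for `k = l` the product has
leading term `(D + D') t^k`, the inverse of `φ` has `-D t^k`, and the group commutator has `(D D' -
D' D) t^(k+l)`. The substitution `t ↦ c t^m` makes orders equal and rescales the leading
coefficient. This gives closure under sums, scalars and brackets (`tangentLieSubalgebra`). That the
inverse of a smooth curve is smooth is an instance of the inverse function theorem.

First geometric fact: tangency to the fibered holonomy group is preserved by `ξ ↦ [X^h, ξ]`. The
horizontal lift `X^h` is smooth off the zero section and annihilates `𝓕`; since the indicatrix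
bundle is compact, `X^h` has a flow `ψ_t` on it for a uniform time, and `ψ_t` maps fibres to fibres
by parallel translation along integral curves of `X`. If `φ_t` is a curve in the holonomy group with
leading term `ξ`, then `φ ψ φ⁻¹ ψ⁻¹` has leading term `[X^h, ξ]`. The flow `ψ_t` need not belong to
the group, but `ψ φ⁻¹ ψ⁻¹` does, because parallel translation conjugates the holonomy groups of two
points; hence so does the commutator (`lie_horField_mem_tangentFields`).

Second geometric fact: curvature fields are tangent to the group. On horizontal lifts the torsion of
`h` reduces to `R(X^h, Y^h) = [X^h, Y^h] - [X, Y]^h`, which is linear over functions on `M` in both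
arguments. By a partition of unity it is enough to treat `g R(∂_i^h, ∂_j^h)` with `g` supported in a
small coordinate ball, and this equals `g [∂_i^h, ∂_j^h]` because coordinate fields commute. Take
the commutator of the two horizontal flows at times `g(π v) t` and `t`. Over the support of `g` it
is parallel translation around a small coordinate parallelogram; where `g` vanishes it is the
identity. It therefore fixes base points, is a diffeomorphism that is a holonomy transformation in
each fibre, and has leading term `g [∂_i^h, ∂_j^h] t²` (`liftFun_smul_curvField_mem`).

The minimality of the infinitesimal holonomy algebra then gives the inclusion. Minimality, applied
to the algebra of vertical fields, also shows that Berwald derivatives are always defined on it. The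
local theory describes the spray by an equation between derivatives of `𝓕²`; from it follow the
invariance of `𝓕` and the independence of the horizontal lift from the chart. Smooth dependence of
flows on time and initial point comes from the inverse function theorem in a space of curves. -/

noncomputable section

namespace FinslerHolonomy
/-! ### Smoothness of the superposition operator and of local flows -/

section Superposition

open Topology

universe u

variable {K : Type*} [TopologicalSpace K] [CompactSpace K]
  {E F G : Type*} [NormedAddCommGroup E] [NormedSpace ℝ E]
  [NormedAddCommGroup F] [NormedSpace ℝ F] [NormedAddCommGroup G] [NormedSpace ℝ G]

/-- The bounded bilinear map on continuous functions induced by a bounded bilinear map. -/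
def pointwiseBilin (K : Type*) [TopologicalSpace K] [CompactSpace K] (b : G →L[ℝ] E →L[ℝ] F) :
    C(K, G) →L[ℝ] C(K, E) →L[ℝ] C(K, F) :=
  LinearMap.mkContinuous₂
    (LinearMap.mk₂ ℝ (fun (A : C(K, G)) (h : C(K, E)) =>
        (⟨fun s => b (A s) (h s), by fun_prop⟩ : C(K, F)))
      (fun _ _ _ => by ext; simp) (fun _ _ _ => by ext; simp)
      (fun _ _ _ => by ext; simp) (fun _ _ _ => by ext; simp)) ‖b‖
    (fun A h => by
      rw [ContinuousMap.norm_le _ (by positivity)]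
      intro s
      simp only [LinearMap.mk₂_apply, ContinuousMap.coe_mk]
      exact (b.le_opNorm₂ _ _).trans (by
        gcongr
        exacts [A.norm_coe_le_norm s, h.norm_coe_le_norm s]))

/-- Composition with `f` is continuous for the uniform norm. Displacing the whole curve `α` by the
constant vector `z - α s` tests this continuity at the pair `(s, z)`, so a single `δ` serves all
`s`. -/
theorem exists_norm_sub_le_near_curve (f : C(E, G)) (α : C(K, E)) {c : ℝ} (hc : 0 < c) :
    ∃ δ > 0, ∀ s : K, ∀ z ∈ Metric.ball (α s) δ, ‖f z - f (α s)‖ ≤ c := by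
  have hcont : ContinuousAt (fun β : C(K, E) => f.comp β) α :=
    (ContinuousMap.continuous_postcomp f).continuousAt
  obtain ⟨δ, hδ, hball⟩ := Metric.continuousAt_iff.1 hcont c hc
  refine ⟨δ, hδ, fun s z hz => ?_⟩
  let γ : C(K, E) := α + ContinuousMap.const K (z - α s)
  have hγ : dist γ α < δ := by
    rw [ContinuousMap.dist_lt_iff hδ]
    intro x
    simpa [γ, dist_eq_norm] using hz
  have := (ContinuousMap.dist_lt_iff hc).1 (hball hγ) s
  rw [dist_eq_norm] at this
  simpa [γ] using this.le

/-- The mean value inequality is applied at each `s` on the ball of radius `δ` about `α s`, with `δ`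
independent of `s`. The derivative of `f` has the form `b (f' x)` so that the derivative of the
superposition operator is a fixed continuous linear map composed with superposition by `f'`. -/
theorem hasFDerivAt_superposition (b : G →L[ℝ] E →L[ℝ] F)
    (f : C(E, F)) (f' : C(E, G)) (hf : ∀ x, HasFDerivAt f (b (f' x)) x) (α : C(K, E)) :
    HasFDerivAt (fun β : C(K, E) => f.comp β) (pointwiseBilin K b (f'.comp α)) α := by
  rw [hasFDerivAt_iff_isLittleO, Asymptotics.isLittleO_iff]
  intro c hc
  obtain ⟨δ, hδ, hs⟩ := exists_norm_sub_le_near_curve f' α (c := c / (‖b‖ + 1)) (by positivity)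
  filter_upwards [Metric.ball_mem_nhds α hδ] with β hβ
  rw [ContinuousMap.norm_le _ (by positivity)]
  intro s
  have hs' : ∀ z ∈ Metric.ball (α s) δ, ‖b (f' z) - b (f' (α s))‖ ≤ c := by
    intro z hz
    rw [← map_sub]
    calc ‖b (f' z - f' (α s))‖ ≤ ‖b‖ * (c / (‖b‖ + 1)) := b.le_opNorm_of_le (hs s z hz)
      _ ≤ (‖b‖ + 1) * (c / (‖b‖ + 1)) := by gcongr; linarith
      _ = c := by field_simp
  have hβs : β s ∈ Metric.ball (α s) δ := (ContinuousMap.dist_apply_le_dist s).trans_lt hβ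
  have := (convex_ball (α s) δ).norm_image_sub_le_of_norm_hasFDerivWithin_le'
    (f := f) (f' := fun z => b (f' z)) (φ := b (f' (α s))) (fun z _ => (hf z).hasFDerivWithinAt)
    hs' (Metric.mem_ball_self hδ) hβs
  calc ‖(f.comp β - f.comp α - pointwiseBilin K b (f'.comp α) (β - α)) s‖
      = ‖f (β s) - f (α s) - b (f' (α s)) (β s - α s)‖ := rfl
    _ ≤ c * ‖β s - α s‖ := this
    _ ≤ c * ‖β - α‖ := by
        gcongr
        exact (β - α).norm_coe_le_norm s

theorem contDiff_succ_superposition (b : G →L[ℝ] E →L[ℝ] F)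
    (f : C(E, F)) (f' : C(E, G)) (hf : ∀ x, HasFDerivAt f (b (f' x)) x) (n : ℕ)
    (hn : ContDiff ℝ n (fun β : C(K, E) => f'.comp β)) :
    ContDiff ℝ (n + 1 : ℕ) (fun β : C(K, E) => f.comp β) := by
  push_cast
  rw [contDiff_succ_iff_hasFDerivAt]
  exact ⟨fun α => pointwiseBilin K b (f'.comp α),
    (pointwiseBilin K b).contDiff.comp hn, hasFDerivAt_superposition b f f' hf⟩

-- Induction on the order of differentiability, for all targets `F` at once: superposition by `f`
-- gains one order over superposition by `fderiv ℝ f`. The common universe keeps `E →L[ℝ] F` among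
-- the admissible targets.
set_option synthInstance.maxHeartbeats 400000 in
theorem contDiff_superposition {K : Type u} [TopologicalSpace K] [CompactSpace K] {E F : Type u}
    [NormedAddCommGroup E] [NormedSpace ℝ E] [NormedAddCommGroup F] [NormedSpace ℝ F]
    (f : C(E, F)) (hf : ContDiff ℝ ∞ f) :
    ContDiff ℝ ∞ (fun β : C(K, E) => f.comp β) := by
  rw [contDiff_infty]
  intro n
  induction n generalizing F with
  | zero => exact contDiff_zero.2 (ContinuousMap.continuous_postcomp f)
  | succ n ih =>
    have hf' : ContDiff ℝ ∞ (fderiv ℝ f) := hf.fderiv_right (by simp)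
    exact contDiff_succ_superposition (ContinuousLinearMap.id ℝ (E →L[ℝ] F)) f
      ⟨fderiv ℝ f, hf'.continuous⟩ (fun x => (hf.differentiable (by simp) x).hasFDerivAt) n
      (ih _ hf')

end Superposition

/-! ### The inverse function theorem on an open set -/

section InverseFunction

open Topology

variable {E F : Type*} [NormedAddCommGroup E] [NormedSpace ℝ E] [CompleteSpace E]
  [NormedAddCommGroup F] [NormedSpace ℝ F]

/-- The smooth inverse function theorem, with the inverse smooth on an open set. -/
theorem exists_openPartialHomeomorph_contDiffOn {f : E → F} {U : Set E} (hU : IsOpen U)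
    (hf : ContDiffOn ℝ ∞ f U) {a : E} (ha : a ∈ U) {f' : E ≃L[ℝ] F}
    (hf' : HasFDerivAt f (f' : E →L[ℝ] F) a) :
    ∃ e : OpenPartialHomeomorph E F, a ∈ e.source ∧ e.source ⊆ U ∧ ⇑e = f ∧
      ContDiffOn ℝ ∞ e.symm e.target := by
  have hfa : ContDiffAt ℝ ∞ f a := hf.contDiffAt (hU.mem_nhds ha)
  let e₀ := hfa.toOpenPartialHomeomorph f hf' (by simp)
  have he₀ : ⇑e₀ = f := rfl
  -- Invertible operators form an open set. Restricting to the points where the derivative is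
  -- invertible makes the inverse smooth at every point of the target, not only at `f a`.
  have hopen : IsOpen {x ∈ U | fderiv ℝ f x ∈ range ((↑) : (E ≃L[ℝ] F) → E →L[ℝ] F)} :=
    (hf.continuousOn_fderiv_of_isOpen hU (by simp)).isOpen_inter_preimage hU
      ContinuousLinearEquiv.isOpen
  refine ⟨e₀.restrOpen _ hopen, ⟨hfa.mem_toOpenPartialHomeomorph_source hf' (by simp), ha,
    ⟨f', hf'.fderiv.symm⟩⟩, fun x hx => hx.2.1, rfl, ?_⟩
  intro y hy
  have hx := (e₀.restrOpen _ hopen).map_target hy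
  set x := (e₀.restrOpen _ hopen).symm y with hxdef
  obtain ⟨g', hg'⟩ := hx.2.2
  have hfx : ContDiffAt ℝ ∞ f x := hf.contDiffAt (hU.mem_nhds hx.2.1)
  refine ((e₀.restrOpen _ hopen).contDiffAt_symm hy (f₀' := g') ?_ hfx).contDiffWithinAt
  rw [hg']
  exact (hfx.differentiableAt (by simp)).hasFDerivAt

end InverseFunction
-- Smooth local flows in vector spaces
section LocalFlow

open Topology intervalIntegral

variable {E : Type} [NormedAddCommGroup E] [NormedSpace ℝ E] [CompleteSpace E]

/-- The integration operator `α ↦ (s ↦ ∫ σ in 0..s, α σ)` on curves defined on `[-1,1]`. -/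
def curveIntegral (E : Type) [NormedAddCommGroup E] [NormedSpace ℝ E] :
    C(Icc (-1 : ℝ) 1, E) →L[ℝ] C(Icc (-1 : ℝ) 1, E) :=
  have hI (α : C(Icc (-1 : ℝ) 1, E)) : Continuous (IccExtend (by norm_num : (-1 : ℝ) ≤ 1) α) :=
    α.continuous.Icc_extend'
  LinearMap.mkContinuous
    { toFun := fun α => ⟨fun s => ∫ σ in (0 : ℝ)..s, IccExtend (by norm_num : (-1 : ℝ) ≤ 1) α σ,
        (continuous_primitive (fun _ _ => (hI α).intervalIntegrable _ _) 0).comp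
          continuous_subtype_val⟩
      map_add' := fun α β => by
        ext s
        exact integral_add ((hI α).intervalIntegrable _ _) ((hI β).intervalIntegrable _ _)
      map_smul' := fun c α => by
        ext s
        exact integral_smul c _ } 1
    (fun α => by
      rw [ContinuousMap.norm_le _ (by positivity)]
      intro s
      have := norm_integral_le_of_norm_le_const (a := (0 : ℝ)) (b := s) (C := ‖α‖)
        (f := IccExtend (by norm_num : (-1 : ℝ) ≤ 1) α) (fun σ _ => α.norm_coe_le_norm _)
      refine this.trans ?_
      rw [one_mul, sub_zero]
      exact mul_le_of_le_one_right (norm_nonneg _) (abs_le.2 s.2))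

/-- Let `α` solve `α(s) = x + ε ∫₀ˢ f(α)`. Then `t ↦ α(t / ε)` solves `y' = f(y)`. -/
theorem hasDerivAt_of_integral_eq {f : C(E, E)} {x : E} {ε : ℝ} (hε : 0 < ε)
    {α : C(Icc (-1 : ℝ) 1, E)}
    (hα : α = ContinuousMap.const _ x + ε • curveIntegral E (f.comp α)) {t : ℝ}
    (ht : t ∈ Ioo (-ε) ε) :
    HasDerivAt (fun t => IccExtend (by norm_num : (-1 : ℝ) ≤ 1) α (t / ε))
      (f (IccExtend (by norm_num : (-1 : ℝ) ≤ 1) α (t / ε))) t := by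
  have h11 : (-1 : ℝ) ≤ 1 := by norm_num
  have hc : Continuous fun σ => f (IccExtend h11 α σ) := f.continuous.comp α.continuous.Icc_extend'
  have hmem : ∀ s ∈ Ioo (-ε) ε, s / ε ∈ Icc (-1 : ℝ) 1 := fun s hs => by
    constructor
    · rw [le_div_iff₀ hε]; linarith [hs.1]
    · rw [div_le_iff₀ hε]; linarith [hs.2]
  have h1 : ∀ᶠ s in 𝓝 t, IccExtend h11 α (s / ε)
      = x + ε • ∫ σ in (0 : ℝ)..(s / ε), f (IccExtend h11 α σ) := by
    filter_upwards [Ioo_mem_nhds ht.1 ht.2] with s hs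
    rw [IccExtend_of_mem h11 α (hmem s hs)]
    conv_lhs => rw [hα]
    rfl
  refine HasDerivAt.congr_of_eventuallyEq ?_ h1
  have h2 := integral_hasDerivAt_right (hc.intervalIntegrable 0 (t / ε))
    hc.aestronglyMeasurable.stronglyMeasurableAtFilter hc.continuousAt
  have h3 := (h2.scomp t ((hasDerivAt_id t).div_const ε)).const_smul ε |>.const_add x
  refine h3.congr_deriv ?_
  simp [smul_smul, hε.ne']

/-- On the fixed interval `[-1, 1]` the equation `α = x + ε ∫ f(α)` turns the length of time into a
parameter `ε`. The map `Q (x, ε, α) = (x, ε, α - x - ε N(α))` is smooth by the smoothness of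
superposition, and at `ε = 0` its derivative in `α` is the identity. The inverse function theorem
yields `α` as a smooth function of `(x, ε)`, and the flow at time `ε` is `α(1)`. -/
theorem exists_local_flow_of_contDiff {f : E → E} (hf : ContDiff ℝ ∞ f) (x₀ : E) :
    ∃ V : Set E, IsOpen V ∧ x₀ ∈ V ∧ ∃ ε > 0, ∃ Φ : ℝ × E → E,
      ContDiffOn ℝ ∞ Φ (Ioo (-ε) ε ×ˢ V) ∧ (∀ x ∈ V, Φ (0, x) = x) ∧
      ∀ t ∈ Ioo (-ε) ε, ∀ x ∈ V, HasDerivAt (fun s => Φ (s, x)) (f (Φ (t, x))) t := by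
  have h11 : (-1 : ℝ) ≤ 1 := by norm_num
  let fc : C(E, E) := ⟨f, hf.continuous⟩
  let X := C(Icc (-1 : ℝ) 1, E)
  let cst : E →L[ℝ] X := ContinuousLinearMap.const ℝ (Icc (-1 : ℝ) 1)
  let N : X → X := fun α => curveIntegral E (fc.comp α)
  have hN : ContDiff ℝ ∞ N := (curveIntegral E).contDiff.comp (contDiff_superposition fc hf)
  let Q : (E × ℝ) × X → (E × ℝ) × X := fun z => (z.1, z.2 - cst z.1.1 - z.1.2 • N z.2)
  have hQ : ContDiff ℝ ∞ Q := by
    have := hN.comp (contDiff_snd (𝕜 := ℝ) (E := E × ℝ) (F := X))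
    have h2 : ContDiff ℝ ∞ fun z : (E × ℝ) × X => cst z.1.1 := by fun_prop
    exact contDiff_fst.prodMk ((contDiff_snd.sub h2).sub
      ((contDiff_snd.comp contDiff_fst).smul this))
  let a : (E × ℝ) × X := ((x₀, 0), cst x₀)
  -- At `ε = 0` the term `ε N(α)` contributes only its derivative in `ε`. The derivative of `Q` is
  -- thus triangular with identities on the diagonal, hence invertible without any estimate.
  let S : E × ℝ →L[ℝ] X := -(cst.comp (ContinuousLinearMap.fst ℝ E ℝ))
    - (ContinuousLinearMap.snd ℝ E ℝ).smulRight (N (cst x₀))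
  let Q' : ((E × ℝ) × X) ≃L[ℝ] ((E × ℝ) × X) :=
    ContinuousLinearEquiv.skewProd (.refl ℝ (E × ℝ)) (.refl ℝ X) S
  have hQ' : HasFDerivAt Q (Q' : ((E × ℝ) × X) →L[ℝ] ((E × ℝ) × X)) a := by
    have h1 : HasFDerivAt (fun z : (E × ℝ) × X => z.1) (ContinuousLinearMap.fst ℝ (E × ℝ) X) a :=
      hasFDerivAt_fst
    have h2 : HasFDerivAt (fun z : (E × ℝ) × X => z.2) (ContinuousLinearMap.snd ℝ (E × ℝ) X) a :=
      hasFDerivAt_snd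
    have h3 := (cst.comp (ContinuousLinearMap.fst ℝ E ℝ)).hasFDerivAt.comp a h1
    have h4 := (ContinuousLinearMap.snd ℝ E ℝ).hasFDerivAt.comp a h1
    have h5 := ((hN.differentiable (by simp) (cst x₀)).hasFDerivAt (x := cst x₀)).comp a h2
    refine (h1.prodMk ((h2.sub h3).sub (h4.smul h5))).congr_fderiv ?_
    refine ContinuousLinearMap.ext fun z => Prod.ext rfl ?_
    show z.2 - cst z.1.1 - ((0 : ℝ) • fderiv ℝ N (cst x₀) z.2 + z.1.2 • N (cst x₀))
      = z.2 + (-(cst z.1.1) - z.1.2 • N (cst x₀))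
    rw [zero_smul]
    abel
  obtain ⟨e, hae, -, heQ, he⟩ := exists_openPartialHomeomorph_contDiffOn isOpen_univ
    hQ.contDiffOn (mem_univ a) hQ'
  have hQa : Q a = ((x₀, 0), 0) := by simp [Q, a]
  -- the implicit solution
  let A : E × ℝ → X := fun p => (e.symm (p, 0)).2
  have hmem0 : ((x₀, (0 : ℝ)), (0 : X)) ∈ e.target := by
    rw [← hQa, ← heQ]; exact e.map_source hae
  have hsym0 : e.symm ((x₀, 0), 0) = a := by
    rw [← hQa, ← heQ]; exact e.left_inv hae
  obtain ⟨δ, hδ, hball⟩ := Metric.isOpen_iff.1 e.open_source a hae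
  have hcA : ContinuousAt (fun p : E × ℝ => e.symm (p, 0)) (x₀, 0) :=
    (e.continuousAt_symm hmem0).comp (f := fun p : E × ℝ => (p, (0 : X)))
      (by fun_prop : Continuous fun p : E × ℝ => (p, (0 : X))).continuousAt
  have hnhds : {p : E × ℝ | (p, (0 : X)) ∈ e.target ∧ dist (A p) (cst x₀) < δ ∧ dist p (x₀, 0) < δ}
      ∈ 𝓝 (x₀, (0 : ℝ)) := by
    refine Filter.inter_mem ?_ (Filter.inter_mem ?_ (Metric.ball_mem_nhds _ hδ))
    · exact (by fun_prop : Continuous fun p : E × ℝ => (p, (0 : X))).continuousAt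
        (e.open_target.mem_nhds hmem0)
    · have h := hcA.snd
      have h0 : (fun p : E × ℝ => (e.symm (p, 0)).2) (x₀, 0) = cst x₀ := by simp [hsym0, a]
      exact h (by rw [h0]; exact Metric.ball_mem_nhds _ hδ)
  obtain ⟨δ', hδ', hsub⟩ := Metric.mem_nhds_iff.1 hnhds
  have hball' : ∀ x ∈ Metric.ball x₀ δ', ∀ t ∈ Ioo (-δ') δ', ((x, t), (0 : X)) ∈ e.target ∧
      dist (A (x, t)) (cst x₀) < δ ∧ dist (x, t) (x₀, 0) < δ := by
    intro x hx t ht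
    refine hsub (?_ : dist (x, t) (x₀, 0) < δ')
    rw [Prod.dist_eq, max_lt_iff]
    exact ⟨hx, by simpa [abs_lt] using ht⟩
  have hfst : ∀ p : E × ℝ, (p, (0 : X)) ∈ e.target → (e.symm (p, 0)).1 = p ∧
      A p = cst p.1 + p.2 • N (A p) := by
    intro p hp
    have h := e.right_inv hp
    rw [heQ] at h
    have h1 : (e.symm (p, 0)).1 = p := congrArg Prod.fst h
    have h2 := congrArg Prod.snd h
    simp only [Q, h1] at h2
    exact ⟨h1, by rw [sub_sub, sub_eq_zero] at h2; exact h2⟩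
  -- Uniqueness of small solutions is the injectivity of `Q` near `a`.
  have huniq : ∀ x ∈ Metric.ball x₀ δ', ∀ t ∈ Ioo (-δ') δ', ∀ β : X, dist β (cst x₀) < δ →
      β = cst x + t • N β → β = A (x, t) := by
    intro x hx t ht β hβ h
    obtain ⟨h1, h2, h3⟩ := hball' x hx t ht
    have hs : ((x, t), β) ∈ e.source := hball (by
      rw [Metric.mem_ball, Prod.dist_eq, max_lt_iff]; exact ⟨h3, hβ⟩)
    have : e ((x, t), β) = ((x, t), 0) := by
      rw [heQ]
      simp only [Q, Prod.mk.injEq, true_and]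
      rw [sub_sub, sub_eq_zero]; exact h
    have := e.left_inv hs ▸ congrArg e.symm this
    exact congrArg Prod.snd this
  have one_mem : (1 : ℝ) ∈ Icc (-1 : ℝ) 1 := by norm_num
  -- Half the radius is kept because the endpoint `δ' / 2` itself has to be an admissible parameter
  -- below.
  refine ⟨Metric.ball x₀ δ', Metric.isOpen_ball, Metric.mem_ball_self hδ', δ' / 2, by positivity,
    fun p => A (p.2, p.1) ⟨1, one_mem⟩, ?_, ?_, ?_⟩
  · have h1 : ContDiffOn ℝ ∞ (fun p : ℝ × E => e.symm ((p.2, p.1), (0 : X)))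
        (Ioo (-(δ' / 2)) (δ' / 2) ×ˢ Metric.ball x₀ δ') := by
      refine he.comp (by fun_prop) ?_
      rintro ⟨t, x⟩ ⟨ht, hx⟩
      exact (hball' x hx t ⟨by linarith [ht.1], by linarith [ht.2]⟩).1
    exact (ContinuousMap.evalCLM ℝ (⟨1, one_mem⟩ : Icc (-1 : ℝ) 1)).contDiff.comp_contDiffOn
      (contDiff_snd.comp_contDiffOn h1)
  · intro x hx
    have := (hfst (x, 0) (hball' x hx 0 ⟨by linarith, hδ'⟩).1).2
    show A (x, 0) _ = x
    rw [this]
    show x + (0 : ℝ) • _ = x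
    rw [zero_smul, add_zero]
  · intro t ht x hx
    set ε := δ' / 2 with hεdef
    have hε : 0 < ε := by positivity
    have hεm : ε ∈ Ioo (-δ') δ' := ⟨by linarith, by linarith⟩
    obtain ⟨h1, h2, -⟩ := hball' x hx ε hεm
    have hα := (hfst (x, ε) h1).2
    -- The solution for the parameter `ε`, slowed down by the factor `s / ε`, solves the equation
    -- for the parameter `s`. By uniqueness the values at `1` for varying `s` trace one curve, the
    -- solution for `ε`.
    have key : ∀ s ∈ Ioo (-ε) ε, A (x, s) ⟨1, one_mem⟩ = IccExtend h11 (A (x, ε)) (s / ε) := by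
      intro s hs
      have hl : |s / ε| ≤ 1 := by
        rw [abs_div, abs_of_pos hε, div_le_one hε]
        exact (abs_lt.2 hs).le
      let β : X := ⟨fun σ => IccExtend h11 (A (x, ε)) (s / ε * σ),
        (A (x, ε)).continuous.Icc_extend'.comp (by fun_prop)⟩
      have hm : ∀ σ ∈ Icc (-1 : ℝ) 1, s / ε * σ ∈ Icc (-1 : ℝ) 1 := fun σ hσ => by
        rw [mem_Icc, ← abs_le, abs_mul]
        exact mul_le_one₀ hl (abs_nonneg _) (abs_le.2 hσ)
      have hβ : β = A (x, s) := by
        refine huniq x hx s ⟨by linarith [hs.1], by linarith [hs.2]⟩ β ?_ ?_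
        · rw [ContinuousMap.dist_lt_iff hδ] at h2 ⊢
          intro σ
          have := h2 ⟨s / ε * σ, hm σ σ.2⟩
          have e1 : β σ = A (x, ε) ⟨s / ε * σ, hm σ σ.2⟩ := IccExtend_of_mem h11 _ (hm σ σ.2)
          rw [e1]
          exact this
        · ext σ
          have e1 : β σ = A (x, ε) ⟨s / ε * σ, hm σ σ.2⟩ := IccExtend_of_mem h11 _ (hm σ σ.2)
          rw [e1]
          have e2 := DFunLike.congr_fun hα ⟨s / ε * σ, hm σ σ.2⟩
          rw [e2]
          have e3 : ∀ τ ∈ uIcc (0 : ℝ) σ, IccExtend h11 (fc.comp β) τ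
              = IccExtend h11 (fc.comp (A (x, ε))) (s / ε * τ) := by
            intro τ hτ
            have hτ' : τ ∈ Icc (-1 : ℝ) 1 :=
              (uIcc_subset_Icc (a₂ := (-1 : ℝ)) (b₂ := 1) (by norm_num) σ.2) hτ
            rw [IccExtend_of_mem h11 _ hτ', IccExtend_of_mem h11 _ (hm τ hτ')]
            show f (IccExtend h11 (A (x, ε)) (s / ε * τ)) = _
            rw [IccExtend_of_mem h11 _ (hm τ hτ')]
            rfl
          show x + ε • (∫ τ in (0 : ℝ)..(s / ε * σ), IccExtend h11 (fc.comp (A (x, ε))) τ)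
            = x + s • (∫ τ in (0 : ℝ)..σ, IccExtend h11 (fc.comp β) τ)
          rw [integral_congr e3]
          rcases eq_or_ne s 0 with rfl | hs0
          · simp
          · have hc : s / ε ≠ 0 := div_ne_zero hs0 hε.ne'
            rw [integral_comp_mul_left _ hc, mul_zero, smul_smul]
            congr 2
            field_simp
      rw [← hβ]
      show IccExtend h11 (A (x, ε)) (s / ε * 1) = _
      rw [mul_one]
    have hd := hasDerivAt_of_integral_eq hε hα ht
    have hv : A (x, t) ⟨1, one_mem⟩ = _ := key t ht
    show HasDerivAt (fun s => A (x, s) ⟨1, one_mem⟩) (f (A (x, t) ⟨1, one_mem⟩)) t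
    rw [hv]
    refine hd.congr_of_eventuallyEq ?_
    filter_upwards [Ioo_mem_nhds ht.1 ht.2] with s hs
    exact key s hs

/-- A bump function extends `f` to a globally smooth field without changing it near `x₀`. For short
times and nearby starting points the flow remains in the ball where the bump function is `1`. -/
theorem exists_local_flow [FiniteDimensional ℝ E] {f : E → E} {U : Set E} (hU : IsOpen U)
    (hf : ContDiffOn ℝ ∞ f U) {x₀ : E} (hx₀ : x₀ ∈ U) :
    ∃ V : Set E, IsOpen V ∧ x₀ ∈ V ∧ ∃ ε > 0, ∃ Φ : ℝ × E → E,
      ContDiffOn ℝ ∞ Φ (Ioo (-ε) ε ×ˢ V) ∧ (∀ x ∈ V, Φ (0, x) = x) ∧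
      ∀ t ∈ Ioo (-ε) ε, ∀ x ∈ V, Φ (t, x) ∈ U ∧
        HasDerivAt (fun s => Φ (s, x)) (f (Φ (t, x))) t := by
  obtain ⟨χ, hχ⟩ : ∃ χ : ContDiffBump x₀, Metric.closedBall x₀ χ.rOut ⊆ U := by
    obtain ⟨δ, hδ, h⟩ := Metric.isOpen_iff.1 hU x₀ hx₀
    exact ⟨⟨δ / 4, δ / 2, by positivity, by linarith⟩,
      (Metric.closedBall_subset_ball (by simp; linarith)).trans h⟩
  have hg : ContDiff ℝ ∞ fun x => χ x • f x := by
    rw [contDiff_iff_contDiffAt]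
    intro x
    by_cases hx : x ∈ Metric.closedBall x₀ χ.rOut
    · exact χ.contDiffAt.smul (hf.contDiffAt (hU.mem_nhds (hχ hx)))
    · refine (contDiffAt_const (c := (0 : E))).congr_of_eventuallyEq ?_
      filter_upwards [Metric.isClosed_closedBall.isOpen_compl.mem_nhds hx] with y hy
      rw [χ.zero_of_le_dist (le_of_not_ge fun h => hy h), zero_smul]
  obtain ⟨V, hV, hxV, ε, hε, Φ, hΦ, hΦ0, hΦ'⟩ := exists_local_flow_of_contDiff hg x₀
  have hopen : IsOpen ((Ioo (-ε) ε ×ˢ V) ∩ Φ ⁻¹' Metric.ball x₀ χ.rIn) :=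
    hΦ.continuousOn.isOpen_inter_preimage (isOpen_Ioo.prod hV) Metric.isOpen_ball
  have hmem : ((0 : ℝ), x₀) ∈ (Ioo (-ε) ε ×ˢ V) ∩ Φ ⁻¹' Metric.ball x₀ χ.rIn :=
    ⟨⟨⟨by linarith, hε⟩, hxV⟩, by simp [hΦ0 x₀ hxV, χ.rIn_pos]⟩
  obtain ⟨T, W, hT, hW, h0T, hxW, hTW⟩ := isOpen_prod_iff.1 hopen 0 x₀ hmem
  obtain ⟨ε', hε', hTε⟩ := Metric.isOpen_iff.1 hT 0 h0T
  rw [Real.ball_eq_Ioo, zero_sub, zero_add] at hTε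
  refine ⟨W, hW, hxW, ε', hε', Φ, hΦ.mono fun z hz => (hTW ⟨hTε hz.1, hz.2⟩).1, ?_, ?_⟩
  · intro x hx
    exact hΦ0 x (hTW (⟨h0T, hx⟩ : ((0 : ℝ), x) ∈ T ×ˢ W)).1.2
  · intro t ht x hx
    have h := hTW (⟨hTε ht, hx⟩ : (t, x) ∈ T ×ˢ W)
    have hb : Φ (t, x) ∈ Metric.ball x₀ χ.rIn := h.2
    refine ⟨hχ (Metric.ball_subset_closedBall (Metric.ball_subset_ball χ.rIn_lt_rOut.le hb)), ?_⟩
    have := hΦ' t h.1.1 x h.1.2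
    rwa [χ.one_of_mem_closedBall (Metric.ball_subset_closedBall hb), one_smul] at this

end LocalFlow
-- Smooth local flows on manifolds
section ManifoldFlow

open Topology

variable {E : Type} [NormedAddCommGroup E] [NormedSpace ℝ E]
  {H : Type*} [TopologicalSpace H] {I : ModelWithCorners ℝ E H} [I.Boundaryless]
  {N : Type*} [TopologicalSpace N] [ChartedSpace H N] [IsManifold I ∞ N]

/-- The vector field `W` on `N`, expressed in the preferred chart at `x₀`. -/
def vectorInChart (I : ModelWithCorners ℝ E H) {N : Type*} [TopologicalSpace N] [ChartedSpace H N]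
    [IsManifold I ∞ N] (W : ∀ x : N, TangentSpace I x) (x₀ : N) (z : E) : E :=
  tangentCoordChange I ((extChartAt I x₀).symm z) x₀ ((extChartAt I x₀).symm z)
    (W ((extChartAt I x₀).symm z))

theorem contDiffOn_vectorInChart {W : ∀ x : N, TangentSpace I x} {O : Set N}
    (hW : ContMDiffOn I I.tangent ∞ (fun x => (⟨x, W x⟩ : TangentBundle I N)) O) (x₀ : N) :
    ContDiffOn ℝ ∞ (vectorInChart I W x₀)
      ((extChartAt I x₀).target ∩ (extChartAt I x₀).symm ⁻¹' O) := by
  have h1 : ContMDiffOn 𝓘(ℝ, E) I.tangent ∞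
      (fun z => (⟨(extChartAt I x₀).symm z, W ((extChartAt I x₀).symm z)⟩ : TangentBundle I N))
      ((extChartAt I x₀).target ∩ (extChartAt I x₀).symm ⁻¹' O) :=
    hW.comp ((contMDiffOn_extChartAt_symm x₀).mono inter_subset_left) inter_subset_right
  have hm : MapsTo (fun z => (⟨(extChartAt I x₀).symm z, W ((extChartAt I x₀).symm z)⟩ :
      TangentBundle I N)) ((extChartAt I x₀).target ∩ (extChartAt I x₀).symm ⁻¹' O)
      (trivializationAt E (TangentSpace I) x₀).source := by
    intro z hz
    have := (extChartAt I x₀).map_target hz.1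
    rw [extChartAt_source] at this
    exact this
  exact (((trivializationAt E (TangentSpace I) x₀).contMDiffOn_iff hm).1 h1).2.contDiffOn

/-- A curve in a chart satisfying the coordinate equation is an integral curve. -/
theorem hasMFDerivAt_of_vectorInChart {W : ∀ x : N, TangentSpace I x} {x₀ : N} {f : ℝ → E} {t : ℝ}
    (hft : f t ∈ (extChartAt I x₀).target) (h : HasDerivAt f (vectorInChart I W x₀ (f t)) t) :
    HasMFDerivAt 𝓘(ℝ, ℝ) I ((extChartAt I x₀).symm ∘ f) t
      ((1 : ℝ →L[ℝ] ℝ).smulRight (W ((extChartAt I x₀).symm (f t)))) := by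
  let xₜ : N := (extChartAt I x₀).symm (f t)
  have hft1 : xₜ ∈ (extChartAt I x₀).source := (extChartAt I x₀).map_target hft
  have hft2 := mem_extChartAt_source (I := I) xₜ
  suffices key : HasDerivAt ((extChartAt I xₜ ∘ (extChartAt I x₀).symm) ∘ f) (W xₜ : E) t by
    refine ⟨(continuousAt_extChartAt_symm'' hft).comp h.continuousAt, ?_⟩
    have h1 := key.hasFDerivAt.hasFDerivWithinAt (s := range 𝓘(ℝ, ℝ))
    convert! h1 using 1
  have hW : tangentCoordChange I x₀ xₜ xₜ (vectorInChart I W x₀ (f t)) = W xₜ := by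
    refine (tangentCoordChange_comp (w := xₜ) (x := x₀) (y := xₜ) ⟨⟨hft2, hft1⟩, hft2⟩).trans ?_
    exact tangentCoordChange_self hft2
  rw [← hW]
  refine HasFDerivAt.comp_hasDerivAt _ ?_ h
  have := hasFDerivWithinAt_tangentCoordChange (I := I) (x := x₀) (y := xₜ) (z := xₜ) ⟨hft1, hft2⟩
  rw [ModelWithCorners.range_eq_univ, hasFDerivWithinAt_univ,
    (extChartAt I x₀).right_inv hft] at this
  exact this

/-- Smooth local flows of smooth vector fields on manifolds. -/
theorem exists_local_flow_manifold [FiniteDimensional ℝ E] {W : ∀ x : N, TangentSpace I x}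
    {O : Set N} (hO : IsOpen O)
    (hW : ContMDiffOn I I.tangent ∞ (fun x => (⟨x, W x⟩ : TangentBundle I N)) O) {x₀ : N}
    (hx₀ : x₀ ∈ O) :
    ∃ V : Set N, IsOpen V ∧ x₀ ∈ V ∧ ∃ ε > 0, ∃ Φ : ℝ × N → N,
      ContMDiffOn (𝓘(ℝ, ℝ).prod I) I ∞ Φ (Ioo (-ε) ε ×ˢ V) ∧ (∀ x ∈ V, Φ (0, x) = x) ∧
      ∀ t ∈ Ioo (-ε) ε, ∀ x ∈ V, Φ (t, x) ∈ O ∧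
        HasMFDerivAt 𝓘(ℝ, ℝ) I (fun s => Φ (s, x)) t
          ((1 : ℝ →L[ℝ] ℝ).smulRight (W (Φ (t, x)))) := by
  let e := extChartAt I x₀
  have hU : IsOpen (e.target ∩ e.symm ⁻¹' O) :=
    (continuousOn_extChartAt_symm x₀).isOpen_inter_preimage (isOpen_extChartAt_target x₀) hO
  have hmem : e x₀ ∈ e.target ∩ e.symm ⁻¹' O :=
    ⟨mem_extChartAt_target x₀, by simpa [e] using hx₀⟩
  obtain ⟨V, hV, hxV, ε, hε, Φ, hΦ, hΦ0, hΦ'⟩ :=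
    exists_local_flow hU (contDiffOn_vectorInChart hW x₀) hmem
  have hV' : IsOpen (e.source ∩ e ⁻¹' V) :=
    (continuousOn_extChartAt x₀).isOpen_inter_preimage (isOpen_extChartAt_source x₀) hV
  refine ⟨e.source ∩ e ⁻¹' V, hV', ⟨mem_extChartAt_source x₀, hxV⟩, ε, hε,
    fun p => e.symm (Φ (p.1, e p.2)), ?_, ?_, ?_⟩
  · refine (contMDiffOn_extChartAt_symm x₀).comp (t := e.target) ?_ ?_
    · have h1 : ContMDiffOn (𝓘(ℝ, ℝ).prod I) 𝓘(ℝ, E) ∞ (fun p : ℝ × N => e p.2)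
          (Ioo (-ε) ε ×ˢ (e.source ∩ e ⁻¹' V)) :=
        (contMDiffOn_extChartAt (x := x₀)).comp contMDiffOn_snd fun p hp => by
          have := hp.2.1
          simpa [e] using this
      exact hΦ.contMDiffOn.comp (contMDiffOn_fst.prodMk_space h1) fun p hp => ⟨hp.1, hp.2.2⟩
    · exact fun p hp => (hΦ' p.1 hp.1 (e p.2) hp.2.2).1.1
  · intro x hx
    show e.symm (Φ (0, e x)) = x
    rw [hΦ0 _ hx.2, e.left_inv hx.1]
  · intro t ht x hx
    obtain ⟨h1, h2⟩ := hΦ' t ht (e x) hx.2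
    exact ⟨h1.2, hasMFDerivAt_of_vectorInChart h1.1 h2⟩

end ManifoldFlow

/-! ### Uniqueness of integral curves -/

section Uniqueness

open Topology

variable {E : Type*} [NormedAddCommGroup E] [NormedSpace ℝ E]
  {H : Type*} [TopologicalSpace H] {I : ModelWithCorners ℝ E H} [I.Boundaryless]
  {N : Type*} [TopologicalSpace N] [ChartedSpace H N] [IsManifold I 1 N] [T2Space N]

/-- Integral curves are unique, when the vector field is `C¹` along one of them. -/
theorem integralCurve_eqOn_Ioo {W : ∀ x : N, TangentSpace I x} {γ γ' : ℝ → N} {a b t₀ : ℝ}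
    (ht₀ : t₀ ∈ Ioo a b)
    (hW : ∀ t ∈ Ioo a b, ContMDiffAt I I.tangent 1 (fun x => (⟨x, W x⟩ : TangentBundle I N)) (γ t))
    (hγ : IsMIntegralCurveOn γ W (Ioo a b)) (hγ' : IsMIntegralCurveOn γ' W (Ioo a b))
    (h : γ t₀ = γ' t₀) : EqOn γ γ' (Ioo a b) := by
  -- The set of disagreement is open because `N` is Hausdorff, the set of agreement by local
  -- uniqueness, and the interval is connected.
  have hc : ContinuousOn (fun t => (γ t, γ' t)) (Ioo a b) := hγ.continuousOn.prodMk hγ'.continuousOn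
  have hopen : IsOpen {t ∈ Ioo a b | γ t ≠ γ' t} :=
    hc.isOpen_inter_preimage isOpen_Ioo (isClosed_diagonal.isOpen_compl)
  have hopen' : IsOpen {t ∈ Ioo a b | γ t = γ' t} := by
    rw [isOpen_iff_mem_nhds]
    rintro t ⟨ht, hte⟩
    have hm := Ioo_mem_nhds ht.1 ht.2
    filter_upwards [hm, isMIntegralCurveAt_eventuallyEq_of_contMDiffAt_boundaryless (hW t ht)
      (hγ.isMIntegralCurveAt hm) (hγ'.isMIntegralCurveAt hm) hte] with s hs hse
    exact ⟨hs, hse⟩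
  intro t ht
  by_contra hne
  obtain ⟨s, -, hs, hs'⟩ := isPreconnected_Ioo (a := a) (b := b) _ _ hopen' hopen
    (fun s hs => (em (γ s = γ' s)).elim (fun h => Or.inl ⟨hs, h⟩) fun h => Or.inr ⟨hs, h⟩)
    ⟨t₀, ht₀, ht₀, h⟩ ⟨t, ht, ht, hne⟩
  exact hs'.2 hs.2

end Uniqueness
-- Flows for a uniform time near a compact set
section CompactFlow

open Topology

variable {E : Type} [NormedAddCommGroup E] [NormedSpace ℝ E]
  {H : Type*} [TopologicalSpace H] {I : ModelWithCorners ℝ E H} [I.Boundaryless]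
  {N : Type*} [TopologicalSpace N] [ChartedSpace H N] [IsManifold I ∞ N]

/-- `Φ` is a smooth flow of `W`, defined for times in `(-ε, ε)` and starting points in `V`, and
staying in `O`. -/
structure IsSmoothFlow (I : ModelWithCorners ℝ E H) {N : Type*} [TopologicalSpace N]
    [ChartedSpace H N] (W : ∀ x : N, TangentSpace I x) (O V : Set N) (ε : ℝ) (Φ : ℝ × N → N) :
    Prop where
  contMDiffOn : ContMDiffOn (𝓘(ℝ, ℝ).prod I) I ∞ Φ (Ioo (-ε) ε ×ˢ V)
  zero : ∀ x ∈ V, Φ (0, x) = x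
  mem : ∀ t ∈ Ioo (-ε) ε, ∀ x ∈ V, Φ (t, x) ∈ O
  hasMFDerivAt : ∀ t ∈ Ioo (-ε) ε, ∀ x ∈ V, HasMFDerivAt 𝓘(ℝ, ℝ) I (fun s => Φ (s, x)) t
    ((1 : ℝ →L[ℝ] ℝ).smulRight (W (Φ (t, x))))

theorem IsSmoothFlow.mono {W : ∀ x : N, TangentSpace I x} {O V V' : Set N} {ε ε' : ℝ}
    {Φ : ℝ × N → N} (h : IsSmoothFlow I W O V ε Φ) (hV : V' ⊆ V) (hε : ε' ≤ ε) :
    IsSmoothFlow I W O V' ε' Φ where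
  contMDiffOn := h.contMDiffOn.mono (prod_mono (Ioo_subset_Ioo (by linarith) hε) hV)
  zero x hx := h.zero x (hV hx)
  mem t ht x hx := h.mem t (Ioo_subset_Ioo (by linarith) hε ht) x (hV hx)
  hasMFDerivAt t ht x hx := h.hasMFDerivAt t (Ioo_subset_Ioo (by linarith) hε ht) x (hV hx)

theorem IsSmoothFlow.isMIntegralCurveOn {W : ∀ x : N, TangentSpace I x} {O V : Set N} {ε : ℝ}
    {Φ : ℝ × N → N} (h : IsSmoothFlow I W O V ε Φ) {x : N} (hx : x ∈ V) :
    IsMIntegralCurveOn (fun s => Φ (s, x)) W (Ioo (-ε) ε) :=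
  fun t ht => (h.hasMFDerivAt t ht x hx).hasMFDerivWithinAt

/-- Smooth flows of smooth vector fields for a uniform time near a compact set. -/
theorem exists_flow_near_compact [FiniteDimensional ℝ E] [T2Space N]
    {W : ∀ x : N, TangentSpace I x} {O K : Set N} (hO : IsOpen O)
    (hW : ContMDiffOn I I.tangent ∞ (fun x => (⟨x, W x⟩ : TangentBundle I N)) O)
    (hK : IsCompact K) (hKO : K ⊆ O) :
    ∃ V : Set N, IsOpen V ∧ K ⊆ V ∧ ∃ ε > 0, ∃ Φ : ℝ × N → N, IsSmoothFlow I W O V ε Φ := by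
  classical
  refine hK.induction_on (p := fun S => ∃ V : Set N, IsOpen V ∧ S ⊆ V ∧ ∃ ε > 0, ∃ Φ : ℝ × N → N,
    IsSmoothFlow I W O V ε Φ) ?_ ?_ ?_ ?_
  · refine ⟨∅, isOpen_empty, subset_rfl, 1, one_pos, Prod.snd, ?_, ?_, ?_, ?_⟩
    · simp [ContMDiffOn]
    all_goals simp
  · rintro S S' hS ⟨V, hV, hSV, h⟩
    exact ⟨V, hV, hS.trans hSV, h⟩
  -- Two flows can be glued after shrinking to the shorter time, since uniqueness of integral curves
  -- makes them agree wherever both are defined.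
  · rintro S S' ⟨V₁, hV₁, hS₁, ε₁, hε₁, Φ₁, h₁⟩ ⟨V₂, hV₂, hS₂, ε₂, hε₂, Φ₂, h₂⟩
    replace h₁ := h₁.mono subset_rfl (min_le_left ε₁ ε₂)
    replace h₂ := h₂.mono subset_rfl (min_le_right ε₁ ε₂)
    set ε := min ε₁ ε₂
    have hε : 0 < ε := lt_min hε₁ hε₂
    have hagree : ∀ t ∈ Ioo (-ε) ε, ∀ x ∈ V₁, x ∈ V₂ → Φ₁ (t, x) = Φ₂ (t, x) := by
      intro t ht x hx₁ hx₂
      refine integralCurve_eqOn_Ioo (I := I) (W := W) (t₀ := 0) ⟨by linarith, hε⟩ (fun s hs => ?_)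
        (h₁.isMIntegralCurveOn hx₁) (h₂.isMIntegralCurveOn hx₂) ?_ ht
      · exact (hW.contMDiffAt (hO.mem_nhds (h₁.mem s hs x hx₁))).of_le (by simp)
      · simp [h₁.zero x hx₁, h₂.zero x hx₂]
    let Φ : ℝ × N → N := fun p => if p.2 ∈ V₁ then Φ₁ p else Φ₂ p
    have e₁ : ∀ t, ∀ x ∈ V₁, Φ (t, x) = Φ₁ (t, x) := fun t x hx => by simp [Φ, hx]
    have e₂ : ∀ t ∈ Ioo (-ε) ε, ∀ x ∈ V₂, Φ (t, x) = Φ₂ (t, x) := fun t ht x hx => by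
      by_cases hx₁ : x ∈ V₁
      · rw [e₁ t x hx₁, hagree t ht x hx₁ hx]
      · simp [Φ, hx₁]
    refine ⟨V₁ ∪ V₂, hV₁.union hV₂, union_subset_union hS₁ hS₂, ε, hε, Φ, ?_, ?_, ?_, ?_⟩
    · rintro ⟨t, x⟩ ⟨ht, hx⟩
      refine ContMDiffAt.contMDiffWithinAt ?_
      rcases hx with hx | hx
      · have hn : Ioo (-ε) ε ×ˢ V₁ ∈ 𝓝 (t, x) :=
          (isOpen_Ioo.prod hV₁).mem_nhds (⟨ht, hx⟩ : (t, x) ∈ Ioo (-ε) ε ×ˢ V₁)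
        refine (h₁.contMDiffOn.contMDiffAt hn).congr_of_eventuallyEq ?_
        filter_upwards [hn] with p hp using e₁ p.1 p.2 hp.2
      · have hn : Ioo (-ε) ε ×ˢ V₂ ∈ 𝓝 (t, x) :=
          (isOpen_Ioo.prod hV₂).mem_nhds (⟨ht, hx⟩ : (t, x) ∈ Ioo (-ε) ε ×ˢ V₂)
        refine (h₂.contMDiffOn.contMDiffAt hn).congr_of_eventuallyEq ?_
        filter_upwards [hn] with p hp using e₂ p.1 hp.1 p.2 hp.2
    · have h0 : (0 : ℝ) ∈ Ioo (-ε) ε := ⟨by linarith, hε⟩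
      rintro x (hx | hx)
      · rw [e₁ 0 x hx, h₁.zero x hx]
      · rw [e₂ 0 h0 x hx, h₂.zero x hx]
    · rintro t ht x (hx | hx)
      · rw [e₁ t x hx]; exact h₁.mem t ht x hx
      · rw [e₂ t ht x hx]; exact h₂.mem t ht x hx
    · rintro t ht x (hx | hx)
      · have := h₁.hasMFDerivAt t ht x hx
        rw [← e₁ t x hx] at this
        exact this.congr_of_eventuallyEq (Filter.Eventually.of_forall fun s => e₁ s x hx)
      · have := h₂.hasMFDerivAt t ht x hx
        rw [← e₂ t ht x hx] at this
        refine this.congr_of_eventuallyEq ?_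
        filter_upwards [Ioo_mem_nhds ht.1 ht.2] with s hs using e₂ s hs x hx
  · intro x hx
    obtain ⟨V, hV, hxV, ε, hε, Φ, h1, h2, h3⟩ := exists_local_flow_manifold hO hW (hKO hx)
    exact ⟨V, mem_nhdsWithin_of_mem_nhds (hV.mem_nhds hxV), V, hV, subset_rfl, ε, hε, Φ,
      h1, h2, fun t ht x hx => (h3 t ht x hx).1, fun t ht x hx => (h3 t ht x hx).2⟩

end CompactFlow

/-! ### Smooth families of inverse maps -/

section ParametricInverse

open Topology

variable {E : Type*} [NormedAddCommGroup E] [NormedSpace ℝ E] [FiniteDimensional ℝ E]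

/-- A smooth family of maps has a smooth family of local inverses, near a point at which one of the
maps has a differentiable left inverse. -/
theorem exists_parametric_inverse {Φ : ℝ × E → E} {U : Set (ℝ × E)} (hU : IsOpen U)
    (hΦ : ContDiffOn ℝ ∞ Φ U) {t₀ : ℝ} {x₀ : E} (hx₀ : (t₀, x₀) ∈ U) {G : E → E}
    (hG : DifferentiableAt ℝ G (Φ (t₀, x₀))) (hGΦ : ∀ᶠ x in 𝓝 x₀, G (Φ (t₀, x)) = x) :
    ∃ V : Set (ℝ × E), IsOpen V ∧ (t₀, Φ (t₀, x₀)) ∈ V ∧ ∃ Ψ : ℝ × E → E, ContDiffOn ℝ ∞ Ψ V ∧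
      ∀ p ∈ V, (p.1, Ψ p) ∈ U ∧ Φ (p.1, Ψ p) = p.2 := by
  have : CompleteSpace E := FiniteDimensional.complete ℝ E
  -- Inverting `(t, x) ↦ (t, Φ (t, x))` produces inverses depending smoothly on `t`. A vector in the
  -- kernel of the derivative has no time component, and the left inverse `G` of `Φ (t₀, ·)` forces
  -- the other component to vanish; in finite dimension injectivity suffices.
  let Q : ℝ × E → ℝ × E := fun p => (p.1, Φ p)
  have hQ : ContDiffOn ℝ ∞ Q U := contDiffOn_fst.prodMk hΦ
  have hd : HasFDerivAt Φ (fderiv ℝ Φ (t₀, x₀)) (t₀, x₀) :=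
    ((hΦ.contDiffAt (hU.mem_nhds hx₀)).differentiableAt (by simp)).hasFDerivAt
  set D := fderiv ℝ Φ (t₀, x₀)
  have hQ' : HasFDerivAt Q ((ContinuousLinearMap.fst ℝ ℝ E).prod D) (t₀, x₀) :=
    hasFDerivAt_fst.prodMk hd
  have hinj : Function.Injective ((ContinuousLinearMap.fst ℝ ℝ E).prod D) := by
    rw [injective_iff_map_eq_zero]
    rintro ⟨τ, w⟩ h
    have h1 : τ = 0 := congrArg Prod.fst h
    have h2 : D (τ, w) = 0 := congrArg Prod.snd h
    subst h1
    have hc : HasFDerivAt (fun x => G (Φ (t₀, x)))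
        ((fderiv ℝ G (Φ (t₀, x₀))).comp (D.comp (ContinuousLinearMap.inr ℝ ℝ E))) x₀ :=
      hG.hasFDerivAt.comp x₀ (HasFDerivAt.comp (g := Φ) x₀ hd (hasFDerivAt_prodMk_right t₀ x₀))
    have := hc.unique ((hasFDerivAt_id x₀).congr_of_eventuallyEq hGΦ)
    have hw := DFunLike.congr_fun this w
    have hw' : fderiv ℝ G (Φ (t₀, x₀)) (D (0, w)) = w := hw
    rw [h2, map_zero] at hw'
    rw [← hw']; rfl
  let Q' : (ℝ × E) ≃L[ℝ] (ℝ × E) := (LinearEquiv.ofInjectiveEndo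
    ((ContinuousLinearMap.fst ℝ ℝ E).prod D).toLinearMap hinj).toContinuousLinearEquiv
  have hQ'' : HasFDerivAt Q (Q' : (ℝ × E) →L[ℝ] (ℝ × E)) (t₀, x₀) := by
    refine hQ'.congr_fderiv ?_
    ext z <;> rfl
  obtain ⟨e, hae, heU, heQ, he⟩ := exists_openPartialHomeomorph_contDiffOn hU hQ hx₀ hQ''
  have hfst : ∀ p ∈ e.target, (e.symm p).1 = p.1 ∧ Φ (e.symm p) = p.2 := by
    intro p hp
    have h := e.right_inv hp
    rw [heQ] at h
    have h1 := congrArg Prod.fst h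
    have h2 := congrArg Prod.snd h
    exact ⟨h1, h2⟩
  refine ⟨e.target, e.open_target, ?_, fun p => (e.symm p).2, contDiff_snd.comp_contDiffOn he, ?_⟩
  · have := e.map_source hae
    rw [heQ] at this
    exact this
  · intro p hp
    obtain ⟨h1, h2⟩ := hfst p hp
    have h3 : (p.1, (e.symm p).2) = e.symm p := by rw [← h1]
    rw [h3]
    exact ⟨heU (e.map_target hp), h2⟩

variable {H : Type*} [TopologicalSpace H] {I : ModelWithCorners ℝ E H} [I.Boundaryless]
  {N : Type*} [TopologicalSpace N] [ChartedSpace H N] [IsManifold I ∞ N]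

theorem exists_parametric_inverse_manifold {Φ : ℝ × N → N} {U : Set (ℝ × N)} (hU : IsOpen U)
    (hΦ : ContMDiffOn (𝓘(ℝ, ℝ).prod I) I ∞ Φ U) {t₀ : ℝ} {x₀ : N} (hx₀ : (t₀, x₀) ∈ U)
    {G : N → N} (hG : MDifferentiableAt I I G (Φ (t₀, x₀)))
    (hGΦ : ∀ᶠ x in 𝓝 x₀, G (Φ (t₀, x)) = x) :
    ∃ V : Set (ℝ × N), IsOpen V ∧ (t₀, Φ (t₀, x₀)) ∈ V ∧ ∃ Ψ : ℝ × N → N,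
      ContMDiffOn (𝓘(ℝ, ℝ).prod I) I ∞ Ψ V ∧ ∀ p ∈ V, (p.1, Ψ p) ∈ U ∧ Φ (p.1, Ψ p) = p.2 := by
  set y₀ := Φ (t₀, x₀) with hy₀
  let e := extChartAt I x₀
  let e' := extChartAt I y₀
  have hex : e.symm (e x₀) = x₀ := e.left_inv (mem_extChartAt_source x₀)
  have hey : e'.symm (e' y₀) = y₀ := e'.left_inv (mem_extChartAt_source y₀)
  -- the domain in coordinates
  have hc : ContMDiffOn 𝓘(ℝ, ℝ × E) (𝓘(ℝ, ℝ).prod I) ∞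
      (fun p : ℝ × E => (p.1, e.symm p.2)) (univ ×ˢ e.target) :=
    contDiff_fst.contMDiff.contMDiffOn.prodMk ((contMDiffOn_extChartAt_symm x₀).comp
      contDiff_snd.contMDiff.contMDiffOn fun p hp => hp.2)
  have hT : IsOpen (univ ×ˢ e.target : Set (ℝ × E)) :=
    isOpen_univ.prod (isOpen_extChartAt_target x₀)
  have hU₁ : IsOpen (U ∩ Φ ⁻¹' e'.source) :=
    hΦ.continuousOn.isOpen_inter_preimage hU (isOpen_extChartAt_source y₀)
  let Û : Set (ℝ × E) := (univ ×ˢ e.target) ∩ (fun p : ℝ × E => (p.1, e.symm p.2)) ⁻¹'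
    (U ∩ Φ ⁻¹' e'.source)
  have hÛ : IsOpen Û := hc.continuousOn.isOpen_inter_preimage hT hU₁
  let Φ' : ℝ × E → E := fun p => e' (Φ (p.1, e.symm p.2))
  have hΦ' : ContDiffOn ℝ ∞ Φ' Û := by
    rw [← contMDiffOn_iff_contDiffOn]
    have h1 : ContMDiffOn 𝓘(ℝ, ℝ × E) I ∞ (fun p : ℝ × E => Φ (p.1, e.symm p.2)) Û :=
      hΦ.comp (hc.mono inter_subset_left) fun p hp => hp.2.1
    refine (contMDiffOn_extChartAt (x := y₀)).comp h1 fun p hp => ?_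
    have := hp.2.2
    rwa [← extChartAt_source I]
  have hmem : (t₀, e x₀) ∈ Û := by
    refine ⟨⟨mem_univ _, mem_extChartAt_target x₀⟩, ?_⟩
    simp only [mem_preimage, hex]
    exact ⟨hx₀, mem_extChartAt_source y₀⟩
  have hΦ'0 : Φ' (t₀, e x₀) = e' y₀ := by simp [Φ', hex, hy₀]
  have hGy : G y₀ = x₀ := hGΦ.self_of_nhds
  have hG' : DifferentiableAt ℝ (fun y => e (G (e'.symm y))) (Φ' (t₀, e x₀)) := by
    rw [hΦ'0, ← mdifferentiableAt_iff_differentiableAt]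
    have h1 : MDifferentiableAt 𝓘(ℝ, E) I e'.symm (e' y₀) :=
      (contMDiffOn_extChartAt_symm (n := ∞) y₀).contMDiffAt
        ((isOpen_extChartAt_target y₀).mem_nhds (mem_extChartAt_target y₀))
        |>.mdifferentiableAt (by simp)
    have h2 : MDifferentiableAt I I G (e'.symm (e' y₀)) := by rw [hey]; exact hG
    have h3 : MDifferentiableAt I 𝓘(ℝ, E) e (G (e'.symm (e' y₀))) := by
      rw [hey, hGy]
      exact (contMDiffAt_extChartAt (n := ∞)).mdifferentiableAt (by simp)
    exact MDifferentiableAt.comp (e' y₀) (g := e) (f := G ∘ e'.symm) h3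
      (MDifferentiableAt.comp (e' y₀) h2 h1)
  have hGΦ' : ∀ᶠ z in 𝓝 (e x₀), (fun y => e (G (e'.symm y))) (Φ' (t₀, z)) = z := by
    have h1 : ∀ᶠ z in 𝓝 (e x₀), (t₀, z) ∈ Û :=
      (by fun_prop : Continuous fun z : E => (t₀, z)).continuousAt (hÛ.mem_nhds hmem)
    have h2 : ∀ᶠ z in 𝓝 (e x₀), G (Φ (t₀, e.symm z)) = e.symm z := by
      have := continuousAt_extChartAt_symm (I := I) x₀
      exact this.eventually (by rw [hex]; exact hGΦ)
    filter_upwards [h1, h2] with z hz hz2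
    simp only [Φ']
    rw [e'.left_inv hz.2.2, hz2, e.right_inv hz.1.2]
  obtain ⟨V, hV, hmV, Ψ, hΨ, hΨ'⟩ := exists_parametric_inverse hÛ hΦ' hmem hG' hGΦ'
  rw [hΦ'0] at hmV
  have hc' : ContMDiffOn (𝓘(ℝ, ℝ).prod I) 𝓘(ℝ, ℝ × E) ∞
      (fun p : ℝ × N => (p.1, e' p.2)) (univ ×ˢ e'.source) :=
    contMDiffOn_fst.prodMk_space ((contMDiffOn_extChartAt (x := y₀)).comp contMDiffOn_snd fun p hp => by
      have := hp.2
      rwa [← extChartAt_source I])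
  refine ⟨(univ ×ˢ e'.source) ∩ (fun p : ℝ × N => (p.1, e' p.2)) ⁻¹' V,
    hc'.continuousOn.isOpen_inter_preimage (isOpen_univ.prod (isOpen_extChartAt_source y₀)) hV,
    ⟨⟨mem_univ _, mem_extChartAt_source y₀⟩, hmV⟩, fun p => e.symm (Ψ (p.1, e' p.2)), ?_, ?_⟩
  · refine (contMDiffOn_extChartAt_symm x₀).comp (t := e.target) ?_ fun p hp =>
      (hΨ' _ hp.2).1.1.2
    exact hΨ.contMDiffOn.comp (hc'.mono inter_subset_left) inter_subset_right
  · rintro ⟨t, y⟩ ⟨⟨-, hy⟩, hp⟩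
    obtain ⟨h1, h2⟩ := hΨ' _ hp
    refine ⟨h1.2.1, ?_⟩
    have h3 : Φ (t, e.symm (Ψ (t, e' y))) ∈ e'.source := h1.2.2
    exact e'.injOn h3 hy h2

end ParametricInverse
-- Calculus of maps that are smooth along a subset
section SmoothAlong

open Topology

variable {E₁ H₁ N E₂ H₂ P E₃ H₃ N' : Type*}
  [NormedAddCommGroup E₁] [NormedSpace ℝ E₁] [TopologicalSpace H₁]
  [TopologicalSpace N] [ChartedSpace H₁ N]
  [NormedAddCommGroup E₂] [NormedSpace ℝ E₂] [TopologicalSpace H₂]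
  [TopologicalSpace P] [ChartedSpace H₂ P]
  [NormedAddCommGroup E₃] [NormedSpace ℝ E₃] [TopologicalSpace H₃]
  [TopologicalSpace N'] [ChartedSpace H₃ N']
  {I₁ : ModelWithCorners ℝ E₁ H₁} {I₂ : ModelWithCorners ℝ E₂ H₂} {I₃ : ModelWithCorners ℝ E₃ H₃}
  {S S' : Type*}

theorem SmoothAlong.comp {e : S → N} {e' : S' → N'} {f : S → P} {g : S' → S}
    (hf : SmoothAlong I₁ I₂ e f) (hg : SmoothAlong I₃ I₁ e' (fun a => e (g a))) :
    SmoothAlong I₃ I₂ e' (fun a => f (g a)) := by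
  intro a
  obtain ⟨U', hU', haU', G', hG', hG'f⟩ := hg a
  obtain ⟨U, hU, haU, G, hG, hGf⟩ := hf (g a)
  refine ⟨U' ∩ G' ⁻¹' U, hG'.continuousOn.isOpen_inter_preimage hU' hU, ⟨haU', ?_⟩,
    fun x => G (G' x), hG.comp (hG'.mono inter_subset_left) inter_subset_right, ?_⟩
  · simpa [hG'f a haU'] using haU
  · intro b hb
    have h1 := hG'f b hb.1
    have h2 : e (g b) ∈ U := by
      have := hb.2
      rwa [mem_preimage, h1] at this
    show G (G' (e' b)) = _
    rw [h1, hGf _ h2]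

theorem SmoothAlong.of_contMDiffOn {e : S → N} {U : Set N} (hU : IsOpen U) (he : ∀ a, e a ∈ U)
    {g : N → P} (hg : ContMDiffOn I₁ I₂ ∞ g U) : SmoothAlong I₁ I₂ e (fun a => g (e a)) :=
  fun a => ⟨U, hU, he a, g, hg, fun _ _ => rfl⟩

theorem SmoothAlong.prodMk {e : S → N} {f : S → P} {f' : S → N'}
    (hf : SmoothAlong I₁ I₂ e f) (hf' : SmoothAlong I₁ I₃ e f') :
    SmoothAlong I₁ (I₂.prod I₃) e (fun a => (f a, f' a)) := by
  intro a
  obtain ⟨U, hU, haU, g, hg, hgf⟩ := hf a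
  obtain ⟨U', hU', haU', g', hg', hgf'⟩ := hf' a
  exact ⟨U ∩ U', hU.inter hU', ⟨haU, haU'⟩, fun x => (g x, g' x),
    (hg.mono inter_subset_left).prodMk (hg'.mono inter_subset_right),
    fun b hb => by simp [hgf b hb.1, hgf' b hb.2]⟩

theorem SmoothAlong.contMDiffOn {U : Set N} (hU : IsOpen U) {g : N → P}
    (h : SmoothAlong I₁ I₂ (Subtype.val : U → N) (fun a => g a)) : ContMDiffOn I₁ I₂ ∞ g U := by
  intro x hx
  obtain ⟨U', hU', hxU', G, hG, hGg⟩ := h ⟨x, hx⟩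
  refine ((hG.contMDiffAt (hU'.mem_nhds hxU')).congr_of_eventuallyEq ?_).contMDiffWithinAt
  filter_upwards [hU.mem_nhds hx, hU'.mem_nhds hxU'] with y hy hy'
  exact (hGg ⟨y, hy⟩ hy').symm

/-- A smooth map along `e` composed with a smooth map of the ambient manifold. -/
theorem SmoothAlong.contMDiffOn_comp {e : S → N} {f : S → P} (hf : SmoothAlong I₁ I₂ e f)
    {U : Set P} (hU : IsOpen U) (hfU : ∀ a, f a ∈ U) {g : P → N'} (hg : ContMDiffOn I₂ I₃ ∞ g U) :
    SmoothAlong I₁ I₃ e (fun a => g (f a)) :=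
  SmoothAlong.comp (e := fun a : S => f a) (g := id) (SmoothAlong.of_contMDiffOn hU hfU hg) hf

/-- The partial derivative in time of a smooth function of time and space. -/
theorem contMDiffOn_deriv_time [IsManifold I₁ ∞ N] [I₁.Boundaryless] {U : Set (ℝ × N)}
    (hU : IsOpen U)
    {g : ℝ × N → ℝ} (hg : ContMDiffOn (𝓘(ℝ, ℝ).prod I₁) 𝓘(ℝ, ℝ) ∞ g U) :
    ContMDiffOn (𝓘(ℝ, ℝ).prod I₁) 𝓘(ℝ, ℝ) ∞ (fun p => deriv (fun t => g (t, p.2)) p.1) U := by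
  rintro ⟨t₀, x₀⟩ h₀
  let e := extChartAt I₁ x₀
  have hc : ContMDiffOn 𝓘(ℝ, ℝ × E₁) (𝓘(ℝ, ℝ).prod I₁) ∞
      (fun p : ℝ × E₁ => (p.1, e.symm p.2)) (univ ×ˢ e.target) :=
    contDiff_fst.contMDiff.contMDiffOn.prodMk ((contMDiffOn_extChartAt_symm x₀).comp
      contDiff_snd.contMDiff.contMDiffOn fun p hp => hp.2)
  have hV : IsOpen ((univ ×ˢ e.target) ∩ (fun p : ℝ × E₁ => (p.1, e.symm p.2)) ⁻¹' U) :=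
    hc.continuousOn.isOpen_inter_preimage (isOpen_univ.prod (isOpen_extChartAt_target x₀)) hU
  set V := (univ ×ˢ e.target) ∩ (fun p : ℝ × E₁ => (p.1, e.symm p.2)) ⁻¹' U
  have hG : ContDiffOn ℝ ∞ (fun p : ℝ × E₁ => g (p.1, e.symm p.2)) V :=
    contMDiffOn_iff_contDiffOn.1 (hg.comp (hc.mono inter_subset_left) inter_subset_right)
  set G := fun p : ℝ × E₁ => g (p.1, e.symm p.2)
  have hG' : ContDiffOn ℝ ∞ (fun p => fderiv ℝ G p (1, 0)) V :=
    (hG.fderiv_of_isOpen hV (by simp)).clm_apply contDiffOn_const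
  have hmem : (t₀, e x₀) ∈ V := by
    refine ⟨⟨mem_univ _, mem_extChartAt_target x₀⟩, ?_⟩
    simpa [e] using h₀
  have hpull : ContMDiffAt (𝓘(ℝ, ℝ).prod I₁) 𝓘(ℝ, ℝ × E₁) ∞ (fun p : ℝ × N => (p.1, e p.2))
      (t₀, x₀) :=
    contMDiffAt_fst.prodMk_space ((contMDiffAt_extChartAt (x := x₀)).comp (t₀, x₀) contMDiffAt_snd)
  have h1 : ContMDiffAt (𝓘(ℝ, ℝ).prod I₁) 𝓘(ℝ, ℝ) ∞ (fun p : ℝ × N => fderiv ℝ G (p.1, e p.2) (1, 0))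
      (t₀, x₀) :=
    ContMDiffAt.comp (t₀, x₀) (g := fun p => fderiv ℝ G p (1, 0)) (I' := 𝓘(ℝ, ℝ × E₁))
      (hG'.contDiffAt (hV.mem_nhds hmem)).contMDiffAt hpull
  refine (h1.congr_of_eventuallyEq ?_).contMDiffWithinAt
  have h2 : ∀ᶠ p in 𝓝 (t₀, x₀), (p.1, e p.2) ∈ V ∧ p.2 ∈ e.source :=
    (hpull.continuousAt.eventually (hV.mem_nhds hmem)).and
      (continuousAt_snd.eventually (extChartAt_source_mem_nhds x₀))
  filter_upwards [h2] with p hp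
  have hd : HasFDerivAt G (fderiv ℝ G (p.1, e p.2)) (p.1, e p.2) :=
    ((hG.contDiffAt (hV.mem_nhds hp.1)).differentiableAt (by simp)).hasFDerivAt
  have h3 : HasDerivAt (fun t => G (t, e p.2)) (fderiv ℝ G (p.1, e p.2) (1, 0)) p.1 :=
    hd.comp_hasDerivAt p.1 (f := fun t => (t, e p.2)) ((hasDerivAt_id _).prodMk (hasDerivAt_const _ _))
  have h4 : (fun t => G (t, e p.2)) = fun t => g (t, p.2) := by
    funext t
    simp only [G]
    rw [e.left_inv hp.2]
  rw [h4] at h3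
  exact h3.deriv

/-! #### Smooth functions depending on time -/

/-- The family `h t` of functions on `S` is smooth for `t` in a neighbourhood of `0`. -/
def SmoothFamily (I₁ : ModelWithCorners ℝ E₁ H₁) (I₂ : ModelWithCorners ℝ E₂ H₂) (e : S → N)
    (h : ℝ → S → P) : Prop :=
  ∃ ε : ℝ, 0 < ε ∧ SmoothAlong (𝓘(ℝ, ℝ).prod I₁) I₂
    (fun z : Ioo (-ε) ε × S => (z.1.1, e z.2)) (fun z => h z.1.1 z.2)

theorem SmoothFamily.smoothAlong_zero {e : S → N} {h : ℝ → S → P}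
    (hh : SmoothFamily I₁ I₂ e h) : SmoothAlong I₁ I₂ e (h 0) := by
  obtain ⟨ε, hε, hs⟩ := hh
  refine SmoothAlong.comp (g := fun a : S => ((⟨0, by linarith, hε⟩ : Ioo (-ε) ε), a)) hs ?_
  exact SmoothAlong.of_contMDiffOn (g := fun x : N => ((0 : ℝ), x)) isOpen_univ (fun _ => mem_univ _)
    (contMDiff_const.prodMk contMDiff_id).contMDiffOn

theorem SmoothFamily.contDiffOn {e : S → N} {h : ℝ → S → ℝ} {ε : ℝ}
    (hs : SmoothAlong (𝓘(ℝ, ℝ).prod I₁) 𝓘(ℝ, ℝ)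
      (fun z : Ioo (-ε) ε × S => (z.1.1, e z.2)) (fun z => h z.1.1 z.2)) (v : S) :
    ContDiffOn ℝ ∞ (fun t => h t v) (Ioo (-ε) ε) := by
  rw [← contMDiffOn_iff_contDiffOn]
  refine SmoothAlong.contMDiffOn isOpen_Ioo ?_
  refine SmoothAlong.comp (g := fun t : Ioo (-ε) ε => (t, v)) hs ?_
  exact SmoothAlong.of_contMDiffOn (g := fun t : ℝ => (t, e v)) isOpen_univ (fun _ => mem_univ _)
    (contMDiff_id.prodMk contMDiff_const).contMDiffOn

theorem SmoothFamily.contDiffAt {e : S → N} {h : ℝ → S → ℝ}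
    (hh : SmoothFamily I₁ 𝓘(ℝ, ℝ) e h) (v : S) : ContDiffAt ℝ ∞ (fun t => h t v) 0 := by
  obtain ⟨ε, hε, hs⟩ := hh
  exact (SmoothFamily.contDiffOn hs v).contDiffAt (Ioo_mem_nhds (by linarith) hε)

/-- A local extension `g` of the family agrees with it for all nearby times at a fixed point of `S`,
so the time derivative of `g` is a local extension of the time derivative. -/
theorem SmoothFamily.deriv [IsManifold I₁ ∞ N] [I₁.Boundaryless] {e : S → N} {h : ℝ → S → ℝ}
    (hh : SmoothFamily I₁ 𝓘(ℝ, ℝ) e h) :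
    SmoothFamily I₁ 𝓘(ℝ, ℝ) e (fun t v => deriv (fun s => h s v) t) := by
  obtain ⟨ε, hε, hs⟩ := hh
  refine ⟨ε, hε, fun a => ?_⟩
  obtain ⟨U, hU, haU, g, hg, hgh⟩ := hs a
  refine ⟨U, hU, haU, _, contMDiffOn_deriv_time hU hg, fun b hb => ?_⟩
  refine Filter.EventuallyEq.deriv_eq ?_
  have h1 : ∀ᶠ t in 𝓝 b.1.1, (t, e b.2) ∈ U :=
    (by fun_prop : Continuous fun t : ℝ => (t, e b.2)).continuousAt (hU.mem_nhds hb)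
  filter_upwards [h1, Ioo_mem_nhds b.1.2.1 b.1.2.2] with t ht ht'
  exact hgh (⟨t, ht'⟩, b.2) ht

theorem SmoothFamily.iteratedDeriv [IsManifold I₁ ∞ N] [I₁.Boundaryless] {e : S → N}
    {h : ℝ → S → ℝ} (hh : SmoothFamily I₁ 𝓘(ℝ, ℝ) e h) (i : ℕ) :
    SmoothAlong I₁ 𝓘(ℝ, ℝ) e (fun v => iteratedDeriv i (fun s => h s v) 0) := by
  induction i generalizing h with
  | zero => simpa using hh.smoothAlong_zero
  | succ i ih => simpa [iteratedDeriv_succ'] using ih hh.deriv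

/-- Reparametrization of time. -/
theorem SmoothFamily.comp_time {e : S → N} {h : ℝ → S → P} (hh : SmoothFamily I₁ I₂ e h)
    {σ : ℝ → ℝ} (hσ : ContDiff ℝ ∞ σ) (hσ0 : σ 0 = 0) :
    SmoothFamily I₁ I₂ e (fun t => h (σ t)) := by
  obtain ⟨ε, hε, hs⟩ := hh
  have : σ ⁻¹' Ioo (-ε) ε ∈ 𝓝 (0 : ℝ) :=
    hσ.continuous.continuousAt.preimage_mem_nhds (by
      rw [hσ0]; exact Ioo_mem_nhds (by linarith) hε)
  obtain ⟨δ, hδ, hsub⟩ := Metric.mem_nhds_iff.1 this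
  rw [Real.ball_eq_Ioo, zero_sub, zero_add] at hsub
  refine ⟨δ, hδ, ?_⟩
  refine SmoothAlong.comp (g := fun z : Ioo (-δ) δ × S =>
    ((⟨σ z.1.1, hsub z.1.2⟩ : Ioo (-ε) ε), z.2)) hs ?_
  exact SmoothAlong.of_contMDiffOn (g := fun x : ℝ × N => (σ x.1, x.2)) isOpen_univ
    (fun _ => mem_univ _) ((hσ.contMDiff.comp contMDiff_fst).prodMk contMDiff_snd).contMDiffOn

theorem SmoothFamily.mono {e : S → N} {h : ℝ → S → P} {ε δ : ℝ} (hδε : δ ≤ ε)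
    (hs : SmoothAlong (𝓘(ℝ, ℝ).prod I₁) I₂
      (fun z : Ioo (-ε) ε × S => (z.1.1, e z.2)) (fun z => h z.1.1 z.2)) :
    SmoothAlong (𝓘(ℝ, ℝ).prod I₁) I₂
      (fun z : Ioo (-δ) δ × S => (z.1.1, e z.2)) (fun z => h z.1.1 z.2) :=
  SmoothAlong.comp (g := fun z : Ioo (-δ) δ × S =>
    ((⟨z.1.1, Ioo_subset_Ioo (by linarith) hδε z.1.2⟩ : Ioo (-ε) ε), z.2)) hs
    (SmoothAlong.of_contMDiffOn (g := id) isOpen_univ (fun _ => mem_univ _) contMDiffOn_id)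

/-- Composition of two smooth families of maps. -/
theorem SmoothFamily.comp {e : S → N} {h : ℝ → S → P} {g : ℝ → S → S}
    (hh : SmoothFamily I₁ I₂ e h) (hg : SmoothFamily I₁ I₁ e (fun t v => e (g t v))) :
    SmoothFamily I₁ I₂ e (fun t v => h t (g t v)) := by
  obtain ⟨ε, hε, hs⟩ := hh
  obtain ⟨δ, hδ, hs'⟩ := hg
  refine ⟨min ε δ, lt_min hε hδ, ?_⟩
  refine SmoothAlong.comp (g := fun z : Ioo (-(min ε δ)) (min ε δ) × S => (z.1, g z.1.1 z.2))
    (SmoothFamily.mono (min_le_left ε δ) hs) ?_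
  refine SmoothAlong.prodMk
    (f' := fun z : Ioo (-(min ε δ)) (min ε δ) × S => e (g z.1.1 z.2)) ?_
    (SmoothFamily.mono (h := fun t v => e (g t v)) (min_le_right ε δ) hs')
  exact SmoothAlong.of_contMDiffOn (g := Prod.fst) isOpen_univ (fun _ => mem_univ _) contMDiffOn_fst

/-- The function `h s (g t v)` of two times. -/
theorem SmoothFamily.exists_contDiffOn_two {e : S → N} {h : ℝ → S → ℝ} {g : ℝ → S → S}
    (hh : SmoothFamily I₁ 𝓘(ℝ, ℝ) e h) (hg : SmoothFamily I₁ I₁ e (fun t v => e (g t v))) (v : S) :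
    ∃ ε > 0, ContDiffOn ℝ ∞ (fun p : ℝ × ℝ => h p.1 (g p.2 v)) (Ioo (-ε) ε ×ˢ Ioo (-ε) ε) := by
  obtain ⟨ε, hε, hs⟩ := hh
  obtain ⟨δ, hδ, hs'⟩ := hg
  refine ⟨min ε δ, lt_min hε hδ, ?_⟩
  replace hs := SmoothFamily.mono (min_le_left ε δ) hs
  replace hs' := SmoothFamily.mono (h := fun t v => e (g t v)) (min_le_right ε δ) hs'
  set ρ := min ε δ
  rw [← contMDiffOn_iff_contDiffOn]
  refine SmoothAlong.contMDiffOn (isOpen_Ioo.prod isOpen_Ioo) ?_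
  refine SmoothAlong.comp (g := fun p : (Ioo (-ρ) ρ ×ˢ Ioo (-ρ) ρ : Set (ℝ × ℝ)) =>
    ((⟨p.1.1, p.2.1⟩ : Ioo (-ρ) ρ), g p.1.2 v)) hs ?_
  refine SmoothAlong.prodMk (SmoothAlong.of_contMDiffOn (g := Prod.fst) isOpen_univ
    (fun _ => mem_univ _) contDiff_fst.contMDiff.contMDiffOn) ?_
  refine SmoothAlong.comp (g := fun p : (Ioo (-ρ) ρ ×ˢ Ioo (-ρ) ρ : Set (ℝ × ℝ)) =>
    ((⟨p.1.2, p.2.2⟩ : Ioo (-ρ) ρ), v)) hs' ?_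
  exact SmoothAlong.of_contMDiffOn (g := fun p : ℝ × ℝ => (p.2, e v)) isOpen_univ
    (fun _ => mem_univ _) (contDiff_snd.contMDiff.prodMk contMDiff_const).contMDiffOn

end SmoothAlong
-- Derivatives at zero: the Leibniz rule and Peano's remainder
section TaylorCoefficients

open Topology Asymptotics Finset.Nat

theorem isOpen_square (ε : ℝ) : IsOpen (Ioo (-ε) ε ×ˢ Ioo (-ε) ε : Set (ℝ × ℝ)) :=
  isOpen_Ioo.prod isOpen_Ioo

/-- The partial derivatives of a smooth function on a square. -/
theorem hasDerivAt_partials {h : ℝ × ℝ → ℝ} {ε : ℝ}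
    (hh : ContDiffOn ℝ ∞ h (Ioo (-ε) ε ×ˢ Ioo (-ε) ε)) {s t : ℝ} (hs : s ∈ Ioo (-ε) ε)
    (ht : t ∈ Ioo (-ε) ε) :
    HasDerivAt (fun s => h (s, t)) (fderiv ℝ h (s, t) (1, 0)) s ∧
    HasDerivAt (fun t => h (s, t)) (fderiv ℝ h (s, t) (0, 1)) t := by
  have hd : HasFDerivAt h (fderiv ℝ h (s, t)) (s, t) :=
    ((hh.contDiffAt ((isOpen_square ε).mem_nhds ⟨hs, ht⟩)).differentiableAt (by simp)).hasFDerivAt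
  exact ⟨hd.comp_hasDerivAt s ((hasDerivAt_id s).prodMk (hasDerivAt_const s t)),
    hd.comp_hasDerivAt t ((hasDerivAt_const t s).prodMk (hasDerivAt_id t))⟩

theorem contDiffOn_partial {h : ℝ × ℝ → ℝ} {ε : ℝ}
    (hh : ContDiffOn ℝ ∞ h (Ioo (-ε) ε ×ˢ Ioo (-ε) ε)) (w : ℝ × ℝ) :
    ContDiffOn ℝ ∞ (fun p => fderiv ℝ h p w) (Ioo (-ε) ε ×ˢ Ioo (-ε) ε) :=
  (hh.fderiv_of_isOpen (isOpen_square ε) (by simp)).clm_apply contDiffOn_const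

theorem partial_comm {h : ℝ × ℝ → ℝ} {ε : ℝ}
    (hh : ContDiffOn ℝ ∞ h (Ioo (-ε) ε ×ˢ Ioo (-ε) ε)) {p : ℝ × ℝ}
    (hp : p ∈ Ioo (-ε) ε ×ˢ Ioo (-ε) ε) (w w' : ℝ × ℝ) :
    fderiv ℝ (fun q => fderiv ℝ h q w) p w' = fderiv ℝ (fun q => fderiv ℝ h q w') p w := by
  have hc := hh.contDiffAt ((isOpen_square ε).mem_nhds hp)
  have hsym : IsSymmSndFDerivAt ℝ h p :=
    hc.isSymmSndFDerivAt (by simp only [minSmoothness_of_isRCLikeNormedField]; exact WithTop.coe_le_coe.2 le_top)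
  have hd : DifferentiableAt ℝ (fderiv ℝ h) p :=
    (hc.fderiv_right (m := 1) (by norm_cast)).differentiableAt (by simp)
  have e : ∀ u : ℝ × ℝ, fderiv ℝ (fun q => fderiv ℝ h q u) p = (fderiv ℝ (fderiv ℝ h) p).flip u := by
    intro u
    rw [fderiv_clm_apply hd (differentiableAt_const u)]
    simp
  rw [e, e]
  exact hsym w' w

theorem iteratedDeriv_succ_partial {h : ℝ × ℝ → ℝ} {ε : ℝ}
    (hh : ContDiffOn ℝ ∞ h (Ioo (-ε) ε ×ˢ Ioo (-ε) ε)) (i : ℕ) {s t : ℝ} (hs : s ∈ Ioo (-ε) ε)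
    (ht : t ∈ Ioo (-ε) ε) :
    iteratedDeriv (i + 1) (fun s => h (s, t)) s
      = iteratedDeriv i (fun s => fderiv ℝ h (s, t) (1, 0)) s := by
  rw [iteratedDeriv_succ']
  refine Filter.EventuallyEq.iteratedDeriv_eq _ ?_
  filter_upwards [Ioo_mem_nhds hs.1 hs.2] with s hs using (hasDerivAt_partials hh hs ht).1.deriv

theorem hasDerivAt_iteratedDeriv_partial {h : ℝ × ℝ → ℝ} {ε : ℝ}
    (hh : ContDiffOn ℝ ∞ h (Ioo (-ε) ε ×ˢ Ioo (-ε) ε)) (i : ℕ) {s t : ℝ} (hs : s ∈ Ioo (-ε) ε)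
    (ht : t ∈ Ioo (-ε) ε) :
    HasDerivAt (fun t => iteratedDeriv i (fun s => h (s, t)) s)
      (iteratedDeriv i (fun s => fderiv ℝ h (s, t) (0, 1)) s) t := by
  induction i generalizing h with
  | zero => simpa using (hasDerivAt_partials hh hs ht).2
  | succ i ih =>
    have h1 := ih (contDiffOn_partial hh (1, 0))
    rw [iteratedDeriv_succ_partial (contDiffOn_partial hh (0, 1)) i hs ht]
    have h2 : (fun s => fderiv ℝ (fun p => fderiv ℝ h p (1, 0)) (s, t) (0, 1))
        =ᶠ[𝓝 s] (fun s => fderiv ℝ (fun p => fderiv ℝ h p (0, 1)) (s, t) (1, 0)) := by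
      filter_upwards [Ioo_mem_nhds hs.1 hs.2] with s hs
      exact partial_comm hh ⟨hs, ht⟩ _ _
    rw [← h2.iteratedDeriv_eq]
    refine h1.congr_of_eventuallyEq ?_
    filter_upwards [Ioo_mem_nhds ht.1 ht.2] with t ht using iteratedDeriv_succ_partial hh i hs ht

/-- The Leibniz rule for the derivatives of `t ↦ h (t, t)`. -/
theorem iteratedDeriv_diagonal {h : ℝ × ℝ → ℝ} {ε : ℝ} (hε : 0 < ε)
    (hh : ContDiffOn ℝ ∞ h (Ioo (-ε) ε ×ˢ Ioo (-ε) ε)) (m : ℕ) :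
    iteratedDeriv m (fun t => h (t, t)) 0 = ∑ ij ∈ Finset.HasAntidiagonal.antidiagonal m,
      (m.choose ij.1 : ℝ) *
        iteratedDeriv ij.2 (fun t => iteratedDeriv ij.1 (fun s => h (s, t)) 0) 0 := by
  have h0 : (0 : ℝ) ∈ Ioo (-ε) ε := ⟨by linarith, hε⟩
  have hmap : ∀ {h : ℝ × ℝ → ℝ}, ContDiffOn ℝ ∞ h (Ioo (-ε) ε ×ˢ Ioo (-ε) ε) →
      ContDiffOn ℝ ∞ (fun t => h (t, t)) (Ioo (-ε) ε) := fun hh =>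
    hh.comp (by fun_prop : ContDiffOn ℝ ∞ (fun t : ℝ => (t, t)) (Ioo (-ε) ε)) fun t ht => ⟨ht, ht⟩
  induction m generalizing h with
  | zero => simp
  | succ m ih =>
    rw [iteratedDeriv_succ']
    have h1 : deriv (fun t => h (t, t)) =ᶠ[𝓝 0]
        (fun t => fderiv ℝ h (t, t) (1, 0)) + (fun t => fderiv ℝ h (t, t) (0, 1)) := by
      filter_upwards [Ioo_mem_nhds h0.1 h0.2] with t ht
      have hd : HasFDerivAt h (fderiv ℝ h (t, t)) (t, t) :=
        ((hh.contDiffAt ((isOpen_square ε).mem_nhds ⟨ht, ht⟩)).differentiableAt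
          (by simp)).hasFDerivAt
      have := hd.comp_hasDerivAt t (f := fun t => (t, t))
        ((hasDerivAt_id t).prodMk (hasDerivAt_id t))
      refine Eq.trans this.deriv ?_
      rw [Pi.add_apply, ← map_add]
      simp
    have hc : ∀ w : ℝ × ℝ, ContDiffAt ℝ m (fun t => fderiv ℝ h (t, t) w) 0 := fun w =>
      ((hmap (contDiffOn_partial hh w)).contDiffAt (Ioo_mem_nhds h0.1 h0.2)).of_le
        (by exact_mod_cast le_top)
    -- The derivative of `h (t, t)` is the sum of the two partial derivatives on the diagonal; the
    -- sums that the induction hypothesis gives for them combine by Pascal's rule.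
    rw [h1.iteratedDeriv_eq, iteratedDeriv_add (hc _) (hc _),
      ih (contDiffOn_partial hh (1, 0)), ih (contDiffOn_partial hh (0, 1)),
      Finset.sum_antidiagonal_choose_succ_mul (fun i j =>
        iteratedDeriv j (fun t => iteratedDeriv i (fun s => h (s, t)) 0) 0), add_comm]
    congr 1
    · refine Finset.sum_congr rfl fun ij _ => ?_
      congr 1
      rw [iteratedDeriv_succ']
      refine Filter.EventuallyEq.iteratedDeriv_eq _ ?_
      filter_upwards [Ioo_mem_nhds h0.1 h0.2] with t ht
      exact (hasDerivAt_iteratedDeriv_partial hh _ h0 ht).deriv.symm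
    · refine Finset.sum_congr rfl fun ij hij => ?_
      rw [Nat.choose_symm_of_eq_add (Finset.HasAntidiagonal.mem_antidiagonal.1 hij).symm]
      congr 1
      refine Filter.EventuallyEq.iteratedDeriv_eq _ ?_
      filter_upwards [Ioo_mem_nhds h0.1 h0.2] with t ht
      exact (iteratedDeriv_succ_partial hh _ h0 ht).symm

/-! #### Peano's form of Taylor's theorem -/

theorem isLittleO_sub_of_iteratedDeriv_eq_zero {y : ℝ → ℝ} (hy : ContDiffAt ℝ ∞ y 0) {k : ℕ}
    (h0 : ∀ i < k, iteratedDeriv i y 0 = 0) :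
    (fun t => y t - iteratedDeriv k y 0 / k.factorial * t ^ k) =o[𝓝 0] fun t => t ^ k := by
  have hyk : ContDiffAt ℝ k y 0 := hy.of_le (by exact_mod_cast le_top)
  obtain ⟨u, hu, hyu⟩ := hyk.contDiffOn (m := k) le_rfl (by simp)
  obtain ⟨δ, hδ, hsub⟩ := Metric.mem_nhds_iff.1 hu
  have hmem : (0 : ℝ) ∈ Metric.ball (0 : ℝ) δ := Metric.mem_ball_self hδ
  have := taylor_isLittleO (convex_ball 0 δ) hmem (hyu.mono hsub)
  rw [Metric.isOpen_ball.nhdsWithin_eq hmem] at this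
  simp only [sub_zero] at this
  refine this.congr_left fun t => ?_
  congr 1
  rw [taylor_within_apply, Finset.sum_range_succ, Finset.sum_eq_zero, zero_add]
  · rw [iteratedDerivWithin_of_isOpen Metric.isOpen_ball hmem]
    simp only [sub_zero, smul_eq_mul]
    ring
  · intro i hi
    rw [iteratedDerivWithin_of_isOpen Metric.isOpen_ball hmem, h0 i (Finset.mem_range.1 hi),
      smul_zero]

/-- A converse to Taylor's theorem: once the lower derivatives vanish, the term of order `i` is
itself `o(t^i)`, so its coefficient is zero. It lets derivatives be read off from asymptotics. -/
theorem iteratedDeriv_eq_zero_of_isLittleO {y : ℝ → ℝ} (hy : ContDiffAt ℝ ∞ y 0) {n : ℕ}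
    (ho : y =o[𝓝 0] fun t => t ^ n) : ∀ i ≤ n, iteratedDeriv i y 0 = 0 := by
  intro i
  induction i using Nat.strong_induction_on with
  | _ i ih =>
    intro hi
    have h1 := isLittleO_sub_of_iteratedDeriv_eq_zero hy fun j hj => ih j hj (hj.le.trans hi)
    have h2 : y =o[𝓝 0] fun t => t ^ i := ho.trans_isBigO (IsBigO.of_bound 1 (by
      filter_upwards [Metric.ball_mem_nhds (0 : ℝ) one_pos] with t ht
      rw [one_mul, norm_pow, norm_pow]
      exact pow_le_pow_of_le_one (norm_nonneg t) (by simpa using ht : ‖t‖ < 1).le hi))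
    have h3 : (fun t : ℝ => iteratedDeriv i y 0 / i.factorial * t ^ i) =o[𝓝 0] fun t => t ^ i := by
      refine (h2.sub h1).congr_left fun t => ?_
      ring
    by_contra hne
    have hc : iteratedDeriv i y 0 / i.factorial ≠ 0 := div_ne_zero hne (by positivity)
    have h4 : (fun t : ℝ => t ^ i) =o[𝓝 0] fun t : ℝ => t ^ i := (isLittleO_const_mul_left_iff hc).1 h3
    have h5 : ∃ᶠ t : ℝ in 𝓝 0, t ^ i ≠ 0 := by
      have : ∃ᶠ t : ℝ in 𝓝[≠] 0, t ^ i ≠ 0 := Filter.Eventually.frequently (by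
        filter_upwards [self_mem_nhdsWithin] with t ht
        exact pow_ne_zero i ht)
      exact this.filter_mono nhdsWithin_le_nhds
    exact isLittleO_irrefl (by simpa using h5) h4

/-- Reparametrization `t ↦ c t ^ l` of the lowest order term of the Taylor expansion. -/
theorem iteratedDeriv_comp_mul_pow {y : ℝ → ℝ} (hy : ContDiffAt ℝ ∞ y 0) {k l : ℕ} (hl : 1 ≤ l)
    (h0 : ∀ i, 1 ≤ i → i < k → iteratedDeriv i y 0 = 0) (hk : 1 ≤ k) (c : ℝ) :
    (∀ i, 1 ≤ i → i < k * l → iteratedDeriv i (fun t => y (c * t ^ l)) 0 = 0) ∧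
    iteratedDeriv (k * l) (fun t => y (c * t ^ l)) 0
      = (k * l).factorial / k.factorial * c ^ k * iteratedDeriv k y 0 := by
  have hsub : ∀ {g : ℝ → ℝ} (a : ℝ) {i : ℕ}, 1 ≤ i → ∀ x : ℝ,
      iteratedDeriv i (fun t => g t - a) x = iteratedDeriv i g x := by
    intro g a i hi x
    obtain ⟨j, rfl⟩ := Nat.exists_eq_add_of_le' hi
    rw [iteratedDeriv_succ', iteratedDeriv_succ']
    congr 1
    funext z
    simp
  set y₁ : ℝ → ℝ := fun t => y t - y 0 with hy₁
  have hy₁c : ContDiffAt ℝ ∞ y₁ 0 := hy.sub contDiffAt_const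
  have h1 : ∀ i < k, iteratedDeriv i y₁ 0 = 0 := by
    intro i hi
    rcases Nat.eq_zero_or_pos i with rfl | hi0
    · simp [hy₁]
    · rw [hsub _ hi0, h0 i hi0 hi]
  have h2 := isLittleO_sub_of_iteratedDeriv_eq_zero hy₁c h1
  rw [hsub _ hk] at h2
  set a := iteratedDeriv k y 0 / k.factorial with ha
  have hσ : Filter.Tendsto (fun t : ℝ => c * t ^ l) (𝓝 0) (𝓝 0) := by
    have : Continuous fun t : ℝ => c * t ^ l := by fun_prop
    have h := this.tendsto 0
    simpa [zero_pow (by omega : l ≠ 0)] using h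
  have h3 := h2.comp_tendsto hσ
  -- Substituting `c t^l` in the asymptotic expansion replaces any formula for higher derivatives of
  -- a composite: the difference from the monomial is `o(t^(k l))`, so their derivatives at `0`
  -- agree up to that order.
  have h4 : (fun t : ℝ => y₁ (c * t ^ l) - a * c ^ k * t ^ (k * l)) =o[𝓝 0]
      fun t : ℝ => t ^ (k * l) := by
    have hb : ((fun t : ℝ => t ^ k) ∘ fun t : ℝ => c * t ^ l) =O[𝓝 0] fun t : ℝ => t ^ (k * l) := by
      refine IsBigO.of_bound (‖c ^ k‖) (Filter.Eventually.of_forall fun t => ?_)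
      rw [← norm_mul]
      apply le_of_eq
      congr 1
      simp only [Function.comp]
      rw [mul_pow, ← pow_mul, mul_comm l k]
    refine (h3.trans_isBigO hb).congr_left fun t => ?_
    simp only [Function.comp]
    rw [mul_pow, ← pow_mul, mul_comm l k]
    ring
  have hz : ContDiffAt ℝ ∞ (fun t : ℝ => y₁ (c * t ^ l)) 0 := by
    have h5 : ContDiffAt ℝ ∞ y₁ (c * (0 : ℝ) ^ l) := by
      rw [zero_pow (by omega : l ≠ 0), mul_zero]; exact hy₁c
    exact h5.comp (0 : ℝ) (by fun_prop : ContDiffAt ℝ ∞ (fun t : ℝ => c * t ^ l) 0)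
  have hp : ContDiffAt ℝ ∞ (fun t : ℝ => a * c ^ k * t ^ (k * l)) 0 := by fun_prop
  have h6 := iteratedDeriv_eq_zero_of_isLittleO (hz.sub hp) h4
  have hpow : ∀ i ≤ k * l, iteratedDeriv i (fun t : ℝ => a * c ^ k * t ^ (k * l)) 0
      = if i = k * l then a * c ^ k * (k * l).factorial else 0 := by
    intro i hi
    rw [iteratedDeriv_const_mul_field, iteratedDeriv_pow]
    split_ifs with h
    · subst h
      simp [Nat.descFactorial_self]
    · rw [zero_pow (by omega), mul_zero, mul_zero]
  have h7 : ∀ i, 1 ≤ i → i ≤ k * l → iteratedDeriv i (fun t => y (c * t ^ l)) 0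
      = if i = k * l then a * c ^ k * (k * l).factorial else 0 := by
    intro i hi hik
    rw [← hpow i hik, ← hsub (y 0) hi (g := fun t => y (c * t ^ l)), ← sub_eq_zero]
    have h8 := h6 i hik
    rw [iteratedDeriv_fun_sub (hz.of_le (by exact_mod_cast le_top))
      (hp.of_le (by exact_mod_cast le_top))] at h8
    exact h8
  constructor
  · intro i hi hik
    rw [h7 i hi hik.le, if_neg hik.ne]
  · rw [h7 (k * l) (by nlinarith) le_rfl, if_pos rfl, ha]
    ring

end TaylorCoefficients
-- Separation and fibrewise scaling in the tangent bundle
section TangentBundleTopology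

variable {n : ℕ} {M : Type*} [TopologicalSpace M]
  [ChartedSpace (EuclideanSpace ℝ (Fin n)) M] [IsManifold (𝓡 n) ∞ M]

/-- Needed for the uniqueness of integral curves in `TM`. Vectors at one point are separated in a
trivialization, vectors at different points by their projections. -/
instance t2Space_tangentBundle [T2Space M] : T2Space (TangentBundle (𝓡 n) M) := by
  refine ⟨fun v w hvw => ?_⟩
  by_cases h : v.proj = w.proj
  · let e := trivializationAt (EuclideanSpace ℝ (Fin n)) (TangentSpace (𝓡 n) : M → Type _) v.proj
    have hv : v ∈ e.source := e.mem_source.2 (mem_chart_source _ v.proj)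
    have hw : w ∈ e.source := e.mem_source.2 (h ▸ mem_chart_source _ v.proj)
    obtain ⟨U, U', hU, hU', hvU, hwU', hd⟩ := t2_separation (fun he => hvw (e.injOn hv hw he))
    exact ⟨e.source ∩ e ⁻¹' U, e.source ∩ e ⁻¹' U', e.continuousOn.isOpen_inter_preimage e.open_source hU,
      e.continuousOn.isOpen_inter_preimage e.open_source hU', ⟨hv, hvU⟩, ⟨hw, hwU'⟩,
      (hd.preimage e).mono inter_subset_right inter_subset_right⟩
  · obtain ⟨U, U', hU, hU', hvU, hwU', hd⟩ := t2_separation h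
    have hc : Continuous (Bundle.TotalSpace.proj : TangentBundle (𝓡 n) M → M) :=
      FiberBundle.continuous_proj _ _
    exact ⟨_, _, hU.preimage hc, hU'.preimage hc, hvU, hwU', hd.preimage _⟩

/-- Scalar multiplication in the fibres of the tangent bundle. -/
def fiberSmul (c : ℝ) (v : TangentBundle (𝓡 n) M) : TangentBundle (𝓡 n) M := ⟨v.proj, c • v.2⟩

theorem fiberSmul_fiberSmul (a b : ℝ) (v : TangentBundle (𝓡 n) M) :
    fiberSmul a (fiberSmul b v) = fiberSmul (a * b) v :=
  congrArg (Bundle.TotalSpace.mk v.proj) (smul_smul a b v.2)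

theorem fiberSmul_one (v : TangentBundle (𝓡 n) M) : fiberSmul 1 v = v :=
  congrArg (Bundle.TotalSpace.mk v.proj) (one_smul ℝ v.2)

theorem contMDiff_fiberSmul :
    ContMDiff (𝓘(ℝ, ℝ).prod (𝓡 n).tangent) (𝓡 n).tangent ∞
      (fun p : ℝ × TangentBundle (𝓡 n) M => fiberSmul p.1 p.2) := by
  rintro ⟨c, v⟩
  rw [Bundle.contMDiffAt_totalSpace]
  have hsnd : ContMDiffAt (𝓘(ℝ, ℝ).prod (𝓡 n).tangent) (𝓡 n).tangent ∞
      (fun p : ℝ × TangentBundle (𝓡 n) M => p.2) (c, v) := contMDiffAt_snd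
  rw [Bundle.contMDiffAt_totalSpace] at hsnd
  refine ⟨hsnd.1, ?_⟩
  have h1 : ContMDiffAt (𝓘(ℝ, ℝ).prod (𝓡 n).tangent) 𝓘(ℝ, EuclideanSpace ℝ (Fin n)) ∞
      (fun p : ℝ × TangentBundle (𝓡 n) M => p.1 • (trivializationAt (EuclideanSpace ℝ (Fin n))
        (TangentSpace (𝓡 n) : M → Type _) v.proj p.2).2) (c, v) :=
    contMDiffAt_fst.smul hsnd.2
  refine h1.congr_of_eventuallyEq ?_
  refine Filter.Eventually.of_forall fun p => ?_
  exact map_smul (fderivWithin ℝ (extChartAt (𝓡 n) v.proj ∘ (extChartAt (𝓡 n) p.2.proj).symm)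
    (range (𝓡 n)) (extChartAt (𝓡 n) p.2.proj p.2.proj)) p.1 p.2.2

end TangentBundleTopology

/-! ### Homogeneous extensions and inverses of curves of diffeomorphisms -/

namespace FinslerMetric

variable {n : ℕ} {M : Type*} [TopologicalSpace M]
  [ChartedSpace (EuclideanSpace ℝ (Fin n)) M] [IsManifold (𝓡 n) ∞ M] (F : FinslerMetric n M)

/-- The tangent bundle without the zero section. -/
def slit (n : ℕ) (M : Type*) [TopologicalSpace M] [ChartedSpace (EuclideanSpace ℝ (Fin n)) M]
    [IsManifold (𝓡 n) ∞ M] : Set (TangentBundle (𝓡 n) M) := {v | v.2 ≠ 0}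

theorem norm_fiberSmul {c : ℝ} (hc : 0 < c) (v : TangentBundle (𝓡 n) M) :
    F.norm (fiberSmul c v) = c * F.norm v := F.homogeneous v.proj v.2 c hc

theorem norm_zero (p : M) : F.norm ⟨p, 0⟩ = 0 := by
  have h := F.homogeneous p 0 2 two_pos
  rw [smul_zero] at h
  linarith

/-- If `𝓕` vanished at `v`, homogeneity would make it vanish on the whole ray, and the second
derivative of `𝓕²` at `v` in the radial direction would be zero, against positive definiteness. The
bounds `±1/2` keep the factor `1 + s + t` positive. -/
theorem norm_pos {v : TangentBundle (𝓡 n) M} (hv : v ∈ slit n M) : 0 < F.norm v := by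
  have h := F.posDef v.proj v.2 v.2 hv hv
  rcases (F.nonneg v).lt_or_eq with h0 | h0
  · exact h0
  exfalso
  have h1 : ∀ c : ℝ, F.norm ⟨v.proj, c • v.2⟩ ^ 2 = 0 ∨ c ≤ 0 := by
    intro c
    rcases lt_or_ge 0 c with hc | hc
    · left
      rw [F.homogeneous v.proj v.2 c hc]
      have : F.norm ⟨v.proj, v.2⟩ = 0 := h0.symm
      rw [this]; ring
    · exact Or.inr hc
  have h2 : (fun s : ℝ => deriv (fun t : ℝ =>
      F.norm ⟨v.proj, v.2 + s • v.2 + t • v.2⟩ ^ 2) 0) =ᶠ[nhds 0] fun _ => 0 := by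
    filter_upwards [Ioo_mem_nhds (show (-1 / 2 : ℝ) < 0 by norm_num)
      (show (0 : ℝ) < 1 / 2 by norm_num)] with s hs
    have h3 : (fun t : ℝ => F.norm ⟨v.proj, v.2 + s • v.2 + t • v.2⟩ ^ 2) =ᶠ[nhds 0] fun _ => 0 := by
      filter_upwards [Ioo_mem_nhds (show (-1 / 2 : ℝ) < 0 by norm_num)
        (show (0 : ℝ) < 1 / 2 by norm_num)] with t ht
      have e : v.2 + s • v.2 + t • v.2 = (1 + s + t) • v.2 := by
        rw [add_smul, add_smul, one_smul]
      rw [e]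
      rcases h1 (1 + s + t) with h | h
      · exact h
      · linarith [hs.1, ht.1]
    rw [h3.deriv_eq]
    simp
  rw [h2.deriv_eq] at h
  simp at h

theorem slit_eq : slit n M = {v | F.norm v ≠ 0} := by
  ext v
  refine ⟨fun hv => (F.norm_pos hv).ne', fun hv h0 => hv ?_⟩
  have : v = ⟨v.proj, 0⟩ := by
    rcases v with ⟨p, y⟩
    simp only at h0
    rw [h0]
  rw [this, F.norm_zero]

theorem isOpen_slit (F : FinslerMetric n M) : IsOpen (slit n M) := by
  rw [F.slit_eq]
  exact isOpen_ne_fun F.continuous continuous_const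

theorem indicatrixBundle_subset_slit : F.indicatrixBundle ⊆ slit n M := by
  intro v hv
  rw [F.slit_eq]
  have : F.norm v = 1 := hv
  simp [this]

/-- The projection of a nonzero tangent vector to the indicatrix bundle. -/
def normalize (v : slit n M) : F.indicatrixBundle :=
  ⟨fiberSmul (F.norm v.1)⁻¹ v.1, by
    show F.norm _ = 1
    rw [F.norm_fiberSmul (inv_pos.2 (F.norm_pos v.2)), inv_mul_cancel₀ (F.norm_pos v.2).ne']⟩

theorem smoothAlong_normalize :
    SmoothAlong (𝓡 n).tangent (𝓡 n).tangent (Subtype.val : slit n M → TangentBundle (𝓡 n) M)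
      (fun v => (F.normalize v).1) := by
  refine SmoothAlong.of_contMDiffOn (U := slit n M) (g := fun v => fiberSmul (F.norm v)⁻¹ v)
    F.isOpen_slit (fun v => v.2) ?_
  have h1 : ContMDiffOn (𝓡 n).tangent 𝓘(ℝ, ℝ) ∞ (fun v => (F.norm v)⁻¹) (slit n M) := by
    intro v hv
    have hF := F.smooth v hv
    have hinv : ContMDiffAt 𝓘(ℝ, ℝ) 𝓘(ℝ, ℝ) ∞ (fun x : ℝ => x⁻¹) (F.norm v) :=
      (contDiffAt_inv ℝ (F.norm_pos hv).ne').contMDiffAt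
    exact hinv.comp_contMDiffWithinAt v hF
  exact contMDiff_fiberSmul.comp_contMDiffOn (h1.prodMk contMDiffOn_id)

theorem fiberSmul_normalize (v : slit n M) : fiberSmul (F.norm v.1) (F.normalize v).1 = v.1 := by
  show fiberSmul (F.norm v.1) (fiberSmul (F.norm v.1)⁻¹ v.1) = v.1
  rw [fiberSmul_fiberSmul, mul_inv_cancel₀ (F.norm_pos v.2).ne', fiberSmul_one]

theorem normalize_fiberSmul {c : ℝ} (hc : 0 < c) (v : F.indicatrixBundle)
    (h : fiberSmul c v.1 ∈ slit n M) : F.normalize ⟨fiberSmul c v.1, h⟩ = v := by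
  have hv : F.norm v.1 = 1 := v.2
  apply Subtype.ext
  show fiberSmul (F.norm (fiberSmul c v.1))⁻¹ (fiberSmul c v.1) = v.1
  rw [F.norm_fiberSmul hc, hv, mul_one, fiberSmul_fiberSmul, inv_mul_cancel₀ hc.ne', fiberSmul_one]

theorem fiberSmul_mem_slit {c : ℝ} (hc : 0 < c) (v : F.indicatrixBundle) :
    fiberSmul c v.1 ∈ slit n M :=
  smul_ne_zero hc.ne' (F.indicatrixBundle_subset_slit v.2)

theorem normalize_coe (v : F.indicatrixBundle) :
    F.normalize ⟨v.1, F.indicatrixBundle_subset_slit v.2⟩ = v := by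
  have h := F.normalize_fiberSmul one_pos v (F.fiberSmul_mem_slit one_pos v)
  simpa [fiberSmul_one] using h

/-! #### Smooth curves of diffeomorphisms -/

/-- The homogeneous extension of a family of permutations of the indicatrix bundle. -/
def extendFamily (φ : ℝ → F.diffGroup) (p : ℝ × TangentBundle (𝓡 n) M) :
    TangentBundle (𝓡 n) M := by
  classical
  exact if h : p.2 ∈ slit n M then fiberSmul (F.norm p.2) ((φ p.1).1 (F.normalize ⟨p.2, h⟩)).1
    else p.2

theorem extendFamily_of_mem (φ : ℝ → F.diffGroup) (t : ℝ) (v : slit n M) :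
    F.extendFamily φ (t, v.1) = fiberSmul (F.norm v.1) ((φ t).1 (F.normalize v)).1 := by
  simp [extendFamily, v.2]

theorem extendFamily_coe (φ : ℝ → F.diffGroup) (t : ℝ) (v : F.indicatrixBundle) :
    F.extendFamily φ (t, v.1) = ((φ t).1 v).1 := by
  have h := F.extendFamily_of_mem φ t ⟨v.1, F.indicatrixBundle_subset_slit v.2⟩
  rw [h, F.normalize_coe]
  have : F.norm v.1 = 1 := v.2
  rw [this, fiberSmul_one]

theorem extendFamily_mem_slit (φ : ℝ → F.diffGroup) (t : ℝ) {v : TangentBundle (𝓡 n) M}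
    (hv : v ∈ slit n M) : F.extendFamily φ (t, v) ∈ slit n M := by
  rw [F.extendFamily_of_mem φ t ⟨v, hv⟩]
  exact F.fiberSmul_mem_slit (F.norm_pos hv) _

theorem extendFamily_inv_extendFamily (φ ψ : ℝ → F.diffGroup) (t s : ℝ) (h : ψ s * φ t = 1)
    {v : TangentBundle (𝓡 n) M} (hv : v ∈ slit n M) :
    F.extendFamily ψ (s, F.extendFamily φ (t, v)) = v := by
  have h1 := F.extendFamily_of_mem ψ s ⟨F.extendFamily φ (t, v), F.extendFamily_mem_slit φ t hv⟩
  refine h1.trans ?_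
  have h2 := F.extendFamily_of_mem φ t ⟨v, hv⟩
  simp only [h2]
  rw [F.normalize_fiberSmul (F.norm_pos hv)]
  have h3 : (ψ s).1 ((φ t).1 (F.normalize ⟨v, hv⟩)) = F.normalize ⟨v, hv⟩ := by
    have := congrArg (fun χ : F.diffGroup => χ.1 (F.normalize ⟨v, hv⟩)) h
    exact this
  have h4 : F.norm ((φ t).1 (F.normalize ⟨v, hv⟩)).1 = 1 := ((φ t).1 (F.normalize ⟨v, hv⟩)).2
  rw [h3, F.norm_fiberSmul (F.norm_pos hv), h4, mul_one]
  exact F.fiberSmul_normalize ⟨v, hv⟩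

/-- The family `φ` of diffeomorphisms is smooth near `0`. -/
def IsSmoothCurve (φ : ℝ → F.diffGroup) : Prop :=
  SmoothFamily (𝓡 n).tangent (𝓡 n).tangent (Subtype.val : F.indicatrixBundle → _)
    (fun t v => ((φ t).1 v).1)

theorem contMDiffOn_extendFamily {φ : ℝ → F.diffGroup} {ε : ℝ}
    (hφ : SmoothAlong (𝓘(ℝ, ℝ).prod (𝓡 n).tangent) (𝓡 n).tangent
      (fun z : Ioo (-ε) ε × F.indicatrixBundle => (z.1.1, z.2.1)) (fun z => ((φ z.1.1).1 z.2).1)) :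
    ContMDiffOn (𝓘(ℝ, ℝ).prod (𝓡 n).tangent) (𝓡 n).tangent ∞ (F.extendFamily φ)
      (Ioo (-ε) ε ×ˢ slit n M) := by
  refine SmoothAlong.contMDiffOn (isOpen_Ioo.prod F.isOpen_slit) ?_
  have hfst : SmoothAlong (𝓘(ℝ, ℝ).prod (𝓡 n).tangent) 𝓘(ℝ, ℝ)
      (Subtype.val : (Ioo (-ε) ε ×ˢ slit n M : Set (ℝ × TangentBundle (𝓡 n) M)) → _)
      (fun z => z.1.1) :=
    SmoothAlong.of_contMDiffOn (g := Prod.fst) isOpen_univ (fun _ => mem_univ _) contMDiffOn_fst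
  have hsnd : SmoothAlong (𝓘(ℝ, ℝ).prod (𝓡 n).tangent) (𝓡 n).tangent
      (Subtype.val : (Ioo (-ε) ε ×ˢ slit n M : Set (ℝ × TangentBundle (𝓡 n) M)) → _)
      (fun z => z.1.2) :=
    SmoothAlong.of_contMDiffOn (g := Prod.snd) isOpen_univ (fun _ => mem_univ _) contMDiffOn_snd
  have h1 : SmoothAlong (𝓘(ℝ, ℝ).prod (𝓡 n).tangent) (𝓡 n).tangent
      (Subtype.val : (Ioo (-ε) ε ×ˢ slit n M : Set (ℝ × TangentBundle (𝓡 n) M)) → _)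
      (fun z => (F.normalize ⟨z.1.2, z.2.2⟩).1) :=
    SmoothAlong.comp (g := fun z : (Ioo (-ε) ε ×ˢ slit n M : Set (ℝ × TangentBundle (𝓡 n) M)) =>
      (⟨z.1.2, z.2.2⟩ : slit n M)) F.smoothAlong_normalize hsnd
  have h2 := SmoothAlong.comp
    (g := fun z : (Ioo (-ε) ε ×ˢ slit n M : Set (ℝ × TangentBundle (𝓡 n) M)) =>
      ((⟨z.1.1, z.2.1⟩ : Ioo (-ε) ε), F.normalize ⟨z.1.2, z.2.2⟩)) hφ (hfst.prodMk h1)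
  have h3 : SmoothAlong (𝓘(ℝ, ℝ).prod (𝓡 n).tangent) 𝓘(ℝ, ℝ)
      (Subtype.val : (Ioo (-ε) ε ×ˢ slit n M : Set (ℝ × TangentBundle (𝓡 n) M)) → _)
      (fun z => F.norm z.1.2) := hsnd.contMDiffOn_comp F.isOpen_slit (fun z => z.2.2) F.smooth
  have h4 := (h3.prodMk h2).contMDiffOn_comp isOpen_univ (fun _ => mem_univ _)
    contMDiff_fiberSmul.contMDiffOn
  refine Eq.mp (congrArg _ ?_) h4
  funext z
  exact (F.extendFamily_of_mem φ z.1.1 ⟨z.1.2, z.2.2⟩).symm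

/-- The homogeneous extension to the slit tangent bundle, an open set, brings the family within
reach of the inverse function theorem with parameters. The left inverse required there is the
extension of `(φ t₀)⁻¹`, which is smooth because each single `φ t₀` is a diffeomorphism. -/
theorem IsSmoothCurve.inv {φ : ℝ → F.diffGroup} (hφ : F.IsSmoothCurve φ) :
    F.IsSmoothCurve (fun t => (φ t)⁻¹) := by
  obtain ⟨ε, hε, hs⟩ := hφ
  refine ⟨ε, hε, ?_⟩
  have hU := F.contMDiffOn_extendFamily hs
  rintro ⟨⟨t₀, ht₀⟩, w₀⟩
  let v₀ : F.indicatrixBundle := (φ t₀)⁻¹.1 w₀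
  have hv₀ : (φ t₀).1 v₀ = w₀ := by
    have := congrArg (fun χ : F.diffGroup => χ.1 w₀) (mul_inv_cancel (φ t₀))
    exact this
  have hslit := F.indicatrixBundle_subset_slit v₀.2
  have hmem : (t₀, v₀.1) ∈ Ioo (-ε) ε ×ˢ slit n M := ⟨ht₀, hslit⟩
  -- the inverse of the single diffeomorphism
  let G : TangentBundle (𝓡 n) M → TangentBundle (𝓡 n) M := fun w =>
    F.extendFamily (fun _ => (φ t₀)⁻¹) (0, w)
  have hG : ContMDiffOn (𝓡 n).tangent (𝓡 n).tangent ∞ G (slit n M) := by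
    -- A single diffeomorphism is regarded as a constant family, so that the smoothness of extended
    -- families applies to it.
    have hconst : SmoothAlong (𝓘(ℝ, ℝ).prod (𝓡 n).tangent) (𝓡 n).tangent
        (fun z : Ioo (-1 : ℝ) 1 × F.indicatrixBundle => (z.1.1, z.2.1))
        (fun z => ((φ t₀)⁻¹.1 z.2).1) := by
      refine SmoothAlong.comp (f := fun v => ((φ t₀)⁻¹.1 v).1)
        (g := fun z : Ioo (-1 : ℝ) 1 × F.indicatrixBundle => z.2) (φ t₀)⁻¹.2.1 ?_
      exact SmoothAlong.of_contMDiffOn (g := Prod.snd) isOpen_univ (fun _ => mem_univ _)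
        contMDiffOn_snd
    have h1 := F.contMDiffOn_extendFamily (φ := fun _ => (φ t₀)⁻¹) hconst
    exact h1.comp (contMDiff_const.prodMk contMDiff_id).contMDiffOn
      fun w hw => ⟨⟨by norm_num, by norm_num⟩, hw⟩
  have hext : F.extendFamily φ (t₀, v₀.1) = w₀.1 := by rw [F.extendFamily_coe, hv₀]
  have hGd : MDifferentiableAt (𝓡 n).tangent (𝓡 n).tangent G (F.extendFamily φ (t₀, v₀.1)) :=
    (hG.contMDiffAt (F.isOpen_slit.mem_nhds (F.extendFamily_mem_slit φ t₀ hslit))).mdifferentiableAt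
      (by simp)
  have hGΦ : ∀ᶠ x in nhds v₀.1, G (F.extendFamily φ (t₀, x)) = x := by
    filter_upwards [F.isOpen_slit.mem_nhds hslit] with x hx
    exact F.extendFamily_inv_extendFamily φ (fun _ => (φ t₀)⁻¹) t₀ 0 (inv_mul_cancel _) hx
  obtain ⟨V, hV, hmV, Ψ, hΨ, hΨ'⟩ := exists_parametric_inverse_manifold
    (isOpen_Ioo.prod F.isOpen_slit) hU hmem hGd hGΦ
  rw [hext] at hmV
  refine ⟨V, hV, hmV, Ψ, hΨ, ?_⟩
  rintro ⟨⟨t, ht⟩, w⟩ hw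
  obtain ⟨h1, h2⟩ := hΨ' _ hw
  have h3 := F.extendFamily_inv_extendFamily φ (fun s => (φ s)⁻¹) t t (inv_mul_cancel _) h1.2
  simp only at h2
  rw [h2, F.extendFamily_coe] at h3
  exact h3.symm

end FinslerMetric

/-! ### Leading terms of formal power series -/

theorem coeff_mul_of_forall_lt {R : Type*} [Semiring R] {A B : PowerSeries R} {k l : ℕ}
    (hA : ∀ i < k, PowerSeries.coeff i A = 0) (hB : ∀ i < l, PowerSeries.coeff i B = 0) :
    (∀ i < k + l, PowerSeries.coeff i (A * B) = 0) ∧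
    PowerSeries.coeff (k + l) (A * B) = PowerSeries.coeff k A * PowerSeries.coeff l B := by
  constructor
  · intro i hi
    rw [PowerSeries.coeff_mul]
    refine Finset.sum_eq_zero fun p hp => ?_
    rw [Finset.HasAntidiagonal.mem_antidiagonal] at hp
    rcases lt_or_ge p.1 k with h | h
    · rw [hA _ h, zero_mul]
    · rw [hB _ (by omega), mul_zero]
  · rw [PowerSeries.coeff_mul, Finset.sum_eq_single (k, l)]
    · intro p hp hne
      rw [Finset.HasAntidiagonal.mem_antidiagonal] at hp
      rcases lt_or_ge p.1 k with h | h
      · rw [hA _ h, zero_mul]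
      · rcases lt_or_ge p.2 l with h' | h'
        · rw [hB _ h', mul_zero]
        · exact absurd (Prod.ext (by simp; omega) (by simp; omega)) hne
    · intro h
      simp at h

/-- The power series `a` is `1 + D X ^ k + ⋯`. -/
def HasLeadingTerm {R : Type*} [Ring R] (a : PowerSeries R) (k : ℕ) (D : R) : Prop :=
  (∀ i < k, PowerSeries.coeff i (a - 1) = 0) ∧ PowerSeries.coeff k (a - 1) = D

namespace HasLeadingTerm

variable {R : Type*} [Ring R] {a b a' b' : PowerSeries R} {k l : ℕ} {D D' : R}

protected theorem one : HasLeadingTerm (1 : PowerSeries R) k 0 := by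
  constructor <;> simp

protected theorem mul (hk : 1 ≤ k) (ha : HasLeadingTerm a k D) (hb : HasLeadingTerm b k D') :
    HasLeadingTerm (b * a) k (D + D') := by
  obtain ⟨h1, h2⟩ := ha
  obtain ⟨h1', h2'⟩ := hb
  have h := coeff_mul_of_forall_lt h1' h1
  -- The last product starts at order `2 * k`, beyond the order `k` under consideration because `k ≥
  -- 1`.
  have e : b * a - 1 = (a - 1) + (b - 1) + (b - 1) * (a - 1) := by
    simp only [sub_mul, mul_sub, one_mul, mul_one]
    abel
  refine ⟨fun i hi => ?_, ?_⟩
  · rw [e, map_add, map_add, h1 i hi, h1' i hi, h.1 i (by omega)]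
    simp
  · rw [e, map_add, map_add, h2, h2', h.1 k (by omega), add_zero]

protected theorem inv (hk : 1 ≤ k) (ha : HasLeadingTerm a k D) (h : a' * a = 1)
    (h0 : PowerSeries.coeff 0 (a' - 1) = 0) : HasLeadingTerm a' k (-D) := by
  obtain ⟨h1, h2⟩ := ha
  -- The last product starts at order `k + 1`, since `a' - 1` has no constant term.
  have e : a' - 1 = - (a - 1) - (a' - 1) * (a - 1) := by
    simp only [sub_mul, mul_sub, one_mul, mul_one, h]
    abel
  have h3 : ∀ i < 1, PowerSeries.coeff i (a' - 1) = 0 := by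
    intro i hi
    obtain rfl : i = 0 := by omega
    exact h0
  have h := coeff_mul_of_forall_lt h3 h1
  refine ⟨fun i hi => ?_, ?_⟩
  · rw [e, map_sub, map_neg, h1 i hi, h.1 i (by omega)]
    simp
  · rw [e, map_sub, map_neg, h2, h.1 k (by omega), sub_zero]

/-- Since `a' b' b a = 1`, the difference `a' b' a b - 1` is `a' b'` times `(a - 1)(b - 1) - (b -
1)(a - 1)`. The second factor starts at order `k + l`, and the first has constant term `1`, so it
does not affect the leading coefficient. -/
protected theorem commutator (hk : 1 ≤ k) (hl : 1 ≤ l) (ha : HasLeadingTerm a k D)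
    (hb : HasLeadingTerm b l D') (ha' : a' * a = 1) (hb' : b' * b = 1)
    (h0 : PowerSeries.coeff 0 (a' - 1) = 0) (h0' : PowerSeries.coeff 0 (b' - 1) = 0) :
    HasLeadingTerm (a' * (b' * (a * b))) (k + l) (D * D' - D' * D) := by
  obtain ⟨h1, h2⟩ := ha
  obtain ⟨h1', h2'⟩ := hb
  have hAB := coeff_mul_of_forall_lt h1 h1'
  have hBA := coeff_mul_of_forall_lt h1' h1
  have e : a' * (b' * (a * b)) - 1 =
      (a' * b') * ((a - 1) * (b - 1) - (b - 1) * (a - 1)) := by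
    have e1 : (a - 1) * (b - 1) - (b - 1) * (a - 1) = a * b - b * a := by
      simp only [sub_mul, mul_sub, one_mul, mul_one]
      abel
    have e2 : (a' * b') * (b * a) = 1 := by
      rw [mul_assoc, ← mul_assoc b', hb', one_mul, ha']
    rw [e1, mul_sub, e2, mul_assoc]
  have hc : ∀ i < k + l, PowerSeries.coeff i ((a - 1) * (b - 1) - (b - 1) * (a - 1)) = 0 :=
    fun i hi => by rw [map_sub, hAB.1 i hi, hBA.1 i (by omega), sub_zero]
  have h := coeff_mul_of_forall_lt (A := a' * b') (k := 0) (by simp) hc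
  have hone : PowerSeries.coeff 0 (a' * b') = 1 := by
    rw [map_sub, PowerSeries.coeff_zero_one, sub_eq_zero] at h0 h0'
    rw [PowerSeries.coeff_mul]
    simp at h0 h0'
    simp [h0, h0']
  rw [zero_add] at h
  refine ⟨fun i hi => ?_, ?_⟩
  · rw [e, h.1 i hi]
  · rw [e, h.2, hone, one_mul, map_sub, hAB.2, add_comm k l, hBA.2, h2, h2']

end HasLeadingTerm

/-! ### Taylor expansions of curves of diffeomorphisms -/

namespace FinslerMetric

variable {n : ℕ} {M : Type*} [TopologicalSpace M]
  [ChartedSpace (EuclideanSpace ℝ (Fin n)) M] [IsManifold (𝓡 n) ∞ M] (F : FinslerMetric n M)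

/-- The group of smooth curves of diffeomorphisms of the indicatrix bundle. -/
def smoothCurves : Subgroup (ℝ → F.diffGroup) where
  carrier := {φ | F.IsSmoothCurve φ}
  mul_mem' := fun {φ ψ} hφ hψ => SmoothFamily.comp (h := fun t v => ((φ t).1 v).1)
    (g := fun t v => (ψ t).1 v) hφ hψ
  one_mem' := ⟨1, one_pos, SmoothAlong.of_contMDiffOn (g := Prod.snd) isOpen_univ
    (fun _ => mem_univ _) contMDiffOn_snd⟩
  inv_mem' := fun hφ => hφ.inv

variable {F}

theorem smoothFamily_const (f : F.smoothFun) :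
    SmoothFamily (𝓡 n).tangent 𝓘(ℝ, ℝ) (Subtype.val : F.indicatrixBundle → _)
      (fun _ v => f.1 v) :=
  ⟨1, one_pos, SmoothAlong.comp (f := f.1)
    (g := fun z : Ioo (-1 : ℝ) 1 × F.indicatrixBundle => z.2) f.2
    (SmoothAlong.of_contMDiffOn (g := Prod.snd) isOpen_univ (fun _ => mem_univ _) contMDiffOn_snd)⟩

theorem smoothFamily_comp (φ : F.smoothCurves) (f : F.smoothFun) :
    SmoothFamily (𝓡 n).tangent 𝓘(ℝ, ℝ) (Subtype.val : F.indicatrixBundle → _)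
      (fun t v => f.1 ((φ.1 t).1 v)) :=
  SmoothFamily.comp (g := fun t v => (φ.1 t).1 v) (smoothFamily_const f) φ.2

theorem contDiffAt_comp (φ : F.smoothCurves) (f : F.smoothFun) (v : F.indicatrixBundle) :
    ContDiffAt ℝ ∞ (fun t => f.1 ((φ.1 t).1 v)) 0 :=
  SmoothFamily.contDiffAt (h := fun t v => f.1 ((φ.1 t).1 v)) (smoothFamily_comp φ f) v

theorem contDiffAt_comp_nat (φ : F.smoothCurves) (f : F.smoothFun) (v : F.indicatrixBundle)
    (i : ℕ) : ContDiffAt ℝ i (fun t => f.1 ((φ.1 t).1 v)) 0 :=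
  (contDiffAt_comp φ f v).of_le (by exact_mod_cast le_top)

/-- The `i`-th Taylor coefficient of `f ∘ φ_t` at `t = 0`, as an operator on smooth functions. -/
def taylorCoeff (φ : F.smoothCurves) (i : ℕ) : Module.End ℝ F.smoothFun where
  toFun f := ⟨fun v => (i.factorial : ℝ)⁻¹ * iteratedDeriv i (fun t => f.1 ((φ.1 t).1 v)) 0,
    F.smoothFun.smul_mem (SmoothFamily.iteratedDeriv (smoothFamily_comp φ f) i) _⟩
  map_add' f g := by
    apply Subtype.ext
    funext v
    show _ * iteratedDeriv i ((fun t => f.1 ((φ.1 t).1 v)) + fun t => g.1 ((φ.1 t).1 v)) 0 =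
      _ * iteratedDeriv i (fun t => f.1 ((φ.1 t).1 v)) 0 +
      _ * iteratedDeriv i (fun t => g.1 ((φ.1 t).1 v)) 0
    rw [iteratedDeriv_add (contDiffAt_comp_nat φ f v i) (contDiffAt_comp_nat φ g v i), mul_add]
  map_smul' c f := by
    apply Subtype.ext
    funext v
    show _ * iteratedDeriv i (fun t => c • f.1 ((φ.1 t).1 v)) 0 =
      c * (_ * iteratedDeriv i (fun t => f.1 ((φ.1 t).1 v)) 0)
    rw [iteratedDeriv_fun_const_smul (contDiffAt_comp_nat φ f v i) c, smul_eq_mul]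
    ring

theorem taylorCoeff_apply (φ : F.smoothCurves) (i : ℕ) (f : F.smoothFun) (v : F.indicatrixBundle) :
    (taylorCoeff φ i f).1 v =
      (i.factorial : ℝ)⁻¹ * iteratedDeriv i (fun t => f.1 ((φ.1 t).1 v)) 0 := rfl

/-- The Taylor expansion at `t = 0` of a smooth curve of diffeomorphisms. -/
def taylor (φ : F.smoothCurves) : PowerSeries (Module.End ℝ F.smoothFun) :=
  PowerSeries.mk (taylorCoeff φ)

theorem coe_sum_smoothFun {ι : Type*} (s : Finset ι) (f : ι → F.smoothFun)
    (v : F.indicatrixBundle) : (∑ i ∈ s, f i).1 v = ∑ i ∈ s, (f i).1 v := by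
  have h := map_sum F.smoothFun.val f s
  have h' := congrFun h v
  rw [Finset.sum_apply] at h'
  exact h'

/-- Pulling back functions reverses composition, whence the exchanged factors. Coefficientwise this
is the Leibniz rule on the diagonal for `f (φ_s (ψ_t v))`; the normalization by factorials absorbs
the binomial coefficients. -/
theorem taylor_mul (φ ψ : F.smoothCurves) : taylor (φ * ψ) = taylor ψ * taylor φ := by
  ext m f v
  rw [PowerSeries.coeff_mul]
  simp only [taylor, PowerSeries.coeff_mk]
  rw [LinearMap.sum_apply]
  refine Eq.trans ?_ (coe_sum_smoothFun _ _ v).symm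
  obtain ⟨ε, hε, h2⟩ := SmoothFamily.exists_contDiffOn_two
    (h := fun t v => f.1 ((φ.1 t).1 v)) (g := fun t v => (ψ.1 t).1 v) (smoothFamily_comp φ f) ψ.2 v
  have h3 := iteratedDeriv_diagonal hε h2 m
  rw [taylorCoeff_apply]
  refine Eq.trans (congrArg _ h3) ?_
  rw [Finset.mul_sum, ← Finset.Nat.sum_antidiagonal_swap]
  refine Finset.sum_congr rfl fun p hp => ?_
  obtain rfl := Finset.HasAntidiagonal.mem_antidiagonal.1 hp
  have h4 : ((taylorCoeff ψ p.1 * taylorCoeff φ p.2) f).1 v = (p.1.factorial : ℝ)⁻¹ *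
      iteratedDeriv p.1 (fun t => (p.2.factorial : ℝ)⁻¹ *
        iteratedDeriv p.2 (fun s => f.1 ((φ.1 s).1 ((ψ.1 t).1 v))) 0) 0 := rfl
  rw [h4, iteratedDeriv_const_mul_field]
  show _ * (((p.1 + p.2).choose p.2 : ℝ) * iteratedDeriv p.1 (fun t =>
    iteratedDeriv p.2 (fun s => f.1 ((φ.1 s).1 ((ψ.1 t).1 v))) 0) 0) = _
  have h5 : ((p.1 + p.2).choose p.2 : ℝ) * p.2.factorial * p.1.factorial =
      (p.1 + p.2).factorial := by
    have := Nat.add_choose_mul_factorial_mul_factorial p.1 p.2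
    rw [mul_right_comm] at this
    exact_mod_cast this
  rw [← h5]
  have := Nat.cast_ne_zero (R := ℝ).2 (Nat.factorial_ne_zero p.1)
  have := Nat.cast_ne_zero (R := ℝ).2 (Nat.factorial_ne_zero p.2)
  have : ((p.1 + p.2).choose p.2 : ℝ) ≠ 0 :=
    Nat.cast_ne_zero.2 (Nat.choose_pos (Nat.le_add_left _ _)).ne'
  field_simp

theorem taylor_one : taylor (1 : F.smoothCurves) = 1 := by
  ext m f v
  rw [PowerSeries.coeff_one]
  simp only [taylor, PowerSeries.coeff_mk]
  rw [taylorCoeff_apply]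
  show _ * iteratedDeriv m (fun _ => f.1 v) 0 = _
  rw [iteratedDeriv_const]
  split_ifs with h
  · simp [h]
  · simp

/-- The curve `φ` starts at the identity, and the first nontrivial coefficient of its Taylor
expansion is `D`, at order `k`. -/
def HasLeadingCoeff (φ : F.smoothCurves) (k : ℕ) (D : Module.End ℝ F.smoothFun) : Prop :=
  φ.1 0 = 1 ∧ HasLeadingTerm (taylor φ) k D

theorem taylor_inv_mul (φ : F.smoothCurves) : taylor φ⁻¹ * taylor φ = 1 := by
  rw [← taylor_mul, mul_inv_cancel, taylor_one]

theorem coeff_zero_taylor_sub_one (φ : F.smoothCurves) (h : φ.1 0 = 1) :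
    PowerSeries.coeff 0 (taylor φ - 1) = 0 := by
  ext f v
  rw [map_sub, PowerSeries.coeff_zero_one]
  simp only [taylor, PowerSeries.coeff_mk]
  show (taylorCoeff φ 0 f).1 v - f.1 v = 0
  rw [taylorCoeff_apply, iteratedDeriv_zero, h]
  simp

theorem coe_inv_zero (φ : F.smoothCurves) (h : φ.1 0 = 1) : φ⁻¹.1 0 = 1 := by
  show (φ.1 0)⁻¹ = 1
  rw [h, inv_one]

namespace HasLeadingCoeff

variable {φ ψ : F.smoothCurves} {k l : ℕ} {D D' : Module.End ℝ F.smoothFun}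

protected theorem one : HasLeadingCoeff (1 : F.smoothCurves) k 0 :=
  ⟨rfl, by rw [taylor_one]; exact HasLeadingTerm.one⟩

protected theorem mul (hk : 1 ≤ k) (hφ : HasLeadingCoeff φ k D) (hψ : HasLeadingCoeff ψ k D') :
    HasLeadingCoeff (φ * ψ) k (D + D') := by
  refine ⟨?_, ?_⟩
  · show φ.1 0 * ψ.1 0 = 1
    rw [hφ.1, hψ.1, one_mul]
  · rw [taylor_mul]
    exact HasLeadingTerm.mul hk hφ.2 hψ.2

protected theorem inv (hk : 1 ≤ k) (hφ : HasLeadingCoeff φ k D) :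
    HasLeadingCoeff φ⁻¹ k (-D) :=
  ⟨coe_inv_zero φ hφ.1, HasLeadingTerm.inv hk hφ.2 (taylor_inv_mul φ)
    (coeff_zero_taylor_sub_one _ (coe_inv_zero φ hφ.1))⟩

/-- The factors are arranged so that the reversed product of the Taylor series is `a' b' a b` with
`a` the series of `φ` and `b` that of `ψ`; this fixes the sign of the bracket. -/
protected theorem commutator (hk : 1 ≤ k) (hl : 1 ≤ l) (hφ : HasLeadingCoeff φ k D)
    (hψ : HasLeadingCoeff ψ l D') :
    HasLeadingCoeff (ψ * φ * ψ⁻¹ * φ⁻¹) (k + l) (D * D' - D' * D) := by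
  refine ⟨?_, ?_⟩
  · show ψ.1 0 * φ.1 0 * (ψ.1 0)⁻¹ * (φ.1 0)⁻¹ = 1
    rw [hφ.1, hψ.1]; simp
  · rw [taylor_mul, taylor_mul, taylor_mul]
    exact HasLeadingTerm.commutator hk hl hφ.2 hψ.2 (taylor_inv_mul φ) (taylor_inv_mul ψ)
      (coeff_zero_taylor_sub_one _ (coe_inv_zero φ hφ.1))
      (coeff_zero_taylor_sub_one _ (coe_inv_zero ψ hψ.1))

end HasLeadingCoeff
end FinslerMetric
-- Tangent vector fields form a Lie algebra
namespace FinslerMetric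

variable {n : ℕ} {M : Type*} [TopologicalSpace M]
  [ChartedSpace (EuclideanSpace ℝ (Fin n)) M] [IsManifold (𝓡 n) ∞ M] {F : FinslerMetric n M}

theorem coeff_taylor_sub_one (φ : F.smoothCurves) {i : ℕ} (hi : 1 ≤ i) :
    PowerSeries.coeff i (taylor φ - 1) = taylorCoeff φ i := by
  rw [map_sub, PowerSeries.coeff_one, if_neg (by omega)]
  exact (sub_zero _).trans (PowerSeries.coeff_mk i (taylorCoeff φ))

theorem hasLeadingCoeff_iff {φ : F.smoothCurves} {k : ℕ} (hk : 1 ≤ k)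
    {D : Module.End ℝ F.smoothFun} :
    HasLeadingCoeff φ k D ↔ φ.1 0 = 1 ∧ ∀ (f : F.smoothFun) (v : F.indicatrixBundle),
      (∀ i : ℕ, 1 ≤ i → i < k → iteratedDeriv i (fun t : ℝ => f.1 ((φ.1 t).1 v)) 0 = 0) ∧
      iteratedDeriv k (fun t : ℝ => f.1 ((φ.1 t).1 v)) 0 = k.factorial * (D f).1 v := by
  refine and_congr_right fun h0 => ⟨fun h f v => ⟨fun i hi hik => ?_, ?_⟩, fun h => ⟨?_, ?_⟩⟩
  · have h1 := h.1 i hik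
    rw [coeff_taylor_sub_one φ hi] at h1
    have h2 := taylorCoeff_apply φ i f v
    rw [h1] at h2
    have h3 : (0 : ℝ) = (i.factorial : ℝ)⁻¹ * iteratedDeriv i (fun t => f.1 ((φ.1 t).1 v)) 0 := h2
    have := Nat.cast_ne_zero (R := ℝ).2 (Nat.factorial_ne_zero i)
    have h4 := (mul_eq_zero.1 h3.symm).resolve_left (inv_ne_zero this)
    exact h4
  · have h1 := h.2
    rw [coeff_taylor_sub_one φ hk] at h1
    have h2 := taylorCoeff_apply φ k f v
    rw [h1] at h2
    have := Nat.cast_ne_zero (R := ℝ).2 (Nat.factorial_ne_zero k)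
    rw [h2, mul_inv_cancel_left₀ this]
  · intro i hik
    rcases Nat.eq_zero_or_pos i with rfl | hi
    · exact coeff_zero_taylor_sub_one φ h0
    · rw [coeff_taylor_sub_one φ hi]
      ext f v
      rw [taylorCoeff_apply, (h f v).1 i hi hik, mul_zero]
      rfl
  · rw [coeff_taylor_sub_one φ hk]
    ext f v
    have := Nat.cast_ne_zero (R := ℝ).2 (Nat.factorial_ne_zero k)
    rw [taylorCoeff_apply, (h f v).2, inv_mul_cancel_left₀ this]

/-- Reparametrization of a smooth curve of diffeomorphisms by `t ↦ c t ^ l`. -/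
theorem HasLeadingCoeff.comp_mul_pow {φ : F.smoothCurves} {k l : ℕ} (hk : 1 ≤ k) (hl : 1 ≤ l)
    {D : Module.End ℝ F.smoothFun} (h : HasLeadingCoeff φ k D) (c : ℝ) :
    ∃ ψ : F.smoothCurves, (∀ t, ψ.1 t = φ.1 (c * t ^ l)) ∧ HasLeadingCoeff ψ (k * l) (c ^ k • D) := by
  have h00 : c * (0 : ℝ) ^ l = 0 := by rw [zero_pow (by omega), mul_zero]
  refine ⟨⟨fun t => φ.1 (c * t ^ l), SmoothFamily.comp_time (h := fun t v => ((φ.1 t).1 v).1)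
    φ.2 (σ := fun t => c * t ^ l) (by fun_prop) h00⟩, fun t => rfl, ?_⟩
  rw [hasLeadingCoeff_iff (Nat.mul_pos hk hl)]
  rw [hasLeadingCoeff_iff hk] at h
  refine ⟨?_, fun f v => ?_⟩
  · show φ.1 (c * 0 ^ l) = 1
    rw [h00, h.1]
  · obtain ⟨h1, h2⟩ := iteratedDeriv_comp_mul_pow (contDiffAt_comp φ f v) hl (h.2 f v).1 hk c
    refine ⟨h1, h2.trans ?_⟩
    rw [(h.2 f v).2]
    have := Nat.cast_ne_zero (R := ℝ).2 (Nat.factorial_ne_zero k)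
    show _ = _ * (c ^ k * (D f).1 v)
    field_simp

/-- An integral curve of order `k` has Taylor coefficient `ξ / k!`. The substitution `t ↦ c t` with
`c ^ k = (k! a)⁻¹` corrects the factor; the positivity of `a` guarantees that such a real `c` exists
for every `k`. -/
theorem mem_tangentFields_of_hasLeadingCoeff {G : Subgroup F.diffGroup} {φ : F.smoothCurves}
    (hφ : ∀ t, φ.1 t ∈ G) {k : ℕ} (hk : 1 ≤ k) {a : ℝ} (ha : 0 < a) {ξ : F.VField}
    (h : HasLeadingCoeff φ k (a • (ξ : F.smoothFun →ₗ[ℝ] F.smoothFun))) :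
    ξ ∈ F.tangentFields G := by
  have hk0 : (0 : ℝ) < k.factorial := Nat.cast_pos.2 (Nat.factorial_pos k)
  obtain ⟨c, hc0, hc⟩ : ∃ c : ℝ, 0 ≤ c ∧ c ^ k = (k.factorial * a)⁻¹ :=
    ⟨((k.factorial * a)⁻¹) ^ ((k : ℝ)⁻¹), by positivity, Real.rpow_inv_natCast_pow (by positivity) (by omega)⟩
  obtain ⟨ψ, hψ, h'⟩ := h.comp_mul_pow hk le_rfl c
  rw [mul_one, hasLeadingCoeff_iff hk] at h'
  refine ⟨k, hk, fun t => ⟨ψ.1 t, by rw [hψ]; exact hφ _⟩, ψ.2, Subtype.ext h'.1, fun f v => ?_⟩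
  refine ⟨(h'.2 f v).1, ((h'.2 f v).2).trans ?_⟩
  show (k.factorial : ℝ) * (c ^ k * (a * (ξ f).1 v)) = (ξ f).1 v
  rw [hc]
  field_simp

/-- Rescaling time absorbs the factorial, so tangency may be tested on the leading Taylor
coefficient, where the algebra of power series applies. -/
theorem mem_tangentFields_iff {G : Subgroup F.diffGroup} {ξ : F.VField} :
    ξ ∈ F.tangentFields G ↔ ∃ k ≥ 1, ∃ φ : F.smoothCurves, (∀ t, φ.1 t ∈ G) ∧
      HasLeadingCoeff φ k (ξ : F.smoothFun →ₗ[ℝ] F.smoothFun) := by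
  constructor
  · rintro ⟨k, hk, φ, hs, h0, h⟩
    have hk0 : (0 : ℝ) < k.factorial := Nat.cast_pos.2 (Nat.factorial_pos k)
    have hL : HasLeadingCoeff (⟨fun t => (φ t).1, hs⟩ : F.smoothCurves) k
        ((k.factorial : ℝ)⁻¹ • (ξ : F.smoothFun →ₗ[ℝ] F.smoothFun)) := by
      rw [hasLeadingCoeff_iff hk]
      refine ⟨congrArg Subtype.val h0, fun f v => ⟨(h f v).1, (h f v).2.trans ?_⟩⟩
      show _ = (k.factorial : ℝ) * ((k.factorial : ℝ)⁻¹ * (ξ f).1 v)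
      rw [mul_inv_cancel_left₀ hk0.ne']
    obtain ⟨c, hc0, hc⟩ : ∃ c : ℝ, 0 ≤ c ∧ c ^ k = k.factorial :=
      ⟨(k.factorial : ℝ) ^ ((k : ℝ)⁻¹), by positivity,
        Real.rpow_inv_natCast_pow (by positivity) (by omega)⟩
    obtain ⟨ψ, hψ, h'⟩ := hL.comp_mul_pow hk le_rfl c
    refine ⟨k, hk, ψ, fun t => by rw [hψ]; exact (φ _).2, ?_⟩
    rwa [mul_one, hc, smul_smul, mul_inv_cancel₀ hk0.ne', one_smul] at h'
  · rintro ⟨k, hk, φ, hφ, h⟩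
    exact mem_tangentFields_of_hasLeadingCoeff hφ hk one_pos (by rwa [one_smul])

/-- The vector fields tangent to a group of diffeomorphisms form a Lie algebra. -/
def tangentLieSubalgebra (G : Subgroup F.diffGroup) : LieSubalgebra ℝ F.VField where
  carrier := F.tangentFields G
  zero_mem' := mem_tangentFields_iff.2 ⟨1, le_rfl, 1, fun _ => G.one_mem, HasLeadingCoeff.one⟩
  add_mem' := by
    intro ξ η hξ hη
    obtain ⟨k, hk, φ, hφ, h⟩ := mem_tangentFields_iff.1 hξ
    obtain ⟨l, hl, ψ, hψ, h'⟩ := mem_tangentFields_iff.1 hη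
    -- The orders `k` and `l` are both raised to `k * l`, by the substitutions `t ^ l` and `t ^ k`,
    -- so that the leading terms can be added.
    obtain ⟨φ', e, h⟩ := h.comp_mul_pow hk hl 1
    obtain ⟨ψ', e', h'⟩ := h'.comp_mul_pow hl hk 1
    rw [one_pow, one_smul] at h h'
    rw [mul_comm l k] at h'
    refine mem_tangentFields_iff.2 ⟨k * l, Nat.mul_pos hk hl, φ' * ψ', fun t => ?_,
      h.mul (Nat.mul_pos hk hl) h'⟩
    exact G.mul_mem (by rw [e]; exact hφ _) (by rw [e']; exact hψ _)
  smul_mem' := by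
    intro a ξ hξ
    obtain ⟨k, hk, φ, hφ, h⟩ := mem_tangentFields_iff.1 hξ
    rcases lt_trichotomy a 0 with ha | rfl | ha
    -- The sign comes from the inverse curve: when `k` is even, no rescaling of time can reverse it.
    · refine mem_tangentFields_of_hasLeadingCoeff (φ := φ⁻¹) (fun t => G.inv_mem (hφ t)) hk
        (inv_pos.2 (neg_pos.2 ha)) ?_
      have e : (-a)⁻¹ • ((a • ξ : F.VField) : F.smoothFun →ₗ[ℝ] F.smoothFun) =
          -(ξ : F.smoothFun →ₗ[ℝ] F.smoothFun) := by
        ext f v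
        show (-a)⁻¹ * (a * (ξ f).1 v) = -(ξ f).1 v
        rw [inv_neg, neg_mul, inv_mul_cancel_left₀ ha.ne]
      rw [e]
      exact h.inv hk
    · rw [zero_smul]
      exact mem_tangentFields_iff.2 ⟨1, le_rfl, 1, fun _ => G.one_mem, HasLeadingCoeff.one⟩
    · refine mem_tangentFields_of_hasLeadingCoeff hφ hk (inv_pos.2 ha) ?_
      rwa [Derivation.coe_smul_linearMap, smul_smul, inv_mul_cancel₀ ha.ne', one_smul]
  lie_mem' := by
    intro ξ η hξ hη
    obtain ⟨k, hk, φ, hφ, h⟩ := mem_tangentFields_iff.1 hξ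
    obtain ⟨l, hl, ψ, hψ, h'⟩ := mem_tangentFields_iff.1 hη
    refine mem_tangentFields_iff.2 ⟨k + l, by omega, ψ * φ * ψ⁻¹ * φ⁻¹, fun t => ?_, ?_⟩
    · exact G.mul_mem (G.mul_mem (G.mul_mem (hψ t) (hφ t)) (G.inv_mem (hψ t))) (G.inv_mem (hφ t))
    · exact h.commutator hk hl h'

end FinslerMetric

/-! ### The spray and the connection of a Finsler metric on an open set of a vector space -/

section LocalFinsler

variable {E : Type*} [NormedAddCommGroup E] [NormedSpace ℝ E]

/-- `L` is (the square of the norm of) a Finsler metric on the open set `U` of `E`. -/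
structure IsLocalFinsler (U : Set E) (L : E × E → ℝ) : Prop where
  isOpen : IsOpen U
  smooth : ContDiffOn ℝ ∞ L (U ×ˢ {0}ᶜ)
  homogeneous : ∀ x ∈ U, ∀ y ≠ 0, ∀ c : ℝ, 0 < c → L (x, c • y) = c ^ 2 * L (x, y)
  posDef : ∀ x ∈ U, ∀ y ≠ 0, ∀ u ≠ 0, 0 < fderiv ℝ (fderiv ℝ L) (x, y) (0, u) (0, u)

/-- The second derivative of `L` in the direction of the fibres. -/
def vertHess (L : E × E → ℝ) (z : E × E) : E →L[ℝ] E →L[ℝ] ℝ :=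
  ((ContinuousLinearMap.compL ℝ E (E × E) ℝ).flip (ContinuousLinearMap.inr ℝ E E)).comp
    ((fderiv ℝ (fderiv ℝ L) z).comp (ContinuousLinearMap.inr ℝ E E))

theorem vertHess_apply (L : E × E → ℝ) (z : E × E) (w w' : E) :
    vertHess L z w w' = fderiv ℝ (fderiv ℝ L) z (0, w) (0, w') := rfl

/-- The right-hand side of the equation for the geodesic coefficients. -/
def sprayRHS (L : E × E → ℝ) (z : E × E) : E →L[ℝ] ℝ :=
  (2⁻¹ : ℝ) • ((fderiv ℝ (fderiv ℝ L) z (z.2, 0)).comp (ContinuousLinearMap.inr ℝ E E) -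
    (fderiv ℝ L z).comp (ContinuousLinearMap.inl ℝ E E))

theorem sprayRHS_apply (L : E × E → ℝ) (z : E × E) (w : E) : sprayRHS L z w =
    2⁻¹ * (fderiv ℝ (fderiv ℝ L) z (z.2, 0) (0, w) - fderiv ℝ L z (w, 0)) := rfl

/-- The vector of the geodesic coefficients. -/
def sprayCoeff (L : E × E → ℝ) (z : E × E) : E :=
  (vertHess L z).inverse (sprayRHS L z)

namespace IsLocalFinsler

variable {U : Set E} {L : E × E → ℝ} (hL : IsLocalFinsler U L)
include hL

theorem isOpen_domain : IsOpen (U ×ˢ ({0}ᶜ : Set E)) := hL.isOpen.prod isOpen_compl_singleton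

theorem contDiffAt {z : E × E} (hz : z ∈ U ×ˢ ({0}ᶜ : Set E)) : ContDiffAt ℝ ∞ L z :=
  hL.smooth.contDiffAt (hL.isOpen_domain.mem_nhds hz)

theorem contDiffAt_fderiv {z : E × E} (hz : z ∈ U ×ˢ ({0}ᶜ : Set E)) :
    ContDiffAt ℝ ∞ (fderiv ℝ L) z := (hL.contDiffAt hz).fderiv_right (by simp)

theorem contDiffAt_fderiv_fderiv {z : E × E} (hz : z ∈ U ×ˢ ({0}ᶜ : Set E)) :
    ContDiffAt ℝ ∞ (fderiv ℝ (fderiv ℝ L)) z := (hL.contDiffAt_fderiv hz).fderiv_right (by simp)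

theorem hasFDerivAt {z : E × E} (hz : z ∈ U ×ˢ ({0}ᶜ : Set E)) :
    HasFDerivAt L (fderiv ℝ L z) z :=
  ((hL.contDiffAt hz).differentiableAt (by simp)).hasFDerivAt

theorem hasFDerivAt_fderiv {z : E × E} (hz : z ∈ U ×ˢ ({0}ᶜ : Set E)) :
    HasFDerivAt (fderiv ℝ L) (fderiv ℝ (fderiv ℝ L) z) z :=
  ((hL.contDiffAt_fderiv hz).differentiableAt (by simp)).hasFDerivAt

theorem symm {z : E × E} (hz : z ∈ U ×ˢ ({0}ᶜ : Set E)) (a b : E × E) :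
    fderiv ℝ (fderiv ℝ L) z a b = fderiv ℝ (fderiv ℝ L) z b a :=
  ((hL.contDiffAt hz).isSymmSndFDerivAt (by simp; exact ENat.LEInfty.out)).eq a b

theorem euler {z : E × E} (hz : z ∈ U ×ˢ ({0}ᶜ : Set E)) : fderiv ℝ L z (0, z.2) = 2 * L z := by
  have h1 : HasDerivAt (fun c : ℝ => (z.1, c • z.2)) ((0 : E), z.2) 1 := by
    refine (hasDerivAt_const _ _).prodMk ?_
    simpa using (hasDerivAt_id (1 : ℝ)).smul_const z.2
  have hz' : (z.1, (1 : ℝ) • z.2) = z := by simp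
  have h2 : HasDerivAt (fun c : ℝ => L (z.1, c • z.2)) (fderiv ℝ L z (0, z.2)) 1 := by
    refine HasFDerivAt.comp_hasDerivAt (l := L) (f := fun c : ℝ => (z.1, c • z.2)) 1 ?_ h1
    rw [hz']
    exact hL.hasFDerivAt hz
  have h3 : HasDerivAt (fun c : ℝ => c ^ 2 * L z) (2 * L z) 1 := by
    simpa using (hasDerivAt_pow 2 (1 : ℝ)).mul_const (L z)
  refine h2.unique (h3.congr_of_eventuallyEq ?_)
  filter_upwards [lt_mem_nhds (zero_lt_one' ℝ)] with c hc
  exact hL.homogeneous z.1 hz.1 z.2 hz.2 c hc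

/-- Euler's relation for degree two, differentiated in the direction `(u, w)`. -/
theorem euler_fderiv {z : E × E} (hz : z ∈ U ×ˢ ({0}ᶜ : Set E)) (u w : E) :
    fderiv ℝ (fderiv ℝ L) z (u, w) (0, z.2) = 2 * fderiv ℝ L z (u, 0) + fderiv ℝ L z (0, w) := by
  have h1 : HasFDerivAt (fun z => fderiv ℝ L z (0, z.2)) _ z :=
    (hL.hasFDerivAt_fderiv hz).clm_apply
      ((ContinuousLinearMap.inr ℝ E E).comp (ContinuousLinearMap.snd ℝ E E)).hasFDerivAt
  have h2 : HasFDerivAt (fun z => 2 * L z) _ z := (hL.hasFDerivAt hz).const_mul 2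
  have h3 : (fun z => fderiv ℝ L z (0, z.2)) =ᶠ[nhds z] fun z => 2 * L z := by
    filter_upwards [hL.isOpen_domain.mem_nhds hz] with z hz using hL.euler hz
  have h4 := congrArg (fun T : E × E →L[ℝ] ℝ => T (u, w)) (h1.unique (h2.congr_of_eventuallyEq h3))
  simp only [add_apply, ContinuousLinearMap.comp_apply,
    ContinuousLinearMap.flip_apply, ContinuousLinearMap.coe_snd', ContinuousLinearMap.inr_apply,
    smul_apply, smul_eq_mul] at h4
  have h5 : fderiv ℝ L z (u, w) = fderiv ℝ L z (u, 0) + fderiv ℝ L z (0, w) := by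
    rw [← map_add]; simp
  linarith

variable [FiniteDimensional ℝ E]

/-- Positive definiteness gives injectivity, and the dual space has the same finite dimension. Hence
the equation `vertHess L z G = sprayRHS L z` determines `G`. -/
theorem isInvertible {z : E × E} (hz : z ∈ U ×ˢ ({0}ᶜ : Set E)) :
    (vertHess L z).IsInvertible := by
  have hinj : Function.Injective (vertHess L z).toLinearMap := by
    rw [injective_iff_map_eq_zero]
    intro u hu
    by_contra hne
    have h1 := hL.posDef z.1 hz.1 z.2 hz.2 u hne
    have h2 : vertHess L z u u = 0 := by
      have : vertHess L z u = 0 := hu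
      rw [this]; rfl
    rw [vertHess_apply] at h2
    exact h1.ne' h2
  have hd : Module.finrank ℝ E = Module.finrank ℝ (E →L[ℝ] ℝ) := by
    rw [← (LinearMap.toContinuousLinearMap : (E →ₗ[ℝ] ℝ) ≃ₗ[ℝ] E →L[ℝ] ℝ).finrank_eq]
    exact Subspace.dual_finrank_eq.symm
  refine ⟨(LinearEquiv.ofInjectiveOfFinrankEq _ hinj hd).toContinuousLinearEquiv, ?_⟩
  ext u w
  rfl

theorem vertHess_sprayCoeff {z : E × E} (hz : z ∈ U ×ˢ ({0}ᶜ : Set E)) :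
    vertHess L z (sprayCoeff L z) = sprayRHS L z := by
  obtain ⟨e, he⟩ := hL.isInvertible hz
  rw [sprayCoeff, ← he, ContinuousLinearMap.inverse_equiv]
  exact e.apply_symm_apply _

theorem eq_sprayCoeff {z : E × E} (hz : z ∈ U ×ˢ ({0}ᶜ : Set E)) {a : E}
    (h : ∀ w, vertHess L z a w = sprayRHS L z w) : a = sprayCoeff L z := by
  obtain ⟨e, he⟩ := hL.isInvertible hz
  have : vertHess L z a = sprayRHS L z := ContinuousLinearMap.ext h
  rw [sprayCoeff, ← this, ← he, ContinuousLinearMap.inverse_equiv]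
  exact (e.symm_apply_apply _).symm

/-- Inversion is smooth at invertible operators, and both ingredients of the spray are built from
derivatives of `L`. -/
theorem contDiffAt_sprayCoeff {z : E × E} (hz : z ∈ U ×ˢ ({0}ᶜ : Set E)) :
    ContDiffAt ℝ ∞ (sprayCoeff L) z := by
  obtain ⟨e, he⟩ := hL.isInvertible hz
  have h2 := hL.contDiffAt_fderiv_fderiv hz
  have h1 := hL.contDiffAt_fderiv hz
  have hA : ContDiffAt ℝ ∞ (vertHess L) z := by
    have h3 : ContDiffAt ℝ ∞ (fun z => (fderiv ℝ (fderiv ℝ L) z).comp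
      (ContinuousLinearMap.inr ℝ E E)) z := h2.clm_comp contDiffAt_const
    have h4 : ContDiffAt ℝ ∞ (fun _ : E × E => (ContinuousLinearMap.compL ℝ E (E × E) ℝ).flip
      (ContinuousLinearMap.inr ℝ E E)) z := contDiffAt_const
    exact h4.clm_comp h3
  have hc : ContDiffAt ℝ ∞ (sprayRHS L) z := by
    have h3 : ContDiffAt ℝ ∞ (fun z : E × E => (z.2, (0 : E))) z :=
      contDiffAt_snd.prodMk contDiffAt_const
    have h4 : ContDiffAt ℝ ∞ (fun z : E × E => (fderiv ℝ (fderiv ℝ L) z (z.2, 0)).comp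
        (ContinuousLinearMap.inr ℝ E E)) z := (h2.clm_apply h3).clm_comp contDiffAt_const
    have h5 : ContDiffAt ℝ ∞ (fun z : E × E => (fderiv ℝ L z).comp
        (ContinuousLinearMap.inl ℝ E E)) z := h1.clm_comp contDiffAt_const
    exact (h4.sub h5).const_smul (2⁻¹ : ℝ)
  have hi : ContDiffAt ℝ ∞ ContinuousLinearMap.inverse (vertHess L z) := by
    rw [← he]
    exact contDiffAt_map_inverse e
  exact (hi.comp z hA).clm_apply hc

theorem hasFDerivAt_sprayCoeff {z : E × E} (hz : z ∈ U ×ˢ ({0}ᶜ : Set E)) :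
    HasFDerivAt (sprayCoeff L) (fderiv ℝ (sprayCoeff L) z) z :=
  ((hL.contDiffAt_sprayCoeff hz).differentiableAt (by simp)).hasFDerivAt

/-- The norm is invariant under the geodesic spray. -/
theorem fderiv_spray {z : E × E} (hz : z ∈ U ×ˢ ({0}ᶜ : Set E)) :
    2 * fderiv ℝ L z (0, sprayCoeff L z) = fderiv ℝ L z (z.2, 0) := by
  -- The equation defining the spray is evaluated on `z.2` itself, where Euler's relations reduce
  -- second derivatives of `L` to first ones.
  have h := congrArg (fun T : E →L[ℝ] ℝ => T z.2) (hL.vertHess_sprayCoeff hz)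
  simp only [vertHess_apply, sprayRHS_apply] at h
  rw [hL.euler_fderiv hz, hL.euler_fderiv hz] at h
  have h0 : fderiv ℝ L z ((0 : E), (0 : E)) = 0 := (fderiv ℝ L z).map_zero
  rw [h0] at h
  linarith

/-- The norm is invariant under parallel translation. -/
theorem fderiv_horizontal {z : E × E} (hz : z ∈ U ×ˢ ({0}ᶜ : Set E)) (w : E) :
    fderiv ℝ L z (w, - fderiv ℝ (sprayCoeff L) z (0, w)) = 0 := by
  -- The invariance under the spray is differentiated in the vertical direction `(0, w)`. The second
  -- derivatives of `L` that appear are those in the defining equation of the spray evaluated on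
  -- `w`, so they cancel.
  have h1 : HasFDerivAt (fun z => 2 * fderiv ℝ L z (0, sprayCoeff L z)) _ z :=
    ((hL.hasFDerivAt_fderiv hz).clm_apply ((ContinuousLinearMap.inr ℝ E E).hasFDerivAt.comp z
      (hL.hasFDerivAt_sprayCoeff hz))).const_mul 2
  have h2 : HasFDerivAt (fun z => fderiv ℝ L z (z.2, 0)) _ z :=
    (hL.hasFDerivAt_fderiv hz).clm_apply
      ((ContinuousLinearMap.inl ℝ E E).comp (ContinuousLinearMap.snd ℝ E E)).hasFDerivAt
  have h3 : (fun z => 2 * fderiv ℝ L z (0, sprayCoeff L z)) =ᶠ[nhds z]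
      fun z => fderiv ℝ L z (z.2, 0) := by
    filter_upwards [hL.isOpen_domain.mem_nhds hz] with z hz using hL.fderiv_spray hz
  have h4 := congrArg (fun T : E × E →L[ℝ] ℝ => T (0, w)) (h1.unique (h2.congr_of_eventuallyEq h3))
  simp only [add_apply, ContinuousLinearMap.comp_apply,
    ContinuousLinearMap.flip_apply, ContinuousLinearMap.coe_snd', ContinuousLinearMap.inr_apply,
    ContinuousLinearMap.inl_apply, smul_apply, smul_eq_mul,
    Function.comp_apply] at h4
  have h := congrArg (fun T : E →L[ℝ] ℝ => T w) (hL.vertHess_sprayCoeff hz)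
  simp only [vertHess_apply, sprayRHS_apply] at h
  rw [hL.symm hz (z.2, 0), hL.symm hz _ (0, w)] at h
  have h5 : fderiv ℝ L z (w, - fderiv ℝ (sprayCoeff L) z (0, w)) =
      fderiv ℝ L z (w, 0) - fderiv ℝ L z (0, fderiv ℝ (sprayCoeff L) z (0, w)) := by
    rw [← map_sub]; simp
  linarith

end IsLocalFinsler

/-- The map of tangent bundles induced by `φ`. -/
def tangentLift (φ : E → E) (z : E × E) : E × E := (φ z.1, fderiv ℝ φ z.1 z.2)

theorem hasFDerivAt_fderiv_apply {φ : E → E} {z : E × E} (hφ : ContDiffAt ℝ ∞ φ z.1)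
    {f : E × E → E} {f' : E × E →L[ℝ] E} (hf : HasFDerivAt f f' z) :
    HasFDerivAt (fun z : E × E => fderiv ℝ φ z.1 (f z))
      ((fderiv ℝ φ z.1).comp f' + ((fderiv ℝ (fderiv ℝ φ) z.1).flip (f z)).comp
        (ContinuousLinearMap.fst ℝ E E)) z := by
  have h1 : HasFDerivAt (fderiv ℝ φ) (fderiv ℝ (fderiv ℝ φ) z.1) z.1 :=
    (((hφ.fderiv_right (m := ∞) (by simp)).differentiableAt (by simp))).hasFDerivAt
  have h2 : HasFDerivAt (fun z : E × E => fderiv ℝ φ z.1) _ z := h1.comp z hasFDerivAt_fst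
  exact h2.clm_apply hf

theorem hasFDerivAt_tangentLift {φ : E → E} {z : E × E} (hφ : ContDiffAt ℝ ∞ φ z.1) :
    HasFDerivAt (tangentLift φ) (((fderiv ℝ φ z.1).comp (ContinuousLinearMap.fst ℝ E E)).prod
      ((fderiv ℝ φ z.1).comp (ContinuousLinearMap.snd ℝ E E) +
        ((fderiv ℝ (fderiv ℝ φ) z.1).flip z.2).comp (ContinuousLinearMap.fst ℝ E E))) z := by
  refine HasFDerivAt.prodMk ?_ (hasFDerivAt_fderiv_apply hφ hasFDerivAt_snd)
  exact (hφ.differentiableAt (by simp)).hasFDerivAt.comp z hasFDerivAt_fst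

theorem fderiv_tangentLift {φ : E → E} {z : E × E} (hφ : ContDiffAt ℝ ∞ φ z.1) (u w : E) :
    fderiv ℝ (tangentLift φ) z (u, w) =
      (fderiv ℝ φ z.1 u, fderiv ℝ φ z.1 w + fderiv ℝ (fderiv ℝ φ) z.1 u z.2) := by
  rw [(hasFDerivAt_tangentLift hφ).fderiv]; rfl

variable [FiniteDimensional ℝ E]

section Transition

variable {U U' : Set E} {L L' : E × E → ℝ} {φ : E → E}

/-- The transformation law of a spray, with its correction by the second derivative of `φ`. By the
chain rule for `L = L' ∘ tangentLift φ`, the candidate satisfies the equation that characterizes the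
spray of `L'`; as the derivative of `φ` is onto, it is enough to test on vectors `fderiv ℝ φ z.1 w`.
-/
theorem sprayCoeff_tangentLift (hL : IsLocalFinsler U L) (hL' : IsLocalFinsler U' L')
    (hφ : ContDiffOn ℝ ∞ φ U) (hφU : MapsTo φ U U')
    (hφi : ∀ x ∈ U, Function.Bijective (fderiv ℝ φ x))
    (hLL : ∀ z ∈ U ×ˢ ({0}ᶜ : Set E), L' (tangentLift φ z) = L z) {z : E × E}
    (hz : z ∈ U ×ˢ ({0}ᶜ : Set E)) :
    (2 : ℝ) • sprayCoeff L' (tangentLift φ z) =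
      (2 : ℝ) • fderiv ℝ φ z.1 (sprayCoeff L z) - fderiv ℝ (fderiv ℝ φ) z.1 z.2 z.2 := by
  have hφa : ∀ {x}, x ∈ U → ContDiffAt ℝ ∞ φ x := fun hx =>
    hφ.contDiffAt (hL.isOpen.mem_nhds hx)
  have hmaps : ∀ {z : E × E}, z ∈ U ×ˢ ({0}ᶜ : Set E) → tangentLift φ z ∈ U' ×ˢ ({0}ᶜ : Set E) := by
    intro z hz
    refine ⟨hφU hz.1, fun h0 => hz.2 ?_⟩
    exact (hφi z.1 hz.1).1 (h0.trans (map_zero _).symm)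
  have h1 : ∀ {z : E × E}, z ∈ U ×ˢ ({0}ᶜ : Set E) → ∀ a,
      fderiv ℝ L z a = fderiv ℝ L' (tangentLift φ z) (fderiv ℝ (tangentLift φ) z a) := by
    intro z hz a
    have e : L =ᶠ[nhds z] L' ∘ tangentLift φ := by
      filter_upwards [hL.isOpen_domain.mem_nhds hz] with z hz using (hLL z hz).symm
    have := ((hL'.hasFDerivAt (hmaps hz)).comp z
      (hasFDerivAt_tangentLift (hφa hz.1)).differentiableAt.hasFDerivAt).congr_of_eventuallyEq e
    rw [this.fderiv]; rfl
  -- Only second derivatives with one vertical argument enter the spray equation. In a vertical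
  -- direction the derivative of `tangentLift φ` depends on the base point alone, which leaves just
  -- one correction term.
  have h2 : ∀ (w : E) (a : E × E), fderiv ℝ (fderiv ℝ L) z a (0, w) =
      fderiv ℝ (fderiv ℝ L') (tangentLift φ z) (fderiv ℝ (tangentLift φ) z a) (0, fderiv ℝ φ z.1 w) +
        fderiv ℝ L' (tangentLift φ z) (0, fderiv ℝ (fderiv ℝ φ) z.1 a.1 w) := by
    intro w a
    have e : (fun z => fderiv ℝ L z (0, w)) =ᶠ[nhds z]
        fun z => fderiv ℝ L' (tangentLift φ z) (0, fderiv ℝ φ z.1 w) := by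
      filter_upwards [hL.isOpen_domain.mem_nhds hz] with z hz
      rw [h1 hz, fderiv_tangentLift (hφa hz.1)]
      simp
    have d1 : HasFDerivAt (fun z => fderiv ℝ L z (0, w)) _ z :=
      (hL.hasFDerivAt_fderiv hz).clm_apply (hasFDerivAt_const ((0 : E), w) z)
    have d2 : HasFDerivAt (fun z => fderiv ℝ L' (tangentLift φ z) (0, fderiv ℝ φ z.1 w)) _ z :=
      ((hL'.hasFDerivAt_fderiv (hmaps hz)).comp z
        (hasFDerivAt_tangentLift (hφa hz.1)).differentiableAt.hasFDerivAt).clm_apply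
        ((ContinuousLinearMap.inr ℝ E E).hasFDerivAt.comp z
          (hasFDerivAt_fderiv_apply (hφa hz.1) (hasFDerivAt_const w z)))
    have := congrArg (fun T : E × E →L[ℝ] ℝ => T a) (d1.unique (d2.congr_of_eventuallyEq e))
    simpa [add_comm] using this
  have hsymm := fun a b => ((hφa hz.1).isSymmSndFDerivAt (by simp; exact ENat.LEInfty.out)).eq a b
  have key : fderiv ℝ φ z.1 (sprayCoeff L z) - (2⁻¹ : ℝ) • fderiv ℝ (fderiv ℝ φ) z.1 z.2 z.2 =
      sprayCoeff L' (tangentLift φ z) := by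
    refine hL'.eq_sprayCoeff (hmaps hz) fun w' => ?_
    obtain ⟨w, rfl⟩ := (hφi z.1 hz.1).2 w'
    have h := congrArg (fun T : E →L[ℝ] ℝ => T w) (hL.vertHess_sprayCoeff hz)
    simp only [vertHess_apply, sprayRHS_apply] at h ⊢
    rw [h2, h2, h1 hz, fderiv_tangentLift (hφa hz.1), fderiv_tangentLift (hφa hz.1),
      fderiv_tangentLift (hφa hz.1)] at h
    simp only [map_zero, zero_add, add_zero, zero_apply] at h
    rw [hsymm w z.2] at h
    set D := fderiv ℝ φ z.1
    set Q := fderiv ℝ (fderiv ℝ φ) z.1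
    set B := fderiv ℝ (fderiv ℝ L') (tangentLift φ z)
    set A := fderiv ℝ L' (tangentLift φ z)
    have e1 : A (D w, Q z.2 w) = A (D w, 0) + A (0, Q z.2 w) := by rw [← map_add]; simp
    have e2 : B (D z.2, Q z.2 z.2) = B (D z.2, 0) + B (0, Q z.2 z.2) := by rw [← map_add]; simp
    have e3 : B (0, D (sprayCoeff L z) - (2⁻¹ : ℝ) • Q z.2 z.2) =
        B (0, D (sprayCoeff L z)) - (2⁻¹ : ℝ) • B (0, Q z.2 z.2) := by
      rw [← B.map_smul, ← B.map_sub]; simp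
    have e4 : A ((0 : E), (0 : E)) = 0 := A.map_zero
    rw [e1, e2] at h
    rw [e3]
    show _ = 2⁻¹ * (B (D z.2, 0) (0, D w) - A (D w, 0))
    simp only [sub_apply, add_apply,
      smul_apply, smul_eq_mul] at h ⊢
    try rw [e4] at h
    linarith
  rw [← key, smul_sub, smul_smul, mul_inv_cancel₀ two_ne_zero, one_smul]

/-- Horizontal vectors are mapped to horizontal vectors. -/
theorem fderiv_tangentLift_horizontal (hL : IsLocalFinsler U L) (hL' : IsLocalFinsler U' L')
    (hφ : ContDiffOn ℝ ∞ φ U) (hφU : MapsTo φ U U')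
    (hφi : ∀ x ∈ U, Function.Bijective (fderiv ℝ φ x))
    (hLL : ∀ z ∈ U ×ˢ ({0}ᶜ : Set E), L' (tangentLift φ z) = L z) {z : E × E}
    (hz : z ∈ U ×ˢ ({0}ᶜ : Set E)) (u : E) :
    fderiv ℝ (tangentLift φ) z (u, - fderiv ℝ (sprayCoeff L) z (0, u)) =
      (fderiv ℝ φ z.1 u, - fderiv ℝ (sprayCoeff L') (tangentLift φ z) (0, fderiv ℝ φ z.1 u)) := by
  have hφz := hφ.contDiffAt (hL.isOpen.mem_nhds hz.1)
  have hmz : tangentLift φ z ∈ U' ×ˢ ({0}ᶜ : Set E) :=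
    ⟨hφU hz.1, fun h0 => hz.2 ((hφi z.1 hz.1).1 (h0.trans (map_zero _).symm))⟩
  rw [fderiv_tangentLift hφz]
  have e : (fun z => (2 : ℝ) • sprayCoeff L' (tangentLift φ z)) =ᶠ[nhds z] fun z =>
      (2 : ℝ) • fderiv ℝ φ z.1 (sprayCoeff L z) - fderiv ℝ (fderiv ℝ φ) z.1 z.2 z.2 := by
    filter_upwards [hL.isOpen_domain.mem_nhds hz] with z hz
    exact sprayCoeff_tangentLift hL hL' hφ hφU hφi hLL hz
  have d1 : HasFDerivAt (fun z => (2 : ℝ) • sprayCoeff L' (tangentLift φ z)) _ z :=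
    ((hL'.hasFDerivAt_sprayCoeff hmz).comp z
      (hasFDerivAt_tangentLift hφz).differentiableAt.hasFDerivAt).const_smul (2 : ℝ)
  have hQ : HasFDerivAt (fderiv ℝ (fderiv ℝ φ)) (fderiv ℝ (fderiv ℝ (fderiv ℝ φ)) z.1) z.1 :=
    ((((hφz.fderiv_right (m := ∞) (by simp)).fderiv_right (m := ∞) (by simp)).differentiableAt
      (by simp))).hasFDerivAt
  have hQ' : HasFDerivAt (fun z : E × E => fderiv ℝ (fderiv ℝ φ) z.1) _ z :=
    hQ.comp z hasFDerivAt_fst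
  have d2 : HasFDerivAt (fun z : E × E => (2 : ℝ) • fderiv ℝ φ z.1 (sprayCoeff L z) -
      fderiv ℝ (fderiv ℝ φ) z.1 z.2 z.2) _ z :=
    ((hasFDerivAt_fderiv_apply hφz (hL.hasFDerivAt_sprayCoeff hz)).const_smul (2 : ℝ)).sub
      ((hQ'.clm_apply hasFDerivAt_snd).clm_apply hasFDerivAt_snd)
  -- The transformation law is differentiated in the vertical direction `(0, u)`. The quadratic term
  -- yields the second derivative of `φ` twice, by symmetry, so the factor `2` drops out.
  have h := congrArg (fun T : E × E →L[ℝ] E => T (0, u)) (d1.unique (d2.congr_of_eventuallyEq e))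
  have hsymm := fun a b => (hφz.isSymmSndFDerivAt (by simp; exact ENat.LEInfty.out)).eq a b
  simp only [add_apply, sub_apply,
    ContinuousLinearMap.comp_apply, ContinuousLinearMap.flip_apply, ContinuousLinearMap.coe_snd',
    ContinuousLinearMap.coe_fst', smul_apply, fderiv_tangentLift hφz, map_zero,
    zero_apply, add_zero] at h
  rw [hsymm u z.2, ← two_smul ℝ (fderiv ℝ (fderiv ℝ φ) z.1 z.2 u), ← smul_sub] at h
  have h' := smul_right_injective E (two_ne_zero' ℝ) h
  rw [h', hsymm u z.2, map_neg]
  congr 1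
  abel

end Transition
end LocalFinsler

/-! ### Second derivatives along lines -/

section SecondDerivative

variable {E : Type*} [NormedAddCommGroup E] [NormedSpace ℝ E]

theorem hasDerivAt_comp_line {F : Type*} [NormedAddCommGroup F] [NormedSpace ℝ F] {f : E → F}
    {z : E} (hf : DifferentiableAt ℝ f z) (a : E) :
    HasDerivAt (fun s : ℝ => f (z + s • a)) (fderiv ℝ f z a) 0 := by
  have h1 : HasDerivAt (fun s : ℝ => z + s • a) a 0 := by
    simpa using ((hasDerivAt_id (0 : ℝ)).smul_const a).const_add z
  refine HasFDerivAt.comp_hasDerivAt (l := f) (f := fun s : ℝ => z + s • a) 0 ?_ h1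
  simpa using hf.hasFDerivAt

theorem deriv_deriv_line {L : E → ℝ} {z : E} (hL : ContDiffAt ℝ ∞ L z) (a b : E) :
    deriv (fun s : ℝ => deriv (fun t : ℝ => L (z + s • a + t • b)) 0) 0 =
      fderiv ℝ (fderiv ℝ L) z a b := by
  have h1 : ∀ᶠ x in nhds z, ContDiffAt ℝ 1 L x :=
    (hL.of_le (m := 1) (by simp)).eventually (by simp)
  have hc : Filter.Tendsto (fun s : ℝ => z + s • a) (nhds 0) (nhds z) := by
    have : Continuous fun s : ℝ => z + s • a := by fun_prop
    simpa using this.tendsto 0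
  have h2 : (fun s : ℝ => deriv (fun t : ℝ => L (z + s • a + t • b)) 0) =ᶠ[nhds 0]
      fun s => fderiv ℝ L (z + s • a) b := by
    filter_upwards [hc.eventually h1] with s hs
    exact (hasDerivAt_comp_line (hs.differentiableAt (by simp)) b).deriv
  rw [h2.deriv_eq]
  have h3 := hasDerivAt_comp_line
    ((hL.fderiv_right (m := ∞) (by simp)).differentiableAt (by simp)) a
  exact (h3.clm_apply (hasDerivAt_const 0 b)).deriv.trans (by simp)

end SecondDerivative

/-! ### The coordinate formulas for the spray and the connection -/

namespace FinslerMetric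

variable {n : ℕ} {M : Type*} [TopologicalSpace M]
  [ChartedSpace (EuclideanSpace ℝ (Fin n)) M] [IsManifold (𝓡 n) ∞ M] (F : FinslerMetric n M)

/-- The square of the Finsler norm in the chart of `TM` at `v₀`. -/
def localEnergy (v₀ : TangentBundle (𝓡 n) M)
    (z : EuclideanSpace ℝ (Fin n) × EuclideanSpace ℝ (Fin n)) : ℝ := F.localNorm v₀ z.1 z.2 ^ 2

theorem sum_coordVec (y : EuclideanSpace ℝ (Fin n)) : ∑ j, y j • coordVec n j = y := by
  ext i
  simp [Finset.sum_apply, Pi.single_apply]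

theorem map_eq_sum {G : Type*} [NormedAddCommGroup G] [NormedSpace ℝ G]
    (T : EuclideanSpace ℝ (Fin n) →L[ℝ] G) (y : EuclideanSpace ℝ (Fin n)) :
    T y = ∑ j, y j • T (coordVec n j) := by
  conv_lhs => rw [← sum_coordVec y]
  simp

section Coordinates

variable {F} {v₀ : TangentBundle (𝓡 n) M} {U : Set (EuclideanSpace ℝ (Fin n))}
  (hL : IsLocalFinsler U (F.localEnergy v₀))
  {z : EuclideanSpace ℝ (Fin n) × EuclideanSpace ℝ (Fin n)} (hz : z ∈ U ×ˢ ({0}ᶜ : Set _))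
include hL hz

theorem localMetric_eq (i j : Fin n) : F.localMetric v₀ z.1 z.2 i j =
    (1 / 2 : ℝ) * fderiv ℝ (fderiv ℝ (F.localEnergy v₀)) z (0, coordVec n i) (0, coordVec n j) := by
  rw [← deriv_deriv_line (hL.contDiffAt hz)]
  simp only [localMetric, localEnergy, Prod.fst_add, Prod.snd_add, Prod.smul_fst, Prod.smul_snd,
    smul_zero, add_zero]

theorem hasDerivAt_localMetric (i j k : Fin n) :
    HasDerivAt (fun s : ℝ => F.localMetric v₀ (z.1 + s • coordVec n k) z.2 i j)
      ((1 / 2 : ℝ) * fderiv ℝ (fderiv ℝ (fderiv ℝ (F.localEnergy v₀))) z (coordVec n k, 0)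
        (0, coordVec n i) (0, coordVec n j)) 0 := by
  have h1 := hasDerivAt_comp_line
    ((hL.contDiffAt_fderiv_fderiv hz).differentiableAt (by simp)) (coordVec n k, 0)
  have h2 := ((h1.clm_apply (hasDerivAt_const 0 (0, coordVec n i))).clm_apply
    (hasDerivAt_const 0 (0, coordVec n j))).const_mul (1 / 2 : ℝ)
  have hc : Filter.Tendsto (fun s : ℝ => z + s • (coordVec n k, 0)) (nhds 0) (nhds z) := by
    have : Continuous fun s : ℝ => z + s • (coordVec n k, (0 : EuclideanSpace ℝ (Fin n))) := by
      fun_prop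
    simpa using this.tendsto 0
  have h3 : (fun s : ℝ => F.localMetric v₀ (z.1 + s • coordVec n k) z.2 i j) =ᶠ[nhds 0]
      fun s => (1 / 2 : ℝ) * fderiv ℝ (fderiv ℝ (F.localEnergy v₀)) (z + s • (coordVec n k, 0))
        (0, coordVec n i) (0, coordVec n j) := by
    filter_upwards [hc.eventually (hL.isOpen_domain.mem_nhds hz)] with s hs
    rw [← localMetric_eq hL hs]
    simp
  refine (h2.congr_of_eventuallyEq h3).congr_deriv ?_
  simp

theorem isUnit_localMetric : IsUnit (F.localMetric v₀ z.1 z.2) := by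
  rw [← Matrix.mulVec_injective_iff_isUnit]
  have : Function.Injective (Matrix.mulVecLin (F.localMetric v₀ z.1 z.2)) := by
    rw [injective_iff_map_eq_zero]
    intro u hu
    by_contra hne
    have h1 := hL.posDef z.1 hz.1 z.2 hz.2 (WithLp.toLp 2 u) (by simpa using hne)
    have h2 : ∀ i, vertHess (F.localEnergy v₀) z (coordVec n i) (WithLp.toLp 2 u) = 0 := by
      intro i
      rw [map_eq_sum]
      have h3 := congrFun hu i
      simp only [Matrix.mulVecLin_apply, Matrix.mulVec, dotProduct, localMetric_eq hL hz] at h3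
      have h4 : (1 / 2 : ℝ) * ∑ j, u j • vertHess (F.localEnergy v₀) z (coordVec n i)
          (coordVec n j) = 0 := by
        rw [Finset.mul_sum]
        refine Eq.trans (Finset.sum_congr rfl fun j _ => ?_) h3
        rw [vertHess_apply, smul_eq_mul]
        ring
      simpa using h4
    have h3 : vertHess (F.localEnergy v₀) z (WithLp.toLp 2 u) (WithLp.toLp 2 u) = 0 := by
      rw [map_eq_sum (vertHess (F.localEnergy v₀) z) (WithLp.toLp 2 u)]
      simp [h2]
    rw [vertHess_apply] at h3
    exact h1.ne' h3
  exact this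

/-- By Euler's relation `g_{jl} y^j = ½ ∂L/∂y^l`, where `L = 𝓕²`. Differentiating this in `x^k`
trades the third derivatives of `L` for second ones. -/
theorem sum_deriv_localMetric (k l : Fin n) :
    ∑ j, deriv (fun s : ℝ => F.localMetric v₀ (z.1 + s • coordVec n k) z.2 j l) 0 * z.2 j =
      (1 / 2 : ℝ) * fderiv ℝ (fderiv ℝ (F.localEnergy v₀)) z (coordVec n k, 0) (0, coordVec n l) := by
  have h0 := (hL.contDiffAt_fderiv_fderiv hz).differentiableAt (n := ∞) (by simp)
  have h1 : HasFDerivAt (fun z => fderiv ℝ (fderiv ℝ (F.localEnergy v₀)) z (0, z.2)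
      (0, coordVec n l)) _ z :=
    (h0.hasFDerivAt.clm_apply ((ContinuousLinearMap.inr ℝ _ _).comp
      (ContinuousLinearMap.snd ℝ _ _)).hasFDerivAt).clm_apply
        (hasFDerivAt_const ((0 : EuclideanSpace ℝ (Fin n)), coordVec n l) z)
  have h2 : HasFDerivAt (fun z => fderiv ℝ (F.localEnergy v₀) z (0, coordVec n l)) _ z :=
    (hL.hasFDerivAt_fderiv hz).clm_apply
      (hasFDerivAt_const ((0 : EuclideanSpace ℝ (Fin n)), coordVec n l) z)
  have h3 : (fun z => fderiv ℝ (fderiv ℝ (F.localEnergy v₀)) z (0, z.2) (0, coordVec n l))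
      =ᶠ[nhds z] fun z => fderiv ℝ (F.localEnergy v₀) z (0, coordVec n l) := by
    filter_upwards [hL.isOpen_domain.mem_nhds hz] with z hz
    rw [hL.symm hz, hL.euler_fderiv hz]
    have e4 : fderiv ℝ (F.localEnergy v₀) z ((0 : EuclideanSpace ℝ (Fin n)),
      (0 : EuclideanSpace ℝ (Fin n))) = 0 := ContinuousLinearMap.map_zero _
    rw [e4]; ring
  have h4 := congrArg (fun T : EuclideanSpace ℝ (Fin n) × EuclideanSpace ℝ (Fin n) →L[ℝ] ℝ =>
    T (coordVec n k, 0)) (h1.unique (h2.congr_of_eventuallyEq h3))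
  have h5 : fderiv ℝ (fderiv ℝ (fderiv ℝ (F.localEnergy v₀))) z (coordVec n k, 0) (0, z.2)
      (0, coordVec n l) = fderiv ℝ (fderiv ℝ (F.localEnergy v₀)) z (coordVec n k, 0)
        (0, coordVec n l) := by
    have h0 : fderiv ℝ (fderiv ℝ (F.localEnergy v₀)) z ((0 : EuclideanSpace ℝ (Fin n)),
      (0 : EuclideanSpace ℝ (Fin n))) = 0 := ContinuousLinearMap.map_zero _
    simpa [h0] using h4
  rw [← h5, Finset.sum_congr rfl fun j _ => by
    rw [(hasDerivAt_localMetric hL hz j l k).deriv]]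
  have h6 := map_eq_sum (((fderiv ℝ (fderiv ℝ (fderiv ℝ (F.localEnergy v₀))) z
    (coordVec n k, 0)).flip (0, coordVec n l)).comp (ContinuousLinearMap.inr ℝ _ _)) z.2
  have h7 : fderiv ℝ (fderiv ℝ (fderiv ℝ (F.localEnergy v₀))) z (coordVec n k, 0) (0, z.2)
      (0, coordVec n l) = ∑ j, z.2 j • fderiv ℝ (fderiv ℝ (fderiv ℝ (F.localEnergy v₀))) z
        (coordVec n k, 0) (0, coordVec n j) (0, coordVec n l) := h6
  rw [h7, Finset.mul_sum]
  refine Finset.sum_congr rfl fun j _ => ?_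
  rw [smul_eq_mul]; ring

/-- Contraction with `y` turns the bracket in the coordinate formula into `2 sprayRHS`, by Euler's
relation. Since the vertical Hessian of `L = 𝓕²` is `2 g`, this is `4 g G` for the spray vector `G`,
and `g⁻¹ / 4` recovers `G`. -/
theorem geodesicCoeff_eq (i : Fin n) :
    F.geodesicCoeff v₀ i z.1 z.2 = sprayCoeff (F.localEnergy v₀) z i := by
  set L := F.localEnergy v₀ with hLdef
  set g := F.localMetric v₀ z.1 z.2 with hg
  have h1 : ∀ l, ∑ j, ∑ k,
      (2 * deriv (fun s : ℝ => F.localMetric v₀ (z.1 + s • coordVec n k) z.2 j l) 0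
      - deriv (fun s : ℝ => F.localMetric v₀ (z.1 + s • coordVec n l) z.2 j k) 0) * z.2 j * z.2 k =
      2 * sprayRHS L z (coordVec n l) := by
    intro l
    have e1 : ∑ k, z.2 k * ∑ j,
        deriv (fun s : ℝ => F.localMetric v₀ (z.1 + s • coordVec n k) z.2 j l) 0 * z.2 j =
        (1 / 2 : ℝ) * fderiv ℝ (fderiv ℝ L) z (z.2, 0) (0, coordVec n l) := by
      rw [Finset.sum_congr rfl fun k _ => by rw [sum_deriv_localMetric hL hz k l]]
      have h6 := map_eq_sum (((fderiv ℝ (fderiv ℝ L) z).flip (0, coordVec n l)).comp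
        (ContinuousLinearMap.inl ℝ _ _)) z.2
      have h7 : fderiv ℝ (fderiv ℝ L) z (z.2, 0) (0, coordVec n l) = ∑ k, z.2 k •
        fderiv ℝ (fderiv ℝ L) z (coordVec n k, 0) (0, coordVec n l) := h6
      rw [h7, Finset.mul_sum]
      refine Finset.sum_congr rfl fun j _ => ?_
      rw [smul_eq_mul]; ring
    have e2 : ∑ k, z.2 k * ∑ j,
        deriv (fun s : ℝ => F.localMetric v₀ (z.1 + s • coordVec n l) z.2 j k) 0 * z.2 j =
        fderiv ℝ L z (coordVec n l, 0) := by
      rw [Finset.sum_congr rfl fun k _ => by rw [sum_deriv_localMetric hL hz l k]]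
      have h6 := map_eq_sum ((fderiv ℝ (fderiv ℝ L) z (coordVec n l, 0)).comp
        (ContinuousLinearMap.inr ℝ _ _)) z.2
      have h7 : fderiv ℝ (fderiv ℝ L) z (coordVec n l, 0) (0, z.2) = ∑ k, z.2 k •
        fderiv ℝ (fderiv ℝ L) z (coordVec n l, 0) (0, coordVec n k) := h6
      have e4 : fderiv ℝ L z ((0 : EuclideanSpace ℝ (Fin n)),
        (0 : EuclideanSpace ℝ (Fin n))) = 0 := ContinuousLinearMap.map_zero _
      rw [hL.euler_fderiv hz, e4, add_zero] at h7
      have h8 : fderiv ℝ L z (coordVec n l, 0) = (1 / 2 : ℝ) * ∑ k, z.2 k •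
          fderiv ℝ (fderiv ℝ L) z (coordVec n l, 0) (0, coordVec n k) := by
        rw [← h7]; ring
      rw [h8, Finset.mul_sum]
      refine Finset.sum_congr rfl fun j _ => ?_
      rw [smul_eq_mul]; ring
    rw [sprayRHS_apply, Finset.sum_comm]
    have e3 : 2 * (2⁻¹ * (fderiv ℝ (fderiv ℝ L) z (z.2, 0) (0, coordVec n l) -
        fderiv ℝ L z (coordVec n l, 0))) =
        2 * ((1 / 2 : ℝ) * fderiv ℝ (fderiv ℝ L) z (z.2, 0) (0, coordVec n l)) -
        fderiv ℝ L z (coordVec n l, 0) := by ring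
    rw [e3, ← e1, ← e2, Finset.mul_sum, ← Finset.sum_sub_distrib]
    refine Finset.sum_congr rfl fun k _ => ?_
    rw [Finset.mul_sum, Finset.mul_sum, Finset.mul_sum, ← Finset.sum_sub_distrib]
    refine Finset.sum_congr rfl fun j _ => ?_
    ring
  have h2 : ∀ l, sprayRHS L z (coordVec n l) = 2 * (g.mulVec (sprayCoeff L z).ofLp) l := by
    intro l
    rw [← hL.vertHess_sprayCoeff hz, vertHess_apply, hL.symm hz]
    have h6 := map_eq_sum ((fderiv ℝ (fderiv ℝ L) z (0, coordVec n l)).comp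
      (ContinuousLinearMap.inr ℝ _ _)) (sprayCoeff L z)
    refine Eq.trans h6 ?_
    rw [Matrix.mulVec, dotProduct, Finset.mul_sum]
    refine Finset.sum_congr rfl fun j _ => ?_
    rw [hg, localMetric_eq hL hz, smul_eq_mul]
    show _ * fderiv ℝ (fderiv ℝ L) z (0, coordVec n l) (0, coordVec n j) = _
    ring
  have h3 : F.geodesicCoeff v₀ i z.1 z.2 =
      (1 / 4 : ℝ) * ∑ l, g⁻¹ i l * (2 * (2 * (g.mulVec (sprayCoeff L z).ofLp) l)) := by
    rw [geodesicCoeff]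
    congr 1
    refine Finset.sum_congr rfl fun l _ => ?_
    rw [← h2 l, ← h1 l, Finset.mul_sum]
    refine Finset.sum_congr rfl fun j _ => ?_
    rw [Finset.mul_sum]
    refine Finset.sum_congr rfl fun k _ => ?_
    ring
  have h4 : (g⁻¹.mulVec (g.mulVec (sprayCoeff L z).ofLp)) i = sprayCoeff L z i := by
    rw [Matrix.mulVec_mulVec, Matrix.nonsing_inv_mul _
      ((Matrix.isUnit_iff_isUnit_det _).1 (isUnit_localMetric hL hz)), Matrix.one_mulVec]
  rw [h3, ← h4]
  conv_rhs => rw [Matrix.mulVec, dotProduct]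
  rw [Finset.mul_sum]
  refine Finset.sum_congr rfl fun l _ => ?_
  ring

theorem connCoeff_eq (i j : Fin n) : F.connCoeff v₀ i j z.1 z.2 =
    fderiv ℝ (sprayCoeff (F.localEnergy v₀)) z (0, coordVec n j) i := by
  have h1 := hasDerivAt_comp_line
    ((hL.contDiffAt_sprayCoeff hz).differentiableAt (by simp)) (0, coordVec n j)
  have h2 := ((EuclideanSpace.proj i : EuclideanSpace ℝ (Fin n) →L[ℝ] ℝ).hasFDerivAt).comp_hasDerivAt
    0 h1
  have hc : Filter.Tendsto (fun s : ℝ => z + s • (0, coordVec n j)) (nhds 0) (nhds z) := by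
    have : Continuous fun s : ℝ => z + s • ((0 : EuclideanSpace ℝ (Fin n)), coordVec n j) := by
      fun_prop
    simpa using this.tendsto 0
  have h3 : (fun s : ℝ => F.geodesicCoeff v₀ i z.1 (z.2 + s • coordVec n j)) =ᶠ[nhds 0]
      (EuclideanSpace.proj i : EuclideanSpace ℝ (Fin n) →L[ℝ] ℝ) ∘
        fun s => sprayCoeff (F.localEnergy v₀) (z + s • (0, coordVec n j)) := by
    filter_upwards [hc.eventually (hL.isOpen_domain.mem_nhds hz)] with s hs
    have := geodesicCoeff_eq hL hs i
    simpa using this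
  exact (h2.congr_of_eventuallyEq h3).deriv

theorem sum_connCoeff_eq (u : EuclideanSpace ℝ (Fin n)) :
    WithLp.toLp 2 (fun i => ∑ j, F.connCoeff v₀ i j z.1 z.2 * u j) =
      fderiv ℝ (sprayCoeff (F.localEnergy v₀)) z (0, u) := by
  have h6 := map_eq_sum ((fderiv ℝ (sprayCoeff (F.localEnergy v₀)) z).comp
    (ContinuousLinearMap.inr ℝ _ _)) u
  refine Eq.trans ?_ h6.symm
  ext i
  simp only [connCoeff_eq hL hz]
  simp [Finset.sum_apply, mul_comm]

end Coordinates
end FinslerMetric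

/-! ### Charts of the tangent bundle and their transition maps -/

section TangentCharts

variable {n : ℕ} {M : Type*} [TopologicalSpace M]
  [ChartedSpace (EuclideanSpace ℝ (Fin n)) M] [IsManifold (𝓡 n) ∞ M]

theorem extChartAt_tangent_apply (v₀ v : TangentBundle (𝓡 n) M) :
    extChartAt (𝓡 n).tangent v₀ v = (extChartAt (𝓡 n) v₀.proj v.proj,
      tangentCoordChange (𝓡 n) v.proj v₀.proj v.proj v.2) := by
  rw [FiberBundle.extChartAt]
  rfl

theorem extChartAt_tangent_source (v₀ : TangentBundle (𝓡 n) M) :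
    (extChartAt (𝓡 n).tangent v₀).source = Bundle.TotalSpace.proj ⁻¹'
      (extChartAt (𝓡 n) v₀.proj).source := by
  rw [extChartAt_source, extChartAt_source]
  ext v
  exact TangentBundle.mem_chart_source_iff v v₀

theorem extChartAt_tangent_target (v₀ : TangentBundle (𝓡 n) M) :
    (extChartAt (𝓡 n).tangent v₀).target = (extChartAt (𝓡 n) v₀.proj).target ×ˢ univ := by
  rw [FiberBundle.extChartAt_target]
  congr 1
  refine inter_eq_left.2 fun x hx => ?_
  have := (extChartAt (𝓡 n) v₀.proj).map_target hx
  rw [extChartAt_source] at this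
  exact this

/-- The inverse of the differential of the chart at `p`. -/
def chartInvDeriv (p : M) (x : EuclideanSpace ℝ (Fin n)) :
    EuclideanSpace ℝ (Fin n) →L[ℝ] TangentSpace (𝓡 n) ((extChartAt (𝓡 n) p).symm x) :=
  tangentCoordChange (𝓡 n) p ((extChartAt (𝓡 n) p).symm x) ((extChartAt (𝓡 n) p).symm x)

theorem tangentCoordChange_chartInvDeriv {p : M} {x : EuclideanSpace ℝ (Fin n)}
    (hx : x ∈ (extChartAt (𝓡 n) p).target) (y : EuclideanSpace ℝ (Fin n)) :
    tangentCoordChange (𝓡 n) ((extChartAt (𝓡 n) p).symm x) p ((extChartAt (𝓡 n) p).symm x)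
      (chartInvDeriv p x y) = y := by
  have h1 := (extChartAt (𝓡 n) p).map_target hx
  have h2 := mem_extChartAt_source (I := 𝓡 n) ((extChartAt (𝓡 n) p).symm x)
  exact (tangentCoordChange_comp ⟨⟨h1, h2⟩, h1⟩).trans (tangentCoordChange_self h1)

theorem chartInvDeriv_ne_zero {p : M} {x : EuclideanSpace ℝ (Fin n)}
    (hx : x ∈ (extChartAt (𝓡 n) p).target) {y : EuclideanSpace ℝ (Fin n)} (hy : y ≠ 0) :
    chartInvDeriv p x y ≠ 0 := by
  intro h
  have h1 := tangentCoordChange_chartInvDeriv hx y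
  rw [h] at h1
  exact hy (h1.symm.trans (map_zero _))

theorem extChartAt_tangent_symm_apply {v₀ : TangentBundle (𝓡 n) M} {x : EuclideanSpace ℝ (Fin n)}
    (hx : x ∈ (extChartAt (𝓡 n) v₀.proj).target) (y : EuclideanSpace ℝ (Fin n)) :
    (extChartAt (𝓡 n).tangent v₀).symm (x, y) =
      ⟨(extChartAt (𝓡 n) v₀.proj).symm x, chartInvDeriv v₀.proj x y⟩ := by
  set w : TangentBundle (𝓡 n) M :=
    ⟨(extChartAt (𝓡 n) v₀.proj).symm x, chartInvDeriv v₀.proj x y⟩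
  have hw : w ∈ (extChartAt (𝓡 n).tangent v₀).source := by
    rw [extChartAt_tangent_source]
    exact (extChartAt (𝓡 n) v₀.proj).map_target hx
  have h : extChartAt (𝓡 n).tangent v₀ w = (x, y) := by
    rw [extChartAt_tangent_apply]
    exact Prod.ext ((extChartAt (𝓡 n) v₀.proj).right_inv hx) (tangentCoordChange_chartInvDeriv hx y)
  rw [← h]
  exact (extChartAt (𝓡 n).tangent v₀).left_inv hw

/-- The domain of the transition map between the charts at `p` and `q`. -/
def transitionDomain (p q : M) : Set (EuclideanSpace ℝ (Fin n)) :=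
  (extChartAt (𝓡 n) p).target ∩ (extChartAt (𝓡 n) p).symm ⁻¹' (extChartAt (𝓡 n) q).source

/-- The transition map between the charts at `p` and `q`. -/
def transition (p q : M) : EuclideanSpace ℝ (Fin n) → EuclideanSpace ℝ (Fin n) :=
  extChartAt (𝓡 n) q ∘ (extChartAt (𝓡 n) p).symm

theorem isOpen_transitionDomain (p q : M) :
    IsOpen (transitionDomain p q : Set (EuclideanSpace ℝ (Fin n))) :=
  (continuousOn_extChartAt_symm p).isOpen_inter_preimage (isOpen_extChartAt_target p)
    (isOpen_extChartAt_source q)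

theorem contDiffOn_transition (p q : M) :
    ContDiffOn ℝ ∞ (transition p q : EuclideanSpace ℝ (Fin n) → _) (transitionDomain p q) := by
  rw [← contMDiffOn_iff_contDiffOn]
  refine (contMDiffOn_extChartAt (x := q)).comp
    ((contMDiffOn_extChartAt_symm p).mono inter_subset_left) fun x hx => ?_
  have := hx.2
  rw [mem_preimage, extChartAt_source] at this
  exact this

theorem fderiv_transition (p q x : M) : fderiv ℝ (transition p q) (extChartAt (𝓡 n) p x) =
    tangentCoordChange (𝓡 n) p q x := by
  rw [tangentCoordChange_def, ModelWithCorners.range_eq_univ, fderivWithin_univ]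
  rfl

theorem extChartAt_mem_transitionDomain {p q x : M} (hp : x ∈ (extChartAt (𝓡 n) p).source)
    (hq : x ∈ (extChartAt (𝓡 n) q).source) : extChartAt (𝓡 n) p x ∈ transitionDomain p q := by
  refine ⟨(extChartAt (𝓡 n) p).map_source hp, ?_⟩
  rw [mem_preimage, (extChartAt (𝓡 n) p).left_inv hp]
  exact hq

theorem bijective_fderiv_transition {p q : M} {x : EuclideanSpace ℝ (Fin n)}
    (hx : x ∈ transitionDomain p q) : Function.Bijective (fderiv ℝ (transition p q) x) := by
  obtain ⟨a, ha, rfl⟩ : ∃ a ∈ (extChartAt (𝓡 n) p).source, extChartAt (𝓡 n) p a = x :=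
    ⟨_, (extChartAt (𝓡 n) p).map_target hx.1, (extChartAt (𝓡 n) p).right_inv hx.1⟩
  have hq : a ∈ (extChartAt (𝓡 n) q).source := by
    have := hx.2
    rwa [mem_preimage, (extChartAt (𝓡 n) p).left_inv ha] at this
  rw [fderiv_transition]
  refine Function.bijective_iff_has_inverse.2 ⟨tangentCoordChange (𝓡 n) q p a, fun u => ?_, fun u => ?_⟩
  · exact (tangentCoordChange_comp ⟨⟨ha, hq⟩, ha⟩).trans (tangentCoordChange_self ha)
  · exact (tangentCoordChange_comp ⟨⟨hq, ha⟩, hq⟩).trans (tangentCoordChange_self hq)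

theorem tangentLift_transition {v₀ v₁ v : TangentBundle (𝓡 n) M}
    (h₀ : v.proj ∈ (extChartAt (𝓡 n) v₀.proj).source)
    (h₁ : v.proj ∈ (extChartAt (𝓡 n) v₁.proj).source) :
    tangentLift (transition v₀.proj v₁.proj) (extChartAt (𝓡 n).tangent v₀ v) =
      extChartAt (𝓡 n).tangent v₁ v := by
  rw [extChartAt_tangent_apply, extChartAt_tangent_apply]
  refine Prod.ext ?_ ?_
  · show extChartAt (𝓡 n) v₁.proj ((extChartAt (𝓡 n) v₀.proj).symm _) = _
    rw [(extChartAt (𝓡 n) v₀.proj).left_inv h₀]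
  · show fderiv ℝ (transition v₀.proj v₁.proj) (extChartAt (𝓡 n) v₀.proj v.proj) _ = _
    rw [fderiv_transition]
    exact tangentCoordChange_comp ⟨⟨mem_extChartAt_source v.proj, h₀⟩, h₁⟩

theorem transition_tangent_eventuallyEq {v₀ v₁ v : TangentBundle (𝓡 n) M}
    (h₀ : v.proj ∈ (extChartAt (𝓡 n) v₀.proj).source)
    (h₁ : v.proj ∈ (extChartAt (𝓡 n) v₁.proj).source) :
    extChartAt (𝓡 n).tangent v₁ ∘ (extChartAt (𝓡 n).tangent v₀).symm
      =ᶠ[nhds (extChartAt (𝓡 n).tangent v₀ v)] tangentLift (transition v₀.proj v₁.proj) := by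
  have hm : extChartAt (𝓡 n).tangent v₀ v ∈ transitionDomain v₀.proj v₁.proj ×ˢ (univ : Set (EuclideanSpace ℝ (Fin n))) := by
    rw [extChartAt_tangent_apply]
    exact ⟨extChartAt_mem_transitionDomain h₀ h₁, mem_univ _⟩
  filter_upwards [((isOpen_transitionDomain v₀.proj v₁.proj).prod isOpen_univ).mem_nhds hm] with z hz
  have e := extChartAt_tangent_symm_apply (v₀ := v₀) hz.1.1 z.2
  have hp : ((extChartAt (𝓡 n).tangent v₀).symm z).proj = (extChartAt (𝓡 n) v₀.proj).symm z.1 :=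
    congrArg Bundle.TotalSpace.proj e
  rw [Function.comp_apply, ← tangentLift_transition (v₀ := v₀) (v₁ := v₁),
    (extChartAt (𝓡 n).tangent v₀).right_inv]
  · rw [extChartAt_tangent_target]; exact ⟨hz.1.1, mem_univ _⟩
  · rw [hp]; exact (extChartAt (𝓡 n) v₀.proj).map_target hz.1.1
  · rw [hp]; exact hz.1.2

/-- Coordinate changes on the tangent spaces of `TM` become derivatives of tangent lifts, the form
in which the local theory compares horizontal vectors. -/
theorem tangentCoordChange_tangent {v₀ v₁ v : TangentBundle (𝓡 n) M}
    (h₀ : v.proj ∈ (extChartAt (𝓡 n) v₀.proj).source)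
    (h₁ : v.proj ∈ (extChartAt (𝓡 n) v₁.proj).source) :
    tangentCoordChange (𝓡 n).tangent v₀ v₁ v =
      fderiv ℝ (tangentLift (transition v₀.proj v₁.proj)) (extChartAt (𝓡 n).tangent v₀ v) := by
  rw [tangentCoordChange_def, ModelWithCorners.range_eq_univ, fderivWithin_univ]
  exact (transition_tangent_eventuallyEq h₀ h₁).fderiv_eq

end TangentCharts

/-! ### The horizontal lift in an arbitrary chart -/

namespace FinslerMetric

variable {n : ℕ} {M : Type*} [TopologicalSpace M]
  [ChartedSpace (EuclideanSpace ℝ (Fin n)) M] [IsManifold (𝓡 n) ∞ M] (F : FinslerMetric n M)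

theorem localEnergy_apply {v₀ : TangentBundle (𝓡 n) M}
    {z : EuclideanSpace ℝ (Fin n) × EuclideanSpace ℝ (Fin n)}
    (hx : z.1 ∈ (extChartAt (𝓡 n) v₀.proj).target) :
    F.localEnergy v₀ z = F.norm ⟨(extChartAt (𝓡 n) v₀.proj).symm z.1,
      chartInvDeriv v₀.proj z.1 z.2⟩ ^ 2 := by
  rw [localEnergy, localNorm, extChartAt_tangent_symm_apply hx]

theorem isLocalFinsler_localEnergy (v₀ : TangentBundle (𝓡 n) M) :
    IsLocalFinsler (extChartAt (𝓡 n) v₀.proj).target (F.localEnergy v₀) := by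
  have hsmooth : ContDiffOn ℝ ∞ (F.localEnergy v₀)
      ((extChartAt (𝓡 n) v₀.proj).target ×ˢ ({0}ᶜ : Set (EuclideanSpace ℝ (Fin n)))) := by
    have h1 : ContMDiffOn 𝓘(ℝ, EuclideanSpace ℝ (Fin n) × EuclideanSpace ℝ (Fin n)) 𝓘(ℝ, ℝ) ∞
        (fun z => F.norm ((extChartAt (𝓡 n).tangent v₀).symm z))
        ((extChartAt (𝓡 n) v₀.proj).target ×ˢ ({0}ᶜ : Set (EuclideanSpace ℝ (Fin n)))) := by
      refine F.smooth.comp ((contMDiffOn_extChartAt_symm v₀).mono fun z hz => ?_) fun z hz => ?_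
      · rw [extChartAt_tangent_target]; exact ⟨hz.1, mem_univ _⟩
      · rw [mem_preimage, extChartAt_tangent_symm_apply (x := z.1) (y := z.2) hz.1]
        exact chartInvDeriv_ne_zero hz.1 hz.2
    exact h1.contDiffOn.pow 2
  refine ⟨isOpen_extChartAt_target v₀.proj, hsmooth, ?_, ?_⟩
  · intro x hx y hy c hc
    rw [F.localEnergy_apply (z := (x, c • y)) hx, F.localEnergy_apply (z := (x, y)) hx]
    simp only [map_smul]
    rw [F.homogeneous _ _ c hc, mul_pow]
  · intro x hx y hy u hu
    have hd := hsmooth.contDiffAt (((isOpen_extChartAt_target v₀.proj).prod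
      isOpen_compl_singleton).mem_nhds (⟨hx, hy⟩ : (x, y) ∈ _ ×ˢ _))
    rw [← deriv_deriv_line hd]
    have h1 := F.posDef _ _ _ (chartInvDeriv_ne_zero hx hy) (chartInvDeriv_ne_zero hx hu)
    have h2 : ∀ s t : ℝ, F.localEnergy v₀ ((x, y) + s • (0, u) + t • (0, u)) =
        F.norm ⟨(extChartAt (𝓡 n) v₀.proj).symm x, chartInvDeriv v₀.proj x y +
          s • chartInvDeriv v₀.proj x u + t • chartInvDeriv v₀.proj x u⟩ ^ 2 := by
      intro s t
      have e : ((x, y) + s • (0, u) + t • (0, u) : EuclideanSpace ℝ (Fin n) ×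
          EuclideanSpace ℝ (Fin n)) = (x, y + s • u + t • u) := by simp
      rw [e, F.localEnergy_apply (z := (x, y + s • u + t • u)) hx]
      simp only [map_add, map_smul]
    simp only [h2]
    linarith

theorem extChartAt_tangent_mem {v₀ v : TangentBundle (𝓡 n) M} (hv : v ∈ slit n M)
    (h₀ : v.proj ∈ (extChartAt (𝓡 n) v₀.proj).source) :
    extChartAt (𝓡 n).tangent v₀ v ∈ (extChartAt (𝓡 n) v₀.proj).target ×ˢ
      ({0}ᶜ : Set (EuclideanSpace ℝ (Fin n))) := by
  rw [extChartAt_tangent_apply]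
  refine ⟨(extChartAt (𝓡 n) v₀.proj).map_source h₀, fun h => hv ?_⟩
  have h1 : tangentCoordChange (𝓡 n) v₀.proj v.proj v.proj
      (tangentCoordChange (𝓡 n) v.proj v₀.proj v.proj v.2) = v.2 :=
    (tangentCoordChange_comp ⟨⟨mem_extChartAt_source v.proj, h₀⟩, mem_extChartAt_source v.proj⟩).trans
      (tangentCoordChange_self (mem_extChartAt_source v.proj))
  have h2 : tangentCoordChange (𝓡 n) v.proj v₀.proj v.proj v.2 = 0 := h
  rw [h2] at h1
  exact h1.symm.trans (map_zero _)

/-- The horizontal lift in the coordinates of the chart at `v₀`. -/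
def localHorLift (v₀ : TangentBundle (𝓡 n) M)
    (z : EuclideanSpace ℝ (Fin n) × EuclideanSpace ℝ (Fin n)) (u : EuclideanSpace ℝ (Fin n)) :
    EuclideanSpace ℝ (Fin n) × EuclideanSpace ℝ (Fin n) :=
  (u, - fderiv ℝ (sprayCoeff (F.localEnergy v₀)) z (0, u))

theorem horLift_eq {v : TangentBundle (𝓡 n) M} (hv : v ∈ slit n M) (u : EuclideanSpace ℝ (Fin n)) :
    F.horLift v u = F.localHorLift v (extChartAt (𝓡 n).tangent v v) u := by
  have h := sum_connCoeff_eq (F.isLocalFinsler_localEnergy v)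
    (extChartAt_tangent_mem hv (mem_extChartAt_source v.proj)) u
  exact Prod.ext rfl (congrArg Neg.neg h)

/-- The horizontal lift does not depend on the chart. -/
theorem tangentCoordChange_horLift {v₀ v : TangentBundle (𝓡 n) M} (hv : v ∈ slit n M)
    (h₀ : v.proj ∈ (extChartAt (𝓡 n) v₀.proj).source) (u : EuclideanSpace ℝ (Fin n)) :
    tangentCoordChange (𝓡 n).tangent v v₀ v (F.horLift v u) =
      F.localHorLift v₀ (extChartAt (𝓡 n).tangent v₀ v)
        (tangentCoordChange (𝓡 n) v.proj v₀.proj v.proj u) := by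
  have hself := mem_extChartAt_source (I := 𝓡 n) v.proj
  -- `horLift` uses at each `v` the chart preferred at `v`, which jumps with `v`. Expressing it in
  -- the one chart at `v₀` is what makes its smoothness accessible.
  rw [tangentCoordChange_tangent hself h₀, F.horLift_eq hv]
  have hLv := F.isLocalFinsler_localEnergy v
  -- The transition map is defined only over the overlap of the charts, so the local Finsler metric
  -- is restricted to it.
  have hLv' : IsLocalFinsler (transitionDomain v.proj v₀.proj) (F.localEnergy v) :=
    ⟨isOpen_transitionDomain _ _, hLv.smooth.mono (prod_mono inter_subset_left Subset.rfl),
      fun x hx => hLv.homogeneous x hx.1, fun x hx => hLv.posDef x hx.1⟩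
  have hz : extChartAt (𝓡 n).tangent v v ∈ transitionDomain v.proj v₀.proj ×ˢ
      ({0}ᶜ : Set (EuclideanSpace ℝ (Fin n))) := by
    refine ⟨?_, (extChartAt_tangent_mem hv hself).2⟩
    rw [extChartAt_tangent_apply]
    exact extChartAt_mem_transitionDomain hself h₀
  have key := fderiv_tangentLift_horizontal hLv' (F.isLocalFinsler_localEnergy v₀)
    (contDiffOn_transition v.proj v₀.proj)
    (fun x hx => (extChartAt (𝓡 n) v₀.proj).map_source hx.2)
    (fun x hx => bijective_fderiv_transition hx) (fun z hz => ?_) hz u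
  · refine key.trans ?_
    rw [tangentLift_transition hself h₀, extChartAt_tangent_apply v v]
    rw [fderiv_transition]
    rfl
  · have hz' : z ∈ (extChartAt (𝓡 n).tangent v).target := by
      rw [extChartAt_tangent_target]; exact ⟨hz.1.1, mem_univ _⟩
    have hw := (extChartAt (𝓡 n).tangent v).map_target hz'
    rw [extChartAt_tangent_source] at hw
    have e := extChartAt_tangent_symm_apply (v₀ := v) hz.1.1 z.2
    have hp : ((extChartAt (𝓡 n).tangent v).symm z).proj ∈ (extChartAt (𝓡 n) v₀.proj).source := by
      have : ((extChartAt (𝓡 n).tangent v).symm z).proj = (extChartAt (𝓡 n) v.proj).symm z.1 :=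
        congrArg Bundle.TotalSpace.proj e
      rw [this]
      exact hz.1.2
    have h1 := tangentLift_transition (v₀ := v) (v₁ := v₀) hw hp
    rw [(extChartAt (𝓡 n).tangent v).right_inv hz'] at h1
    rw [h1]
    show F.norm ((extChartAt (𝓡 n).tangent v₀).symm (extChartAt (𝓡 n).tangent v₀ _)) ^ 2 =
      F.norm ((extChartAt (𝓡 n).tangent v).symm z) ^ 2
    rw [(extChartAt (𝓡 n).tangent v₀).left_inv]
    rw [extChartAt_tangent_source]
    exact hp

end FinslerMetric

/-! ### Lie brackets of vector fields as commutators of derivations -/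

section LieBracket

open VectorField Topology

variable {E : Type*} [NormedAddCommGroup E] [NormedSpace ℝ E]
  {H : Type*} [TopologicalSpace H] {I : ModelWithCorners ℝ E H} [I.Boundaryless]
  {N : Type*} [TopologicalSpace N] [ChartedSpace H N] [IsManifold I ∞ N]
  {G : Type*} [NormedAddCommGroup G] [NormedSpace ℝ G]

/-- The differential of a vector-valued function, with values in the vector space. -/
def mdiff (I : ModelWithCorners ℝ E H) {N : Type*} [TopologicalSpace N] [ChartedSpace H N]
    (f : N → G) (x : N) : TangentSpace I x →L[ℝ] G := mfderiv I 𝓘(ℝ, G) f x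

theorem hasMFDerivAt_mdiff {f : N → G} {x : N} (hf : MDifferentiableAt I 𝓘(ℝ, G) f x) :
    HasMFDerivAt I 𝓘(ℝ, G) f x (mdiff I f x) := hf.hasMFDerivAt

theorem mdiff_comp_extChartAt {f : N → G} {g : E → G} {x₀ x : N}
    (hx : x ∈ (extChartAt I x₀).source) (h : f =ᶠ[𝓝 x] g ∘ extChartAt I x₀)
    (hg : DifferentiableAt ℝ g (extChartAt I x₀ x)) :
    MDifferentiableAt I 𝓘(ℝ, G) f x ∧
    mdiff I f x = (fderiv ℝ g (extChartAt I x₀ x)).comp (mdiff I (extChartAt I x₀) x) := by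
  rw [extChartAt_source] at hx
  have h1 : HasMFDerivAt I 𝓘(ℝ, G) (g ∘ extChartAt I x₀) x
      ((fderiv ℝ g (extChartAt I x₀ x)).comp (mdiff I (extChartAt I x₀) x)) :=
    HasMFDerivAt.comp (I' := 𝓘(ℝ, E)) x hg.hasFDerivAt.hasMFDerivAt
      (hasMFDerivAt_mdiff (mdifferentiableAt_extChartAt hx))
  have h2 := h1.congr_of_eventuallyEq h
  exact ⟨h2.mdifferentiableAt, h2.mfderiv⟩

theorem differentiableAt_comp_extChartAt_symm {f : N → G} {x₀ x : N}
    (hx : x ∈ (extChartAt I x₀).source) (hf : MDifferentiableAt I 𝓘(ℝ, G) f x) :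
    DifferentiableAt ℝ (f ∘ (extChartAt I x₀).symm) (extChartAt I x₀ x) := by
  have h1 : MDifferentiableAt 𝓘(ℝ, E) I (extChartAt I x₀).symm (extChartAt I x₀ x) := by
    have := mdifferentiableWithinAt_extChartAt_symm ((extChartAt I x₀).map_source hx)
    rwa [ModelWithCorners.range_eq_univ, mdifferentiableWithinAt_univ] at this
  have h2 : MDifferentiableAt I 𝓘(ℝ, G) f ((extChartAt I x₀).symm (extChartAt I x₀ x)) := by
    rwa [(extChartAt I x₀).left_inv hx]
  exact (h2.comp _ h1).differentiableAt

theorem mdiff_eq_fderiv {f : N → G} {x₀ x : N}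
    (hx : x ∈ (extChartAt I x₀).source) (hf : MDifferentiableAt I 𝓘(ℝ, G) f x) :
    mdiff I f x = (fderiv ℝ (f ∘ (extChartAt I x₀).symm) (extChartAt I x₀ x)).comp
      (mdiff I (extChartAt I x₀) x) := by
  refine (mdiff_comp_extChartAt hx ?_ (differentiableAt_comp_extChartAt_symm hx hf)).2
  filter_upwards [(isOpen_extChartAt_source x₀).mem_nhds hx] with y hy
  show f y = f ((extChartAt I x₀).symm (extChartAt I x₀ y))
  rw [(extChartAt I x₀).left_inv hy]

theorem mdiff_extChartAt_self (x : N) :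
    mdiff I (extChartAt I x) x = ContinuousLinearMap.id ℝ E := mfderiv_extChartAt_self

theorem mdiff_eq_fderiv_self {f : N → G} {x : N} (hf : MDifferentiableAt I 𝓘(ℝ, G) f x) :
    mdiff I f x = fderiv ℝ (f ∘ (extChartAt I x).symm) (extChartAt I x x) := by
  rw [mdiff_eq_fderiv (mem_extChartAt_source x) hf, mdiff_extChartAt_self]
  rfl

/-- The vector field `W` in the chart at `x₀`. -/
def chartField (I : ModelWithCorners ℝ E H) {N : Type*} [TopologicalSpace N] [ChartedSpace H N]
    (W : ∀ x : N, TangentSpace I x) (x₀ : N) : E → E :=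
  mpullbackWithin 𝓘(ℝ, E) I (extChartAt I x₀).symm W (range I)

theorem mdiff_mpullbackWithin {f : N → G} {x₀ x : N} (hx : x ∈ (extChartAt I x₀).source)
    (hf : MDifferentiableAt I 𝓘(ℝ, G) f x) (W : ∀ x : N, TangentSpace I x) :
    mdiff I f x (W x) = fderiv ℝ (f ∘ (extChartAt I x₀).symm) (extChartAt I x₀ x)
      (chartField I W x₀ (extChartAt I x₀ x)) := by
  rw [mdiff_eq_fderiv hx hf]
  have h1 : (mfderivWithin 𝓘(ℝ, E) I (extChartAt I x₀).symm (range I) (extChartAt I x₀ x)).inverse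
      (W ((extChartAt I x₀).symm (extChartAt I x₀ x))) = mdiff I (extChartAt I x₀) x (W x) := by
    have h2 : (mfderivWithin 𝓘(ℝ, E) I (extChartAt I x₀).symm (range I) (extChartAt I x₀ x)).inverse
        = mfderiv I 𝓘(ℝ, E) (extChartAt I x₀) ((extChartAt I x₀).symm (extChartAt I x₀ x)) :=
      ContinuousLinearMap.inverse_eq (mfderivWithin_extChartAt_symm_comp_mfderiv_extChartAt
        ((extChartAt I x₀).map_source hx)) (mfderiv_extChartAt_comp_mfderivWithin_extChartAt_symm
        ((extChartAt I x₀).map_source hx))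
    rw [h2]
    have h3 : ∀ y, y = x → (mfderiv I 𝓘(ℝ, E) (extChartAt I x₀) y (W y) : E) =
      mdiff I (extChartAt I x₀) x (W x) := by
      rintro y rfl; rfl
    exact h3 _ ((extChartAt I x₀).left_inv hx)
  exact congrArg (fderiv ℝ (f ∘ (extChartAt I x₀).symm) (extChartAt I x₀ x)) h1.symm

theorem mlieBracket_eq_lieBracket (V W : ∀ x : N, TangentSpace I x) (x : N) :
    mlieBracket I V W x = lieBracket ℝ
      (chartField I V x)
      (chartField I W x) (extChartAt I x x) := by
  have h1 : mlieBracket I V W x = (mfderiv I 𝓘(ℝ, E) (extChartAt I x) x).inverse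
    ((lieBracketWithin ℝ (chartField I V x) (chartField I W x)
      ((extChartAt I x).symm ⁻¹' univ ∩ range I)) ((extChartAt I x x))) := mlieBracketWithin_apply
  have h3 : (extChartAt I x).symm ⁻¹' univ ∩ range I = univ := by
    rw [preimage_univ, univ_inter, I.range_eq_univ]
  rw [h1, h3, lieBracketWithin_univ]
  have h2 : (mfderiv I 𝓘(ℝ, E) (extChartAt I x) x).inverse = ContinuousLinearMap.id ℝ E := by
    have : mfderiv I 𝓘(ℝ, E) (extChartAt I x) x = ContinuousLinearMap.id ℝ E :=
      mfderiv_extChartAt_self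
    rw [this]
    exact ContinuousLinearMap.inverse_id
  rw [h2]
  rfl

theorem differentiableAt_mpullbackWithin [CompleteSpace E] {V : ∀ x : N, TangentSpace I x} {x : N}
    (hV : MDifferentiableAt I I.tangent (fun y => (⟨y, V y⟩ : TangentBundle I N)) x) :
    DifferentiableAt ℝ (chartField I V x)
      (extChartAt I x x) := by
  have : IsManifold I 2 N := IsManifold.of_le (n := ∞) (by exact ENat.LEInfty.out)
  have h := MDifferentiableWithinAt.differentiableWithinAt_mpullbackWithin_vectorField
    (s := univ) (mdifferentiableWithinAt_univ.2 hV)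
  have h3 : (extChartAt I x).symm ⁻¹' univ ∩ range I = univ := by
    rw [preimage_univ, univ_inter, I.range_eq_univ]
  have h4 : DifferentiableWithinAt ℝ (chartField I V x)
    ((extChartAt I x).symm ⁻¹' univ ∩ range I) (extChartAt I x x) := h
  rwa [h3, differentiableWithinAt_univ] at h4

/-- The function `x ↦ df(W)`, in a chart. -/
theorem mdiff_apply_eventuallyEq {f : N → G} {x : N} (hf : ContMDiffAt I 𝓘(ℝ, G) ∞ f x)
    (W : ∀ x : N, TangentSpace I x) : (fun y => mdiff I f y (W y)) =ᶠ[𝓝 x]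
      (fun z => fderiv ℝ (f ∘ (extChartAt I x).symm) z
        (chartField I W x z)) ∘ extChartAt I x := by
  have h1 : ∀ᶠ y in 𝓝 x, ContMDiffAt I 𝓘(ℝ, G) 1 f y := by
    obtain ⟨u, hu, h⟩ := (contMDiffAt_iff_contMDiffOn_nhds (n := 1) (by simp)).1
      (hf.of_le (by simp))
    filter_upwards [eventually_eventually_nhds.2 hu] with y hy using h.contMDiffAt hy
  filter_upwards [h1, (isOpen_extChartAt_source x).mem_nhds (mem_extChartAt_source (I := I) x)]
    with y hy hys
  exact mdiff_mpullbackWithin hys (hy.mdifferentiableAt (by simp)) W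

theorem contDiffAt_comp_extChartAt_symm {f : N → G} {x : N}
    (hf : ContMDiffAt I 𝓘(ℝ, G) ∞ f x) :
    ContDiffAt ℝ ∞ (f ∘ (extChartAt I x).symm) (extChartAt I x x) := by
  have h1 : ContMDiffAt 𝓘(ℝ, E) I ∞ (extChartAt I x).symm (extChartAt I x x) :=
    (contMDiffOn_extChartAt_symm x).contMDiffAt ((isOpen_extChartAt_target x).mem_nhds
      (mem_extChartAt_target x))
  have h2 : ContMDiffAt I 𝓘(ℝ, G) ∞ f ((extChartAt I x).symm (extChartAt I x x)) := by
    rwa [(extChartAt I x).left_inv (mem_extChartAt_source x)]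
  exact (h2.comp _ h1).contDiffAt

/-- The Lie bracket of vector fields is the commutator of the associated derivations. -/
theorem mdiff_mlieBracket [CompleteSpace E] {f : N → G} {V W : ∀ x : N, TangentSpace I x} {x : N}
    (hf : ContMDiffAt I 𝓘(ℝ, G) ∞ f x)
    (hV : MDifferentiableAt I I.tangent (fun y => (⟨y, V y⟩ : TangentBundle I N)) x)
    (hW : MDifferentiableAt I I.tangent (fun y => (⟨y, W y⟩ : TangentBundle I N)) x) :
    mdiff I f x (mlieBracket I V W x) =
      mdiff I (fun y => mdiff I f y (W y)) x (V x) - mdiff I (fun y => mdiff I f y (V y)) x (W x) := by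
  have hf' := contDiffAt_comp_extChartAt_symm hf
  have hd : DifferentiableAt ℝ (fderiv ℝ (f ∘ (extChartAt I x).symm)) (extChartAt I x x) :=
    (hf'.fderiv_right (m := ∞) (by simp)).differentiableAt (by simp)
  have hself : ∀ V : ∀ x : N, TangentSpace I x,
      chartField I V x (extChartAt I x x) = V x := by
    intro V
    have h := mdiff_mpullbackWithin (mem_extChartAt_source (I := I) x)
      (mdifferentiableAt_extChartAt (I := I) (mem_chart_source H x)) V
    rw [mdiff_extChartAt_self] at h
    have h2 : (extChartAt I x ∘ (extChartAt I x).symm) =ᶠ[𝓝 (extChartAt I x x)] id := by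
      filter_upwards [(isOpen_extChartAt_target x).mem_nhds (mem_extChartAt_target x)] with z hz
      exact (extChartAt I x).right_inv hz
    rw [h2.fderiv_eq, fderiv_id] at h
    exact h.symm
  -- In the chart, applying `W` and then `V` to `f` gives a second derivative of `f` plus a term
  -- with the derivative of `W`. The former is symmetric and cancels in the commutator, while the
  -- latter terms form the bracket.
  have key : ∀ V W : ∀ x : N, TangentSpace I x,
      MDifferentiableAt I I.tangent (fun y => (⟨y, W y⟩ : TangentBundle I N)) x →
      mdiff I (fun y => mdiff I f y (W y)) x (V x) =
      fderiv ℝ (fderiv ℝ (f ∘ (extChartAt I x).symm)) (extChartAt I x x) (V x) (W x) +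
      fderiv ℝ (f ∘ (extChartAt I x).symm) (extChartAt I x x)
        (fderiv ℝ (chartField I W x)
          (extChartAt I x x) (V x)) := by
    intro V W hW
    have hW' := differentiableAt_mpullbackWithin hW
    have h := (mdiff_comp_extChartAt (mem_extChartAt_source (I := I) x)
      (mdiff_apply_eventuallyEq hf W) (hd.clm_apply hW')).2
    rw [h, mdiff_extChartAt_self]
    have h3 := (hd.hasFDerivAt.clm_apply hW'.hasFDerivAt).fderiv
    refine (congrArg (fun T : E →L[ℝ] G => T (V x)) h3).trans ?_
    have h4 := hself W
    show fderiv ℝ (f ∘ (extChartAt I x).symm) (extChartAt I x x)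
        (fderiv ℝ (chartField I W x)
          (extChartAt I x x) (V x)) + fderiv ℝ (fderiv ℝ (f ∘ (extChartAt I x).symm))
          (extChartAt I x x) (V x) (chartField I W x
          (extChartAt I x x)) = _
    rw [h4, add_comm]
  have hsymm : fderiv ℝ (fderiv ℝ (f ∘ (extChartAt I x).symm)) (extChartAt I x x) (V x) (W x) =
      fderiv ℝ (fderiv ℝ (f ∘ (extChartAt I x).symm)) (extChartAt I x x) (W x) (V x) :=
    (hf'.isSymmSndFDerivAt (by simp; exact ENat.LEInfty.out)).eq (V x) (W x)
  have h1 : mdiff I f x (mlieBracket I V W x) = fderiv ℝ (f ∘ (extChartAt I x).symm)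
      (extChartAt I x x) (fderiv ℝ (chartField I W x) (extChartAt I x x) (V x) -
        fderiv ℝ (chartField I V x) (extChartAt I x x) (W x)) := by
    rw [mdiff_eq_fderiv_self (hf.mdifferentiableAt (by simp)), mlieBracket_eq_lieBracket]
    show fderiv ℝ (f ∘ (extChartAt I x).symm) (extChartAt I x x)
      (fderiv ℝ (chartField I W x) (extChartAt I x x) (chartField I V x (extChartAt I x x)) -
      fderiv ℝ (chartField I V x) (extChartAt I x x) (chartField I W x (extChartAt I x x))) = _
    rw [hself V, hself W]
  rw [h1, key V W hW, key W V hV, hsymm, map_sub]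
  abel

end LieBracket
-- Smoothness of horizontal lifts and compactness of the indicatrix bundle
namespace FinslerMetric

variable {n : ℕ} {M : Type*} [TopologicalSpace M]
  [ChartedSpace (EuclideanSpace ℝ (Fin n)) M] [IsManifold (𝓡 n) ∞ M] (F : FinslerMetric n M)

/-- The smooth vector fields on `M`. -/
abbrev BaseField (n : ℕ) (M : Type*) [TopologicalSpace M]
    [ChartedSpace (EuclideanSpace ℝ (Fin n)) M] [IsManifold (𝓡 n) ∞ M] : Type _ :=
  Cₛ^∞⟮𝓡 n; EuclideanSpace ℝ (Fin n), (TangentSpace (𝓡 n) : M → Type _)⟯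

theorem contDiffOn_localHorLift (v₀ : TangentBundle (𝓡 n) M) :
    ContDiffOn ℝ ∞ (fun p : (EuclideanSpace ℝ (Fin n) × EuclideanSpace ℝ (Fin n)) ×
      EuclideanSpace ℝ (Fin n) => F.localHorLift v₀ p.1 p.2)
      (((extChartAt (𝓡 n) v₀.proj).target ×ˢ {0}ᶜ) ×ˢ univ) := by
  rintro ⟨z, u⟩ ⟨hz, -⟩
  have hL := F.isLocalFinsler_localEnergy v₀
  have h1 : ContDiffAt ℝ ∞ (fderiv ℝ (sprayCoeff (F.localEnergy v₀))) z :=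
    (hL.contDiffAt_sprayCoeff hz).fderiv_right (by simp)
  have h2 : ContDiffAt ℝ ∞ (fun p : (EuclideanSpace ℝ (Fin n) × EuclideanSpace ℝ (Fin n)) ×
      EuclideanSpace ℝ (Fin n) => fderiv ℝ (sprayCoeff (F.localEnergy v₀)) p.1 (0, p.2)) (z, u) :=
    (h1.comp (z, u) contDiffAt_fst).clm_apply (contDiffAt_const.prodMk contDiffAt_snd)
  exact (contDiffAt_snd.prodMk h2.neg).contDiffWithinAt

/-- The horizontal lift of a smooth vector field is smooth on the slit tangent bundle. -/
theorem contMDiffOn_horLiftField (X : BaseField n M) :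
    ContMDiffOn (𝓡 n).tangent (𝓡 n).tangent.tangent ∞
      (fun v => (⟨v, F.horLiftField X v⟩ : TangentBundle (𝓡 n).tangent (TangentBundle (𝓡 n) M)))
      (slit n M) := by
  intro v₀ hv₀
  refine ContMDiffAt.contMDiffWithinAt ?_
  rw [Bundle.contMDiffAt_totalSpace]
  refine ⟨contMDiffAt_id, ?_⟩
  have hsrc : (extChartAt (𝓡 n).tangent v₀).source ∈ nhds v₀ :=
    (isOpen_extChartAt_source v₀).mem_nhds (mem_extChartAt_source v₀)
  have hX : ContMDiffAt (𝓡 n).tangent (𝓡 n).tangent ∞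
      (fun v : TangentBundle (𝓡 n) M => (⟨v.proj, X v.proj⟩ : TangentBundle (𝓡 n) M)) v₀ :=
    (X.contMDiff v₀.proj).comp v₀ (Bundle.contMDiffAt_proj (TangentSpace (𝓡 n) : M → Type _))
  rw [Bundle.contMDiffAt_totalSpace] at hX
  have hu : ContMDiffAt (𝓡 n).tangent 𝓘(ℝ, EuclideanSpace ℝ (Fin n)) ∞
      (fun v : TangentBundle (𝓡 n) M =>
        (tangentCoordChange (𝓡 n) v.proj v₀.proj v.proj (X v.proj) : EuclideanSpace ℝ (Fin n))) v₀ :=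
    hX.2
  have hc : ContMDiffAt (𝓡 n).tangent 𝓘(ℝ, EuclideanSpace ℝ (Fin n) × EuclideanSpace ℝ (Fin n)) ∞
      (extChartAt (𝓡 n).tangent v₀) v₀ := contMDiffAt_extChartAt
  have hz : extChartAt (𝓡 n).tangent v₀ v₀ ∈ (extChartAt (𝓡 n) v₀.proj).target ×ˢ
      ({0}ᶜ : Set (EuclideanSpace ℝ (Fin n))) :=
    extChartAt_tangent_mem hv₀ (mem_extChartAt_source v₀.proj)
  have hl := (F.contDiffOn_localHorLift v₀).contMDiffOn.contMDiffAt
    ((((isOpen_extChartAt_target v₀.proj).prod isOpen_compl_singleton).prod isOpen_univ).mem_nhds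
    (⟨hz, mem_univ _⟩ : (extChartAt (𝓡 n).tangent v₀ v₀,
      tangentCoordChange (𝓡 n) v₀.proj v₀.proj v₀.proj (X v₀.proj)) ∈ _ ×ˢ _))
  have h3 := ContMDiffAt.comp (x := v₀) (I' := 𝓘(ℝ, (EuclideanSpace ℝ (Fin n) ×
    EuclideanSpace ℝ (Fin n)) × EuclideanSpace ℝ (Fin n))) hl (hc.prodMk_space hu)
  refine h3.congr_of_eventuallyEq ?_
  filter_upwards [hsrc, F.isOpen_slit.mem_nhds hv₀] with v hv hvs
  rw [extChartAt_tangent_source] at hv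
  exact F.tangentCoordChange_horLift hvs hv (X v.proj)

/-- This is the invariance of `L` under parallel translation, read in the chart at `v`; it makes
horizontal lifts tangent to the indicatrix bundle. -/
theorem mdiff_energy_horLift {v : TangentBundle (𝓡 n) M} (hv : v ∈ slit n M)
    (u : EuclideanSpace ℝ (Fin n)) :
    mdiff (𝓡 n).tangent (fun w => F.norm w ^ 2) v (F.horLift v u) = 0 := by
  have h1 : MDifferentiableAt (𝓡 n).tangent 𝓘(ℝ, ℝ) (fun w => F.norm w ^ 2) v := by
    have h2 := (F.smooth.contMDiffAt (F.isOpen_slit.mem_nhds hv)).mdifferentiableAt (by simp)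
    have h3 : DifferentiableAt ℝ (fun x : ℝ => x ^ 2) (F.norm v) := by fun_prop
    exact MDifferentiableAt.comp v h3.mdifferentiableAt h2
  rw [mdiff_eq_fderiv_self h1]
  have hz := extChartAt_tangent_mem hv (mem_extChartAt_source v.proj)
  have h4 := (F.isLocalFinsler_localEnergy v).fderiv_horizontal hz u
  rw [F.horLift_eq hv]
  exact h4

theorem hasMFDerivAt_proj (v : TangentBundle (𝓡 n) M) :
    HasMFDerivAt (𝓡 n).tangent (𝓡 n) (Bundle.TotalSpace.proj : TangentBundle (𝓡 n) M → M) v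
      (ContinuousLinearMap.fst ℝ (EuclideanSpace ℝ (Fin n)) (EuclideanSpace ℝ (Fin n))) := by
  have h1 : MDifferentiableAt (𝓡 n).tangent (𝓡 n)
      (Bundle.TotalSpace.proj : TangentBundle (𝓡 n) M → M) v :=
    (Bundle.contMDiffAt_proj (n := 1) (TangentSpace (𝓡 n) : M → Type _)).mdifferentiableAt (by simp)
  refine ⟨h1.continuousAt, ?_⟩
  have h2 : HasFDerivAt (Prod.fst : EuclideanSpace ℝ (Fin n) × EuclideanSpace ℝ (Fin n) → _)
    (ContinuousLinearMap.fst ℝ (EuclideanSpace ℝ (Fin n)) (EuclideanSpace ℝ (Fin n)))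
    (extChartAt (𝓡 n).tangent v v) := hasFDerivAt_fst
  refine (h2.congr_of_eventuallyEq ?_).hasFDerivWithinAt
  filter_upwards [(isOpen_extChartAt_target v).mem_nhds (mem_extChartAt_target v)] with z hz
  rw [extChartAt_tangent_target] at hz
  show extChartAt (𝓡 n) v.proj ((extChartAt (𝓡 n).tangent v).symm z).proj = z.1
  have e := extChartAt_tangent_symm_apply (v₀ := v) hz.1 z.2
  have hp : ((extChartAt (𝓡 n).tangent v).symm z).proj = (extChartAt (𝓡 n) v.proj).symm z.1 :=
    congrArg Bundle.TotalSpace.proj e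
  rw [hp, (extChartAt (𝓡 n) v.proj).right_inv hz.1]

theorem mdiff_comp_proj {G : Type*} [NormedAddCommGroup G] [NormedSpace ℝ G] {f : M → G}
    {v : TangentBundle (𝓡 n) M} (hf : MDifferentiableAt (𝓡 n) 𝓘(ℝ, G) f v.proj)
    (w : TangentSpace (𝓡 n).tangent v) :
    mdiff (𝓡 n).tangent (fun v : TangentBundle (𝓡 n) M => f v.proj) v w =
      mdiff (𝓡 n) f v.proj
        (show EuclideanSpace ℝ (Fin n) × EuclideanSpace ℝ (Fin n) from w).1 := by
  have h := HasMFDerivAt.comp (I' := 𝓡 n) v (hasMFDerivAt_mdiff hf) (hasMFDerivAt_proj v)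
  have h2 := h.mfderiv
  have h3 := congrArg (fun T : (EuclideanSpace ℝ (Fin n) × EuclideanSpace ℝ (Fin n)) →L[ℝ] G => T w) h2
  exact h3

theorem horLift_add (v : TangentBundle (𝓡 n) M) (u u' : EuclideanSpace ℝ (Fin n)) :
    F.horLift v (u + u') = F.horLift v u + F.horLift v u' := by
  refine Prod.ext rfl ?_
  ext i
  show -(∑ j, _ * (u j + u' j)) = -(∑ j, _ * u j) + -(∑ j, _ * u' j)
  simp only [mul_add, Finset.sum_add_distrib]
  ring

theorem horLift_smul (v : TangentBundle (𝓡 n) M) (c : ℝ) (u : EuclideanSpace ℝ (Fin n)) :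
    F.horLift v (c • u) = c • F.horLift v u := by
  refine Prod.ext rfl ?_
  ext i
  show -(∑ j, _ * (c * u j)) = c * -(∑ j, _ * u j)
  rw [mul_neg, Finset.mul_sum]
  congr 1
  refine Finset.sum_congr rfl fun j _ => ?_
  ring

theorem isClosed_indicatrixBundle : IsClosed F.indicatrixBundle :=
  isClosed_eq F.continuous continuous_const

/-- Over a neighbourhood of a point, the indicatrix bundle is contained in a compact set. -/
theorem exists_isCompact_over (v₀ : TangentBundle (𝓡 n) M) : ∃ U ∈ nhds v₀.proj,
    ∃ K : Set (TangentBundle (𝓡 n) M), IsCompact K ∧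
      ∀ v ∈ F.indicatrixBundle, v.proj ∈ U → v ∈ K := by
  obtain ⟨K, hK, hKs, hKc⟩ := (local_compact_nhds (x := extChartAt (𝓡 n) v₀.proj v₀.proj)
    ((isOpen_extChartAt_target v₀.proj).mem_nhds (mem_extChartAt_target (I := 𝓡 n) v₀.proj)))
  have hcont : ContinuousOn (extChartAt (𝓡 n).tangent v₀).symm (K ×ˢ univ) :=
    (continuousOn_extChartAt_symm v₀).mono (by
      rw [extChartAt_tangent_target]; exact prod_mono hKs Subset.rfl)
  -- With `m` a positive lower bound of `𝓕` on unit coordinate vectors over `K`, homogeneity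
  -- confines the coordinates of indicatrix vectors to the ball of radius `m⁻¹`. The product with
  -- the sphere is empty in dimension zero, where any `m` will do.
  obtain ⟨m, hm, hmS⟩ : ∃ m > 0, ∀ x ∈ K, ∀ y ∈ Metric.sphere (0 : EuclideanSpace ℝ (Fin n)) 1,
      m ≤ F.norm ((extChartAt (𝓡 n).tangent v₀).symm (x, y)) := by
    rcases (K ×ˢ Metric.sphere (0 : EuclideanSpace ℝ (Fin n)) 1).eq_empty_or_nonempty with he | hne
    · refine ⟨1, one_pos, fun x hx y hy => ?_⟩
      have : (x, y) ∈ K ×ˢ Metric.sphere (0 : EuclideanSpace ℝ (Fin n)) 1 := ⟨hx, hy⟩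
      rw [he] at this
      exact this.elim
    · obtain ⟨z, hz, hmin⟩ := (hKc.prod (isCompact_sphere 0 1)).exists_isMinOn hne
        (F.continuous.comp_continuousOn (hcont.mono (prod_mono Subset.rfl (subset_univ _))))
      refine ⟨_, F.norm_pos (v := (extChartAt (𝓡 n).tangent v₀).symm z) ?_,
        fun x hx y hy => hmin (⟨hx, hy⟩ : (x, y) ∈ _ ×ˢ _)⟩
      have h1 := extChartAt_tangent_symm_apply (v₀ := v₀) (hKs hz.1) z.2
      show (extChartAt (𝓡 n).tangent v₀).symm (z.1, z.2) ∈ slit n M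
      rw [h1]
      refine chartInvDeriv_ne_zero (hKs hz.1) fun h0 => ?_
      have := hz.2
      rw [h0] at this
      simp at this
  refine ⟨(extChartAt (𝓡 n) v₀.proj).source ∩ extChartAt (𝓡 n) v₀.proj ⁻¹' K, Filter.inter_mem
    ((isOpen_extChartAt_source v₀.proj).mem_nhds (mem_extChartAt_source v₀.proj))
    ((continuousAt_extChartAt v₀.proj).preimage_mem_nhds hK),
    (extChartAt (𝓡 n).tangent v₀).symm '' (K ×ˢ Metric.closedBall 0 m⁻¹),
    (hKc.prod (isCompact_closedBall 0 m⁻¹)).image_of_continuousOn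
      (hcont.mono (prod_mono Subset.rfl (subset_univ _))), fun v hv hp => ?_⟩
  have hvs : v ∈ (extChartAt (𝓡 n).tangent v₀).source := by
    rw [extChartAt_tangent_source]; exact hp.1
  refine ⟨extChartAt (𝓡 n).tangent v₀ v, ?_, (extChartAt (𝓡 n).tangent v₀).left_inv hvs⟩
  have hz := extChartAt_tangent_mem (F.indicatrixBundle_subset_slit hv) (v₀ := v₀) hp.1
  set z := extChartAt (𝓡 n).tangent v₀ v with hzdef
  have hz1 : z.1 = extChartAt (𝓡 n) v₀.proj v.proj := by rw [hzdef, extChartAt_tangent_apply]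
  have hzK : z.1 ∈ K := by rw [hz1]; exact hp.2
  refine ⟨hzK, ?_⟩
  have hy : 0 < ‖z.2‖ := norm_pos_iff.2 hz.2
  have h1 := hmS z.1 hzK (‖z.2‖⁻¹ • z.2) (by
    rw [mem_sphere_zero_iff_norm, norm_smul, norm_inv, norm_norm, inv_mul_cancel₀ hy.ne'])
  rw [extChartAt_tangent_symm_apply (v₀ := v₀) (hKs hzK)] at h1
  have h2 : F.norm ⟨(extChartAt (𝓡 n) v₀.proj).symm z.1, chartInvDeriv v₀.proj z.1 z.2⟩ = 1 := by
    have h3 := extChartAt_tangent_symm_apply (v₀ := v₀) (hKs hzK) z.2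
    have h4 : (extChartAt (𝓡 n).tangent v₀).symm (z.1, z.2) = v :=
      (extChartAt (𝓡 n).tangent v₀).left_inv hvs
    rw [h4] at h3
    have h5 : F.norm v = 1 := hv
    rw [h3] at h5
    exact h5
  rw [map_smul] at h1
  have h6 := F.homogeneous _ (chartInvDeriv v₀.proj z.1 z.2) ‖z.2‖⁻¹ (inv_pos.2 hy)
  have h7 : m ≤ ‖z.2‖⁻¹ := by
    rw [h2, mul_one] at h6
    exact h1.trans h6.le
  rw [mem_closedBall_zero_iff]
  exact (le_inv_comm₀ hm hy).1 h7

theorem isCompact_indicatrixBundle [CompactSpace M] : IsCompact F.indicatrixBundle := by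
  have key := fun p : M => F.exists_isCompact_over ⟨p, 0⟩
  choose U hU K hK hUK using key
  obtain ⟨t, ht⟩ := isCompact_univ.elim_nhds_subcover U fun p _ => hU p
  refine (t.isCompact_biUnion fun p _ => hK p).of_isClosed_subset F.isClosed_indicatrixBundle
    fun v hv => ?_
  obtain ⟨p, hp, hvp⟩ := mem_iUnion₂.1 (ht.2 (mem_univ v.proj))
  exact mem_iUnion₂.2 ⟨p, hp, hUK p v hv hvp⟩

end FinslerMetric

/-! ### The local group law of a flow -/

section FlowGroup

variable {E : Type} [NormedAddCommGroup E] [NormedSpace ℝ E]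
  {H : Type*} [TopologicalSpace H] {I : ModelWithCorners ℝ E H} [I.Boundaryless]
  {N : Type*} [TopologicalSpace N] [ChartedSpace H N] [IsManifold I ∞ N]

theorem hasMFDerivAt_comp_add {γ : ℝ → N} {W : ∀ x : N, TangentSpace I x} {s t : ℝ}
    (h : HasMFDerivAt 𝓘(ℝ, ℝ) I γ (s + t) ((1 : ℝ →L[ℝ] ℝ).smulRight (W (γ (s + t))))) :
    HasMFDerivAt 𝓘(ℝ, ℝ) I (fun s => γ (s + t)) s
      ((1 : ℝ →L[ℝ] ℝ).smulRight (W (γ (s + t)))) := by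
  have h1 : HasMFDerivAt 𝓘(ℝ, ℝ) 𝓘(ℝ, ℝ) (fun s : ℝ => s + t) s (1 : ℝ →L[ℝ] ℝ) :=
    ((hasFDerivAt_id s).add_const t).hasMFDerivAt
  exact HasMFDerivAt.comp s h h1

/-- Both sides are integral curves in `s` with the same value at `s = 0`. They are compared on the
largest interval on which both are defined, and this contains `s`. -/
theorem IsSmoothFlow.comp_eq [T2Space N] {W : ∀ x : N, TangentSpace I x} {O V : Set N} {ε : ℝ}
    {Φ : ℝ × N → N} (h : IsSmoothFlow I W O V ε Φ) (hO : IsOpen O)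
    (hW : ContMDiffOn I I.tangent ∞ (fun x => (⟨x, W x⟩ : TangentBundle I N)) O)
    {x : N} (hx : x ∈ V) {s t : ℝ} (hs : s ∈ Ioo (-ε) ε) (ht : t ∈ Ioo (-ε) ε)
    (hst : s + t ∈ Ioo (-ε) ε) (hxt : Φ (t, x) ∈ V) : Φ (s, Φ (t, x)) = Φ (s + t, x) := by
  have hε : 0 < ε := by linarith [hs.1, hs.2]
  have h0 : (0 : ℝ) ∈ Ioo (max (-ε) (-ε - t)) (min ε (ε - t)) := by
    simp only [mem_Ioo, max_lt_iff, lt_min_iff]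
    refine ⟨⟨?_, ?_⟩, ?_, ?_⟩ <;> linarith [ht.1, ht.2]
  have hs' : s ∈ Ioo (max (-ε) (-ε - t)) (min ε (ε - t)) := by
    simp only [mem_Ioo, max_lt_iff, lt_min_iff]
    refine ⟨⟨?_, ?_⟩, ?_, ?_⟩ <;> linarith [hs.1, hs.2, hst.1, hst.2]
  have hsub : ∀ r ∈ Ioo (max (-ε) (-ε - t)) (min ε (ε - t)),
      r ∈ Ioo (-ε) ε ∧ r + t ∈ Ioo (-ε) ε := by
    intro r hr
    simp only [mem_Ioo, max_lt_iff, lt_min_iff] at hr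
    refine ⟨⟨?_, ?_⟩, ?_, ?_⟩ <;> linarith [hr.1.1, hr.1.2, hr.2.1, hr.2.2]
  refine integralCurve_eqOn_Ioo (I := I) (W := W) h0 (fun r hr => ?_) (fun r hr => ?_)
    (fun r hr => ?_) ?_ hs' (γ := fun s => Φ (s, Φ (t, x))) (γ' := fun s => Φ (s + t, x))
  · exact (hW.contMDiffAt (hO.mem_nhds (h.mem r (hsub r hr).1 _ hxt))).of_le (by simp)
  · exact (h.hasMFDerivAt r (hsub r hr).1 _ hxt).hasMFDerivWithinAt
  · exact (hasMFDerivAt_comp_add (γ := fun s => Φ (s, x))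
      (h.hasMFDerivAt _ (hsub r hr).2 x hx)).hasMFDerivWithinAt
  · simp [h.zero _ hxt]

end FlowGroup

/-! ### Horizontal flows on the indicatrix bundle -/

namespace FinslerMetric

variable {n : ℕ} {M : Type*} [TopologicalSpace M]
  [ChartedSpace (EuclideanSpace ℝ (Fin n)) M] [IsManifold (𝓡 n) ∞ M] (F : FinslerMetric n M)

/-- The Finsler norm is constant along horizontal curves. -/
theorem norm_eq_of_horizontal {γ : ℝ → TangentBundle (𝓡 n) M} {u : ℝ → EuclideanSpace ℝ (Fin n)}
    {a b : ℝ} (hγ : ∀ t ∈ Ioo a b, γ t ∈ slit n M ∧ HasMFDerivAt 𝓘(ℝ, ℝ) (𝓡 n).tangent γ t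
      ((1 : ℝ →L[ℝ] ℝ).smulRight (F.horLift (γ t) (u t)))) {s t : ℝ} (hs : s ∈ Ioo a b)
    (ht : t ∈ Ioo a b) : F.norm (γ s) = F.norm (γ t) := by
  have h1 : ∀ t ∈ Ioo a b, HasDerivAt (fun s => F.norm (γ s) ^ 2) 0 t := by
    intro t ht
    obtain ⟨h0, hd⟩ := hγ t ht
    have h2 : MDifferentiableAt (𝓡 n).tangent 𝓘(ℝ, ℝ) (fun w => F.norm w ^ 2) (γ t) := by
      have h2 := (F.smooth.contMDiffAt (F.isOpen_slit.mem_nhds h0)).mdifferentiableAt (by simp)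
      have h3 : DifferentiableAt ℝ (fun x : ℝ => x ^ 2) (F.norm (γ t)) := by fun_prop
      exact MDifferentiableAt.comp _ h3.mdifferentiableAt h2
    have h4 := (HasMFDerivAt.comp t (hasMFDerivAt_mdiff h2) hd).hasFDerivAt
    have h5 : ∃ T : ℝ →L[ℝ] ℝ, HasFDerivAt (fun s => F.norm (γ s) ^ 2) T t ∧ T 1 =
      mdiff (𝓡 n).tangent (fun w => F.norm w ^ 2) (γ t) ((1 : ℝ) • F.horLift (γ t) (u t)) :=
      ⟨_, h4, rfl⟩
    obtain ⟨T, hT, hT1⟩ := h5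
    refine hT.hasDerivAt.congr_deriv (hT1.trans ?_)
    show mdiff (𝓡 n).tangent (fun w => F.norm w ^ 2) (γ t) ((1 : ℝ) • F.horLift (γ t) (u t)) = 0
    rw [one_smul, F.mdiff_energy_horLift h0]
  have h2 := isOpen_Ioo.is_const_of_deriv_eq_zero isPreconnected_Ioo
    (fun t ht => (h1 t ht).differentiableAt.differentiableWithinAt)
    (fun t ht => (h1 t ht).deriv) hs ht
  exact (sq_eq_sq₀ (F.nonneg _) (F.nonneg _)).1 h2

/-- The flow of the horizontal lift of a vector field on the indicatrix bundle. -/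
theorem exists_horizontal_flow [T2Space M] [CompactSpace M] (X : BaseField n M) :
    ∃ ε > 0, ∃ φ : F.smoothCurves, φ.1 0 = 1 ∧
      (∀ v, ∀ t ∈ Ioo (-ε) ε, HasMFDerivAt 𝓘(ℝ, ℝ) (𝓡 n).tangent (fun s => ((φ.1 s).1 v).1) t
        ((1 : ℝ →L[ℝ] ℝ).smulRight (F.horLiftField X ((φ.1 t).1 v).1))) ∧
      ∀ s ∈ Ioo (-ε) ε, ∀ t ∈ Ioo (-ε) ε, s + t ∈ Ioo (-ε) ε → φ.1 s * φ.1 t = φ.1 (s + t) := by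
  obtain ⟨V, hV, hIV, ε, hε, Φ, hΦ⟩ := exists_flow_near_compact F.isOpen_slit
    (F.contMDiffOn_horLiftField X) F.isCompact_indicatrixBundle F.indicatrixBundle_subset_slit
  have h00 : (0 : ℝ) ∈ Ioo (-ε) ε := ⟨by linarith, hε⟩
  -- The flow lines are horizontal, so `𝓕` keeps the value `1` along them.
  have hmem : ∀ t ∈ Ioo (-ε) ε, ∀ v ∈ F.indicatrixBundle, Φ (t, v) ∈ F.indicatrixBundle := by
    intro t ht v hv
    have h1 := F.norm_eq_of_horizontal (γ := fun s => Φ (s, v)) (u := fun s => X (Φ (s, v)).proj)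
      (fun s hs => ⟨hΦ.mem s hs v (hIV hv), hΦ.hasMFDerivAt s hs v (hIV hv)⟩) ht h00
    simp only [hΦ.zero v (hIV hv)] at h1
    exact h1.trans hv
  classical
  -- Outside the interval of existence the identity is used, so that the curve is defined for all
  -- real times; only times near `0` matter. With this choice `Ht (-t)` inverts `Ht t` for every
  -- `t`.
  let Ht : ℝ → F.indicatrixBundle → F.indicatrixBundle := fun t v =>
    if h : t ∈ Ioo (-ε) ε then ⟨Φ (t, v.1), hmem t h v.1 v.2⟩ else v
  have hHt : ∀ {t}, t ∈ Ioo (-ε) ε → ∀ v, (Ht t v).1 = Φ (t, v.1) := fun h v => by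
    simp only [Ht, dif_pos h]
  have hHt' : ∀ {t}, t ∉ Ioo (-ε) ε → ∀ v, Ht t v = v := fun h v => by
    simp only [Ht, dif_neg h]
  have hadd : ∀ s ∈ Ioo (-ε) ε, ∀ t ∈ Ioo (-ε) ε, s + t ∈ Ioo (-ε) ε → ∀ v,
      Ht s (Ht t v) = Ht (s + t) v := by
    intro s hs t ht hst v
    apply Subtype.ext
    rw [hHt hs, hHt ht, hHt hst]
    exact hΦ.comp_eq F.isOpen_slit (F.contMDiffOn_horLiftField X) (hIV v.2) hs ht hst
      (hIV (hmem t ht v.1 v.2))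
  have hzero : ∀ v, Ht 0 v = v := fun v => Subtype.ext (by rw [hHt h00, hΦ.zero v.1 (hIV v.2)])
  have hneg : ∀ t, t ∈ Ioo (-ε) ε → -t ∈ Ioo (-ε) ε := fun t h =>
    ⟨by linarith [h.2], by linarith [h.1]⟩
  have hinv : ∀ t v, Ht (-t) (Ht t v) = v := by
    intro t v
    by_cases h : t ∈ Ioo (-ε) ε
    · rw [hadd _ (hneg t h) _ h (by simpa using h00), neg_add_cancel, hzero]
    · rw [hHt' h, hHt' (fun h' => h (by simpa using hneg _ h'))]
  have hsm : ∀ t, SmoothAlong (𝓡 n).tangent (𝓡 n).tangent (Subtype.val : F.indicatrixBundle → _)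
      (fun v => (Ht t v).1) := by
    intro t
    by_cases h : t ∈ Ioo (-ε) ε
    · have h1 : ContMDiffOn (𝓡 n).tangent (𝓡 n).tangent ∞ (fun v => Φ (t, v)) V :=
        hΦ.contMDiffOn.comp (contMDiff_const.prodMk contMDiff_id).contMDiffOn fun v hv => ⟨h, hv⟩
      have h2 := SmoothAlong.of_contMDiffOn (e := (Subtype.val : F.indicatrixBundle → _)) hV
        (fun v => hIV v.2) h1
      refine Eq.mp (congrArg _ ?_) h2
      funext v
      exact (hHt h v).symm
    · have h2 := F.diffGroup.one_mem.1
      refine Eq.mp (congrArg _ ?_) h2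
      funext v
      exact congrArg Subtype.val (hHt' h v).symm
  let φ : ℝ → F.diffGroup := fun t =>
    ⟨⟨Ht t, Ht (-t), hinv t, fun v => by simpa using hinv (-t) v⟩, hsm t, hsm (-t)⟩
  have hφ : F.IsSmoothCurve φ := by
    refine ⟨ε, hε, ?_⟩
    have h2 := SmoothAlong.of_contMDiffOn
      (e := fun z : Ioo (-ε) ε × F.indicatrixBundle => (z.1.1, z.2.1)) (isOpen_Ioo.prod hV)
      (fun z => ⟨z.1.2, hIV z.2.2⟩) hΦ.contMDiffOn
    refine Eq.mp (congrArg _ ?_) h2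
    funext z
    exact (hHt z.1.2 z.2).symm
  refine ⟨ε, hε, ⟨φ, hφ⟩, ?_, ?_, ?_⟩
  · exact Subtype.ext (Equiv.ext hzero)
  · intro v t ht
    have h1 := hΦ.hasMFDerivAt t ht v.1 (hIV v.2)
    rw [← hHt ht v] at h1
    refine h1.congr_of_eventuallyEq ?_
    filter_upwards [Ioo_mem_nhds ht.1 ht.2] with s hs
    exact hHt hs v
  · intro s hs t ht hst
    exact Subtype.ext (Equiv.ext (hadd s hs t ht hst))

end FinslerMetric

/-! ### Derivatives of functions along vector fields -/

section

open VectorField Topology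

variable {E : Type*} [NormedAddCommGroup E] [NormedSpace ℝ E] [CompleteSpace E]
  {H : Type*} [TopologicalSpace H] {I : ModelWithCorners ℝ E H} [I.Boundaryless]
  {N : Type*} [TopologicalSpace N] [ChartedSpace H N] [IsManifold I ∞ N]
  {G : Type*} [NormedAddCommGroup G] [NormedSpace ℝ G]

theorem mdifferentiableAt_mdiff_apply {f : N → G} {W : ∀ x : N, TangentSpace I x} {x : N}
    (hf : ContMDiffAt I 𝓘(ℝ, G) ∞ f x)
    (hW : MDifferentiableAt I I.tangent (fun y => (⟨y, W y⟩ : TangentBundle I N)) x) :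
    MDifferentiableAt I 𝓘(ℝ, G) (fun y => mdiff I f y (W y)) x :=
  (mdiff_comp_extChartAt (mem_extChartAt_source (I := I) x) (mdiff_apply_eventuallyEq hf W)
    ((((contDiffAt_comp_extChartAt_symm hf).fderiv_right (m := ∞) (by simp)).differentiableAt
      (by simp)).clm_apply (differentiableAt_mpullbackWithin hW))).1

theorem mdiff_congr {f g : N → G} {x : N} (h : f =ᶠ[𝓝 x] g) : mdiff I f x = mdiff I g x :=
  h.mfderiv_eq

theorem contMDiff_mdiff_apply {f : N → G} (hf : ContMDiff I 𝓘(ℝ, G) ∞ f)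
    {W : ∀ x : N, TangentSpace I x}
    (hW : ContMDiff I I.tangent ∞ (fun y => (⟨y, W y⟩ : TangentBundle I N))) :
    ContMDiff I 𝓘(ℝ, G) ∞ (fun y => mdiff I f y (W y)) := by
  have h1 : ContMDiff I.tangent 𝓘(ℝ, G).tangent ∞ (tangentMap I 𝓘(ℝ, G) f) :=
    hf.contMDiff_tangentMap (by simp)
  exact (contMDiff_snd_tangentBundle_modelSpace G 𝓘(ℝ, G)).comp (h1.comp hW)

end

/-! ### Horizontal and curvature fields as derivations on the indicatrix bundle -/

namespace FinslerMetric

variable {n : ℕ} {M : Type*} [TopologicalSpace M]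
  [ChartedSpace (EuclideanSpace ℝ (Fin n)) M] [IsManifold (𝓡 n) ∞ M] {F : FinslerMetric n M}

/-- The velocity at `t = 0` of a smooth curve of diffeomorphisms starting at the identity. -/
def velocity (φ : F.smoothCurves) (h : φ.1 0 = 1) : F.VField :=
  Derivation.mk' (taylorCoeff φ 1) (by
    intro f g
    apply Subtype.ext
    funext v
    rw [taylorCoeff_apply]
    have hf := (contDiffAt_comp φ f v).differentiableAt (by simp)
    have hg := (contDiffAt_comp φ g v).differentiableAt (by simp)
    have h1 : deriv (fun t => f.1 ((φ.1 t).1 v) * g.1 ((φ.1 t).1 v)) 0 = _ := deriv_fun_mul hf hg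
    have h0 : ((φ.1 0).1 v) = v := by rw [h]; rfl
    have h2 : f.1 v * (taylorCoeff φ 1 g).1 v + g.1 v * (taylorCoeff φ 1 f).1 v =
        (f • taylorCoeff φ 1 g + g • taylorCoeff φ 1 f).1 v := rfl
    rw [← h2, taylorCoeff_apply, taylorCoeff_apply, iteratedDeriv_one, iteratedDeriv_one,
      iteratedDeriv_one]
    refine (congrArg _ h1).trans ?_
    rw [h0]
    simp only [Nat.factorial_one, Nat.cast_one, inv_one, one_mul]
    ring)

theorem velocity_apply (φ : F.smoothCurves) (h : φ.1 0 = 1) (f : F.smoothFun)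
    (v : F.indicatrixBundle) : (velocity φ h f).1 v = deriv (fun t => f.1 ((φ.1 t).1 v)) 0 := by
  show (taylorCoeff φ 1 f).1 v = _
  rw [taylorCoeff_apply, iteratedDeriv_one]
  simp

theorem hasLeadingCoeff_velocity (φ : F.smoothCurves) (h : φ.1 0 = 1) :
    HasLeadingCoeff φ 1 (velocity φ h : F.smoothFun →ₗ[ℝ] F.smoothFun) := by
  rw [hasLeadingCoeff_iff le_rfl]
  refine ⟨h, fun f v => ⟨fun i h1 h2 => absurd h1 (by omega), ?_⟩⟩
  rw [iteratedDeriv_one]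
  refine (velocity_apply φ h f v).symm.trans ?_
  simp

/-- The chain rule with an extension `g` that has to agree with `f` only near `v`. Differentiability
at the single point suffices, which admits functions that are smooth only off the zero section. -/
theorem velocity_eq_mdiff (φ : F.smoothCurves) (h : φ.1 0 = 1) {v : F.indicatrixBundle}
    {w : TangentSpace (𝓡 n).tangent v.1}
    (hw : HasMFDerivAt 𝓘(ℝ, ℝ) (𝓡 n).tangent (fun s => ((φ.1 s).1 v).1) 0
      ((1 : ℝ →L[ℝ] ℝ).smulRight w)) {f : F.smoothFun} {g : TangentBundle (𝓡 n) M → ℝ}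
    (hg : MDifferentiableAt (𝓡 n).tangent 𝓘(ℝ, ℝ) g v.1)
    (hgf : ∀ᶠ x in nhds v.1, ∀ hx : x ∈ F.indicatrixBundle, g x = f.1 ⟨x, hx⟩) :
    (velocity φ h f).1 v = mdiff (𝓡 n).tangent g v.1 w := by
  have h0 : ((φ.1 0).1 v).1 = v.1 := by rw [h]; rfl
  have h1 : HasMFDerivAt (𝓡 n).tangent 𝓘(ℝ, ℝ) g ((φ.1 0).1 v).1 (mdiff (𝓡 n).tangent g v.1) := by
    rw [h0]
    exact hasMFDerivAt_mdiff hg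
  have h4 := (HasMFDerivAt.comp 0 h1 hw).hasFDerivAt
  obtain ⟨T, hT, hT1⟩ : ∃ T : ℝ →L[ℝ] ℝ, HasFDerivAt (fun s => g ((φ.1 s).1 v).1) T 0 ∧
      T 1 = mdiff (𝓡 n).tangent g v.1 ((1 : ℝ) • w) := ⟨_, h4, rfl⟩
  rw [one_smul] at hT1
  rw [velocity_apply, ← hT1, ← hT.hasDerivAt.deriv]
  refine Filter.EventuallyEq.deriv_eq ?_
  have hc : Filter.Tendsto (fun s => ((φ.1 s).1 v).1) (nhds 0) (nhds v.1) := by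
    have := hw.continuousAt
    rw [ContinuousAt, h0] at this
    exact this
  filter_upwards [hc.eventually hgf] with s hs
  exact (hs ((φ.1 s).1 v).2).symm

/-- The vector field `W` and the derivation `ξ` agree on all local extensions of functions. -/
theorem IsRestriction.ext [T2Space M] {W : ∀ v : TangentBundle (𝓡 n) M, TangentSpace (𝓡 n).tangent v}
    {ξ η : F.VField} (hξ : F.IsRestriction W ξ) (hη : F.IsRestriction W η) : ξ = η := by
  suffices h : ∀ (ζ : F.VField), (∀ g, ζ (F.restrictFun g) = 0) → ζ = 0 by
    refine sub_eq_zero.1 (h (ξ - η) fun g => ?_)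
    apply Subtype.ext
    funext v
    show (ξ (F.restrictFun g)).1 v - (η (F.restrictFun g)).1 v = 0
    exact sub_eq_zero.2 ((hξ g v).trans (hη g v).symm)
  intro ζ hζ
  ext f v
  -- Multiplied by a bump function `χ`, a local extension of `f` becomes a global function, and `χ`
  -- is one itself. If `ζ` kills the restrictions of both, the Leibniz rule leaves `χ v * ζ f v = 0`
  -- with `χ v = 1`.
  obtain ⟨U, hU, hvU, g, hg, hgf⟩ := f.2 v
  obtain ⟨χ, hχ⟩ := (SmoothBumpFunction.nhds_basis_tsupport (I := (𝓡 n).tangent) v.1).mem_iff.1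
    (hU.mem_nhds hvU)
  have hgs : ContMDiff (𝓡 n).tangent 𝓘(ℝ, ℝ) ∞ (fun x => χ x * g x) := by
    refine contMDiff_of_tsupport fun x hx => ?_
    have hxU : x ∈ U := hχ.2 (tsupport_mul_subset_left hx)
    exact χ.contMDiff.contMDiffAt.mul (hg.contMDiffAt (hU.mem_nhds hxU))
  let G : C^∞⟮(𝓡 n).tangent, TangentBundle (𝓡 n) M; ℝ⟯ := ⟨fun x => χ x * g x, hgs⟩
  let C : C^∞⟮(𝓡 n).tangent, TangentBundle (𝓡 n) M; ℝ⟯ := ⟨χ, χ.contMDiff⟩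
  have h1 : F.restrictFun G = F.restrictFun C * f := by
    apply Subtype.ext
    funext w
    show χ w.1 * g w.1 = χ w.1 * f.1 w
    by_cases hw : w.1 ∈ U
    · rw [hgf w hw]
    · have : χ w.1 = 0 := by
        by_contra hne
        exact hw (hχ.2 (subset_tsupport _ hne))
      rw [this, zero_mul, zero_mul]
  have h2 := hζ G
  rw [h1, Derivation.leibniz, hζ C, smul_zero, add_zero] at h2
  have h3 := congrArg (fun k : F.smoothFun => k.1 v) h2
  have h4 : χ v.1 * (ζ f).1 v = 0 := h3
  have h5 : χ v.1 = 1 := χ.eq_one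
  rw [h5, one_mul] at h4
  exact h4

section Horizontal

open VectorField

variable [T2Space M] [CompactSpace M]

variable (F) in
/-- The flow of `X^h` on the indicatrix bundle. -/
def horFlow (X : BaseField n M) : F.smoothCurves := (F.exists_horizontal_flow X).choose_spec.2.choose

theorem horFlow_spec (X : BaseField n M) : ∃ ε > 0, (horFlow F X).1 0 = 1 ∧
    (∀ v, ∀ t ∈ Ioo (-ε) ε, HasMFDerivAt 𝓘(ℝ, ℝ) (𝓡 n).tangent
      (fun s => (((horFlow F X).1 s).1 v).1) t
        ((1 : ℝ →L[ℝ] ℝ).smulRight (F.horLiftField X (((horFlow F X).1 t).1 v).1))) ∧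
    ∀ s ∈ Ioo (-ε) ε, ∀ t ∈ Ioo (-ε) ε, s + t ∈ Ioo (-ε) ε →
      (horFlow F X).1 s * (horFlow F X).1 t = (horFlow F X).1 (s + t) :=
  ⟨_, (F.exists_horizontal_flow X).choose_spec.1,
    (F.exists_horizontal_flow X).choose_spec.2.choose_spec⟩

theorem horFlow_zero (X : BaseField n M) : (horFlow F X).1 0 = 1 := by
  obtain ⟨ε, hε, h, -⟩ := horFlow_spec (F := F) X
  exact h

variable (F) in
/-- The horizontal lift of `X` as a vector field on the indicatrix bundle. -/
def horField (X : BaseField n M) : F.VField := velocity (horFlow F X) (horFlow_zero X)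

theorem horField_eq_mdiff (X : BaseField n M) {v : F.indicatrixBundle} {f : F.smoothFun}
    {g : TangentBundle (𝓡 n) M → ℝ} (hg : MDifferentiableAt (𝓡 n).tangent 𝓘(ℝ, ℝ) g v.1)
    (hgf : ∀ᶠ x in nhds v.1, ∀ hx : x ∈ F.indicatrixBundle, g x = f.1 ⟨x, hx⟩) :
    (horField F X f).1 v = mdiff (𝓡 n).tangent g v.1 (F.horLiftField X v.1) := by
  obtain ⟨ε, hε, h0, h1, -⟩ := horFlow_spec (F := F) X
  have h2 := h1 v 0 ⟨by linarith, hε⟩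
  have h3 : ((horFlow F X).1 0).1 v = v := by rw [h0]; rfl
  rw [h3] at h2
  exact velocity_eq_mdiff _ _ h2 hg hgf

theorem isRestriction_horField (X : BaseField n M) :
    F.IsRestriction (F.horLiftField X) (horField F X) := fun g v =>
  horField_eq_mdiff X (g.contMDiff.mdifferentiableAt (by simp))
    (Filter.Eventually.of_forall fun _ _ => rfl)

theorem mdifferentiableAt_horLiftField (X : BaseField n M) {v : TangentBundle (𝓡 n) M}
    (hv : v ∈ slit n M) : MDifferentiableAt (𝓡 n).tangent (𝓡 n).tangent.tangent
      (fun v => (⟨v, F.horLiftField X v⟩ : TangentBundle (𝓡 n).tangent (TangentBundle (𝓡 n) M))) v :=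
  ((F.contMDiffOn_horLiftField X).contMDiffAt (F.isOpen_slit.mem_nhds hv)).mdifferentiableAt
    (by simp)

/-- To apply `X^h` to the function `Y^h g`, its extension `w ↦ dg(Y^h)` to `TM` is used. That
extension need not be differentiable on the zero section, but it is near the indicatrix bundle. -/
theorem isRestriction_lie_horField (X Y : BaseField n M) :
    F.IsRestriction (mlieBracket (𝓡 n).tangent (F.horLiftField X) (F.horLiftField Y))
      ⁅horField F X, horField F Y⁆ := by
  intro g v
  have hv := F.indicatrixBundle_subset_slit v.2
  have key : ∀ X Y : BaseField n M, (horField F X (horField F Y (F.restrictFun g))).1 v =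
      mdiff (𝓡 n).tangent (fun w => mdiff (𝓡 n).tangent g w (F.horLiftField Y w)) v.1
        (F.horLiftField X v.1) := by
    intro X Y
    refine horField_eq_mdiff X (mdifferentiableAt_mdiff_apply g.contMDiff.contMDiffAt
      (mdifferentiableAt_horLiftField Y hv)) (Filter.Eventually.of_forall fun x hx => ?_)
    exact (isRestriction_horField Y g ⟨x, hx⟩).symm
  have h := mdiff_mlieBracket (g.contMDiff.contMDiffAt (x := v.1))
    (mdifferentiableAt_horLiftField (F := F) X hv) (mdifferentiableAt_horLiftField (F := F) Y hv)
  rw [← key, ← key] at h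
  refine Eq.trans ?_ h.symm
  rw [Derivation.commutator_apply]
  rfl

theorem mdifferentiableAt_baseField (X : BaseField n M) (p : M) :
    MDifferentiableAt (𝓡 n) (𝓡 n).tangent (fun q => (⟨q, X q⟩ : TangentBundle (𝓡 n) M)) p :=
  (X.contMDiff p).mdifferentiableAt (by simp)

/-- The Lie bracket of vector fields on `M`. -/
def baseBracket (X Y : BaseField n M) : BaseField n M :=
  ⟨mlieBracket (𝓡 n) X Y, fun p => by
    have : IsManifold (𝓡 n) (((⊤ : ℕ∞) : WithTop ℕ∞) + 1) M := by
      have e : ((⊤ : ℕ∞) : WithTop ℕ∞) + 1 = ∞ := by simp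
      rw [e]; infer_instance
    have : IsManifold (𝓡 n) (minSmoothness ℝ 2) M :=
      IsManifold.of_le (n := ∞) (by simp; exact ENat.LEInfty.out)
    exact ContMDiffAt.mlieBracket_vectorField (n := ⊤) (m := ⊤) (X.contMDiff p) (Y.contMDiff p)
      (by simp)⟩

/-- Horizontal lifts are related by the projection to the fields on `M`, hence so are their
brackets. This is tested on the coordinates of the chart at the base point, pulled back to `TM`. -/
theorem mlieBracket_horLiftField_fst (X Y : BaseField n M) {v : TangentBundle (𝓡 n) M}
    (hv : v ∈ slit n M) :
    (show EuclideanSpace ℝ (Fin n) × EuclideanSpace ℝ (Fin n) from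
      mlieBracket (𝓡 n).tangent (F.horLiftField X) (F.horLiftField Y) v).1 =
      baseBracket X Y v.proj := by
  have hχ : ContMDiffAt (𝓡 n) 𝓘(ℝ, EuclideanSpace ℝ (Fin n)) ∞ (extChartAt (𝓡 n) v.proj) v.proj :=
    contMDiffAt_extChartAt
  have hχd : ∀ᶠ q in nhds v.proj,
      MDifferentiableAt (𝓡 n) 𝓘(ℝ, EuclideanSpace ℝ (Fin n)) (extChartAt (𝓡 n) v.proj) q := by
    filter_upwards [(chartAt (EuclideanSpace ℝ (Fin n)) v.proj).open_source.mem_nhds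
      (mem_chart_source _ v.proj)] with q hq using mdifferentiableAt_extChartAt hq
  have hproj : Filter.Tendsto (Bundle.TotalSpace.proj : TangentBundle (𝓡 n) M → M) (nhds v)
      (nhds v.proj) := (FiberBundle.continuous_proj _ _).continuousAt
  have hf : ContMDiffAt (𝓡 n).tangent 𝓘(ℝ, EuclideanSpace ℝ (Fin n)) ∞
      (fun w : TangentBundle (𝓡 n) M => extChartAt (𝓡 n) v.proj w.proj) v :=
    ContMDiffAt.comp v hχ (Bundle.contMDiffAt_proj (TangentSpace (𝓡 n) : M → Type _))
  have key : ∀ X Y : BaseField n M, mdiff (𝓡 n).tangent (fun w => mdiff (𝓡 n).tangent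
      (fun w : TangentBundle (𝓡 n) M => extChartAt (𝓡 n) v.proj w.proj) w (F.horLiftField Y w)) v
        (F.horLiftField X v) =
      mdiff (𝓡 n) (fun q => mdiff (𝓡 n) (extChartAt (𝓡 n) v.proj) q (Y q)) v.proj (X v.proj) := by
    intro X Y
    have e : (fun w => mdiff (𝓡 n).tangent (fun w : TangentBundle (𝓡 n) M =>
        extChartAt (𝓡 n) v.proj w.proj) w (F.horLiftField Y w)) =ᶠ[nhds v]
        fun w => mdiff (𝓡 n) (extChartAt (𝓡 n) v.proj) w.proj (Y w.proj) := by
      filter_upwards [hproj.eventually hχd] with w hw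
      exact mdiff_comp_proj hw (F.horLiftField Y w)
    rw [mdiff_congr e]
    exact mdiff_comp_proj (f := fun q => mdiff (𝓡 n) (extChartAt (𝓡 n) v.proj) q (Y q))
      (mdifferentiableAt_mdiff_apply hχ (mdifferentiableAt_baseField Y v.proj))
      (F.horLiftField X v)
  have h1 := mdiff_mlieBracket hf (mdifferentiableAt_horLiftField (F := F) X hv)
    (mdifferentiableAt_horLiftField (F := F) Y hv)
  have h2 := mdiff_mlieBracket hχ (mdifferentiableAt_baseField X v.proj)
    (mdifferentiableAt_baseField Y v.proj)
  rw [key, key, ← h2, mdiff_comp_proj (hχ.mdifferentiableAt (by simp)),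
    mdiff_extChartAt_self] at h1
  exact h1

variable (F) in
/-- The curvature vector field `R(X^h, Y^h)` on the indicatrix bundle. -/
def curvField (X Y : BaseField n M) : F.VField :=
  ⁅horField F X, horField F Y⁆ - horField F (baseBracket X Y)

/-- The projector `h` is idempotent and fixes horizontal lifts, so each of the three terms
containing `h` is `±h[X^h, Y^h]` and one of them survives. The horizontal part `h[X^h, Y^h]` is `[X,
Y]^h`. -/
theorem isCurvatureField_curvField (X Y : BaseField n M) :
    F.IsCurvatureField X Y (curvField F X Y) := by
  intro g v
  have hv := F.indicatrixBundle_subset_slit v.2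
  have h1 := isRestriction_lie_horField (F := F) X Y g v
  have h2 := isRestriction_horField (F := F) (baseBracket X Y) g v
  have h3 : (curvField F X Y (F.restrictFun g)).1 v =
      mdiff (𝓡 n).tangent g v.1 (mlieBracket (𝓡 n).tangent (F.horLiftField X) (F.horLiftField Y) v.1
        - F.horLiftField (baseBracket X Y) v.1) := by
    rw [map_sub]
    exact congrArg₂ (· - ·) h1 h2
  refine h3.trans (congrArg (mdiff (𝓡 n).tangent g v.1) ?_)
  have h4 : F.horLiftField (baseBracket X Y) v.1 = F.horProj v.1
      (mlieBracket (𝓡 n).tangent (F.horLiftField X) (F.horLiftField Y) v.1) :=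
    congrArg (F.horLift v.1) (mlieBracket_horLiftField_fst (F := F) X Y hv).symm
  rw [h4]
  show _ = mlieBracket (𝓡 n).tangent (F.horLiftField X) (F.horLiftField Y) v.1
    - F.horProj v.1 (mlieBracket (𝓡 n).tangent (F.horLiftField X) (F.horLiftField Y) v.1)
    - F.horProj v.1 (mlieBracket (𝓡 n).tangent (F.horLiftField X) (F.horLiftField Y) v.1)
    + F.horProj v.1 (mlieBracket (𝓡 n).tangent (F.horLiftField X) (F.horLiftField Y) v.1)
  abel

theorem IsCurvatureField.eq {X Y : BaseField n M} {ξ : F.VField} (h : F.IsCurvatureField X Y ξ) :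
    ξ = curvField F X Y := IsRestriction.ext h (isCurvatureField_curvField X Y)

theorem isBerwaldDeriv_iff {X : BaseField n M} {ξ η : F.VField} :
    F.IsBerwaldDeriv X ξ η ↔ F.IsVertical ξ ∧ η = ⁅horField F X, ξ⁆ := by
  refine and_congr_right fun _ => ⟨?_, fun h => ⟨_, isRestriction_horField X, h⟩⟩
  rintro ⟨H, hH, rfl⟩
  rw [IsRestriction.ext hH (isRestriction_horField X)]

/-- The derivative of a function along a vector field on `M`. -/
def baseDeriv (X : BaseField n M) (f : C^∞⟮𝓡 n, M; ℝ⟯) : C^∞⟮𝓡 n, M; ℝ⟯ :=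
  ⟨fun p => mdiff (𝓡 n) f p (X p), contMDiff_mdiff_apply f.contMDiff X.contMDiff⟩

variable (F) in
/-- The pull-back of a smooth function on `M` to the indicatrix bundle. -/
def liftFun (f : C^∞⟮𝓡 n, M; ℝ⟯) : F.smoothFun :=
  F.restrictFun ⟨fun v => f v.proj, f.contMDiff.comp
    (Bundle.contMDiff_proj (TangentSpace (𝓡 n) : M → Type _))⟩

theorem isVertical_iff {ξ : F.VField} : F.IsVertical ξ ↔ ∀ f, ξ (liftFun F f) = 0 := by
  refine ⟨fun h f => h f _ fun v => rfl, fun h f f' hf => ?_⟩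
  rw [show f' = liftFun F f from Subtype.ext (funext hf), h]

theorem horField_liftFun (X : BaseField n M) (f : C^∞⟮𝓡 n, M; ℝ⟯) :
    horField F X (liftFun F f) = liftFun F (baseDeriv X f) := by
  apply Subtype.ext
  funext v
  refine (isRestriction_horField X _ v).trans ?_
  exact mdiff_comp_proj (f.contMDiff.mdifferentiableAt (by simp)) (F.horLiftField X v.1)

variable (F) in
/-- The Lie algebra of vertical vector fields. -/
def verticalAlgebra : LieSubalgebra ℝ F.VField where
  carrier := {ξ | ∀ f, ξ (liftFun F f) = 0}
  zero_mem' f := rfl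
  add_mem' {ξ η} hξ hη f := by
    rw [Derivation.add_apply, hξ, hη, add_zero]
  smul_mem' c ξ hξ f := by
    rw [Derivation.smul_apply, hξ, smul_zero]
  lie_mem' {ξ η} hξ hη f := by
    rw [Derivation.commutator_apply, hξ, hη, map_zero, map_zero, sub_zero]

/-- `X^h` sends functions of the base point to functions of the base point, so both terms of the
commutator vanish on them. -/
theorem lie_horField_mem_verticalAlgebra (X : BaseField n M) {ξ : F.VField}
    (hξ : ξ ∈ verticalAlgebra F) : ⁅horField F X, ξ⁆ ∈ verticalAlgebra F := by
  intro f
  rw [Derivation.commutator_apply, hξ, horField_liftFun, hξ, map_zero, sub_zero]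

theorem curvField_mem_verticalAlgebra (X Y : BaseField n M) :
    curvField F X Y ∈ verticalAlgebra F := by
  intro f
  rw [curvField, Derivation.sub_apply, Derivation.commutator_apply, horField_liftFun,
    horField_liftFun, horField_liftFun, horField_liftFun, horField_liftFun]
  apply Subtype.ext
  funext v
  show mdiff (𝓡 n) (fun p => mdiff (𝓡 n) f p (Y p)) v.1.proj (X v.1.proj) -
    mdiff (𝓡 n) (fun p => mdiff (𝓡 n) f p (X p)) v.1.proj (Y v.1.proj) -
    mdiff (𝓡 n) f v.1.proj (mlieBracket (𝓡 n) X Y v.1.proj) = 0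
  rw [mdiff_mlieBracket f.contMDiff.contMDiffAt (mdifferentiableAt_baseField X _)
    (mdifferentiableAt_baseField Y _), sub_self]

theorem mem_infHolonomyAlgebra_iff {ξ : F.VField} : ξ ∈ F.infHolonomyAlgebra ↔
    ∀ L : LieSubalgebra ℝ F.VField, ((∀ X Y ξ, F.IsCurvatureField X Y ξ → ξ ∈ L) ∧
      (∀ ξ ∈ L, ∀ X η, F.IsBerwaldDeriv X ξ η → η ∈ L)) → ξ ∈ L := by
  rw [infHolonomyAlgebra, ← SetLike.mem_coe, LieSubalgebra.coe_sInf]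
  exact mem_iInter₂

theorem curvField_mem_infHolonomyAlgebra (X Y : BaseField n M) :
    curvField F X Y ∈ F.infHolonomyAlgebra := by
  rw [mem_infHolonomyAlgebra_iff]
  exact fun L hL => hL.1 X Y _ (isCurvatureField_curvField X Y)

/-- The minimality of the infinitesimal holonomy algebra, freed of existential conditions:
restrictions of fields of `TM` are unique, so the relations defining curvature fields and Berwald
derivatives single out `curvField` and brackets with `horField`. -/
theorem infHolonomyAlgebra_le {L : LieSubalgebra ℝ F.VField} (h : ∀ X Y, curvField F X Y ∈ L)
    (h' : ∀ X, ∀ ξ ∈ L, F.IsVertical ξ → ⁅horField F X, ξ⁆ ∈ L) : F.infHolonomyAlgebra ≤ L := by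
  refine sInf_le ⟨fun X Y ξ hξ => ?_, fun ξ hξ X η hη => ?_⟩
  · rw [hξ.eq]
    exact h X Y
  · obtain ⟨hv, rfl⟩ := isBerwaldDeriv_iff.1 hη
    exact h' X ξ hξ hv

/-- The vertical fields form a Lie algebra that contains the curvature fields and is stable under
brackets with horizontal lifts, so minimality applies. -/
theorem isVertical_of_mem_infHolonomyAlgebra {ξ : F.VField} (hξ : ξ ∈ F.infHolonomyAlgebra) :
    F.IsVertical ξ :=
  isVertical_iff.2 (infHolonomyAlgebra_le (L := verticalAlgebra F) curvField_mem_verticalAlgebra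
    (fun X _ h _ => lie_horField_mem_verticalAlgebra X h) hξ)

theorem exists_berwaldDeriv_mem (X : BaseField n M) {ξ : F.VField}
    (hξ : ξ ∈ F.infHolonomyAlgebra) : ∃ η ∈ F.infHolonomyAlgebra, F.IsBerwaldDeriv X ξ η := by
  have hB : F.IsBerwaldDeriv X ξ ⁅horField F X, ξ⁆ :=
    isBerwaldDeriv_iff.2 ⟨isVertical_of_mem_infHolonomyAlgebra hξ, rfl⟩
  refine ⟨_, ?_, hB⟩
  rw [mem_infHolonomyAlgebra_iff] at hξ ⊢
  exact fun L hL => hL.2 ξ (hξ L hL) X _ hB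

end Horizontal
end FinslerMetric

/-! ### Linearity of the curvature over functions on the base -/

section Derivation

variable {A : Type*} [CommRing A] [Algebra ℝ A]

theorem derivation_add_lie (D D' D'' : Derivation ℝ A A) : ⁅D + D', D''⁆ = ⁅D, D''⁆ + ⁅D', D''⁆ :=
  add_lie _ _ _

theorem derivation_smul_sub (a : A) (D D' : Derivation ℝ A A) : a • (D - D') = a • D - a • D' :=
  smul_sub _ _ _

theorem derivation_smul_neg (a : A) (D : Derivation ℝ A A) : a • -D = -(a • D) := smul_neg _ _

theorem derivation_smul_lie (a : A) (D D' : Derivation ℝ A A) :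
    ⁅a • D, D'⁆ = a • ⁅D, D'⁆ - D' a • D := by
  ext b
  simp only [Derivation.commutator_apply, Derivation.sub_apply, Derivation.smul_apply, smul_eq_mul,
    Derivation.leibniz]
  ring

theorem derivation_eq_zero (D : Derivation ℝ A A) (h : D = D + D) : D = 0 := left_eq_add.1 h

end Derivation

namespace FinslerMetric

open VectorField

variable {n : ℕ} {M : Type*} [TopologicalSpace M]
  [ChartedSpace (EuclideanSpace ℝ (Fin n)) M] [IsManifold (𝓡 n) ∞ M] {F : FinslerMetric n M}

theorem IsRestriction.add {W W' : ∀ v : TangentBundle (𝓡 n) M, TangentSpace (𝓡 n).tangent v}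
    {ξ η : F.VField} (hξ : F.IsRestriction W ξ) (hη : F.IsRestriction W' η) :
    F.IsRestriction (fun v => W v + W' v) (ξ + η) := by
  intro g v
  show (ξ (F.restrictFun g)).1 v + (η (F.restrictFun g)).1 v = _
  exact (congrArg₂ (· + ·) (hξ g v) (hη g v)).trans (map_add (mdiff (𝓡 n).tangent g v.1) _ _).symm

theorem IsRestriction.smul {W : ∀ v : TangentBundle (𝓡 n) M, TangentSpace (𝓡 n).tangent v}
    {ξ : F.VField} (hξ : F.IsRestriction W ξ) {f : TangentBundle (𝓡 n) M → ℝ} {f' : F.smoothFun}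
    (hf : ∀ v : F.indicatrixBundle, f'.1 v = f v.1) :
    F.IsRestriction (fun v => f v • W v) (f' • ξ) := by
  intro g v
  show f'.1 v * (ξ (F.restrictFun g)).1 v = _
  rw [hf]
  exact (congrArg (f v.1 * ·) (hξ g v)).trans (map_smul (mdiff (𝓡 n).tangent g v.1) _ _).symm

/-- The product of a function and a vector field on `M`. -/
def smulField (f : C^∞⟮𝓡 n, M; ℝ⟯) (X : BaseField n M) : BaseField n M :=
  ⟨fun p => f p • X p, f.contMDiff.smul_section X.contMDiff⟩

theorem liftFun_mul (f g : C^∞⟮𝓡 n, M; ℝ⟯) : liftFun F (f * g) = liftFun F f * liftFun F g := rfl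

variable [T2Space M] [CompactSpace M]

theorem baseBracket_swap (X Y : BaseField n M) : baseBracket Y X = -baseBracket X Y := by
  ext p : 1
  exact mlieBracket_swap_apply

theorem baseBracket_add_left (X X' Y : BaseField n M) :
    baseBracket (X + X') Y = baseBracket X Y + baseBracket X' Y := by
  ext p : 1
  exact mlieBracket_add_left (mdifferentiableAt_baseField X p) (mdifferentiableAt_baseField X' p)

theorem baseBracket_smulField_left (f : C^∞⟮𝓡 n, M; ℝ⟯) (X Y : BaseField n M) :
    baseBracket (smulField f X) Y =
      smulField f (baseBracket X Y) - smulField (baseDeriv Y f) X := by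
  ext p : 1
  refine (mlieBracket_smul_left (f.contMDiff.mdifferentiableAt (by simp))
    (mdifferentiableAt_baseField X p)).trans ?_
  show -(mdiff (𝓡 n) f p (Y p)) • X p + f p • mlieBracket (𝓡 n) X Y p =
    f p • mlieBracket (𝓡 n) X Y p - mdiff (𝓡 n) f p (Y p) • X p
  rw [neg_smul]
  abel

theorem horField_add (X Y : BaseField n M) :
    horField F (X + Y) = horField F X + horField F Y := by
  refine IsRestriction.ext (isRestriction_horField (X + Y)) ?_
  refine Eq.mp (congrArg (fun W => F.IsRestriction W _) ?_)
    ((isRestriction_horField X).add (isRestriction_horField Y))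
  funext v
  exact (F.horLift_add v _ _).symm

theorem horField_smulField (f : C^∞⟮𝓡 n, M; ℝ⟯) (X : BaseField n M) :
    horField F (smulField f X) = liftFun F f • horField F X := by
  refine IsRestriction.ext (isRestriction_horField (smulField f X)) ?_
  refine Eq.mp (congrArg (fun W => F.IsRestriction W _) ?_)
    ((isRestriction_horField X).smul (f := fun v => f v.proj) (f' := liftFun F f) fun _ => rfl)
  funext v
  exact (F.horLift_smul v _ _).symm

variable (F) in
/-- The horizontal lift, as an additive map. -/
def horHom : BaseField n M →+ F.VField where
  toFun := horField F
  map_zero' := by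
    have h := horField_add (F := F) (0 : BaseField n M) 0
    rw [add_zero] at h
    exact derivation_eq_zero _ h
  map_add' := horField_add

theorem horField_sub (X Y : BaseField n M) :
    horField F (X - Y) = horField F X - horField F Y := map_sub (horHom F) X Y

theorem horField_neg (X : BaseField n M) : horField F (-X) = -horField F X := map_neg (horHom F) X

theorem curvField_swap (X Y : BaseField n M) : curvField F Y X = -curvField F X Y := by
  rw [curvField, curvField, baseBracket_swap X Y, horField_neg, ← lie_skew (horField F X)]
  abel

theorem curvField_add_left (X X' Y : BaseField n M) :
    curvField F (X + X') Y = curvField F X Y + curvField F X' Y := by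
  simp only [curvField, baseBracket_add_left, horField_add, derivation_add_lie]
  abel

/-- Both `[(f X)^h, Y^h]` and `[f X, Y]^h` contain the term `-(Y f) X^h`, which cancels in the
difference. -/
theorem curvField_smulField_left (f : C^∞⟮𝓡 n, M; ℝ⟯) (X Y : BaseField n M) :
    curvField F (smulField f X) Y = liftFun F f • curvField F X Y := by
  simp only [curvField, baseBracket_smulField_left, horField_sub, horField_smulField,
    derivation_smul_lie, horField_liftFun, derivation_smul_sub]
  abel

theorem curvField_smulField_right (f : C^∞⟮𝓡 n, M; ℝ⟯) (X Y : BaseField n M) :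
    curvField F X (smulField f Y) = liftFun F f • curvField F X Y := by
  rw [curvField_swap, curvField_smulField_left, curvField_swap]
  rw [derivation_smul_neg]
  abel

theorem curvField_sum_left {ι : Type*} (s : Finset ι) (X : ι → BaseField n M) (Y : BaseField n M) :
    curvField F (∑ i ∈ s, X i) Y = ∑ i ∈ s, curvField F (X i) Y :=
  map_sum (AddMonoidHom.mk' (fun X => curvField F X Y) fun X X' => curvField_add_left X X' Y) X s

theorem curvField_add_right (X Y Y' : BaseField n M) :
    curvField F X (Y + Y') = curvField F X Y + curvField F X Y' := by
  rw [curvField_swap, curvField_add_left, curvField_swap Y, curvField_swap Y' X]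
  abel

theorem curvField_sum_right {ι : Type*} (s : Finset ι) (X : BaseField n M) (Y : ι → BaseField n M) :
    curvField F X (∑ i ∈ s, Y i) = ∑ i ∈ s, curvField F X (Y i) :=
  map_sum (AddMonoidHom.mk' (curvField F X) (curvField_add_right X)) Y s

end FinslerMetric
-- Reduction of curvature fields to coordinate fields
namespace FinslerMetric

open VectorField

theorem smul_sum_smul {ι E : Type*} [Fintype ι] [AddCommGroup E] [Module ℝ E] (c : ℝ) (a : ι → ℝ)
    (w : ι → E) : c • ∑ i, a i • w i = ∑ i, (c * (1 * a i)) • (1 : ℝ) • w i := by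
  simp only [Finset.smul_sum, mul_smul, one_smul]

variable {n : ℕ} {M : Type*} [TopologicalSpace M]
  [ChartedSpace (EuclideanSpace ℝ (Fin n)) M] [IsManifold (𝓡 n) ∞ M]

theorem tangentCoordChange_tangentCoordChange {p q : M} (hq : q ∈ (extChartAt (𝓡 n) p).source)
    (u : EuclideanSpace ℝ (Fin n)) :
    tangentCoordChange (𝓡 n) q p q (tangentCoordChange (𝓡 n) p q q u) = u :=
  (tangentCoordChange_comp ⟨⟨hq, mem_extChartAt_source q⟩, hq⟩).trans (tangentCoordChange_self hq)

theorem tangentCoordChange_tangentCoordChange_self {p q : M}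
    (hq : q ∈ (extChartAt (𝓡 n) p).source) (u : EuclideanSpace ℝ (Fin n)) :
    tangentCoordChange (𝓡 n) p q q (tangentCoordChange (𝓡 n) q p q u) = u :=
  (tangentCoordChange_comp ⟨⟨mem_extChartAt_source q, hq⟩, mem_extChartAt_source q⟩).trans
    (tangentCoordChange_self (mem_extChartAt_source q))

theorem contMDiffOn_chartVector (p : M) (u : EuclideanSpace ℝ (Fin n)) :
    ContMDiffOn (𝓡 n) (𝓡 n).tangent ∞ (fun q => (⟨q, tangentCoordChange (𝓡 n) p q q u⟩ :
      TangentBundle (𝓡 n) M)) (chartAt (EuclideanSpace ℝ (Fin n)) p).source := by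
  have hm : MapsTo (fun q => (⟨q, tangentCoordChange (𝓡 n) p q q u⟩ : TangentBundle (𝓡 n) M))
      (chartAt (EuclideanSpace ℝ (Fin n)) p).source
      (trivializationAt (EuclideanSpace ℝ (Fin n)) (TangentSpace (𝓡 n)) p).source := by
    intro q hq
    exact hq
  rw [(trivializationAt (EuclideanSpace ℝ (Fin n)) (TangentSpace (𝓡 n)) p).contMDiffOn_iff hm]
  refine ⟨contMDiffOn_id, (contMDiffOn_const (c := u)).congr fun q hq => ?_⟩
  rw [← extChartAt_source (𝓡 n)] at hq
  exact tangentCoordChange_tangentCoordChange hq u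

variable [T2Space M]

/-- The coordinate vector field `∂_i` of the chart at `p`, multiplied by a bump function. -/
def coordField {p : M} (χ : SmoothBumpFunction (𝓡 n) p) (i : Fin n) : BaseField n M :=
  ⟨fun q => χ q • (tangentCoordChange (𝓡 n) p q q (coordVec n i) : TangentSpace (𝓡 n) q),
    ContMDiffOn.smul_section_of_tsupport χ.contMDiff.contMDiffOn
      (chartAt (EuclideanSpace ℝ (Fin n)) p).open_source χ.tsupport_subset_chartAt_source
      (contMDiffOn_chartVector p (coordVec n i))⟩

/-- The coefficients of a vector field in the chart at `p`, multiplied by a bump function. -/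
def coordCoeff {p : M} (χ : SmoothBumpFunction (𝓡 n) p) (X : BaseField n M) (i : Fin n) :
    C^∞⟮𝓡 n, M; ℝ⟯ :=
  ⟨fun q => χ q * (show EuclideanSpace ℝ (Fin n) from tangentCoordChange (𝓡 n) q p q (X q)) i, by
    refine contMDiff_of_tsupport fun q hq => χ.contMDiff.contMDiffAt.mul ?_
    have hq' : q ∈ (chartAt (EuclideanSpace ℝ (Fin n)) p).source :=
      χ.tsupport_subset_chartAt_source (tsupport_mul_subset_left hq)
    have h := (((trivializationAt (EuclideanSpace ℝ (Fin n)) (TangentSpace (𝓡 n)) p).contMDiffAt_iff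
      (x₀ := q) (f := fun q => (⟨q, X q⟩ : TangentBundle (𝓡 n) M)) hq').1 (X.contMDiff q)).2
    exact (EuclideanSpace.proj (𝕜 := ℝ) i : EuclideanSpace ℝ (Fin n) →L[ℝ] ℝ).contDiff.contMDiff.contMDiffAt.comp q h⟩

/-- The neighbourhoods of `p` which are balls in the chart. -/
def chartBall (p : M) (δ : ℝ) : Set M :=
  {q | q ∈ (extChartAt (𝓡 n) p).source ∧ dist (extChartAt (𝓡 n) p q) (extChartAt (𝓡 n) p p) < δ}

theorem chartBall_mem_nhds (p : M) {δ : ℝ} (hδ : 0 < δ) : chartBall (n := n) p δ ∈ nhds p :=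
  Filter.inter_mem ((isOpen_extChartAt_source p).mem_nhds (mem_extChartAt_source p))
    ((continuousAt_extChartAt (I := 𝓡 n) p).preimage_mem_nhds (Metric.ball_mem_nhds _ hδ))

theorem bump_eq_one {p : M} (χ : SmoothBumpFunction (𝓡 n) p) {q : M}
    (hq : q ∈ chartBall (n := n) p χ.rIn) : χ q = 1 := by
  refine χ.one_of_dist_le ?_ hq.2.le
  rw [← extChartAt_source (𝓡 n)]
  exact hq.1

/-- Where `g` is nonzero the bump function equals `1`, so this is the expansion of `X` in
coordinates; elsewhere both sides vanish. -/
theorem smulField_eq_sum {p : M} (χ : SmoothBumpFunction (𝓡 n) p) (X : BaseField n M)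
    (g : C^∞⟮𝓡 n, M; ℝ⟯) (hg : ∀ q, g q ≠ 0 → q ∈ chartBall (n := n) p χ.rIn) :
    smulField g X = ∑ i, smulField (g * coordCoeff χ X i) (coordField χ i) := by
  ext q : 1
  have h0 : (∑ i, smulField (g * coordCoeff χ X i) (coordField χ i)) q =
      ∑ i, smulField (g * coordCoeff χ X i) (coordField χ i) q := by
    have h1 := map_sum (ContMDiffSection.coeAddHom (𝓡 n) (EuclideanSpace ℝ (Fin n)) ∞
      (TangentSpace (𝓡 n) : M → Type _)) (fun i => smulField (g * coordCoeff χ X i) (coordField χ i))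
      Finset.univ
    exact (congrFun h1 q).trans (Finset.sum_apply _ _ _)
  rw [h0]
  show g q • X q = ∑ i, (g q * (χ q * (show EuclideanSpace ℝ (Fin n) from
    tangentCoordChange (𝓡 n) q p q (X q)) i)) •
      (χ q • (tangentCoordChange (𝓡 n) p q q (coordVec n i) : TangentSpace (𝓡 n) q))
  by_cases h : g q = 0
  · simp only [h, zero_mul, zero_smul, Finset.sum_const_zero]
    rfl
  rw [bump_eq_one χ (hg q h)]
  have h1 := tangentCoordChange_tangentCoordChange_self (hg q h).1 (X q)
  set u : EuclideanSpace ℝ (Fin n) := tangentCoordChange (𝓡 n) q p q (X q) with hu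
  have h2 : u = ∑ i, u i • coordVec n i := by
    ext j
    simp [Finset.sum_apply, Pi.single_apply]
  have h3 : tangentCoordChange (𝓡 n) p q q u =
      ∑ i, u i • tangentCoordChange (𝓡 n) p q q (coordVec n i) := by
    conv_lhs => rw [h2]
    rw [map_sum]
    simp only [map_smul]
  refine (congrArg (g q • ·) (h1.symm.trans h3)).trans ?_
  exact smul_sum_smul (g q) u fun i => tangentCoordChange (𝓡 n) p q q (coordVec n i)

theorem liftFun_sum_one_smul {F : FinslerMetric n M} {ι : Type*} [Fintype ι]
    (ρ : ι → C^∞⟮𝓡 n, M; ℝ⟯) (hρ : ∀ q, ∑ i, ρ i q = 1) (ξ : F.VField) :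
    ξ = ∑ i, liftFun F (ρ i) • ξ := by
  have h1 : ∑ i, liftFun F (ρ i) = 1 := by
    apply Subtype.ext
    funext v
    exact (coe_sum_smoothFun _ _ v).trans (hρ v.1.proj)
  calc ξ = (1 : F.smoothFun) • ξ := (one_smul _ ξ).symm
    _ = _ := by rw [← h1]; exact Finset.sum_smul

variable [CompactSpace M]

/-- Every curvature vector field belongs to a space of vector fields, if this space contains the
curvature vector fields `R(g ∂_i, ∂_j)` for functions `g` supported in small coordinate balls. -/
theorem curvField_mem_of_coordField {F : FinslerMetric n M} (L : Submodule ℝ F.VField)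
    (h : ∀ (p : M) (χ : SmoothBumpFunction (𝓡 n) p) (i j : Fin n) (g : C^∞⟮𝓡 n, M; ℝ⟯),
      (∀ q, g q ≠ 0 → q ∈ chartBall (n := n) p (χ.rIn / 4)) →
      liftFun F g • curvField F (coordField χ i) (coordField χ j) ∈ L) (X Y : BaseField n M) :
    curvField F X Y ∈ L := by
  have hloc : ∀ (p : M) (χ : SmoothBumpFunction (𝓡 n) p) (g : C^∞⟮𝓡 n, M; ℝ⟯),
      (∀ q, g q ≠ 0 → q ∈ chartBall (n := n) p (χ.rIn / 4)) →
      liftFun F g • curvField F X Y ∈ L := by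
    intro p χ g hg
    have hg' : ∀ q, g q ≠ 0 → q ∈ chartBall (n := n) p χ.rIn := fun q hq =>
      ⟨(hg q hq).1, (hg q hq).2.trans (by linarith [χ.rIn_pos])⟩
    rw [← curvField_smulField_left, smulField_eq_sum χ X g hg', curvField_sum_left]
    refine L.sum_mem fun i _ => ?_
    -- Linearity over functions carries the factor `g` to the second argument, so that `Y` too is
    -- expanded only where the bump function is `1`.
    have e : curvField F (smulField (g * coordCoeff χ X i) (coordField χ i)) Y =
        liftFun F (coordCoeff χ X i) • curvField F (coordField χ i) (smulField g Y) := by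
      rw [curvField_smulField_left, curvField_smulField_right, mul_comm, liftFun_mul]
      exact mul_smul _ _ _
    rw [e, smulField_eq_sum χ Y g hg', curvField_sum_right]
    have e2 : liftFun F (coordCoeff χ X i) • ∑ j, curvField F (coordField χ i)
        (smulField (g * coordCoeff χ Y j) (coordField χ j)) = ∑ j, liftFun F (coordCoeff χ X i *
          (g * coordCoeff χ Y j)) • curvField F (coordField χ i) (coordField χ j) := by
      refine Finset.smul_sum.trans (Finset.sum_congr rfl fun j _ => ?_)
      rw [curvField_smulField_right, liftFun_mul]
      exact (mul_smul _ _ _).symm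
    rw [e2]
    refine L.sum_mem fun j _ => h p χ i j _ fun q hq => hg q ?_
    rintro h0
    exact hq (by show coordCoeff χ X i q * (g q * coordCoeff χ Y j q) = 0; rw [h0]; ring)
  have hχ : ∀ p : M, Nonempty (SmoothBumpFunction (𝓡 n) p) := fun p => inferInstance
  let χ : ∀ p : M, SmoothBumpFunction (𝓡 n) p := fun p => (hχ p).some
  -- Supports lie in balls of radius `ρ = rIn / 4`. This leaves room for parallelograms with sides
  -- shorter than `ρ`: their corners stay within `3 ρ`, and flow lines from there within `4 ρ`.
  obtain ⟨t, ht⟩ := isCompact_univ.elim_nhds_subcover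
    (fun p => interior (chartBall (n := n) p ((χ p).rIn / 4)))
    fun p _ => interior_mem_nhds.2 (chartBall_mem_nhds p (by linarith [(χ p).rIn_pos]))
  obtain ⟨ρ, hρ⟩ := SmoothPartitionOfUnity.exists_isSubordinate (𝓡 n) (isClosed_univ (X := M))
    (fun p : t => interior (chartBall (n := n) p.1 ((χ p.1).rIn / 4))) (fun _ => isOpen_interior)
    (fun q hq => by
      obtain ⟨p, hp, hqp⟩ := mem_iUnion₂.1 (ht.2 hq)
      exact mem_iUnion.2 ⟨⟨p, hp⟩, hqp⟩)
  rw [liftFun_sum_one_smul (fun p : t => ρ p) (fun q => by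
    rw [← ρ.sum_eq_one (mem_univ q), finsum_eq_sum_of_fintype]) (curvField F X Y)]
  refine L.sum_mem fun p _ => hloc p.1 (χ p.1) _ fun q hq => ?_
  exact interior_subset (hρ p (subset_tsupport _ hq))

end FinslerMetric
-- Concatenation of parallel translations
namespace FinslerMetric

theorem toSpanSingleton_comp_toSpanSingleton {E : Type*} [NormedAddCommGroup E] [NormedSpace ℝ E]
    (w : E) (a : ℝ) : (ContinuousLinearMap.toSpanSingleton ℝ w).comp
      (ContinuousLinearMap.toSpanSingleton ℝ a) = ContinuousLinearMap.toSpanSingleton ℝ (a • w) := by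
  ext
  simp

variable {n : ℕ} {M : Type*} [TopologicalSpace M]
  [ChartedSpace (EuclideanSpace ℝ (Fin n)) M] [IsManifold (𝓡 n) ∞ M] (F : FinslerMetric n M)

/-- `T` is the parallel translation of indicatrices along a piecewise `C^r` curve from `p` to
`q`. -/
def IsTransport (r : ℕ∞) (p q : M) (T : F.indicatrix p → F.indicatrix q) : Prop :=
  ∃ (m : ℕ) (τ : ℕ → ℝ) (c : ℝ → M), IsSubdivision m τ ∧
    (∀ i < m, ContMDiffOn 𝓘(ℝ, ℝ) (𝓡 n) r c (Icc (τ i) (τ (i + 1)))) ∧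
    c 0 = p ∧ c 1 = q ∧
    ∀ y : F.indicatrix p, ∃ V : ℝ → TangentBundle (𝓡 n) M,
      F.IsParallel m τ c V ∧ V 0 = ⟨p, y.1⟩ ∧ V 1 = ⟨q, (T y).1⟩

theorem IsSubdivision.le_one {m : ℕ} {τ : ℕ → ℝ} (h : IsSubdivision m τ) {i : ℕ} (hi : i ≤ m) :
    τ i ≤ 1 := by
  induction hi using Nat.decreasingInduction with
  | self => exact h.2.1.le
  | of_succ k hk ih => exact (h.2.2 k hk).le.trans ih

theorem IsSubdivision.nonneg {m : ℕ} {τ : ℕ → ℝ} (h : IsSubdivision m τ) {i : ℕ} (hi : i ≤ m) :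
    0 ≤ τ i := by
  induction i with
  | zero => exact h.1.ge
  | succ k ih => exact (ih (by omega)).trans (h.2.2 k (by omega)).le

/-- The concatenation of two curves defined on the unit interval. -/
def join {α : Type*} (c c' : ℝ → α) (s : ℝ) : α :=
  if s ≤ 1 / 2 then c (2 * s) else c' (2 * s - 1)

/-- The concatenation of two subdivisions of the unit interval. -/
def joinSubdivision (m : ℕ) (τ τ' : ℕ → ℝ) (i : ℕ) : ℝ :=
  if i < m then τ i / 2 else (1 + τ' (i - m)) / 2

theorem join_of_le {α : Type*} {c c' : ℝ → α} {s : ℝ} (hs : s ≤ 1 / 2) :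
    join c c' s = c (2 * s) := if_pos hs

theorem join_of_ge {α : Type*} {c c' : ℝ → α} (h : c 1 = c' 0) {s : ℝ} (hs : 1 / 2 ≤ s) :
    join c c' s = c' (2 * s - 1) := by
  rcases hs.eq_or_lt with rfl | hs
  · rw [join_of_le le_rfl]
    norm_num
    exact h
  · exact if_neg hs.not_ge

theorem joinSubdivision_of_le {m : ℕ} {τ τ' : ℕ → ℝ} (h : τ m = 1) (h' : τ' 0 = 0) {i : ℕ}
    (hi : i ≤ m) : joinSubdivision m τ τ' i = τ i / 2 := by
  rcases hi.eq_or_lt with rfl | hi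
  · rw [joinSubdivision, if_neg (lt_irrefl _), Nat.sub_self, h, h', add_zero]
  · exact if_pos hi

theorem joinSubdivision_add {m : ℕ} {τ τ' : ℕ → ℝ} (i : ℕ) :
    joinSubdivision m τ τ' (m + i) = (1 + τ' i) / 2 := by
  rw [joinSubdivision, if_neg (by omega), Nat.add_sub_cancel_left]

theorem IsSubdivision.join {m m' : ℕ} {τ τ' : ℕ → ℝ} (h : IsSubdivision m τ)
    (h' : IsSubdivision m' τ') : IsSubdivision (m + m') (joinSubdivision m τ τ') := by
  refine ⟨?_, ?_, fun i hi => ?_⟩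
  · rw [joinSubdivision_of_le h.2.1 h'.1 (Nat.zero_le m), h.1, zero_div]
  · rw [joinSubdivision_add, h'.2.1]
    norm_num
  · rcases lt_or_ge i m with him | him
    · rw [joinSubdivision_of_le h.2.1 h'.1 him.le, joinSubdivision_of_le h.2.1 h'.1 him]
      linarith [h.2.2 i him]
    · obtain ⟨k, rfl⟩ := Nat.exists_eq_add_of_le him
      rw [add_assoc, joinSubdivision_add, joinSubdivision_add]
      linarith [h'.2.2 k (by omega)]

/-- A property of the pieces of two curves which is inherited by the pieces of the
concatenation. -/
theorem forall_join {α : Type*} {c c' : ℝ → α} (hc : c 1 = c' 0) {m m' : ℕ} {τ τ' : ℕ → ℝ}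
    (h : IsSubdivision m τ) (h' : IsSubdivision m' τ') {P : (ℝ → α) → ℝ → ℝ → Prop}
    (hP : ∀ (f g : ℝ → α) (a b k : ℝ), P f (2 * a - k) (2 * b - k) →
      (∀ s ∈ Icc a b, g s = f (2 * s - k)) → P g a b)
    (h1 : ∀ i < m, P c (τ i) (τ (i + 1))) (h2 : ∀ i < m', P c' (τ' i) (τ' (i + 1))) :
    ∀ i < m + m', P (FinslerMetric.join c c') (joinSubdivision m τ τ' i)
      (joinSubdivision m τ τ' (i + 1)) := by
  intro i hi
  rcases lt_or_ge i m with him | him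
  · rw [joinSubdivision_of_le h.2.1 h'.1 him.le, joinSubdivision_of_le h.2.1 h'.1 him]
    refine hP c _ _ _ 0 ?_ fun s hs => ?_
    · convert! h1 i him using 1 <;> ring
    · rw [join_of_le, sub_zero]
      linarith [hs.2, h.le_one (i := i + 1) him]
  · obtain ⟨k, rfl⟩ := Nat.exists_eq_add_of_le him
    rw [add_assoc, joinSubdivision_add, joinSubdivision_add]
    refine hP c' _ _ _ 1 ?_ fun s hs => ?_
    · convert! h2 k (by omega) using 1 <;> ring
    · rw [join_of_ge hc]
      linarith [hs.1, h'.nonneg (i := k) (by omega)]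

/-- The velocity of `V` is horizontal on `[a, b]`. -/
def IsHorizontalOn (V : ℝ → TangentBundle (𝓡 n) M) (a b : ℝ) : Prop :=
  ∀ s ∈ Icc a b, ∃ w : TangentSpace (𝓡 n).tangent (V s),
    HasMFDerivWithinAt 𝓘(ℝ, ℝ) (𝓡 n).tangent V (Icc a b) s
      (ContinuousLinearMap.toSpanSingleton ℝ w) ∧ F.horProj (V s) w = w

theorem horProj_smul (v : TangentBundle (𝓡 n) M) (c : ℝ)
    (w : EuclideanSpace ℝ (Fin n) × EuclideanSpace ℝ (Fin n)) (hw : F.horProj v w = w) :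
    F.horProj v (c • w) = (c • w : EuclideanSpace ℝ (Fin n) × EuclideanSpace ℝ (Fin n)) :=
  (F.horLift_smul v c w.1).trans (congrArg (c • ·) hw)

variable {F}

theorem IsHorizontalOn.comp_affine {f g : ℝ → TangentBundle (𝓡 n) M} {a b k : ℝ}
    (h : F.IsHorizontalOn f (2 * a - k) (2 * b - k)) (hg : ∀ s ∈ Icc a b, g s = f (2 * s - k)) :
    F.IsHorizontalOn g a b := by
  intro s hs
  have hmaps : MapsTo (fun s : ℝ => 2 * s - k) (Icc a b) (Icc (2 * a - k) (2 * b - k)) :=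
    fun s hs => ⟨by linarith [hs.1], by linarith [hs.2]⟩
  obtain ⟨w, hw, hw'⟩ := h _ (hmaps hs)
  have hσ : HasMFDerivWithinAt 𝓘(ℝ, ℝ) 𝓘(ℝ, ℝ) (fun s : ℝ => 2 * s - k) (Icc a b) s
      (ContinuousLinearMap.toSpanSingleton ℝ (2 : ℝ)) := by
    have h0 : HasDerivAt (fun s : ℝ => 2 * s - k) 2 s := by
      simpa using ((hasDerivAt_id s).const_mul 2).sub_const k
    exact h0.hasFDerivAt.hasFDerivWithinAt.hasMFDerivWithinAt
  have h1 := HasMFDerivWithinAt.comp s hw hσ hmaps.subset_preimage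
  have h2 := HasMFDerivWithinAt.congr_of_eventuallyEq h1 (f₁ := g)
    (by filter_upwards [self_mem_nhdsWithin] with x hx using hg x hx) (hg s hs)
  let w' : EuclideanSpace ℝ (Fin n) × EuclideanSpace ℝ (Fin n) := (2 : ℝ) • w
  refine ⟨w', ?_, ?_⟩
  · refine Eq.mp (congrArg (HasMFDerivWithinAt 𝓘(ℝ, ℝ) (𝓡 n).tangent g (Icc a b) s) ?_) h2
    exact toSpanSingleton_comp_toSpanSingleton
      (E := EuclideanSpace ℝ (Fin n) × EuclideanSpace ℝ (Fin n)) w 2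
  · have h3 := F.horProj_smul _ 2 w hw'
    rw [hg s hs]
    exact h3

/-- Curves and parallel fields are concatenated at double speed. Horizontality survives the affine
change of time because `h` commutes with the scaling of velocities. -/
theorem IsTransport.comp {r : ℕ∞} {p q q' : M} {T : F.indicatrix p → F.indicatrix q}
    {T' : F.indicatrix q → F.indicatrix q'} (hT' : F.IsTransport r q q' T')
    (hT : F.IsTransport r p q T) : F.IsTransport r p q' (T' ∘ T) := by
  obtain ⟨m, τ, c, hτ, hc, hc0, hc1, h⟩ := hT
  obtain ⟨m', τ', c', hτ', hc', hc0', hc1', h'⟩ := hT'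
  have hcc : c 1 = c' 0 := hc1.trans hc0'.symm
  refine ⟨m + m', joinSubdivision m τ τ', join c c', hτ.join hτ',
    forall_join (P := fun f a b => ContMDiffOn 𝓘(ℝ, ℝ) (𝓡 n) r f (Icc a b)) hcc hτ hτ' ?_ hc hc',
    ?_, ?_, fun y => ?_⟩
  · intro f g a b k hf hg
    have hσ : ContDiff ℝ r (fun s : ℝ => 2 * s - k) := by fun_prop
    exact (hf.comp hσ.contMDiff.contMDiffOn
      fun s hs => ⟨by linarith [hs.1], by linarith [hs.2]⟩).congr hg
  · rw [join_of_le (by norm_num), mul_zero, hc0]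
  · rw [join_of_ge hcc (by norm_num), ← hc1']
    norm_num
  · obtain ⟨V, ⟨hV, hVc, hVh⟩, hV0, hV1⟩ := h y
    obtain ⟨V', ⟨hV', hVc', hVh'⟩, hV0', hV1'⟩ := h' (T y)
    have hVV : V 1 = V' 0 := hV1.trans hV0'.symm
    have hI : ∀ s ∈ Icc (0 : ℝ) 1, s ≤ 1 / 2 → 2 * s ∈ Icc (0 : ℝ) 1 := fun s hs h =>
      ⟨by linarith [hs.1], by linarith⟩
    have hI' : ∀ s ∈ Icc (0 : ℝ) 1, 1 / 2 ≤ s → 2 * s - 1 ∈ Icc (0 : ℝ) 1 := fun s hs h =>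
      ⟨by linarith, by linarith [hs.2]⟩
    refine ⟨join V V', ⟨?_, fun s hs => ?_, ?_⟩, ?_, ?_⟩
    · have h1 : ContinuousOn (join V V') (Icc 0 (1 / 2)) := by
        refine (hV.comp (f := fun s : ℝ => 2 * s) (by fun_prop) fun s hs => ?_).congr
          fun s hs => join_of_le hs.2
        exact hI s ⟨hs.1, by linarith [hs.2]⟩ hs.2
      have h2 : ContinuousOn (join V V') (Icc (1 / 2) 1) := by
        refine (hV'.comp (f := fun s : ℝ => 2 * s - 1) (by fun_prop) fun s hs => ?_).congr
          fun s hs => join_of_ge hVV hs.1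
        exact hI' s ⟨by linarith [hs.1], hs.2⟩ hs.1
      have h3 := h1.union_of_isClosed h2 isClosed_Icc isClosed_Icc
      rwa [Icc_union_Icc_eq_Icc (by norm_num) (by norm_num)] at h3
    · rcases le_total s (1 / 2) with h | h
      · rw [join_of_le h, join_of_le h, hVc _ (hI s hs h)]
      · rw [join_of_ge hVV h, join_of_ge hcc h, hVc' _ (hI' s hs h)]
    · exact forall_join (P := F.IsHorizontalOn) hVV hτ hτ'
        (fun f g a b k hf hg => IsHorizontalOn.comp_affine hf hg) hVh hVh'
    · rw [join_of_le (by norm_num), mul_zero, hV0]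
    · rw [join_of_ge hVV (by norm_num)]
      norm_num
      exact hV1'

/-- Indicatrices are empty in dimension zero; there is then no vector from which to read off a
curve, and the constant curve is used. -/
theorem IsTransport.of_isEmpty (r : ℕ∞) (p : M) [IsEmpty (F.indicatrix p)]
    (T : F.indicatrix p → F.indicatrix p) : F.IsTransport r p p T :=
  ⟨1, fun i => i, fun _ => p, ⟨by simp, by simp, fun i _ => by simp⟩, fun _ _ => contMDiffOn_const,
    rfl, rfl, fun y => isEmptyElim y⟩

theorem exists_inclIndicatrix_eq {p : M} (v : F.indicatrixBundle) (hv : v.1.proj = p) :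
    ∃ y, F.inclIndicatrix p y = v := by
  obtain ⟨⟨q, y⟩, h⟩ := v
  obtain rfl : q = p := hv
  exact ⟨⟨y, h⟩, rfl⟩

theorem inclIndicatrix_injective (p : M) : Function.Injective (F.inclIndicatrix p) := by
  intro y z h
  have h1 : (⟨p, y.1⟩ : TangentBundle (𝓡 n) M) = ⟨p, z.1⟩ := congrArg Subtype.val h
  have h2 := eq_of_heq (Bundle.TotalSpace.mk.inj h1).2
  exact Subtype.ext h2

end FinslerMetric
-- The fibered holonomy group and brackets with horizontal lifts
namespace FinslerMetric

variable {n : ℕ} {M : Type*} [TopologicalSpace M]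
  [ChartedSpace (EuclideanSpace ℝ (Fin n)) M] [IsManifold (𝓡 n) ∞ M] {F : FinslerMetric n M}

/-! #### Curves of diffeomorphisms near `t = 0` -/

theorem IsSmoothCurve.congr {φ ψ : ℝ → F.diffGroup} (hφ : F.IsSmoothCurve φ)
    (h : ∀ᶠ t in nhds 0, φ t = ψ t) : F.IsSmoothCurve ψ := by
  obtain ⟨ε, hε, hs⟩ := hφ
  obtain ⟨δ, hδ, hδ'⟩ := Metric.eventually_nhds_iff.1 h
  refine ⟨min ε δ, lt_min hε hδ, ?_⟩
  refine Eq.mp (congrArg _ ?_)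
    (SmoothFamily.mono (h := fun t v => ((φ t).1 v).1) (min_le_left ε δ) hs)
  funext z
  have hz : dist z.1.1 0 < δ := by
    rw [Real.dist_0_eq_abs, abs_lt]
    exact ⟨by linarith [z.1.2.1, min_le_right ε δ], by linarith [z.1.2.2, min_le_right ε δ]⟩
  exact congrArg (fun Φ : F.diffGroup => (Φ.1 z.2).1) (hδ' hz)

/-- Tangency depends only on the germ at `t = 0`, so the curve may be replaced by the identity at
the times when it leaves `G`. -/
theorem mem_tangentFields_of_eventually {G : Subgroup F.diffGroup} {φ : F.smoothCurves}
    (hφ : ∀ᶠ t in nhds 0, φ.1 t ∈ G) {k : ℕ} (hk : 1 ≤ k) {ξ : F.VField}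
    (h : HasLeadingCoeff φ k (ξ : F.smoothFun →ₗ[ℝ] F.smoothFun)) :
    ξ ∈ F.tangentFields G := by
  classical
  let ψ : ℝ → F.diffGroup := fun t => if φ.1 t ∈ G then φ.1 t else 1
  have hψ : ∀ᶠ t in nhds 0, φ.1 t = ψ t := by
    filter_upwards [hφ] with t ht
    exact (if_pos ht).symm
  refine mem_tangentFields_iff.2 ⟨k, hk, ⟨ψ, IsSmoothCurve.congr φ.2 hψ⟩, fun t => ?_, ?_⟩
  · show (if φ.1 t ∈ G then φ.1 t else 1) ∈ G
    split_ifs with ht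
    · exact ht
    · exact G.one_mem
  · rw [hasLeadingCoeff_iff hk] at h ⊢
    refine ⟨hψ.self_of_nhds.symm.trans h.1, fun f v => ?_⟩
    have e : (fun t => f.1 ((ψ t).1 v)) =ᶠ[nhds 0] fun t => f.1 ((φ.1 t).1 v) := by
      filter_upwards [hψ] with t ht
      rw [ht]
    refine ⟨fun i h1 h2 => (e.iteratedDeriv_eq i).trans ((h.2 f v).1 i h1 h2),
      (e.iteratedDeriv_eq k).trans (h.2 f v).2⟩

/-! #### The fibered holonomy group -/

/-- The restriction of `Φ` to each indicatrix is a holonomy transformation. -/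
def IsFiberwiseHolonomy (r : ℕ∞) (Φ : F.diffGroup) : Prop :=
  ∀ p : M, ∃ h ∈ F.holonomyGroup r p, ∀ y : F.indicatrix p,
    Φ.1 (F.inclIndicatrix p y) = F.inclIndicatrix p (h y)

/-- The generating set is already a subgroup, because each `holonomyGroup r p` is a group. -/
theorem mem_fiberedHolonomyGroup_iff {r : ℕ∞} {Φ : F.diffGroup} :
    Φ ∈ F.fiberedHolonomyGroup r ↔ IsFiberwiseHolonomy r Φ := by
  refine ⟨fun h => ?_, fun h => Subgroup.subset_closure h⟩
  induction h using Subgroup.closure_induction with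
  | mem Φ h => exact h
  | one => exact fun p => ⟨1, one_mem _, fun y => rfl⟩
  | mul Φ Ψ _ _ hΦ hΨ =>
    intro p
    obtain ⟨h, hh, e⟩ := hΦ p
    obtain ⟨h', hh', e'⟩ := hΨ p
    refine ⟨h * h', mul_mem hh hh', fun y => ?_⟩
    show Φ.1 (Ψ.1 _) = _
    rw [e', e]
    rfl
  | inv Φ _ hΦ =>
    intro p
    obtain ⟨h, hh, e⟩ := hΦ p
    refine ⟨h⁻¹, inv_mem hh, fun y => ?_⟩
    show Φ.1.symm _ = _
    rw [Equiv.symm_apply_eq, e]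
    exact congrArg _ (h.apply_symm_apply y).symm

/-- The holonomy groups at the ends of a curve are conjugate. -/
theorem conj_mem_holonomyGroup {r : ℕ∞} {p q : M} (e : F.indicatrix p ≃ F.indicatrix q)
    (he : F.IsTransport r p q e) (he' : F.IsTransport r q p e.symm)
    {h : Equiv.Perm (F.indicatrix q)} (hh : h ∈ F.holonomyGroup r q) :
    e.symm.permCongr h ∈ F.holonomyGroup r p := by
  have key : F.holonomyGroup r q ≤
      (F.holonomyGroup r p).comap (e.symm.permCongrHom : _ ≃* _).toMonoidHom := by
    refine (Subgroup.closure_le _).2 fun k hk => Subgroup.subset_closure ?_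
    have hk' : F.IsTransport r q q k := hk
    exact he'.comp (hk'.comp he)
  exact key hh

variable [T2Space M] [CompactSpace M]

theorem contMDiffOn_smoothCurve (φ : F.smoothCurves) :
    ∃ ε > 0, ∀ v, ContMDiffOn 𝓘(ℝ, ℝ) (𝓡 n).tangent ∞ (fun t => ((φ.1 t).1 v).1) (Ioo (-ε) ε) := by
  obtain ⟨ε, hε, hs⟩ := φ.2
  refine ⟨ε, hε, fun v => SmoothAlong.contMDiffOn isOpen_Ioo ?_⟩
  refine SmoothAlong.comp (g := fun t : Ioo (-ε) ε => (t, v)) hs ?_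
  exact SmoothAlong.of_contMDiffOn (g := fun t : ℝ => (t, v.1)) isOpen_univ (fun _ => mem_univ _)
    (contMDiff_id.prodMk contMDiff_const).contMDiffOn

/-- The curves followed by the flow of a horizontal lift project to integral curves. -/
theorem hasMFDerivAt_proj_horFlow {X : BaseField n M} {v : F.indicatrixBundle} {t : ℝ}
    (h : HasMFDerivAt 𝓘(ℝ, ℝ) (𝓡 n).tangent (fun s => (((horFlow F X).1 s).1 v).1) t
        ((1 : ℝ →L[ℝ] ℝ).smulRight (F.horLiftField X (((horFlow F X).1 t).1 v).1))) :
    HasMFDerivAt 𝓘(ℝ, ℝ) (𝓡 n) (fun s => (((horFlow F X).1 s).1 v).1.proj) t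
      ((1 : ℝ →L[ℝ] ℝ).smulRight (X (((horFlow F X).1 t).1 v).1.proj)) := by
  have h1 := HasMFDerivAt.comp t (hasMFDerivAt_proj (((horFlow F X).1 t).1 v).1) h
  exact h1

/-- Flow lines of `X^h` project to integral curves of `X`, which are unique. Hence all vectors of
one fibre travel over the same curve, and this curve can be computed on the base. -/
theorem horFlow_proj_eq (X : BaseField n M) : ∃ ε > 0, ∀ v : F.indicatrixBundle, ∀ γ : ℝ → M,
    ∀ a b, a ∈ Ico (-ε) 0 → b ∈ Ioc 0 ε → γ 0 = v.1.proj →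
    (∀ t ∈ Ioo a b, HasMFDerivAt 𝓘(ℝ, ℝ) (𝓡 n) γ t ((1 : ℝ →L[ℝ] ℝ).smulRight (X (γ t)))) →
    ∀ t ∈ Ioo a b, (((horFlow F X).1 t).1 v).1.proj = γ t := by
  obtain ⟨ε, hε, h0, h1, -⟩ := horFlow_spec (F := F) X
  refine ⟨ε, hε, fun v γ a b ha hb hγ0 hγ t ht => ?_⟩
  refine integralCurve_eqOn_Ioo (I := 𝓡 n) (W := X) (t₀ := 0) ⟨ha.2, hb.1⟩ (fun s hs => ?_)
    (fun s hs => ?_) (fun s hs => (hγ s hs).hasMFDerivWithinAt) ?_ ht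
    (γ := fun t => (((horFlow F X).1 t).1 v).1.proj)
  · exact (X.contMDiff _).of_le (by simp)
  · exact (hasMFDerivAt_proj_horFlow (h1 v s
      (Ioo_subset_Ioo ha.1 hb.2 hs))).hasMFDerivWithinAt
  · show (((horFlow F X).1 0).1 v).1.proj = _
    rw [h0]
    exact hγ0.symm

/-- The flow of a horizontal lift consists of parallel translations. -/
theorem exists_transport_horFlow_aux (r : ℕ∞) (X : BaseField n M) : ∃ ε > 0,
    ∀ t ∈ Ioo (-ε) ε, ∀ (p : M) (y₀ : F.indicatrix p), ∃ (q : M) (T : F.indicatrix p → F.indicatrix q),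
      (∀ y, ((horFlow F X).1 t).1 (F.inclIndicatrix p y) = F.inclIndicatrix q (T y)) ∧
      F.IsTransport r p q T := by
  obtain ⟨ε₁, hε₁, h0, h1, -⟩ := horFlow_spec (F := F) X
  obtain ⟨ε₂, hε₂, h2⟩ := contMDiffOn_smoothCurve (horFlow F X)
  obtain ⟨ε₃, hε₃, h3⟩ := horFlow_proj_eq (F := F) X
  refine ⟨min ε₁ (min ε₂ ε₃), lt_min hε₁ (lt_min hε₂ hε₃), fun t ht p y₀ => ?_⟩
  set ε := min ε₁ (min ε₂ ε₃) with hε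
  have hε0 : 0 < ε := lt_min hε₁ (lt_min hε₂ hε₃)
  have le₁ : ε ≤ ε₁ := min_le_left _ _
  have le₂ : ε ≤ ε₂ := (min_le_right _ _).trans (min_le_left _ _)
  have le₃ : ε ≤ ε₃ := (min_le_right _ _).trans (min_le_right _ _)
  have hmem : ∀ s ∈ Icc (0 : ℝ) 1, s * t ∈ Ioo (-ε) ε := by
    intro s hs
    rw [mem_Ioo, ← abs_lt] at ht ⊢
    rw [abs_mul, abs_of_nonneg hs.1]
    exact (mul_le_of_le_one_left (abs_nonneg t) hs.2).trans_lt ht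
  -- The flow up to time `t` is reparametrized over `[0, 1]`. The vector `y₀` serves only to name
  -- the base curve, which is the same for every vector of the fibre.
  let c : ℝ → M := fun s => (((horFlow F X).1 (s * t)).1 (F.inclIndicatrix p y₀)).1.proj
  have hproj : ∀ y, ∀ s ∈ Icc (0 : ℝ) 1,
      (((horFlow F X).1 (s * t)).1 (F.inclIndicatrix p y)).1.proj = c s := by
    intro y s hs
    refine h3 _ (fun s => (((horFlow F X).1 s).1 (F.inclIndicatrix p y₀)).1.proj) (-ε) ε
      ⟨by linarith, by linarith⟩ ⟨hε0, le₃⟩ ?_ (fun u hu => ?_) _ (hmem s hs)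
    · show (((horFlow F X).1 0).1 (F.inclIndicatrix p y₀)).1.proj = p
      rw [h0]
      rfl
    · exact hasMFDerivAt_proj_horFlow (h1 _ u (Ioo_subset_Ioo (by linarith) le₁ hu))
  have hT : ∀ y, ∃ z, F.inclIndicatrix (c 1) z = ((horFlow F X).1 t).1 (F.inclIndicatrix p y) := by
    intro y
    have h := hproj y 1 (by simp)
    rw [one_mul] at h
    exact exists_inclIndicatrix_eq _ h
  choose T hT using hT
  have hlin : ContDiff ℝ ∞ (fun s : ℝ => s * t) := by fun_prop
  have hV : ∀ v, ContMDiffOn 𝓘(ℝ, ℝ) (𝓡 n).tangent ∞ (fun s => (((horFlow F X).1 (s * t)).1 v).1)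
      (Icc 0 1) := fun v => (h2 v).comp hlin.contMDiff.contMDiffOn
    fun s hs => Ioo_subset_Ioo (by linarith) le₂ (hmem s hs)
  refine ⟨c 1, T, fun y => (hT y).symm, 1, fun i => i, c, ⟨by simp, by simp, fun i _ => by simp⟩,
    fun i hi => ?_, ?_, rfl, fun y => ?_⟩
  · obtain rfl : i = 0 := by omega
    have h4 := (Bundle.contMDiff_proj (n := ∞) (IB := 𝓡 n)
      (TangentSpace (𝓡 n) : M → Type _)).comp_contMDiffOn (hV (F.inclIndicatrix p y₀))
    have h5 : ContMDiffOn 𝓘(ℝ, ℝ) (𝓡 n) r c (Icc 0 1) := h4.of_le (by exact_mod_cast le_top)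
    simpa using h5
  · show (((horFlow F X).1 (0 * t)).1 (F.inclIndicatrix p y₀)).1.proj = p
    rw [zero_mul, h0]
    rfl
  · refine ⟨fun s => (((horFlow F X).1 (s * t)).1 (F.inclIndicatrix p y)).1,
      ⟨(hV _).continuousOn, hproj y, fun i hi => ?_⟩, ?_, ?_⟩
    · obtain rfl : i = 0 := by omega
      intro s hs
      have hs' : s ∈ Icc (0 : ℝ) 1 := by simpa using hs
      have h4 := h1 (F.inclIndicatrix p y) _ (Ioo_subset_Ioo (by linarith) le₁ (hmem s hs'))
      have hσ : HasMFDerivAt 𝓘(ℝ, ℝ) 𝓘(ℝ, ℝ) (fun s : ℝ => s * t) s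
          (ContinuousLinearMap.toSpanSingleton ℝ t) := by
        have h0 : HasDerivAt (fun s : ℝ => s * t) t s := by
          simpa using (hasDerivAt_id s).mul_const t
        exact h0.hasFDerivAt.hasMFDerivAt
      have h5 := (HasMFDerivAt.comp s h4 hσ).hasMFDerivWithinAt
        (s := Icc (((0 : ℕ) : ℝ)) ((0 + 1 : ℕ) : ℝ))
      let v := (((horFlow F X).1 (s * t)).1 (F.inclIndicatrix p y)).1
      let u : EuclideanSpace ℝ (Fin n) := X v.proj
      refine ⟨F.horLift v (t • u), ?_, rfl⟩
      refine Eq.mp (congrArg (HasMFDerivWithinAt 𝓘(ℝ, ℝ) (𝓡 n).tangent _ _ s) ?_) h5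
      have h6 : F.horLift v (t • u) = t • F.horLift v u := F.horLift_smul v t u
      rw [h6]
      exact toSpanSingleton_comp_toSpanSingleton
        (E := EuclideanSpace ℝ (Fin n) × EuclideanSpace ℝ (Fin n)) (F.horLift v u) t
    · show (((horFlow F X).1 (0 * t)).1 (F.inclIndicatrix p y)).1 = _
      rw [zero_mul, h0]
      rfl
    · show (((horFlow F X).1 (1 * t)).1 (F.inclIndicatrix p y)).1 = _
      rw [one_mul, ← hT]
      rfl

/-- The flow at time `-t` is also a parallel translation, and by the local group law it inverts the
flow at time `t`. It therefore returns to `p` and makes the transport a bijection whose inverse is a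
transport. -/
theorem exists_transport_horFlow (r : ℕ∞) (X : BaseField n M) : ∃ ε > 0,
    ∀ t ∈ Ioo (-ε) ε, ((horFlow F X).1 t)⁻¹ = (horFlow F X).1 (-t) ∧
      ∀ p : M, ∃ (q : M) (e : F.indicatrix p ≃ F.indicatrix q),
      (∀ y, ((horFlow F X).1 t).1 (F.inclIndicatrix p y) = F.inclIndicatrix q (e y)) ∧
      F.IsTransport r p q e ∧ F.IsTransport r q p e.symm := by
  obtain ⟨ε₁, hε₁, h0, -, h1⟩ := horFlow_spec (F := F) X
  obtain ⟨ε₂, hε₂, h2⟩ := exists_transport_horFlow_aux (F := F) r X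
  refine ⟨min ε₁ ε₂, lt_min hε₁ hε₂, fun t ht => ?_⟩
  have ht₁ : t ∈ Ioo (-ε₁) ε₁ :=
    Ioo_subset_Ioo (by linarith [min_le_left ε₁ ε₂]) (min_le_left _ _) ht
  have ht₂ : t ∈ Ioo (-ε₂) ε₂ :=
    Ioo_subset_Ioo (by linarith [min_le_right ε₁ ε₂]) (min_le_right _ _) ht
  have hinv : ((horFlow F X).1 t)⁻¹ = (horFlow F X).1 (-t) := by
    refine inv_eq_of_mul_eq_one_left ?_
    rw [h1 (-t) ⟨by linarith [ht₁.2], by linarith [ht₁.1]⟩ t ht₁ (by simpa using hε₁),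
      neg_add_cancel, h0]
  refine ⟨hinv, fun p => ?_⟩
  rcases isEmpty_or_nonempty (F.indicatrix p) with hp | ⟨⟨y₀⟩⟩
  · exact ⟨p, Equiv.refl _, fun y => isEmptyElim y, IsTransport.of_isEmpty r p _,
      IsTransport.of_isEmpty r p _⟩
  obtain ⟨q, T, hT, hT'⟩ := h2 t ht₂ p y₀
  obtain ⟨p', T', hS, hS'⟩ := h2 (-t) ⟨by linarith [ht₂.2], by linarith [ht₂.1]⟩ q (T y₀)
  have hback : ∀ y, F.inclIndicatrix p' (T' (T y)) = F.inclIndicatrix p y := by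
    intro y
    rw [← hS, ← hT, ← hinv]
    exact Equiv.symm_apply_apply _ _
  obtain rfl : p' = p := congrArg (fun v : F.indicatrixBundle => v.1.proj) (hback y₀)
  refine ⟨q, ⟨T, T', fun y => inclIndicatrix_injective _ (hback y),
    fun z => inclIndicatrix_injective _ ?_⟩, hT, hT', hS'⟩
  rw [← hT, ← hS, ← hinv]
  exact Equiv.apply_symm_apply _ _

/-- The fields tangent to the fibered holonomy group are closed under the brackets with horizontal
lifts. -/
theorem lie_horField_mem_tangentFields (r : ℕ∞) (X : BaseField n M) {ξ : F.VField}
    (hξ : ξ ∈ F.tangentFields (F.fiberedHolonomyGroup r)) :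
    ⁅horField F X, ξ⁆ ∈ F.tangentFields (F.fiberedHolonomyGroup r) := by
  obtain ⟨k, hk, φ, hφ, h⟩ := mem_tangentFields_iff.1 hξ
  obtain ⟨ε, hε, hH⟩ := exists_transport_horFlow (F := F) r X
  have h' := (hasLeadingCoeff_velocity (horFlow F X) (horFlow_zero X)).commutator le_rfl hk h
  refine mem_tangentFields_of_eventually ?_ (by omega : 1 ≤ 1 + k) h'
  filter_upwards [Ioo_mem_nhds (neg_lt_zero.2 hε) hε] with t ht
  have ht' : -t ∈ Ioo (-ε) ε := ⟨by linarith [ht.2], by linarith [ht.1]⟩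
  have hinv := (hH t ht).1
  -- The horizontal flow moves the base points and does not belong to the group itself; what does
  -- belong is the conjugate of `(φ t)⁻¹` by it, since parallel translation carries one holonomy
  -- group to another. Together with `φ t` it makes up the commutator.
  have key : (horFlow F X).1 t * (φ.1 t)⁻¹ * ((horFlow F X).1 t)⁻¹ ∈ F.fiberedHolonomyGroup r := by
    rw [mem_fiberedHolonomyGroup_iff]
    intro p
    obtain ⟨q, e, he, hpq, hqp⟩ := (hH (-t) ht').2 p
    obtain ⟨h, hh, hφh⟩ := mem_fiberedHolonomyGroup_iff.1 (inv_mem (hφ t)) q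
    refine ⟨_, conj_mem_holonomyGroup e hpq hqp hh, fun y => ?_⟩
    rw [← hinv] at he
    show ((horFlow F X).1 t).1 ((φ.1 t)⁻¹.1 (((horFlow F X).1 t)⁻¹.1 (F.inclIndicatrix p y))) = _
    rw [he, hφh]
    have h1 := he (e.symm (h (e y)))
    rw [e.apply_symm_apply] at h1
    rw [← h1]
    exact Equiv.apply_symm_apply _ _
  have e : (φ * horFlow F X * φ⁻¹ * (horFlow F X)⁻¹).1 t =
      φ.1 t * ((horFlow F X).1 t * (φ.1 t)⁻¹ * ((horFlow F X).1 t)⁻¹) := by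
    show φ.1 t * (horFlow F X).1 t * (φ.1 t)⁻¹ * ((horFlow F X).1 t)⁻¹ = _
    simp only [mul_assoc]
  rw [e]
  exact mul_mem (hφ t) key

end FinslerMetric

/-! ### Smooth families with times depending on the point -/

section SmoothFamily

variable {E₁ H₁ N E₂ H₂ P : Type*}
  [NormedAddCommGroup E₁] [NormedSpace ℝ E₁] [TopologicalSpace H₁]
  [TopologicalSpace N] [ChartedSpace H₁ N]
  [NormedAddCommGroup E₂] [NormedSpace ℝ E₂] [TopologicalSpace H₂]
  [TopologicalSpace P] [ChartedSpace H₂ P]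
  {I₁ : ModelWithCorners ℝ E₁ H₁} {I₂ : ModelWithCorners ℝ E₂ H₂} {S : Type*}

theorem SmoothFamily.smoothAlong_at {e : S → N} {h : ℝ → S → P} {ε : ℝ}
    (hs : SmoothAlong (𝓘(ℝ, ℝ).prod I₁) I₂
      (fun z : Ioo (-ε) ε × S => (z.1.1, e z.2)) (fun z => h z.1.1 z.2)) {t : ℝ}
    (ht : t ∈ Ioo (-ε) ε) : SmoothAlong I₁ I₂ e (h t) := by
  refine SmoothAlong.comp (g := fun a : S => ((⟨t, ht⟩ : Ioo (-ε) ε), a)) hs ?_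
  exact SmoothAlong.of_contMDiffOn (g := fun x : N => (t, x)) isOpen_univ (fun _ => mem_univ _)
    (contMDiff_const.prodMk contMDiff_id).contMDiffOn

/-- Composition of smooth families of maps, with a rescaling of time depending on the point. -/
theorem SmoothFamily.comp_smul {e : S → N} {h : ℝ → S → P} {k : ℝ → S → S} {g : S → ℝ}
    (hh : SmoothFamily I₁ I₂ e h) (hk : SmoothFamily I₁ I₁ e (fun t v => e (k t v)))
    (hg : SmoothAlong I₁ 𝓘(ℝ, ℝ) e g) {B : ℝ} (hB : ∀ v, |g v| ≤ B) :
    SmoothFamily I₁ I₂ e (fun t v => h (g v * t) (k t v)) := by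
  obtain ⟨ε, hε, hs⟩ := hh
  obtain ⟨δ, hδ, hs'⟩ := hk
  -- The bound on `g` makes the admissible time uniform in the point; `|B| + 1` is positive even
  -- when `B` is not.
  have hB' : 0 < |B| + 1 := by positivity
  have hpos : 0 < ε / (|B| + 1) := div_pos hε hB'
  have hmem : ∀ z : Ioo (-(min (ε / (|B| + 1)) δ)) (min (ε / (|B| + 1)) δ) × S,
      g z.2 * z.1.1 ∈ Ioo (-ε) ε := by
    intro z
    rw [mem_Ioo, ← abs_lt, abs_mul]
    have h1 : |z.1.1| < ε / (|B| + 1) := lt_of_lt_of_le (abs_lt.2 z.1.2) (min_le_left _ _)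
    rw [lt_div_iff₀ hB'] at h1
    nlinarith [hB z.2, le_abs_self B, abs_nonneg z.1.1, abs_nonneg (g z.2)]
  refine ⟨min (ε / (|B| + 1)) δ, lt_min hpos hδ, ?_⟩
  refine SmoothAlong.comp (g := fun z : Ioo (-(min (ε / (|B| + 1)) δ)) (min (ε / (|B| + 1)) δ) × S =>
    ((⟨g z.2 * z.1.1, hmem z⟩ : Ioo (-ε) ε), k z.1.1 z.2)) hs ?_
  refine SmoothAlong.prodMk (f := fun z : Ioo (-(min (ε / (|B| + 1)) δ)) (min (ε / (|B| + 1)) δ) × S =>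
      g z.2 * z.1.1)
    (f' := fun z : Ioo (-(min (ε / (|B| + 1)) δ)) (min (ε / (|B| + 1)) δ) × S => e (k z.1.1 z.2)) ?_
    (SmoothFamily.mono (h := fun t v => e (k t v)) (min_le_right _ δ) hs')
  refine SmoothAlong.prod_comp (fun z => z.1 * z.2) (contDiff_fst.mul contDiff_snd) ?_ ?_
  · exact SmoothAlong.comp (f := g) hg (SmoothAlong.of_contMDiffOn (g := Prod.snd) isOpen_univ
      (fun _ => mem_univ _) contMDiffOn_snd)
  · exact SmoothAlong.of_contMDiffOn (g := Prod.fst) isOpen_univ (fun _ => mem_univ _)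
      contMDiffOn_fst

end SmoothFamily

namespace FinslerMetric

variable {n : ℕ} {M : Type*} [TopologicalSpace M]
  [ChartedSpace (EuclideanSpace ℝ (Fin n)) M] [IsManifold (𝓡 n) ∞ M] {F : FinslerMetric n M}

/-- A smooth family of maps with a smooth family of inverses is a smooth curve of
diffeomorphisms. -/
theorem exists_smoothCurve_eq {f f' : ℝ → F.indicatrixBundle → F.indicatrixBundle}
    (hf : SmoothFamily (𝓡 n).tangent (𝓡 n).tangent (Subtype.val : F.indicatrixBundle → _)
      (fun t v => (f t v).1))
    (hf' : SmoothFamily (𝓡 n).tangent (𝓡 n).tangent (Subtype.val : F.indicatrixBundle → _)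
      (fun t v => (f' t v).1))
    (h : ∀ᶠ t in nhds 0, Function.LeftInverse (f' t) (f t) ∧ Function.RightInverse (f' t) (f t)) :
    ∃ φ : F.smoothCurves, ∀ᶠ t in nhds 0, ∀ v, (φ.1 t).1 v = f t v := by
  obtain ⟨ε, hε, hs⟩ := hf
  obtain ⟨ε', hε', hs'⟩ := hf'
  obtain ⟨δ, hδ, hinv⟩ := Metric.eventually_nhds_iff.1 h
  let ρ := min δ (min ε ε')
  have hρ : 0 < ρ := lt_min hδ (lt_min hε hε')
  have le₁ : ρ ≤ δ := min_le_left _ _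
  have le₂ : ρ ≤ ε := (min_le_right _ _).trans (min_le_left _ _)
  have le₃ : ρ ≤ ε' := (min_le_right _ _).trans (min_le_right _ _)
  have hd : ∀ t ∈ Ioo (-ρ) ρ, dist t 0 < δ := by
    intro t ht
    rw [Real.dist_0_eq_abs, abs_lt]
    exact ⟨by linarith [ht.1], by linarith [ht.2]⟩
  classical
  let φ : ℝ → F.diffGroup := fun t => if ht : t ∈ Ioo (-ρ) ρ then
    ⟨⟨f t, f' t, (hinv (hd t ht)).1, (hinv (hd t ht)).2⟩,
      SmoothFamily.smoothAlong_at (h := fun t v => (f t v).1) hs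
        (Ioo_subset_Ioo (by linarith) le₂ ht),
      SmoothFamily.smoothAlong_at (h := fun t v => (f' t v).1) hs'
        (Ioo_subset_Ioo (by linarith) le₃ ht)⟩ else 1
  have hφ : ∀ t ∈ Ioo (-ρ) ρ, ∀ v, (φ t).1 v = f t v := by
    intro t ht v
    simp only [φ, dif_pos ht]
    rfl
  refine ⟨⟨φ, ρ, hρ, ?_⟩, ?_⟩
  · refine Eq.mp (congrArg _ ?_) (SmoothFamily.mono (h := fun t v => (f t v).1) le₂ hs)
    funext z
    exact congrArg Subtype.val (hφ z.1.1 z.1.2 z.2).symm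
  · filter_upwards [Ioo_mem_nhds (neg_lt_zero.2 hρ) hρ] with t ht using hφ t ht

/-! #### Translations in a chart -/

/-- In the chart at `p`, the diffeomorphism `A` covers the translation by `a`, on the ball of radius
`ρ`. -/
def IsTranslationOver (p : M) (ρ : ℝ) (A : F.diffGroup) (a : EuclideanSpace ℝ (Fin n)) : Prop :=
  ∀ v : F.indicatrixBundle, v.1.proj ∈ chartBall (n := n) p ρ →
    (A.1 v).1.proj ∈ (extChartAt (𝓡 n) p).source ∧
    extChartAt (𝓡 n) p (A.1 v).1.proj = extChartAt (𝓡 n) p v.1.proj + a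

/-- The translations by `-a`, `-b`, `a`, `b` are applied in this order and close up a parallelogram.
From a point within `ρ` of the centre all its corners stay within `3 ρ`, where the four maps are
known to cover translations. -/
theorem proj_commutator_eq {p : M} {ρ : ℝ} {A B : F.diffGroup} {a b : EuclideanSpace ℝ (Fin n)}
    (hA : IsTranslationOver p (3 * ρ) A a) (hA' : IsTranslationOver p (3 * ρ) A⁻¹ (-a))
    (hB : IsTranslationOver p (3 * ρ) B b) (hB' : IsTranslationOver p (3 * ρ) B⁻¹ (-b))
    (ha : ‖a‖ < ρ) (hb : ‖b‖ < ρ) {v : F.indicatrixBundle}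
    (hv : v.1.proj ∈ chartBall (n := n) p ρ) :
    ((B * A * B⁻¹ * A⁻¹).1 v).1.proj = v.1.proj := by
  show (B.1 (A.1 (B⁻¹.1 (A⁻¹.1 v)))).1.proj = _
  have hρ : 0 < ρ := (norm_nonneg a).trans_lt ha
  set x := extChartAt (𝓡 n) p v.1.proj with hx
  set x₀ := extChartAt (𝓡 n) p p with hx₀
  have hd : ‖x - x₀‖ < ρ := by
    rw [← dist_eq_norm]
    exact hv.2
  have hn : ∀ c d e : EuclideanSpace ℝ (Fin n), ‖c‖ < ρ → ‖d‖ < ρ → e = x + c + d →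
      dist e x₀ < 3 * ρ := by
    rintro c d e hc hd' rfl
    rw [dist_eq_norm]
    have e1 : x + c + d - x₀ = (x - x₀) + c + d := by abel
    rw [e1]
    linarith [norm_add_le ((x - x₀) + c) d, norm_add_le (x - x₀) c]
  have h0 : ‖(0 : EuclideanSpace ℝ (Fin n))‖ < ρ := by rwa [_root_.norm_zero]
  have ha' : ‖-a‖ < ρ := by rwa [norm_neg]
  have hb' : ‖-b‖ < ρ := by rwa [norm_neg]
  obtain ⟨s1, c1⟩ := hA' v ⟨hv.1, hn 0 0 _ h0 h0 (by rw [hx]; abel)⟩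
  obtain ⟨s2, c2⟩ := hB' _ ⟨s1, hn (-a) 0 _ ha' h0 (by rw [c1]; abel)⟩
  obtain ⟨s3, c3⟩ := hA _ ⟨s2, hn (-a) (-b) _ ha' hb' (by rw [c2, c1])⟩
  obtain ⟨s4, c4⟩ := hB _ ⟨s3, hn (-b) 0 _ hb' h0 (by rw [c3, c2, c1]; abel)⟩
  refine (extChartAt (𝓡 n) p).injOn s4 hv.1 ?_
  rw [c4, c3, c2, c1]
  abel

theorem mdiff_extChartAt_eq {p q : M} (hq : q ∈ (extChartAt (𝓡 n) p).source) :
    mdiff (𝓡 n) (extChartAt (𝓡 n) p) q = tangentCoordChange (𝓡 n) q p q := by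
  rw [extChartAt_source] at hq
  rw [mdiff_eq_fderiv_self (mdifferentiableAt_extChartAt hq)]
  exact fderiv_transition q p q

variable [T2Space M]

theorem tangentCoordChange_coordField {p : M} (χ : SmoothBumpFunction (𝓡 n) p) (i : Fin n) {q : M}
    (hq : q ∈ chartBall (n := n) p χ.rIn) :
    tangentCoordChange (𝓡 n) q p q (coordField χ i q) = coordVec n i := by
  show tangentCoordChange (𝓡 n) q p q
    (χ q • tangentCoordChange (𝓡 n) p q q (coordVec n i)) = coordVec n i
  rw [bump_eq_one χ hq, one_smul, tangentCoordChange_tangentCoordChange hq.1]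

theorem isOpen_chartBall (p : M) (δ : ℝ) : IsOpen (chartBall (n := n) p δ) :=
  (continuousOn_extChartAt p).isOpen_inter_preimage (isOpen_extChartAt_source p)
    Metric.isOpen_ball

/-- Coordinate vector fields commute. -/
theorem baseBracket_coordField {p : M} (χ : SmoothBumpFunction (𝓡 n) p) (i j : Fin n) {q : M}
    (hq : q ∈ chartBall (n := n) p χ.rIn) [CompactSpace M] :
    baseBracket (coordField χ i) (coordField χ j) q = 0 := by
  have hs : q ∈ (chartAt (EuclideanSpace ℝ (Fin n)) p).source := by
    rw [← extChartAt_source (𝓡 n)]; exact hq.1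
  have h1 := mdiff_mlieBracket (contMDiffAt_extChartAt' (n := ∞) (I := 𝓡 n) hs)
    (mdifferentiableAt_baseField (coordField χ i) q)
    (mdifferentiableAt_baseField (coordField χ j) q)
  have h2 : ∀ i, mdiff (𝓡 n) (fun y => mdiff (𝓡 n) (extChartAt (𝓡 n) p) y (coordField χ i y)) q =
      0 := by
    intro i
    have e : (fun y => mdiff (𝓡 n) (extChartAt (𝓡 n) p) y (coordField χ i y)) =ᶠ[nhds q]
        fun _ => coordVec n i := by
      filter_upwards [(isOpen_chartBall p χ.rIn).mem_nhds hq] with y hy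
      rw [mdiff_extChartAt_eq hy.1]
      exact tangentCoordChange_coordField χ i hy
    rw [mdiff_congr e]
    exact (hasMFDerivAt_const (I := 𝓡 n) (I' := 𝓘(ℝ, EuclideanSpace ℝ (Fin n)))
      (coordVec n i) q).mfderiv
  rw [h2, h2, mdiff_extChartAt_eq hq.1] at h1
  have h3 := tangentCoordChange_tangentCoordChange_self hq.1
    (baseBracket (coordField χ i) (coordField χ j) q)
  have h4 : tangentCoordChange (𝓡 n) q p q (baseBracket (coordField χ i) (coordField χ j) q) = 0 :=
    h1.trans (sub_self _)
  rw [h4] at h3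
  exact h3.symm.trans (map_zero _)

variable [CompactSpace M]

/-- Where the bump function is `1` the field is a coordinate field, with straight integral curves in
the chart. The bound `ε ≤ rIn / 4` keeps segments that start within `3 rIn / 4` inside the ball of
radius `rIn`, and uniqueness identifies them with the projected flow lines. -/
theorem isTranslationOver_horFlow {p : M} (χ : SmoothBumpFunction (𝓡 n) p) (i : Fin n) :
    ∃ ε > 0, ε ≤ χ.rIn / 4 ∧ ∀ t ∈ Ioo (-ε) ε, IsTranslationOver p (3 * (χ.rIn / 4))
      ((horFlow F (coordField χ i)).1 t) (t • coordVec n i) := by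
  obtain ⟨ε, hε, h⟩ := horFlow_proj_eq (F := F) (coordField χ i)
  have hR := χ.rIn_pos
  refine ⟨min ε (χ.rIn / 4), lt_min hε (by linarith), min_le_right _ _, fun t ht v hv => ?_⟩
  set x := extChartAt (𝓡 n) p v.1.proj with hx
  have hball : ∀ s ∈ Ioo (-(min ε (χ.rIn / 4))) (min ε (χ.rIn / 4)),
      dist (x + s • coordVec n i) (extChartAt (𝓡 n) p p) < χ.rIn := by
    intro s hs
    have h1 : |s| < χ.rIn / 4 := (abs_lt.2 hs).trans_le (min_le_right _ _)
    have h2 := hv.2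
    rw [← hx, dist_eq_norm] at h2
    rw [dist_eq_norm, add_sub_right_comm]
    have h3 : ‖s • coordVec n i‖ = |s| := by
      rw [norm_smul, PiLp.norm_single]
      simp
    linarith [norm_add_le (x - extChartAt (𝓡 n) p p) (s • coordVec n i)]
  have htgt : ∀ s ∈ Ioo (-(min ε (χ.rIn / 4))) (min ε (χ.rIn / 4)),
      x + s • coordVec n i ∈ (extChartAt (𝓡 n) p).target := by
    intro s hs
    refine χ.ball_subset ⟨(hball s hs).trans χ.rIn_lt_rOut, ?_⟩
    rw [ModelWithCorners.range_eq_univ]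
    exact mem_univ _
  have hpos : 0 < min ε (χ.rIn / 4) := lt_min hε (by linarith)
  have hγ := h v (fun s => (extChartAt (𝓡 n) p).symm (x + s • coordVec n i))
    (-(min ε (χ.rIn / 4))) (min ε (χ.rIn / 4)) ⟨by linarith [min_le_left ε (χ.rIn / 4)], by linarith⟩
    ⟨hpos, min_le_left _ _⟩ (by
      show (extChartAt (𝓡 n) p).symm (x + (0 : ℝ) • coordVec n i) = _
      rw [zero_smul, add_zero]
      exact (extChartAt (𝓡 n) p).left_inv hv.1) (fun s hs => by
      refine hasMFDerivAt_of_vectorInChart (W := coordField χ i) (x₀ := p)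
        (f := fun s => x + s • coordVec n i) (htgt s hs) ?_
      have hq : (extChartAt (𝓡 n) p).symm (x + s • coordVec n i) ∈ chartBall (n := n) p χ.rIn := by
        refine ⟨(extChartAt (𝓡 n) p).map_target (htgt s hs), ?_⟩
        rw [(extChartAt (𝓡 n) p).right_inv (htgt s hs)]
        exact hball s hs
      have hv' : vectorInChart (𝓡 n) (coordField χ i) p (x + s • coordVec n i) = coordVec n i :=
        tangentCoordChange_coordField χ i hq
      rw [hv']
      simpa using ((hasDerivAt_id s).smul_const (coordVec n i)).const_add x) t ht
  rw [hγ]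
  exact ⟨(extChartAt (𝓡 n) p).map_target (htgt t ht), (extChartAt (𝓡 n) p).right_inv (htgt t ht)⟩

end FinslerMetric
-- Curvature fields are tangent to the fibered holonomy group
namespace FinslerMetric

variable {n : ℕ} {M : Type*} [TopologicalSpace M]
  [ChartedSpace (EuclideanSpace ℝ (Fin n)) M] [IsManifold (𝓡 n) ∞ M] {F : FinslerMetric n M}
  [T2Space M] [CompactSpace M]

/-- The restriction of `A` to each indicatrix is a parallel translation. -/
def IsFiberwiseTransport (r : ℕ∞) (A : F.diffGroup) : Prop :=
  ∀ p : M, ∃ (q : M) (e : F.indicatrix p ≃ F.indicatrix q),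
    (∀ y, A.1 (F.inclIndicatrix p y) = F.inclIndicatrix q (e y)) ∧ F.IsTransport r p q e

omit [T2Space M] [CompactSpace M] in
theorem IsFiberwiseTransport.mul {r : ℕ∞} {A B : F.diffGroup} (hA : IsFiberwiseTransport r A)
    (hB : IsFiberwiseTransport r B) : IsFiberwiseTransport r (A * B) := by
  intro p
  obtain ⟨q, e, he, h⟩ := hB p
  obtain ⟨q', e', he', h'⟩ := hA q
  refine ⟨q', e.trans e', fun y => ?_, h'.comp h⟩
  show A.1 (B.1 _) = _
  rw [he, he']
  rfl

/-- A closed transport is a holonomy transformation. -/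
theorem IsFiberwiseTransport.exists_mem_holonomyGroup {r : ℕ∞} {A : F.diffGroup}
    (hA : IsFiberwiseTransport r A) {p : M}
    (hp : ∀ v : F.indicatrixBundle, v.1.proj = p → (A.1 v).1.proj = p) :
    ∃ h ∈ F.holonomyGroup r p, ∀ y, A.1 (F.inclIndicatrix p y) = F.inclIndicatrix p (h y) := by
  rcases isEmpty_or_nonempty (F.indicatrix p) with h | ⟨⟨y₀⟩⟩
  · exact ⟨1, one_mem _, fun y => isEmptyElim y⟩
  obtain ⟨q, e, he, h⟩ := hA p
  have h1 := hp (F.inclIndicatrix p y₀) rfl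
  rw [he] at h1
  obtain rfl : q = p := h1
  exact ⟨e, Subgroup.subset_closure h, he⟩

theorem exists_isFiberwiseTransport_horFlow (r : ℕ∞) (X : BaseField n M) : ∃ ε > 0,
    ∀ t ∈ Ioo (-ε) ε, ((horFlow F X).1 t)⁻¹ = (horFlow F X).1 (-t) ∧
      IsFiberwiseTransport r ((horFlow F X).1 t) := by
  obtain ⟨ε, hε, h⟩ := exists_transport_horFlow (F := F) r X
  refine ⟨ε, hε, fun t ht => ⟨(h t ht).1, fun p => ?_⟩⟩
  obtain ⟨q, e, he, hpq, -⟩ := (h t ht).2 p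
  exact ⟨q, e, he, hpq⟩

/-- The commutator of the flows of two horizontal lifts, at times `t` and `c t`. -/
def flowCommutator (F : FinslerMetric n M) (X Y : BaseField n M) (c t : ℝ) : F.diffGroup :=
  (horFlow F Y).1 t * (horFlow F X).1 (c * t) * ((horFlow F Y).1 t)⁻¹ * ((horFlow F X).1 (c * t))⁻¹

theorem flowCommutator_inv (X Y : BaseField n M) (c t : ℝ) : (flowCommutator F X Y c t)⁻¹ =
    (horFlow F X).1 (c * t) * (horFlow F Y).1 t * ((horFlow F X).1 (c * t))⁻¹ *
      ((horFlow F Y).1 t)⁻¹ := by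
  simp only [flowCommutator, mul_inv_rev, inv_inv, mul_assoc]

theorem flowCommutator_zero (X Y : BaseField n M) (c : ℝ) : flowCommutator F X Y c 0 = 1 := by
  simp only [flowCommutator, mul_zero, horFlow_zero]
  simp

/-- For a constant `c` the flow at time `c t` has leading coefficient `c X^h` at order one, so the
commutator has `c [X^h, Y^h]` at order two. Below, `c` is the value of `g` on the fibre of `v`. -/
theorem iteratedDeriv_flowCommutator (X Y : BaseField n M) (c : ℝ) (f : F.smoothFun)
    (v : F.indicatrixBundle) :
    (∀ i : ℕ, 1 ≤ i → i < 2 →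
      iteratedDeriv i (fun t => f.1 ((flowCommutator F X Y c t).1 v)) 0 = 0) ∧
    iteratedDeriv 2 (fun t => f.1 ((flowCommutator F X Y c t).1 v)) 0 =
      (2 : ℕ).factorial * (c * (⁅horField F X, horField F Y⁆ f).1 v) := by
  obtain ⟨φ, hφ, h⟩ := (hasLeadingCoeff_velocity (horFlow F X) (horFlow_zero X)).comp_mul_pow
    le_rfl le_rfl c
  have h' := h.commutator (by norm_num) le_rfl
    (hasLeadingCoeff_velocity (horFlow F Y) (horFlow_zero Y))
  rw [hasLeadingCoeff_iff (by norm_num)] at h'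
  have e : ∀ t, (horFlow F Y * φ * (horFlow F Y)⁻¹ * φ⁻¹).1 t = flowCommutator F X Y c t := by
    intro t
    show (horFlow F Y).1 t * φ.1 t * ((horFlow F Y).1 t)⁻¹ * (φ.1 t)⁻¹ = _
    rw [hφ, pow_one]
    rfl
  have h2 := h'.2 f v
  simp only [e] at h2
  refine ⟨h2.1, h2.2.trans (congrArg _ ?_)⟩
  show c ^ 1 * ((horField F X) ((horField F Y) f)).1 v -
    (horField F Y (c ^ 1 • horField F X f)).1 v = _
  rw [Derivation.map_smul, pow_one]
  show c * ((horField F X) ((horField F Y) f)).1 v - c * (horField F Y (horField F X f)).1 v =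
    c * (((horField F X) ((horField F Y) f)).1 v - (horField F Y (horField F X f)).1 v)
  ring

/-- Coordinate fields commute on the support of `g`, so the correction term `g [∂_i, ∂_j]^h`
vanishes. -/
theorem liftFun_smul_curvField {p : M} (χ : SmoothBumpFunction (𝓡 n) p) (i j : Fin n)
    (g : C^∞⟮𝓡 n, M; ℝ⟯) (hg : ∀ q, g q ≠ 0 → q ∈ chartBall (n := n) p (χ.rIn / 4)) :
    liftFun F g • curvField F (coordField χ i) (coordField χ j) =
      liftFun F g • ⁅horField F (coordField χ i), horField F (coordField χ j)⁆ := by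
  have h0 : smulField g (baseBracket (coordField χ i) (coordField χ j)) = 0 := by
    ext q : 1
    show g q • baseBracket (coordField χ i) (coordField χ j) q = 0
    by_cases hq : g q = 0
    · rw [hq, zero_smul]
    · rw [baseBracket_coordField χ i j ⟨(hg q hq).1, (hg q hq).2.trans (by linarith [χ.rIn_pos])⟩,
        smul_zero]
  have h1 := horField_smulField (F := F) g (baseBracket (coordField χ i) (coordField χ j))
  rw [h0] at h1
  rw [curvField, derivation_smul_sub, ← h1]
  have h2 : horField F (0 : BaseField n M) = 0 := map_zero (horHom F)
  rw [h2]
  abel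

/-- The curvature vector fields `R(g ∂_i, ∂_j)` are tangent to the fibered holonomy group. -/
theorem liftFun_smul_curvField_mem (r : ℕ∞) {p : M} (χ : SmoothBumpFunction (𝓡 n) p) (i j : Fin n)
    (g : C^∞⟮𝓡 n, M; ℝ⟯) (hg : ∀ q, g q ≠ 0 → q ∈ chartBall (n := n) p (χ.rIn / 4)) :
    liftFun F g • curvField F (coordField χ i) (coordField χ j) ∈
      F.tangentFields (F.fiberedHolonomyGroup r) := by
  rw [liftFun_smul_curvField χ i j g hg]
  set X : BaseField n M := coordField χ i
  set Y : BaseField n M := coordField χ j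
  obtain ⟨B, hB⟩ : ∃ B, ∀ q, |g q| ≤ B := by
    obtain ⟨B, hB⟩ := isCompact_univ.exists_bound_of_continuousOn g.contMDiff.continuous.continuousOn
    exact ⟨B, fun q => hB q (mem_univ q)⟩
  obtain ⟨ε₁, hε₁, hX⟩ := exists_isFiberwiseTransport_horFlow (F := F) r X
  obtain ⟨ε₂, hε₂, hY⟩ := exists_isFiberwiseTransport_horFlow (F := F) r Y
  obtain ⟨ε₃, hε₃, hε₃', hX'⟩ := isTranslationOver_horFlow (F := F) χ i
  obtain ⟨ε₄, hε₄, hε₄', hY'⟩ := isTranslationOver_horFlow (F := F) χ j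
  let ε := min (min ε₁ ε₂) (min ε₃ ε₄)
  have hε : 0 < ε := lt_min (lt_min hε₁ hε₂) (lt_min hε₃ hε₄)
  have hsub : ∀ {s : ℝ}, s ∈ Ioo (-ε) ε → s ∈ Ioo (-ε₁) ε₁ ∧ s ∈ Ioo (-ε₂) ε₂ ∧
      s ∈ Ioo (-ε₃) ε₃ ∧ s ∈ Ioo (-ε₄) ε₄ := by
    intro s hs
    simp only [mem_Ioo, ← abs_lt] at hs ⊢
    simp only [ε, lt_min_iff] at hs
    exact ⟨hs.1.1, hs.1.2, hs.2.1, hs.2.2⟩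
  have hneg : ∀ {s : ℝ}, s ∈ Ioo (-ε) ε → -s ∈ Ioo (-ε) ε := fun h =>
    ⟨by linarith [h.2], by linarith [h.1]⟩
  -- the commutators and their inverses are fiberwise transports
  have htr : ∀ {c t : ℝ}, t ∈ Ioo (-ε) ε → c * t ∈ Ioo (-ε) ε →
      IsFiberwiseTransport r (flowCommutator F X Y c t) := by
    intro c t ht hct
    rw [flowCommutator, (hX _ (hsub hct).1).1, (hY _ (hsub ht).2.1).1]
    exact (((hY _ (hsub ht).2.1).2.mul (hX _ (hsub hct).1).2).mul
      (hY _ (hsub (hneg ht)).2.1).2).mul (hX _ (hsub (hneg hct)).1).2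
  -- they preserve the fibers over the support of `g`
  have hunit : ∀ (s : ℝ) (k : Fin n), ‖s • coordVec n k‖ = |s| := by
    intro s k
    rw [norm_smul, PiLp.norm_single]
    simp
  have hproj : ∀ {t : ℝ}, t ∈ Ioo (-ε) ε → ∀ v : F.indicatrixBundle,
      g v.1.proj * t ∈ Ioo (-ε) ε →
      ((flowCommutator F X Y (g v.1.proj) t).1 v).1.proj = v.1.proj ∧
      (((flowCommutator F X Y (g v.1.proj) t)⁻¹).1 v).1.proj = v.1.proj := by
    intro t ht v hct
    -- With `g = 0` the flow of `X` runs for time `0` and the commutator collapses to the identity,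
    -- so closed parallelograms are needed only over the support of `g`.
    by_cases hv : g v.1.proj = 0
    · have h1 : flowCommutator F X Y (g v.1.proj) t = 1 := by
        rw [hv, flowCommutator, zero_mul, horFlow_zero]
        simp
      rw [h1, inv_one]
      exact ⟨rfl, rfl⟩
    have hA := hX' _ (hsub hct).2.2.1
    have hA' := hX' _ (hsub (hneg hct)).2.2.1
    have hB := hY' _ (hsub ht).2.2.2
    have hB' := hY' _ (hsub (hneg ht)).2.2.2
    rw [neg_smul, ← (hX _ (hsub hct).1).1] at hA'
    rw [neg_smul, ← (hY _ (hsub ht).2.1).1] at hB'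
    have ha : ‖(g v.1.proj * t) • coordVec n i‖ < χ.rIn / 4 := by
      rw [hunit]
      exact (abs_lt.2 (hsub hct).2.2.1).trans_le hε₃'
    have hb : ‖t • coordVec n j‖ < χ.rIn / 4 := by
      rw [hunit]
      exact (abs_lt.2 (hsub ht).2.2.2).trans_le hε₄'
    rw [flowCommutator_inv]
    exact ⟨proj_commutator_eq hA hA' hB hB' ha hb (hg _ hv),
      proj_commutator_eq hB hB' hA hA' hb ha (hg _ hv)⟩
  -- small times
  have hsmall : ∀ᶠ t in nhds (0 : ℝ), t ∈ Ioo (-ε) ε ∧ ∀ q, g q * t ∈ Ioo (-ε) ε := by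
    have hB' : 0 < |B| + 1 := by positivity
    have hpos : 0 < min ε (ε / (|B| + 1)) := lt_min hε (div_pos hε hB')
    filter_upwards [Ioo_mem_nhds (neg_lt_zero.2 hpos) hpos] with t ht
    rw [mem_Ioo, ← abs_lt, lt_min_iff, lt_div_iff₀ hB'] at ht
    refine ⟨abs_lt.1 ht.1, fun q => ?_⟩
    rw [mem_Ioo, ← abs_lt, abs_mul]
    nlinarith [hB q, le_abs_self B, abs_nonneg t, abs_nonneg (g q)]
  -- the diffeomorphisms obtained by taking the time `g(π v) t`
  have hsm : SmoothAlong (𝓡 n).tangent 𝓘(ℝ, ℝ) (Subtype.val : F.indicatrixBundle → _)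
      (fun v => g v.1.proj) := (liftFun F g).2
  have hBv : ∀ v : F.indicatrixBundle, |g v.1.proj| ≤ B := fun v => hB _
  have hid : SmoothFamily (𝓡 n).tangent (𝓡 n).tangent (Subtype.val : F.indicatrixBundle → _)
      (fun _ v => v.1) := (1 : F.smoothCurves).2
  -- The factors are composed from the right. The time `g(π v) t` is always computed from the
  -- initial vector `v`, not from the intermediate points.
  have hf : SmoothFamily (𝓡 n).tangent (𝓡 n).tangent (Subtype.val : F.indicatrixBundle → _)
      (fun t v => ((flowCommutator F X Y (g v.1.proj) t).1 v).1) :=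
    SmoothFamily.comp (h := fun t v => (((horFlow F Y).1 t).1 v).1) (horFlow F Y).2
      (SmoothFamily.comp_smul (h := fun t v => (((horFlow F X).1 t).1 v).1) (horFlow F X).2
        (SmoothFamily.comp (h := fun t v => ((((horFlow F Y)⁻¹).1 t).1 v).1) ((horFlow F Y)⁻¹).2
          (SmoothFamily.comp_smul (h := fun t v => ((((horFlow F X)⁻¹).1 t).1 v).1)
            (k := fun _ v => v) ((horFlow F X)⁻¹).2 hid hsm hBv)) hsm hBv)
  have hf' : SmoothFamily (𝓡 n).tangent (𝓡 n).tangent (Subtype.val : F.indicatrixBundle → _)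
      (fun t v => (((flowCommutator F X Y (g v.1.proj) t)⁻¹).1 v).1) := by
    simp only [flowCommutator_inv]
    exact SmoothFamily.comp_smul (h := fun t v => (((horFlow F X).1 t).1 v).1) (horFlow F X).2
      (SmoothFamily.comp (h := fun t v => (((horFlow F Y).1 t).1 v).1) (horFlow F Y).2
        (SmoothFamily.comp_smul (h := fun t v => ((((horFlow F X)⁻¹).1 t).1 v).1)
          ((horFlow F X)⁻¹).2 ((horFlow F Y)⁻¹).2 hsm hBv)) hsm hBv
  -- The commutator preserves base points, so `g` has the same value before and after; hence the
  -- fibrewise inverses assemble into an inverse of the whole map.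
  obtain ⟨Φ, hΦ⟩ := exists_smoothCurve_eq
    (f := fun t v => (flowCommutator F X Y (g v.1.proj) t).1 v)
    (f' := fun t v => ((flowCommutator F X Y (g v.1.proj) t)⁻¹).1 v) hf hf' (by
    filter_upwards [hsmall] with t ht
    refine ⟨fun v => ?_, fun v => ?_⟩
    · show ((flowCommutator F X Y (g ((flowCommutator F X Y (g v.1.proj) t).1 v).1.proj) t)⁻¹).1
        ((flowCommutator F X Y (g v.1.proj) t).1 v) = v
      rw [(hproj ht.1 v (ht.2 _)).1]
      exact Equiv.symm_apply_apply _ _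
    · show (flowCommutator F X Y (g (((flowCommutator F X Y (g v.1.proj) t)⁻¹).1 v).1.proj) t).1
        (((flowCommutator F X Y (g v.1.proj) t)⁻¹).1 v) = v
      rw [(hproj ht.1 v (ht.2 _)).2]
      exact Equiv.apply_symm_apply _ _)
  refine mem_tangentFields_of_eventually (φ := Φ) ?_ (one_le_two : 1 ≤ 2) ?_
  -- On the fibre over `q` the map is the commutator with the constant `c = g q`. It is a parallel
  -- translation along a curve that returns to `q`, hence a holonomy transformation.
  · filter_upwards [hΦ, hsmall] with t ht ht'
    rw [mem_fiberedHolonomyGroup_iff]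
    intro q
    obtain ⟨h, hh, e⟩ := (htr ht'.1 (ht'.2 q)).exists_mem_holonomyGroup (p := q) (by
      rintro v rfl
      exact (hproj ht'.1 v (ht'.2 _)).1)
    exact ⟨h, hh, fun y => (ht _).trans (e y)⟩
  · rw [hasLeadingCoeff_iff one_le_two]
    refine ⟨Subtype.ext (Equiv.ext fun v => ?_), fun f v => ?_⟩
    · refine (hΦ.self_of_nhds v).trans ?_
      show (flowCommutator F X Y (g v.1.proj) 0).1 v = v
      rw [flowCommutator_zero]
      rfl
    · have e : (fun t => f.1 ((Φ.1 t).1 v)) =ᶠ[nhds 0]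
          fun t => f.1 ((flowCommutator F X Y (g v.1.proj) t).1 v) := by
        filter_upwards [hΦ] with t ht
        rw [ht]
      obtain ⟨h1, h2⟩ := iteratedDeriv_flowCommutator (F := F) X Y (g v.1.proj) f v
      exact ⟨fun k hk hk' => (e.iteratedDeriv_eq k).trans (h1 k hk hk'),
        (e.iteratedDeriv_eq 2).trans h2⟩

/-- The infinitesimal holonomy algebra is tangent to the fibered holonomy group. -/
theorem infHolonomyAlgebra_le_tangentLieSubalgebra (r : ℕ∞) :
    F.infHolonomyAlgebra ≤ tangentLieSubalgebra (F.fiberedHolonomyGroup r) :=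
  infHolonomyAlgebra_le
    (fun X Y => curvField_mem_of_coordField (tangentLieSubalgebra (F.fiberedHolonomyGroup r)).toSubmodule
      (fun _ χ i j g hg => liftFun_smul_curvField_mem r χ i j g hg) X Y)
    fun X _ hξ _ => lie_horField_mem_tangentFields r X hξ

end FinslerMetric
end FinslerHolonomy

end

/-! ### The theorem -/

theorem mainTheorem5 (n : ℕ) (M : Type*) [TopologicalSpace M] [T2Space M] [CompactSpace M]
    [ChartedSpace (EuclideanSpace ℝ (Fin n)) M] [IsManifold (𝓡 n) ∞ M]
    (F : FinslerHolonomy.FinslerMetric n M) (r : ℕ∞) (hr : 1 ≤ r) :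
    -- the curvature vector fields exist and belong to the infinitesimal holonomy algebra
    (∀ X Y : Cₛ^∞⟮𝓡 n; EuclideanSpace ℝ (Fin n), (TangentSpace (𝓡 n) : M → Type _)⟯,
      ∃ ξ ∈ F.infHolonomyAlgebra, F.IsCurvatureField X Y ξ) ∧
    -- the infinitesimal holonomy algebra is closed under horizontal Berwald derivatives
    (∀ ξ ∈ F.infHolonomyAlgebra,
      ∀ X : Cₛ^∞⟮𝓡 n; EuclideanSpace ℝ (Fin n), (TangentSpace (𝓡 n) : M → Type _)⟯,
        ∃ η ∈ F.infHolonomyAlgebra, F.IsBerwaldDeriv X ξ η) ∧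
    -- its elements are tangent to the fibered holonomy group
    (∀ ξ ∈ F.infHolonomyAlgebra, ξ ∈ F.tangentFields (F.fiberedHolonomyGroup r)) ∧
    -- it is a Lie subalgebra of the fibered holonomy algebra (which is a Lie algebra)
    (∃ L : LieSubalgebra ℝ F.VField, (L : Set F.VField) = F.fiberedHolonomyAlgebra r ∧
      F.infHolonomyAlgebra ≤ L) := by
  have hle := FinslerHolonomy.FinslerMetric.infHolonomyAlgebra_le_tangentLieSubalgebra (F := F) r
  exact ⟨fun X Y => ⟨_, FinslerHolonomy.FinslerMetric.curvField_mem_infHolonomyAlgebra X Y,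
      FinslerHolonomy.FinslerMetric.isCurvatureField_curvField X Y⟩,
    fun ξ hξ X => FinslerHolonomy.FinslerMetric.exists_berwaldDeriv_mem X hξ,
    fun ξ hξ => hle hξ, _, rfl, hle⟩
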